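/- Let $n\ge 1$ and let $\pi\colon\mathcal Y\to\mathbb D=\{|s|<1\}$ be a semistable degeneration of compact Kähler manifolds of dimension $n$: $\mathcal Y$ is a complex manifold of dimension $n+1$, $\pi$ is a proper surjective holomorphic map with connected fibres $\mathcal Y_s=\pi^{-1}(s)$, $\pi$ is a submersion over $\mathbb D\setminus\{0\}$, and $\mathcal Y_0=\sum_{i=1}^a D_i$ is a reduced simple normal crossings divisor (so near each point of $\mathcal Y_0$ there are holomorphic coordinates in which the components $D_i$ through this point are distinct coordinate hyperplanes and $\pi$ is the product of the corresponding coordinates). Let $\gamma$ be a Kähler metric on $\mathcal Y$, with distance $d_\gamma$, and $\gamma_s=\gamma|_{\mathcal Y_s}$. Put $\operatorname{Sing}(\mathcal Y_0)=\bigcup_{i<j}D_i\cap D_j$, $\mathcal Y_0^{\rm reg}=\mathcal Y_0\setminus\operatorname{Sing}(\mathcal Y_0)$. Use the volume form $\gamma_s^n$, $d^c=\frac{\sqrt{-1}}2(\bar\partial-\partial)$, and $|df|^2_{\gamma_s}=\operatorname{tr}_{\gamma_s}(df\wedge d^c\bar f)$ (for $s=0$ everything is on $\mathcal Y_0^{\rm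 reg}$). Fix an integer $\nu\ge n$, and set $\epsilon(s)=2|s|^{1/(4\nu)}$ and $$A_s=\{z\in\mathcal Y_0^{\rm reg}: d_\gamma(z,\operatorname{Sing}(\mathcal Y_0))>\epsilon(s)\}$$ (with $d_\gamma(z,\emptyset)=\infty$). Then there are $\rho\in(0,1]$ and maps $F_s$ ($|s|<\rho$) such that each $F_s$ is a diffeomorphism from $A_s$ onto an open subset $F_s(A_s)$ of $\mathcal Y_s$ (of $\mathcal Y_0^{\rm reg}$ if $s=0$), given by the flow along horizontal lifts: for $z\in A_s$, $F_s(z)=c(1)$ for a curve $c\colon[0,1]\to\mathcal Y\setminus\operatorname{Sing}(\mathcal Y_0)$ with $c(0)=z$ and $\pi(c(t))=ts$, whose velocity $c'(t)$ is $\gamma$-orthogonal to $\ker d\pi$ and satisfies $d\pi(c'(t))=s$. Moreover, with constants $K_1,K_3$ independent of $s$, $K_{2,\beta}$ depending also on $\beta$ but not on $s$, and $K_{4,\alpha}$ depending also on $\alpha$ but not on $s$, for all $|s|<\rho$: 1. $F_0=\mathrm{id}_{\mathcal Y_0^{\rm reg}}$. 2. $d_\gamma(F_s(z),z)\le K_1|s|^{3/4}$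 for all $z\in A_s$. 3. For every smooth differential form $\beta$ on $\mathcal Y$, with $\beta_s=\beta|_{\mathcal Y_s}$, $\|F_s^*\beta_s-\beta_0\|_{L^\infty(A_s)}\le K_{2,\beta}|s|^{1/2}$, the pointwise norm of a $k$-form being its operator norm as a multilinear form on $(T\mathcal Y_0^{\rm reg},\gamma_0)$. 4. For $\chi,\chi'\in C_0^\infty(A_s)$ (complex valued), with $(F_s)_*\chi$ the push-forward extended by $0$, $$\bigl|((F_s)_*\chi,(F_s)_*\chi')_{L^2(\mathcal Y_s,\gamma_s)}-(\chi,\chi')_{L^2(\mathcal Y_0^{\rm reg},\gamma_0)}\bigr|\le K_3|s|^{1/2}\|\chi\|_{L^2(\gamma_0)}\|\chi'\|_{L^2(\gamma_0)},$$ $$\bigl|\|d((F_s)_*\chi)\|^2_{L^2(\mathcal Y_s,\gamma_s)}-\|d\chi\|^2_{L^2(\mathcal Y_0^{\rm reg},\gamma_0)}\bigr|\le K_3|s|^{1/2}\|d\chi\|^2_{L^2(\mathcal Y_0^{\rm reg},\gamma_0)},$$ $$\bigl|\|d((F_s)_*\chi)\|_{L^2(\mathcal Y_s,\gamma_s)}-\|d\chi\|_{L^2(\mathcal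 Y_0^{\rm reg},\gamma_0)}\bigr|\le K_3|s|^{1/2}\|d\chi\|_{L^2(\mathcal Y_0^{\rm reg},\gamma_0)}.$$ 5. For every smooth $(1,1)$-form $\alpha$ on $\mathcal Y$, with $\alpha_s=\alpha|_{\mathcal Y_s}$, and every $\chi\in C_0^\infty(A_s)$, $$\Bigl|\int_{\mathcal Y_s}(F_s)_*\chi\,\alpha_s^n-\int_{\mathcal Y_0}\chi\,\alpha_0^n\Bigr|\le K_{4,\alpha}|s|^{1/2}\|\chi\|_{L^1(\mathcal Y_0^{\rm reg},\gamma_0)},$$ $$\Bigl|\int_{\mathcal Y_s}d((F_s)_*\chi)\wedge d^c((F_s)_*\chi)\wedge\alpha_s^{n-1}-\int_{\mathcal Y_0}d\chi\wedge d^c\chi\wedge\alpha_0^{n-1}\Bigr|\le K_{4,\alpha}|s|^{1/2}\|d\chi\|^2_{L^2(\mathcal Y_0^{\rm reg},\gamma_0)}.$$ -/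

import Mathlib

open Set MeasureTheory Manifold
open scoped ContDiff ENNReal

noncomputable section

/-- The model space `ℂ^m`. -/
abbrev Cn (m : ℕ) : Type := Fin m → ℂ

/-- The smooth real manifold underlying a complex manifold. -/
instance isManifold_real_of_complex {m : ℕ} {Y : Type*} [TopologicalSpace Y]
    [ChartedSpace (Cn m) Y] [IsManifold 𝓘(ℂ, Cn m) ω Y] : IsManifold 𝓘(ℝ, Cn m) ∞ Y := by
  apply isManifold_of_contDiffOn
  intro e e' he he'
  have h := (contDiffGroupoid ω 𝓘(ℂ, Cn m)).compatible he he'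
  rw [contDiffGroupoid, mem_groupoid_of_pregroupoid] at h
  have h1 : ContDiffOn ℂ ω (𝓘(ℂ, Cn m) ∘ e.symm ≫ₕ e' ∘ 𝓘(ℂ, Cn m).symm)
      (𝓘(ℂ, Cn m).symm ⁻¹' (e.symm ≫ₕ e').source ∩ range 𝓘(ℂ, Cn m)) := h.1
  exact (h1.restrict_scalars ℝ).of_le le_top

section Forms

variable {m : ℕ} (Y : Type*) [TopologicalSpace Y] [ChartedSpace (Cn m) Y]

/-- Complex valued (not necessarily continuous) differential `k`-forms on a complex manifold of
dimension `m`. -/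
abbrev DForm (k : ℕ) : Type _ := ∀ y : Y, TangentSpace 𝓘(ℝ, Cn m) y [⋀^Fin k]→L[ℝ] ℂ

variable {Y}

/-- The expression of a form in a chart, i.e. its pull-back by the inverse of the chart. -/
def DForm.inChart {k : ℕ} (β : DForm (m := m) Y k) (e : OpenPartialHomeomorph Y (Cn m))
    (x : Cn m) : Cn m [⋀^Fin k]→L[ℝ] ℂ :=
  (β (e.symm x)).compContinuousLinearMap (mfderiv 𝓘(ℝ, Cn m) 𝓘(ℝ, Cn m) e.symm x)

/-- Smooth differential forms. -/
def DForm.IsSmooth {k : ℕ} (β : DForm (m := m) Y k) : Prop :=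
  ∀ e ∈ atlas (Cn m) Y, ContDiffOn ℝ ∞ (β.inChart e) e.target

/-- Closed differential forms, `dβ = 0`. -/
def DForm.IsClosed {k : ℕ} (β : DForm (m := m) Y k) : Prop :=
  ∀ e ∈ atlas (Cn m) Y, ∀ x ∈ e.target, extDeriv (β.inChart e) x = 0

/-- The complex structure `J` (multiplication by `i`) on the tangent space at `y`. -/
def cplxJ (y : Y) (v : TangentSpace 𝓘(ℝ, Cn m) y) : TangentSpace 𝓘(ℝ, Cn m) y :=
  (Complex.I • (show Cn m from v) : Cn m)

/-- A `2`-form is of type `(1,1)` iff it is `J`-invariant. -/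
def DForm.IsOneOne (α : DForm (m := m) Y 2) : Prop :=
  ∀ (y : Y) (u v : TangentSpace 𝓘(ℝ, Cn m) y), α y ![cplxJ y u, cplxJ y v] = α y ![u, v]

variable (m Y) in
/-- A Kähler metric: a smooth `J`-invariant Riemannian metric `g` whose fundamental form
`g(J·,·)` is closed. -/
structure KahlerMetric [IsManifold 𝓘(ℂ, Cn m) ω Y] extends
    Bundle.ContMDiffRiemannianMetric 𝓘(ℝ, Cn m) ∞ (Cn m)
      (fun y : Y => TangentSpace 𝓘(ℝ, Cn m) y) where
  inner_J : ∀ (y : Y) (u v : TangentSpace 𝓘(ℝ, Cn m) y),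
    inner y (cplxJ y u) (cplxJ y v) = inner y u v
  /-- The Kähler form. -/
  form : DForm (m := m) Y 2
  form_apply : ∀ (y : Y) (u v : TangentSpace 𝓘(ℝ, Cn m) y),
    form y ![u, v] = (inner y (cplxJ y u) v : ℂ)
  closed : form.IsClosed

variable [IsManifold 𝓘(ℂ, Cn m) ω Y]

open scoped Bundle in
/-- The distance `d_γ` induced by a Kähler metric (infimum of lengths of `C¹` paths; it is `∞`
between points which are not joined by a path). -/
def KahlerMetric.edist (γ : KahlerMetric m Y) (y z : Y) : ℝ≥0∞ :=
  letI : Bundle.RiemannianBundle (fun y : Y => TangentSpace 𝓘(ℝ, Cn m) y) :=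
    ⟨γ.toRiemannianMetric⟩
  riemannianEDist 𝓘(ℝ, Cn m) y z

/-- The distance to a set (`∞` for the empty set). -/
def KahlerMetric.distTo (γ : KahlerMetric m Y) (y : Y) (A : Set Y) : ℝ≥0∞ :=
  ⨅ p ∈ A, γ.edist y p

/-- The closed tubular neighbourhood `{y | d_γ(y, A) ≤ r}`. -/
def KahlerMetric.closedTube (γ : KahlerMetric m Y) (A : Set Y) (r : ℝ) : Set Y :=
  {y | γ.distTo y A ≤ ENNReal.ofReal r}

/-- The norm of a tangent vector. -/
def KahlerMetric.vnorm (γ : KahlerMetric m Y) (y : Y) (v : TangentSpace 𝓘(ℝ, Cn m) y) : ℝ :=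
  Real.sqrt (γ.inner y v v)

end Forms

/-- The value `(w₁ ∧ ⋯ ∧ wₙ)(v)` of a wedge product of `n` two-forms on a vector space, on the
`2n` vectors `v (1,0), v (1,1), v (2,0), …, v (n,1)` (in this order). -/
def wedgeTwo {n : ℕ} {V : Type*} (w : Fin n → V → V → ℂ) (v : Fin n × Fin 2 → V) : ℂ :=
  (1 / 2 ^ n) * ∑ σ : Equiv.Perm (Fin n × Fin 2),
    ((Equiv.Perm.sign σ : ℤ) : ℂ) * ∏ j, w j (v (σ (j, 0))) (v (σ (j, 1)))

/-! ### Semistable degenerations -/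

section Degeneration

variable {n a : ℕ} {Y : Type*} [TopologicalSpace Y] [ChartedSpace (Cn (n + 1)) Y]

/-- The differential `dπ_y` of a holomorphic function. -/
def hdiff (π : Y → ℂ) (y : Y) (v : TangentSpace 𝓘(ℝ, Cn (n + 1)) y) : ℂ :=
  (mfderiv 𝓘(ℂ, Cn (n + 1)) 𝓘(ℂ, ℂ) π y : Cn (n + 1) → ℂ) v

open scoped Classical in
/-- `π : Y → 𝔻` is a semistable degeneration of compact manifolds of dimension `n`, with central
fibre the reduced simple normal crossings divisor `D₁ + ⋯ + D_a`: `π` is a proper holomorphic map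
onto the unit disc with connected fibres, submersive away from the central fibre, and around each
point of the central fibre there are holomorphic coordinates in which the components `D_i` through
this point are distinct coordinate hyperplanes and `π` is the product of these coordinates. -/
structure IsSemistableDegeneration (π : Y → ℂ) (D : Fin a → Set Y) : Prop where
  holomorphic : ContMDiff 𝓘(ℂ, Cn (n + 1)) 𝓘(ℂ, ℂ) ω π
  norm_lt_one : ∀ y, ‖π y‖ < 1
  proper : ∀ K : Set ℂ, K ⊆ Metric.ball 0 1 → IsCompact K → IsCompact (π ⁻¹' K)
  connected_fibres : ∀ s ∈ Metric.ball (0 : ℂ) 1, IsConnected (π ⁻¹' {s})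
  submersive : ∀ y, π y ≠ 0 → ∃ v : TangentSpace 𝓘(ℝ, Cn (n + 1)) y, hdiff π y v ≠ 0
  closed_component : ∀ i, IsClosed (D i)
  connected_component : ∀ i, IsConnected (D i)
  central_fibre : π ⁻¹' {0} = ⋃ i, D i
  normal_crossings : ∀ y, π y = 0 →
    ∃ e ∈ IsManifold.maximalAtlas 𝓘(ℂ, Cn (n + 1)) ω Y, y ∈ e.source ∧
      (∀ i, y ∉ D i → Disjoint (D i) e.source) ∧
      ∃ σ : Fin a → Fin (n + 1), InjOn σ {i | y ∈ D i} ∧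
        (∀ i, y ∈ D i → ∀ x ∈ e.source, x ∈ D i ↔ e x (σ i) = 0) ∧
        ∀ x ∈ e.source, π x = ∏ i with y ∈ D i, e x (σ i)

/-- `Sing(Y₀)`, the union of the pairwise intersections of the components. -/
def singLocus (D : Fin a → Set Y) : Set Y := ⋃ (i) (j) (_ : i < j), D i ∩ D j

/-- The smooth locus `Y_s \ Sing(Y₀)` of the fibre over `s`. This is all of `Y_s` for `s ≠ 0`, and
`Y₀^reg` for `s = 0`. Its tangent space at `y` is the kernel of `dπ_y`. -/
def smoothFibre (π : Y → ℂ) (D : Fin a → Set Y) (s : ℂ) : Set Y := π ⁻¹' {s} \ singLocus D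

/-- A holomorphic local parametrisation of (the smooth locus of) the fibre `Y_s` by an open subset
of `ℂⁿ`. -/
structure FibreParam (π : Y → ℂ) (D : Fin a → Set Y) (s : ℂ) where
  toHomeo : OpenPartialHomeomorph (Cn n) (smoothFibre π D s)
  holomorphic : ContMDiffOn 𝓘(ℂ, Cn n) 𝓘(ℂ, Cn (n + 1)) ω
    (fun x => (toHomeo x : Y)) toHomeo.source
  immersive : ∀ x ∈ toHomeo.source, Function.Injective
    (mfderiv 𝓘(ℂ, Cn n) 𝓘(ℂ, Cn (n + 1)) (fun x => (toHomeo x : Y)) x)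

/-- The underlying map of a parametrisation, with values in the total space. -/
def FibreParam.map {π : Y → ℂ} {D : Fin a → Set Y} {s : ℂ} (φ : FibreParam (n := n) π D s)
    (x : Cn n) : Y := φ.toHomeo x

/-- The images of `∂/∂x₁, ∂/∂y₁, …, ∂/∂xₙ, ∂/∂yₙ` under the differential of a
parametrisation. -/
def FibreParam.frame {π : Y → ℂ} {D : Fin a → Set Y} {s : ℂ} (φ : FibreParam (n := n) π D s)
    (x : Cn n) (p : Fin n × Fin 2) : TangentSpace 𝓘(ℝ, Cn (n + 1)) (φ.map x) :=
  mfderiv 𝓘(ℝ, Cn n) 𝓘(ℝ, Cn (n + 1)) φ.map x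
    (Pi.single p.1 (if p.2 = 0 then 1 else Complex.I) : Cn n)

variable [IsManifold 𝓘(ℂ, Cn (n + 1)) ω Y]

/-- The horizontal lift at `y` of `c ∈ ℂ = T𝔻`: the tangent vector `w` with `dπ(w) = c` which is
`γ`-orthogonal to the fibre. -/
def IsHorizontalLift (π : Y → ℂ) (γ : KahlerMetric (n + 1) Y) (y : Y) (c : ℂ)
    (w : TangentSpace 𝓘(ℝ, Cn (n + 1)) y) : Prop :=
  hdiff π y w = c ∧ ∀ v, hdiff π y v = 0 → γ.inner y w v = 0

/-- The values of the form `γⁿ` on `2n` tangent vectors at `y`. -/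
def gammaPow (γ : KahlerMetric (n + 1) Y) (y : Y)
    (v : Fin n × Fin 2 → TangentSpace 𝓘(ℝ, Cn (n + 1)) y) : ℂ :=
  wedgeTwo (fun _ u w => γ.form y ![u, w]) v

/-- The measure on `Y_s` with volume form `γ_sⁿ`: the smallest measure which in each holomorphic
parametrisation of the fibre dominates (equivalently, equals) the Lebesgue measure times the
coefficient of `γ_sⁿ`. -/
def fibreVolume [MeasurableSpace Y] (π : Y → ℂ) (D : Fin a → Set Y)
    (γ : KahlerMetric (n + 1) Y) (s : ℂ) : Measure Y :=
  ⨆ φ : FibreParam (n := n) π D s,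
    Measure.map φ.map ((volume.restrict φ.toHomeo.source).withDensity
      fun x => ENNReal.ofReal (gammaPow γ (φ.map x) (φ.frame x)).re)

/-- The quotient `Ψ / γⁿ` at `y` of two forms of top degree on the tangent space `ker dπ_y` of the
fibre, i.e. the unique `c` with `Ψ = c γⁿ` there. -/
def topQuotient (π : Y → ℂ) (γ : KahlerMetric (n + 1) Y) (y : Y)
    (Ψ : (Fin n × Fin 2 → TangentSpace 𝓘(ℝ, Cn (n + 1)) y) → ℂ) : ℂ :=
  Classical.epsilon fun c : ℂ =>
    ∀ v : Fin n × Fin 2 → TangentSpace 𝓘(ℝ, Cn (n + 1)) y,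
      (∀ p, hdiff π y (v p) = 0) → Ψ v = c * gammaPow γ y v

/-- The integral over `Y_s` of a form `Ψ` of top degree `2n`: the integral of `Ψ / γⁿ` against the
measure with volume form `γⁿ`. -/
def fibreIntegral [MeasurableSpace Y] (π : Y → ℂ) (D : Fin a → Set Y)
    (γ : KahlerMetric (n + 1) Y) (s : ℂ)
    (Ψ : ∀ y : Y, (Fin n × Fin 2 → TangentSpace 𝓘(ℝ, Cn (n + 1)) y) → ℂ) : ℂ :=
  ∫ y, topQuotient π γ y (Ψ y) ∂fibreVolume π D γ s

/-- The differential at `y` of a function `f` on the smooth locus of `Y_s`. Only its values on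
vectors tangent to `Y_s` are meaningful, and these do not depend on any choice. -/
def fibreDiff (π : Y → ℂ) (D : Fin a → Set Y) (s : ℂ) (f : Y → ℂ) (y : Y)
    (v : TangentSpace 𝓘(ℝ, Cn (n + 1)) y) : ℂ :=
  (mfderivWithin 𝓘(ℝ, Cn (n + 1)) 𝓘(ℝ, ℂ) f (smoothFibre π D s) y :
    Cn (n + 1) → ℂ) v

/-- `dᶜ = (i/2)(∂̄ - ∂)` on functions, that is `dᶜf(v) = -df(Jv)/2`. -/
def fibreDc (π : Y → ℂ) (D : Fin a → Set Y) (s : ℂ) (f : Y → ℂ) (y : Y)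
    (v : TangentSpace 𝓘(ℝ, Cn (n + 1)) y) : ℂ :=
  -(1 / 2) * fibreDiff π D s f y (cplxJ y v)

/-- The squared norm `|df|²_γ` at a point of the fibre, normalised so that
`|df|²_γ = tr_γ(df ∧ dᶜ f̄)`: one half of `∑ |df(e_p)|²` over an orthonormal basis `e` of the
tangent space of the fibre (the supremum is over all such bases; all give the same sum). -/
def fibreDiffNormSq (π : Y → ℂ) (D : Fin a → Set Y) (γ : KahlerMetric (n + 1) Y) (s : ℂ)
    (f : Y → ℂ) (y : Y) : ℝ :=
  (1 / 2) * ⨆ e : {e : Fin n × Fin 2 → TangentSpace 𝓘(ℝ, Cn (n + 1)) y //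
      (∀ p, hdiff π y (e p) = 0) ∧ ∀ p q, γ.inner y (e p) (e q) = if p = q then 1 else 0},
    ∑ p, ‖fibreDiff π D s f y (e.1 p)‖ ^ 2

/-- `(f, h)_{L²(Y_s, γ_s)}`. -/
def fibreInner [MeasurableSpace Y] (π : Y → ℂ) (D : Fin a → Set Y)
    (γ : KahlerMetric (n + 1) Y) (s : ℂ) (f h : Y → ℂ) : ℂ :=
  ∫ y, f y * (starRingEnd ℂ) (h y) ∂fibreVolume π D γ s

/-- `‖f‖_{L¹(Y_s, γ_s)}`. -/
def fibreL1 [MeasurableSpace Y] (π : Y → ℂ) (D : Fin a → Set Y)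
    (γ : KahlerMetric (n + 1) Y) (s : ℂ) (f : Y → ℂ) : ℝ :=
  ∫ y, ‖f y‖ ∂fibreVolume π D γ s

/-- `‖f‖_{L²(Y_s, γ_s)}`. -/
def fibreL2 [MeasurableSpace Y] (π : Y → ℂ) (D : Fin a → Set Y)
    (γ : KahlerMetric (n + 1) Y) (s : ℂ) (f : Y → ℂ) : ℝ :=
  Real.sqrt (∫ y, ‖f y‖ ^ 2 ∂fibreVolume π D γ s)

/-- `‖df‖_{L²(Y_s, γ_s)}`. -/
def fibreDiffL2 [MeasurableSpace Y] (π : Y → ℂ) (D : Fin a → Set Y)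
    (γ : KahlerMetric (n + 1) Y) (s : ℂ) (f : Y → ℂ) : ℝ :=
  Real.sqrt (∫ y, fibreDiffNormSq π D γ s f y ∂fibreVolume π D γ s)

/-- The integrand `f αⁿ`. -/
def mulPow (f : Y → ℂ) (α : DForm (m := n + 1) Y 2) (y : Y)
    (v : Fin n × Fin 2 → TangentSpace 𝓘(ℝ, Cn (n + 1)) y) : ℂ :=
  f y * wedgeTwo (fun _ u w => α y ![u, w]) v

/-- The integrand `df ∧ dᶜf ∧ α^{n-1}` on `Y_s` (for `n ≥ 1`). -/
def dWedgeDcPow (π : Y → ℂ) (D : Fin a → Set Y) (s : ℂ) (f : Y → ℂ)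
    (α : DForm (m := n + 1) Y 2) (y : Y)
    (v : Fin n × Fin 2 → TangentSpace 𝓘(ℝ, Cn (n + 1)) y) : ℂ :=
  wedgeTwo (fun j u w =>
    if (j : ℕ) = 0 then
      fibreDiff π D s f y u * fibreDc π D s f y w - fibreDiff π D s f y w * fibreDc π D s f y u
    else α y ![u, w]) v

/-- The domain of `F_s`: the points of `Y₀^reg` at distance more than `ε(s) = 2|s|^{1/(4ν)}` from
`Sing(Y₀)`. -/
def retractDomain (π : Y → ℂ) (D : Fin a → Set Y) (γ : KahlerMetric (n + 1) Y) (ν : ℕ) (s : ℂ) :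
    Set Y :=
  smoothFibre π D 0 \ γ.closedTube (singLocus D) (2 * ‖s‖ ^ (1 / (4 * (ν : ℝ))))

/-- `F` restricts to a diffeomorphism of `A`, an open subset of `Y₀^reg`, onto an open subset of
the smooth locus of `Y_s`. (Smoothness of a map on a subset is in the sense of existence of
compatible Taylor expansions; on submanifolds it is the usual notion.) -/
def IsFibreDiffeo (π : Y → ℂ) (D : Fin a → Set Y) (s : ℂ) (A : Set Y) (F : Y → Y) : Prop :=
  MapsTo F A (smoothFibre π D s) ∧
  (∃ O : Set Y, IsOpen O ∧ F '' A = smoothFibre π D s ∩ O) ∧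
  ContMDiffOn 𝓘(ℝ, Cn (n + 1)) 𝓘(ℝ, Cn (n + 1)) ∞ F A ∧
  ∃ G : Y → Y, LeftInvOn G F A ∧
    ContMDiffOn 𝓘(ℝ, Cn (n + 1)) 𝓘(ℝ, Cn (n + 1)) ∞ G (F '' A)

/-- The differential of a smooth map on an open subset `A` of `Y₀^reg`. Only its values on vectors
tangent to `Y₀` are meaningful, and these do not depend on any choice. -/
def mapDiff (F : Y → Y) (A : Set Y) (z : Y) (v : TangentSpace 𝓘(ℝ, Cn (n + 1)) z) :
    TangentSpace 𝓘(ℝ, Cn (n + 1)) (F z) :=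
  mfderivWithin 𝓘(ℝ, Cn (n + 1)) 𝓘(ℝ, Cn (n + 1)) F A z v

/-- Test functions `C₀^∞(A)` (complex valued), for an open subset `A` of `Y₀^reg`, extended by `0`
outside `A`. -/
def IsTestFunction (A : Set Y) (χ : Y → ℂ) : Prop :=
  ContMDiffOn 𝓘(ℝ, Cn (n + 1)) 𝓘(ℝ, ℂ) ∞ χ A ∧ ∃ K ⊆ A, IsCompact K ∧ ∀ y ∉ K, χ y = 0

/-- The push-forward of the function `χ` on `A` by the injective map `F : A → Y`, extended by `0`
outside the image of `F`. -/
def pushFwd (F : Y → Y) (A : Set Y) (χ : Y → ℂ) : Y → ℂ :=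
  Function.extend (fun z : A => F z) (fun z : A => χ z) 0

end Degeneration

end

open Set MeasureTheory Manifold
open scoped ContDiff ENNReal Topology
set_option linter.unusedSectionVars false

noncomputable section

/-! ### Smooth dependence of flows on initial values, by the inverse function theorem on curves -/

section Flow

open ContinuousMap Metric

variable {E F : Type*} [NormedAddCommGroup E] [NormedSpace ℝ E] [NormedAddCommGroup F]
  [NormedSpace ℝ F] {K : Type*} [TopologicalSpace K] [CompactSpace K]

/-! Let `H` be the horizontal lift of the vector `1` on the disc. The map `F_s` is the time one map
of the field `s • H`. If `θ` denotes the real part of `dπ`, then `H` has size `O(1 / ‖θ‖)` and its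
derivative has size `O(1 / ‖θ‖ ^ 2)` (`exists_horizLift_bound`), so everything rests on a lower
bound for `dπ` on `A_s`.

This bound comes from the normal crossings (`exists_le_hd`). On the component `D i` the product rule
leaves `dπ = (∏_{j ≠ i} x_j) dx_i`. There are at most `n` factors `x_j`, and each of them is at
least a constant times the distance to the singular locus, because replacing `x_j` by zero moves the
point into `D i ∩ D j`. Hence `|dπ| ≥ c · dist ^ n`, and on `A_s` the inequality `n ≤ ν` turns this
into `|dπ| ≥ c |s|^{1/4}`.

Consequently, on a ball around the starting point whose radius is a small multiple of `|dπ|` (or a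
fixed radius, if that is smaller), the field `s • H` is `O(|s|^{3/4})` and its derivative is
`O(|s|^{1/2})`. The flow cannot leave this ball up to time one, it moves points by `O(|s|^{3/4})`,
and its differential is the identity up to `O(|s|^{1/2})` (`exists_smooth_time_one_map_of_bound`,
`exists_local_flow`). Smoothness of the time one map and the bound on its differential are obtained
together in `exists_smooth_time_one_map`: integral curves solve `c - ∫ X(c) = x` in the Banach space
of continuous curves, and the left side has derivative `1 - A` with `‖A‖ ≤ δ ≤ 1/2`.

The flow is defined on a full neighbourhood in the total space and raises `π` by exactly `s`. The
inverse function theorem there shows that the image of `A_s` is open in the fibre and that the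
inverse is smooth, while uniqueness of horizontal curves gives injectivity (`IsFlowCurve.eqOn`,
`isFibreDiffeo_of_localRep`). Compactness of the central fibre makes the constants uniform
(`exists_uniform_flow`), and the displacement bound and the bound for pull-backs of forms are then
read off in charts.

For the integral estimates, a unitary frame `u` of the central fibre is carried by the differential
of `F_s` to a frame `w` for which the matrices `γ(w_p, w_q)` and `γ(J w_p, w_q)` lie within `δ = K
|s|^{1/2}` of the standard ones (`exists_isAlmostIsometry`). Volume forms, powers of `α` and
Dirichlet densities are expressed by these matrices, the inverse Gram matrix and the values of `α`
and `dχ` on the frames. Since `F_s` need not be holomorphic, `dᶜ` is controlled by expanding `J w_p`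
in the frame `w`. The pointwise comparison is integrated by a change of variables between fibres
(`IsFibreMap.setIntegral_image`, `IsFibreMap.norm_integral_sub_le`). -/

/-- Composition on the left with a continuous map, on the space of continuous maps. -/
def nemytskii (K : Type*) [TopologicalSpace K] (X : E → F) (hX : Continuous X) (c : C(K, E)) :
    C(K, F) := ⟨fun t => X (c t), hX.comp c.continuous⟩

/-- Pointwise application, as a bilinear map on spaces of continuous maps. -/
def applyPointwise (K : Type*) [TopologicalSpace K] [CompactSpace K] (E F : Type*)
    [NormedAddCommGroup E] [NormedSpace ℝ E] [NormedAddCommGroup F] [NormedSpace ℝ F] :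
    C(K, E →L[ℝ] F) →L[ℝ] C(K, E) →L[ℝ] C(K, F) :=
  LinearMap.mkContinuous₂
    (LinearMap.mk₂ ℝ (fun (A : C(K, E →L[ℝ] F)) (h : C(K, E)) =>
      (⟨fun t => A t (h t), A.continuous.clm_apply h.continuous⟩ : C(K, F)))
      (fun _ _ _ => by ext; simp) (fun _ _ _ => by ext; simp) (fun _ _ _ => by ext; simp)
      (fun _ _ _ => by ext; simp)) 1
    (fun A h => by
      rw [ContinuousMap.norm_le _ (by positivity)]
      intro t
      simp only [LinearMap.mk₂_apply, ContinuousMap.coe_mk, one_mul]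
      exact (A t).le_of_opNorm_le_of_le (A.norm_coe_le_norm t) (h.norm_coe_le_norm t))

/-- The range of `c` is compact, so `fderiv ℝ X` is uniformly continuous around it. The mean value
inequality on the ball of radius `δ` around `c t` therefore holds with one `δ` for all `t`, which is
what the supremum norm requires. -/
lemma hasFDerivAt_nemytskii {X : E → F} (hX : ContDiff ℝ 1 X) (c : C(K, E)) :
    HasFDerivAt (nemytskii K X hX.continuous)
      (applyPointwise K E F
        (nemytskii K (fderiv ℝ X) (hX.continuous_fderiv one_ne_zero) c)) c := by
  rw [hasFDerivAt_iff_isLittleO_nhds_zero, Asymptotics.isLittleO_iff]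
  intro ε hε
  have hK : IsCompact (range c) := isCompact_range c.continuous
  have hcont : Continuous (fderiv ℝ X) := hX.continuous_fderiv one_ne_zero
  have key : ∃ δ > 0, ∀ x ∈ range c, ∀ y, dist x y < δ →
      dist (fderiv ℝ X x) (fderiv ℝ X y) < ε := by
    have := hK.uniformContinuousAt_of_continuousAt (fderiv ℝ X)
      (fun x _ => hcont.continuousAt) (r := {p | dist p.1 p.2 < ε}) (dist_mem_uniformity hε)
    rw [Metric.mem_uniformity_dist] at this
    obtain ⟨δ, hδ, h⟩ := this
    exact ⟨δ, hδ, fun x hx y hxy => h hxy hx⟩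
  obtain ⟨δ, hδ, h⟩ := key
  filter_upwards [Metric.ball_mem_nhds (0 : C(K, E)) hδ] with g hg
  rw [mem_ball_zero_iff] at hg
  rw [ContinuousMap.norm_le _ (by positivity)]
  intro t
  change ‖X (c t + g t) - X (c t) - fderiv ℝ X (c t) (g t)‖ ≤ _
  have hb : ∀ y ∈ ball (c t) δ, ‖fderiv ℝ X y - fderiv ℝ X (c t)‖ ≤ ε := by
    intro y hy
    rw [← dist_eq_norm, dist_comm]
    exact (h _ ⟨t, rfl⟩ y (by rwa [dist_comm])).le
  have := (convex_ball (c t) δ).norm_image_sub_le_of_norm_fderiv_le'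
    (f := X) (φ := fderiv ℝ X (c t)) (x := c t) (y := c t + g t) (C := ε)
    (fun y _ => (hX.differentiable one_ne_zero) y) hb (mem_ball_self hδ)
    (by rw [mem_ball_iff_norm, add_sub_cancel_left]; exact (g.norm_coe_le_norm t).trans_lt hg)
  rw [add_sub_cancel_left] at this
  exact this.trans (by gcongr; exact g.norm_coe_le_norm t)

/-- The derivative is pointwise application of the operator attached to `fderiv ℝ X`, so order `m +
1` for `X` reduces to order `m` for a map into `E →L[ℝ] F`. This is why `F` is quantified inside the
induction and shares its universe with `E`. -/
lemma contDiff_nemytskii_nat.{u} {E : Type u} [NormedAddCommGroup E] [NormedSpace ℝ E] (m : ℕ) :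
    ∀ {F : Type u} [NormedAddCommGroup F] [NormedSpace ℝ F] {X : E → F} (hc : Continuous X)
      (_ : ContDiff ℝ m X), ContDiff ℝ m (nemytskii K X hc) := by
  induction m with
  | zero =>
    intro F _ _ X hc hX
    exact contDiff_zero.2 (ContinuousMap.continuous_postcomp ⟨X, hc⟩)
  | succ m ih =>
    intro F _ _ X hc hX
    have h1 : ContDiff ℝ 1 X := hX.of_le (by norm_cast; omega)
    have hd : ContDiff ℝ m (fderiv ℝ X) := hX.fderiv_right (by norm_cast)
    refine contDiff_succ_iff_hasFDerivAt.2 ⟨_, ?_, fun c => hasFDerivAt_nemytskii h1 c⟩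
    exact (applyPointwise K E F).contDiff.comp (ih (h1.continuous_fderiv one_ne_zero) hd)

lemma contDiff_nemytskii.{u} {E F : Type u} [NormedAddCommGroup E] [NormedSpace ℝ E]
    [NormedAddCommGroup F] [NormedSpace ℝ F] {X : E → F} (hX : ContDiff ℝ ∞ X) :
    ContDiff ℝ ∞ (nemytskii K X hX.continuous) :=
  contDiff_infty.2 fun m => contDiff_nemytskii_nat m hX.continuous (hX.of_le (mod_cast le_top))

/-- The operator `c ↦ ∫₀ᵗ c` on continuous curves. -/
def volterra (E : Type*) [NormedAddCommGroup E] [NormedSpace ℝ E] [CompleteSpace E] :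
    C(Icc (0 : ℝ) 1, E) →L[ℝ] C(Icc (0 : ℝ) 1, E) :=
  LinearMap.mkContinuous
    { toFun := fun c => ⟨fun t => ∫ τ in (0 : ℝ)..t, c (projIcc 0 1 zero_le_one τ),
        (intervalIntegral.continuous_primitive (fun a b =>
          (c.continuous.comp continuous_projIcc).intervalIntegrable a b) 0).comp
            continuous_subtype_val⟩
      map_add' := fun c d => by
        ext t
        simp only [ContinuousMap.coe_mk, ContinuousMap.add_apply]
        exact intervalIntegral.integral_add
          ((c.continuous.comp continuous_projIcc).intervalIntegrable _ _)
          ((d.continuous.comp continuous_projIcc).intervalIntegrable _ _)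
      map_smul' := fun r c => by
        ext t
        simp only [ContinuousMap.coe_mk, ContinuousMap.smul_apply, RingHom.id_apply]
        exact intervalIntegral.integral_smul _ _ } 1
    (fun c => by
      rw [ContinuousMap.norm_le _ (by positivity)]
      intro t
      simp only [LinearMap.coe_mk, AddHom.coe_mk, ContinuousMap.coe_mk, one_mul]
      refine (intervalIntegral.norm_integral_le_of_norm_le_const (C := ‖c‖)
        (fun τ _ => c.norm_coe_le_norm _)).trans ?_
      rw [sub_zero, abs_of_nonneg t.2.1]
      exact mul_le_of_le_one_right (norm_nonneg _) t.2.2)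

lemma norm_volterra_le [CompleteSpace E] (c : C(Icc (0 : ℝ) 1, E)) : ‖volterra E c‖ ≤ ‖c‖ := by
  simpa using (volterra E).le_of_opNorm_le (LinearMap.mkContinuous_norm_le _ zero_le_one _) c

/-- A perturbation of the identity by an operator of norm at most `1/2`. -/
lemma exists_equiv_sub_of_norm_le [CompleteSpace E] (A : E →L[ℝ] E) {δ : ℝ} (hA : ‖A‖ ≤ δ)
    (hδ : δ ≤ 1 / 2) : ∃ T : E ≃L[ℝ] E, (T : E →L[ℝ] E) = ContinuousLinearMap.id ℝ E - A ∧
      ∀ u, ‖T.symm u - u‖ ≤ 2 * δ * ‖u‖ := by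
  have hA1 : ‖A‖ < 1 := by linarith
  let U := Units.oneSub A hA1
  let T := ContinuousLinearEquiv.ofUnit U
  have hT : ∀ u, T u = u - A u := fun u => rfl
  refine ⟨T, by ext u; rw [ContinuousLinearEquiv.coe_coe, hT]; rfl, fun u => ?_⟩
  have h1 : T.symm u - u = A (T.symm u) := by
    have := hT (T.symm u)
    rw [T.apply_symm_apply] at this
    nth_rewrite 2 [this]
    abel
  have h2 : ‖A (T.symm u)‖ ≤ δ * ‖T.symm u‖ := A.le_of_opNorm_le hA _
  have h3 : ‖T.symm u‖ ≤ ‖u‖ + δ * ‖T.symm u‖ := by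
    calc ‖T.symm u‖ = ‖u + (T.symm u - u)‖ := by congr 1; abel
      _ ≤ ‖u‖ + ‖T.symm u - u‖ := norm_add_le _ _
      _ ≤ _ := by rw [h1]; gcongr
  have hδ0 : 0 ≤ δ := (norm_nonneg A).trans hA
  rw [h1]
  have h4 : ‖T.symm u‖ ≤ 2 * ‖u‖ := by nlinarith [norm_nonneg (T.symm u)]
  calc _ ≤ δ * ‖T.symm u‖ := h2
    _ ≤ δ * (2 * ‖u‖) := by gcongr
    _ = _ := by ring

/-- Solutions of the integral equation, as continuous curves. -/
lemma exists_integral_curve [CompleteSpace E] {X : E → E} {x₁ : E} {R M δ : ℝ} (hR : 0 < R)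
    (hX : ContDiffOn ℝ ∞ X (ball x₁ R)) (hM : ∀ x ∈ ball x₁ R, ‖X x‖ ≤ M) (hMR : M ≤ R / 4)
    (hδ : ∀ x ∈ ball x₁ R, ‖fderiv ℝ X x‖ ≤ δ) :
    ∃ c : ℝ → E, c 0 = x₁ ∧ ∀ t ∈ Icc (0 : ℝ) 1, c t ∈ closedBall x₁ (R / 4) ∧
      HasDerivWithinAt c (X (c t)) (Icc 0 1) t := by
  have hx1 : x₁ ∈ ball x₁ R := mem_ball_self hR
  have hM0 : 0 ≤ M := (norm_nonneg _).trans (hM _ hx1)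
  have hδ0 : 0 ≤ δ := (norm_nonneg _).trans (hδ _ hx1)
  have hsub : closedBall x₁ (R / 4) ⊆ ball x₁ R := closedBall_subset_ball (by linarith)
  have hlip : LipschitzOnWith δ.toNNReal X (ball x₁ R) :=
    (convex_ball x₁ R).lipschitzOnWith_of_nnnorm_fderiv_le
      (fun x hx => ((hX x hx).contDiffAt (isOpen_ball.mem_nhds hx)).differentiableAt (by simp))
      (fun x hx => by
        rw [← NNReal.coe_le_coe, coe_nnnorm, Real.coe_toNNReal _ hδ0]; exact hδ x hx)
  -- Speed at most `M ≤ R / 4` during a unit of time keeps the curve in the ball of radius `R / 4`.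
  have hPL : IsPicardLindelof (fun _ => X) (tmin := 0) (tmax := 1) ⟨0, by simp⟩ x₁
      (R / 4).toNNReal 0 M.toNNReal δ.toNNReal := by
    constructor
    · intro t _
      rw [Real.coe_toNNReal _ (by linarith)]
      exact hlip.mono hsub
    · intro x _; exact continuousOn_const
    · intro t _ x hx
      rw [Real.coe_toNNReal _ (by linarith)] at *
      exact hM x (hsub hx)
    · simp only [sub_zero, sub_self, NNReal.coe_zero, Real.coe_toNNReal _ hM0]
      rw [Real.coe_toNNReal _ (by linarith)]
      simpa using hMR
  obtain ⟨α, hα⟩ := ODE.FunSpace.exists_isFixedPt_next hPL (mem_closedBall_self le_rfl)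
  refine ⟨α.compProj, by
    have := ODE.FunSpace.compProj_val (α := α) (t := ⟨0, by simp⟩)
    rw [this, ← hα, ODE.FunSpace.next_apply₀], fun t ht ↦ ⟨?_, ?_⟩⟩
  · have := α.compProj_mem_closedBall hPL.mul_max_le (t := t)
    rwa [Real.coe_toNNReal _ (by linarith)] at this
  · apply ODE.hasDerivWithinAt_picard_Icc (t₀ := 0) (by simp) hPL.continuousOn_uncurry
      α.continuous_compProj.continuousOn (fun _ ht' ↦ α.compProj_mem_closedBall hPL.mul_max_le)
      x₁ ht |>.congr_of_mem _ ht
    intro t' ht'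
    nth_rw 1 [← hα]
    rw [ODE.FunSpace.compProj_of_mem ht', ODE.FunSpace.next_apply]

/-- The time one map of the flow of a small smooth vector field is smooth. -/
theorem exists_smooth_time_one_map [CompleteSpace E] [HasContDiffBump E] {X : E → E} {x₁ : E}
    {R M δ : ℝ} (hR : 0 < R)
    (hX : ContDiffOn ℝ ∞ X (ball x₁ R)) (hM : ∀ x ∈ ball x₁ R, ‖X x‖ ≤ M) (hMR : M ≤ R / 4)
    (hδ : ∀ x ∈ ball x₁ R, ‖fderiv ℝ X x‖ ≤ δ) (hδ2 : δ ≤ 1 / 2) :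
    ∃ Φ : E → E, ContDiffAt ℝ ∞ Φ x₁ ∧ (∀ u, ‖fderiv ℝ Φ x₁ u - u‖ ≤ 2 * δ * ‖u‖) ∧
      ∀ᶠ x in 𝓝 x₁, ∃ c : ℝ → E, c 0 = x ∧ c 1 = Φ x ∧ ∀ t ∈ Icc (0 : ℝ) 1, c t ∈ ball x₁ R ∧
        HasDerivWithinAt c (X (c t)) (Icc 0 1) t := by
  obtain ⟨c₁, hc₁0, hc₁⟩ := exists_integral_curve hR hX hM hMR hδ
  have hδ0 : 0 ≤ δ := (norm_nonneg _).trans (hδ _ (mem_ball_self hR))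
  -- The cut-off makes the field globally smooth, so that composition with it acts on all continuous
  -- curves. It is `1` on the ball of radius `R / 2`, in which all relevant curves stay.
  let b : ContDiffBump x₁ := ⟨R / 2, 3 * R / 4, by linarith, by linarith⟩
  let Z : E → E := fun x => b x • X x
  have hZ : ContDiff ℝ ∞ Z := by
    rw [contDiff_iff_contDiffAt]
    intro x
    by_cases hx : x ∈ ball x₁ R
    · exact b.contDiffAt.smul ((hX x hx).contDiffAt (isOpen_ball.mem_nhds hx))
    · have : Z =ᶠ[𝓝 x] fun _ => 0 := by
        have hx' : x ∉ closedBall x₁ (3 * R / 4) := fun h =>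
          hx (closedBall_subset_ball (by linarith) h)
        filter_upwards [isClosed_closedBall.isOpen_compl.mem_nhds hx'] with y hy
        have : b y = 0 := b.zero_of_le_dist (by
          have : ¬ dist y x₁ ≤ 3 * R / 4 := hy
          exact (not_le.1 this).le)
        simp [Z, this]
      exact contDiffAt_const.congr_of_eventuallyEq this
  have hZX : ∀ x ∈ closedBall x₁ (R / 2), Z x = X x := fun x hx => by
    simp only [Z, b.one_of_mem_closedBall hx, one_smul]
  have hZd : ∀ x ∈ ball x₁ (R / 2), ‖fderiv ℝ Z x‖ ≤ δ := fun x hx => by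
    have : Z =ᶠ[𝓝 x] X := by
      filter_upwards [isOpen_ball.mem_nhds hx] with y hy using hZX y (ball_subset_closedBall hy)
    rw [this.fderiv_eq]
    exact hδ x (ball_subset_ball (by linarith) hx)
  have hc₁cont : ContinuousOn c₁ (Icc 0 1) := fun t ht => (hc₁ t ht).2.continuousWithinAt
  let C₁ : C(Icc (0 : ℝ) 1, E) := ⟨fun t => c₁ t, hc₁cont.domRestrict⟩
  -- Solutions of `Ψ c = x`, with `x` regarded as a constant curve, are the integral curves of `Z`
  -- issuing from `x`. Inverting `Ψ` near `C₁` thus solves the equation for all nearby `x`, smoothly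
  -- in `x`.
  let Ψ : C(Icc (0 : ℝ) 1, E) → C(Icc (0 : ℝ) 1, E) := fun c =>
    c - volterra E (nemytskii _ Z hZ.continuous c)
  have hΨ : ContDiff ℝ ∞ Ψ :=
    contDiff_id.sub ((volterra E).contDiff.comp (contDiff_nemytskii hZ))
  have hZ1 : ContDiff ℝ 1 Z := hZ.of_le (by simp)
  let A : C(Icc (0 : ℝ) 1, E) →L[ℝ] C(Icc (0 : ℝ) 1, E) := (volterra E).comp
    (applyPointwise _ E E (nemytskii _ (fderiv ℝ Z) (hZ1.continuous_fderiv one_ne_zero) C₁))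
  have hA : ‖A‖ ≤ δ := by
    refine A.opNorm_le_bound hδ0 fun h => (norm_volterra_le _).trans ?_
    rw [ContinuousMap.norm_le _ (by positivity)]
    intro t
    change ‖fderiv ℝ Z (C₁ t) (h t)‖ ≤ _
    refine ContinuousLinearMap.le_of_opNorm_le_of_le _ ?_ (h.norm_coe_le_norm t)
    exact hZd _ (closedBall_subset_ball (by linarith) (hc₁ t t.2).1)
  obtain ⟨T, hT, hTs⟩ := exists_equiv_sub_of_norm_le A hA hδ2
  have hΨd : HasFDerivAt Ψ (T : C(Icc (0 : ℝ) 1, E) →L[ℝ] C(Icc (0 : ℝ) 1, E)) C₁ := by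
    rw [hT]
    exact (hasFDerivAt_id C₁).sub ((volterra E).hasFDerivAt.comp C₁ (hasFDerivAt_nemytskii hZ1 C₁))
  have hΨs : HasStrictFDerivAt Ψ (T : C(Icc (0 : ℝ) 1, E) →L[ℝ] C(Icc (0 : ℝ) 1, E)) C₁ :=
    hΨ.contDiffAt.hasStrictFDerivAt' hΨd (by simp)
  have hΨC : Ψ C₁ = ContinuousLinearMap.const ℝ (Icc (0 : ℝ) 1) x₁ := by
    ext t
    have hint : ∫ τ in (0 : ℝ)..t, Z (C₁ (projIcc 0 1 zero_le_one τ)) = c₁ t - c₁ 0 := by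
      refine intervalIntegral.integral_eq_sub_of_hasDerivAt_of_le t.2.1
        (hc₁cont.mono (Icc_subset_Icc_right t.2.2)) (fun τ hτ => ?_)
        ((hZ.continuous.comp (C₁.continuous.comp continuous_projIcc)).intervalIntegrable _ _)
      have hτ' : τ ∈ Icc (0 : ℝ) 1 := ⟨hτ.1.le, hτ.2.le.trans t.2.2⟩
      rw [projIcc_of_mem zero_le_one hτ']
      change HasDerivAt c₁ (Z (c₁ τ)) τ
      rw [hZX _ (closedBall_subset_closedBall (by linarith) (hc₁ τ hτ').1)]
      exact (hc₁ τ hτ').2.hasDerivAt (Icc_mem_nhds hτ.1 (hτ.2.trans_le t.2.2))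
    change c₁ t - ∫ τ in (0 : ℝ)..t, Z (C₁ (projIcc 0 1 zero_le_one τ)) = x₁
    rw [hint, hc₁0]
    abel
  have hright := hΨs.eventually_right_inverse
  have hLd := hΨs.to_localInverse
  have hL : ContDiffAt ℝ ∞ (hΨs.localInverse Ψ T C₁) (Ψ C₁) :=
    hΨ.contDiffAt.to_localInverse hΨd (by simp)
  have hL1 : hΨs.localInverse Ψ T C₁ (Ψ C₁) = C₁ := hΨs.localInverse_apply_image
  generalize hΨs.localInverse Ψ T C₁ = L at hright hLd hL hL1
  rw [hΨC] at hL hright hLd hL1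
  let cst : E →L[ℝ] C(Icc (0 : ℝ) 1, E) := ContinuousLinearMap.const ℝ (Icc (0 : ℝ) 1)
  let ev : C(Icc (0 : ℝ) 1, E) →L[ℝ] E := ContinuousMap.evalCLM ℝ ⟨1, by simp⟩
  have hd : HasFDerivAt (fun x => ev (L (cst x)))
      (ev.comp ((T.symm : C(Icc (0 : ℝ) 1, E) →L[ℝ] C(Icc (0 : ℝ) 1, E)).comp cst)) x₁ :=
    ev.hasFDerivAt.comp x₁ (HasFDerivAt.comp x₁ hLd.hasFDerivAt cst.hasFDerivAt)
  refine ⟨fun x => ev (L (cst x)), ?_, fun u => ?_, ?_⟩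
  · exact ev.contDiff.contDiffAt.comp x₁ (ContDiffAt.comp x₁ hL cst.contDiff.contDiffAt)
  · rw [hd.fderiv]
    have h1 : ‖cst u‖ ≤ ‖u‖ := (ContinuousMap.norm_le _ (norm_nonneg _)).2 fun _ => le_rfl
    calc ‖ev (T.symm (cst u)) - u‖ = ‖(T.symm (cst u) - cst u) ⟨1, by simp⟩‖ := rfl
      _ ≤ ‖T.symm (cst u) - cst u‖ := ContinuousMap.norm_coe_le_norm _ _
      _ ≤ 2 * δ * ‖cst u‖ := hTs _
      _ ≤ _ := by gcongr
  · have hcont : Filter.Tendsto (fun x => L (cst x)) (𝓝 x₁) (𝓝 C₁) := by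
      have := (ContDiffAt.comp x₁ hL cst.contDiff.contDiffAt).continuousAt.tendsto
      simpa [hL1, cst, Function.comp_def] using this
    -- Curves within `R / 4` of `C₁`, which itself stays within `R / 4` of `x₁`, remain in the
    -- region where `Z = X`.
    filter_upwards [hcont (Metric.ball_mem_nhds C₁ (show 0 < R / 4 by linarith)),
      cst.continuous.continuousAt.eventually hright] with x hx hx2
    set C := L (cst x)
    have hCx : ∀ t : Icc (0 : ℝ) 1,
        C t = x + ∫ τ in (0 : ℝ)..t, Z (C (projIcc 0 1 zero_le_one τ)) := by
      intro t
      have := congrArg (fun c : C(Icc (0 : ℝ) 1, E) => c t) hx2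
      change C t - ∫ τ in (0 : ℝ)..t, Z (C (projIcc 0 1 zero_le_one τ)) = x at this
      rw [← this]; abel
    have hCball : ∀ t : Icc (0 : ℝ) 1, C t ∈ ball x₁ (R / 2) := by
      intro t
      have h1 : dist (C t) (C₁ t) < R / 4 := (C.dist_apply_le_dist t).trans_lt hx
      have h2 : dist (c₁ t) x₁ ≤ R / 4 := (hc₁ t t.2).1
      have h3 : dist (C t) x₁ ≤ dist (C t) (C₁ t) + dist (c₁ t) x₁ := dist_triangle _ _ _
      rw [mem_ball]; linarith
    have hcc : Continuous fun τ : ℝ => Z (C (projIcc 0 1 zero_le_one τ)) :=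
      hZ.continuous.comp (C.continuous.comp continuous_projIcc)
    refine ⟨fun t => x + ∫ τ in (0 : ℝ)..t, Z (C (projIcc 0 1 zero_le_one τ)), by simp,
      (hCx ⟨1, by simp⟩).symm, fun t ht => ?_⟩
    have hct := hCx ⟨t, ht⟩
    have hb := hCball ⟨t, ht⟩
    beta_reduce
    rw [← hct]
    refine ⟨ball_subset_ball (by linarith) hb, ?_⟩
    rw [← hZX _ (ball_subset_closedBall hb)]
    have h4 := (intervalIntegral.integral_hasDerivAt_right (hcc.intervalIntegrable 0 t)
      (hcc.stronglyMeasurableAtFilter _ _) hcc.continuousAt)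
    rw [projIcc_of_mem zero_le_one ht] at h4
    exact (h4.const_add x).hasDerivWithinAt

end Flow

/-! ### Differentials of holomorphic charts and the metric in a chart -/

section ChartCalculus

variable {m : ℕ} {Y : Type*} [TopologicalSpace Y] [ChartedSpace (Cn m) Y]

lemma HasMFDerivAt.restrictScalars_real {E E' M M' : Type*} [NormedAddCommGroup E]
    [NormedSpace ℂ E] [NormedAddCommGroup E'] [NormedSpace ℂ E']
    [TopologicalSpace M] [ChartedSpace E M] [TopologicalSpace M'] [ChartedSpace E' M']
    {f : M → M'} {y : M} {L : E →L[ℂ] E'} (h : HasMFDerivAt 𝓘(ℂ, E) 𝓘(ℂ, E') f y L) :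
    HasMFDerivAt 𝓘(ℝ, E) 𝓘(ℝ, E') f y (L.restrictScalars ℝ) :=
  ⟨h.1, HasFDerivWithinAt.restrictScalars ℝ h.2⟩

lemma mem_maximalAtlas_real {e : OpenPartialHomeomorph Y (Cn m)}
    (he : e ∈ IsManifold.maximalAtlas 𝓘(ℂ, Cn m) ω Y) :
    e ∈ IsManifold.maximalAtlas 𝓘(ℝ, Cn m) ∞ Y := by
  have key : ∀ f : OpenPartialHomeomorph (Cn m) (Cn m), f ∈ contDiffGroupoid ω 𝓘(ℂ, Cn m) →
      f ∈ contDiffGroupoid ∞ 𝓘(ℝ, Cn m) := by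
    intro f hf
    rw [contDiffGroupoid, mem_groupoid_of_pregroupoid] at hf ⊢
    exact ⟨(ContDiffOn.restrict_scalars ℝ hf.1).of_le le_top,
      (ContDiffOn.restrict_scalars ℝ hf.2).of_le le_top⟩
  intro e' he'
  exact ⟨key _ (he e' he').1, key _ (he e' he').2⟩

/-- The differential of a chart, as an endomorphism of the model space. -/
def chartD (e : OpenPartialHomeomorph Y (Cn m)) (y : Y) : Cn m →L[ℝ] Cn m :=
  mfderiv 𝓘(ℝ, Cn m) 𝓘(ℝ, Cn m) e y

/-- The differential of the inverse of a chart, as an endomorphism of the model space. -/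
def chartDinv (e : OpenPartialHomeomorph Y (Cn m)) (x : Cn m) : Cn m →L[ℝ] Cn m :=
  mfderiv 𝓘(ℝ, Cn m) 𝓘(ℝ, Cn m) e.symm x

variable [IsManifold 𝓘(ℂ, Cn m) ω Y]

lemma mdifferentiable_of_mem_maximalAtlas_real {e : OpenPartialHomeomorph Y (Cn m)}
    (he : e ∈ IsManifold.maximalAtlas 𝓘(ℂ, Cn m) ω Y) :
    e.MDifferentiable 𝓘(ℝ, Cn m) 𝓘(ℝ, Cn m) :=
  ⟨fun _ hy => ((contMDiffOn_of_mem_maximalAtlas (mem_maximalAtlas_real he)).mdifferentiableOn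
      (by simp)) _ hy,
   fun _ hy => ((contMDiffOn_symm_of_mem_maximalAtlas (mem_maximalAtlas_real he)).mdifferentiableOn
      (by simp)) _ hy⟩

lemma hasMFDerivAt_chart {e : OpenPartialHomeomorph Y (Cn m)}
    (he : e ∈ IsManifold.maximalAtlas 𝓘(ℂ, Cn m) ω Y) {y : Y} (hy : y ∈ e.source) :
    HasMFDerivAt 𝓘(ℝ, Cn m) 𝓘(ℝ, Cn m) e y (chartD e y) :=
  ((mdifferentiable_of_mem_maximalAtlas_real he).mdifferentiableAt hy).hasMFDerivAt

lemma hasMFDerivAt_chart_symm {e : OpenPartialHomeomorph Y (Cn m)}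
    (he : e ∈ IsManifold.maximalAtlas 𝓘(ℂ, Cn m) ω Y) {x : Cn m} (hx : x ∈ e.target) :
    HasMFDerivAt 𝓘(ℝ, Cn m) 𝓘(ℝ, Cn m) e.symm x (chartDinv e x) :=
  ((mdifferentiable_of_mem_maximalAtlas_real he).mdifferentiableAt_symm hx).hasMFDerivAt

lemma chartDinv_chartD {e : OpenPartialHomeomorph Y (Cn m)}
    (he : e ∈ IsManifold.maximalAtlas 𝓘(ℂ, Cn m) ω Y) {y : Y} (hy : y ∈ e.source) (v : Cn m) :
    chartDinv e (e y) (chartD e y v) = v :=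
  DFunLike.congr_fun ((mdifferentiable_of_mem_maximalAtlas_real he).symm_comp_deriv hy) v

lemma chartD_chartDinv {e : OpenPartialHomeomorph Y (Cn m)}
    (he : e ∈ IsManifold.maximalAtlas 𝓘(ℂ, Cn m) ω Y) {x : Cn m} (hx : x ∈ e.target) (v : Cn m) :
    chartD e (e.symm x) (chartDinv e x v) = v :=
  DFunLike.congr_fun ((mdifferentiable_of_mem_maximalAtlas_real he).comp_symm_deriv hx) v

lemma chartD_chartDinv' {e : OpenPartialHomeomorph Y (Cn m)}
    (he : e ∈ IsManifold.maximalAtlas 𝓘(ℂ, Cn m) ω Y) {y : Y} (hy : y ∈ e.source) (v : Cn m) :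
    chartD e y (chartDinv e (e y) v) = v := by
  have := chartD_chartDinv he (e.map_source hy) v
  rwa [e.left_inv hy] at this

/-- The real differential of the holomorphic map `e.symm` is the restriction of a complex linear
one. This transports the `J`-invariance of the metric and the complex linearity of `dπ` to charts.
-/
lemma chartDinv_smul {e : OpenPartialHomeomorph Y (Cn m)}
    (he : e ∈ IsManifold.maximalAtlas 𝓘(ℂ, Cn m) ω Y) {x : Cn m} (hx : x ∈ e.target) (c : ℂ)
    (v : Cn m) : chartDinv e x (c • v) = c • chartDinv e x v := by
  have h := ((contMDiffOn_symm_of_mem_maximalAtlas he).mdifferentiableOn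
    (by simp) x hx).mdifferentiableAt (e.open_target.mem_nhds hx)
  have h2 := (HasMFDerivAt.restrictScalars_real h.hasMFDerivAt).mfderiv
  have h3 : chartDinv e x = (show Cn m →L[ℂ] Cn m from
      mfderiv 𝓘(ℂ, Cn m) 𝓘(ℂ, Cn m) e.symm x).restrictScalars ℝ := h2
  rw [h3]
  exact (show Cn m →L[ℂ] Cn m from mfderiv 𝓘(ℂ, Cn m) 𝓘(ℂ, Cn m) e.symm x).map_smul c v

lemma chartD_smul {e : OpenPartialHomeomorph Y (Cn m)}
    (he : e ∈ IsManifold.maximalAtlas 𝓘(ℂ, Cn m) ω Y) {y : Y} (hy : y ∈ e.source) (c : ℂ)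
    (v : Cn m) : chartD e y (c • v) = c • chartD e y v := by
  have h := chartDinv_smul he (e.map_source hy) c (chartD e y v)
  rw [chartDinv_chartD he hy] at h
  rw [← h, chartD_chartDinv' he hy]

/-- The metric as a bilinear form on the model space. -/
def KahlerMetric.gm (γ : KahlerMetric m Y) (y : Y) : Cn m →L[ℝ] Cn m →L[ℝ] ℝ := γ.inner y

/-- The expression of the metric in a chart. -/
def KahlerMetric.inChart (γ : KahlerMetric m Y) (e : OpenPartialHomeomorph Y (Cn m)) (x : Cn m) :
    Cn m →L[ℝ] Cn m →L[ℝ] ℝ :=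
  (γ.gm (e.symm x)).bilinearComp (chartDinv e x) (chartDinv e x)

lemma KahlerMetric.inChart_apply (γ : KahlerMetric m Y) (e : OpenPartialHomeomorph Y (Cn m))
    (x u v : Cn m) :
    γ.inChart e x u v = γ.gm (e.symm x) (chartDinv e x u) (chartDinv e x v) := rfl

lemma KahlerMetric.gm_eq (γ : KahlerMetric m Y) {e : OpenPartialHomeomorph Y (Cn m)}
    (he : e ∈ IsManifold.maximalAtlas 𝓘(ℂ, Cn m) ω Y) {y : Y} (hy : y ∈ e.source) (u v : Cn m) :
    γ.gm y u v = γ.inChart e (e y) (chartD e y u) (chartD e y v) := by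
  rw [KahlerMetric.inChart_apply, chartDinv_chartD he hy, chartDinv_chartD he hy, e.left_inv hy]

lemma KahlerMetric.gm_symm (γ : KahlerMetric m Y) (y : Y) (u v : Cn m) :
    γ.gm y u v = γ.gm y v u := γ.symm y u v

lemma KahlerMetric.gm_pos (γ : KahlerMetric m Y) (y : Y) {u : Cn m} (hu : u ≠ 0) :
    0 < γ.gm y u u := γ.pos y u hu

lemma KahlerMetric.gm_I (γ : KahlerMetric m Y) (y : Y) (u v : Cn m) :
    γ.gm y (Complex.I • u) (Complex.I • v) = γ.gm y u v := γ.inner_J y u v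

/-- The curve of vectors is the tangent map of `e.symm` composed with the constant field `u`. These
coordinate fields are what the bundle metric is evaluated on. -/
lemma contMDiffOn_chartDinv {e : OpenPartialHomeomorph Y (Cn m)}
    (he : e ∈ IsManifold.maximalAtlas 𝓘(ℂ, Cn m) ω Y) (u : Cn m) :
    ContMDiffOn 𝓘(ℝ, Cn m) (𝓘(ℝ, Cn m).prod 𝓘(ℝ, Cn m)) ∞
      (fun x => (⟨e.symm x, chartDinv e x u⟩ : TangentBundle 𝓘(ℝ, Cn m) Y)) e.target := by
  have h := (contMDiffOn_symm_of_mem_maximalAtlas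
    (mem_maximalAtlas_real he)).contMDiffOn_tangentMapWithin (m := ∞) le_rfl
    e.open_target.uniqueMDiffOn
  let s : ∀ x : Cn m, TangentSpace 𝓘(ℝ, Cn m) x := fun _ => u
  have hs : ContMDiff 𝓘(ℝ, Cn m) 𝓘(ℝ, Cn m).tangent ∞
      (fun x => (⟨x, s x⟩ : TangentBundle 𝓘(ℝ, Cn m) (Cn m))) := by
    intro x
    refine (Bundle.contMDiffAt_section (E := TangentSpace 𝓘(ℝ, Cn m)) (s := s) x).2 ?_
    simpa [s] using contMDiffAt_const
  refine (h.comp hs.contMDiffOn (t := Bundle.TotalSpace.proj ⁻¹' e.target) (s := e.target)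
    fun x hx => hx).congr ?_
  intro x hx
  simp only [Function.comp, tangentMapWithin, chartDinv, s]
  rw [mfderivWithin_of_isOpen e.open_target hx]
  rfl

/-- In finite dimension, smoothness of a map into bilinear forms can be tested on fixed pairs of
vectors. There it is the smooth bundle metric paired with two coordinate fields. -/
lemma KahlerMetric.contDiffOn_inChart (γ : KahlerMetric m Y)
    {e : OpenPartialHomeomorph Y (Cn m)}
    (he : e ∈ IsManifold.maximalAtlas 𝓘(ℂ, Cn m) ω Y) :
    ContDiffOn ℝ ∞ (γ.inChart e) e.target := by
  rw [contDiffOn_clm_apply]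
  intro u
  rw [contDiffOn_clm_apply]
  intro v
  rw [← contMDiffOn_iff_contDiffOn]
  intro x hx
  have : ContMDiffWithinAt 𝓘(ℝ, Cn m) (𝓘(ℝ, Cn m).prod 𝓘(ℝ)) ∞
      (fun x ↦ Bundle.TotalSpace.mk' ℝ (E := Bundle.Trivial Y ℝ) (e.symm x)
        (γ.inner (e.symm x) (chartDinv e x u) (chartDinv e x v))) e.target x := by
    apply ContMDiffWithinAt.clm_bundle_apply₂ (F₁ := Cn m) (F₂ := Cn m)
    · exact ContMDiffAt.comp_contMDiffWithinAt x γ.contMDiff.contMDiffAt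
        (contMDiffOn_symm_of_mem_maximalAtlas (mem_maximalAtlas_real he) x hx)
    · exact contMDiffOn_chartDinv he u x hx
    · exact contMDiffOn_chartDinv he v x hx
  simp only [Bundle.contMDiffWithinAt_totalSpace] at this
  exact this.2

end ChartCalculus

section Instances

variable (m : ℕ)

/-- A shortcut instance. -/
@[reducible] def cnNormedAddCommGroup : NormedAddCommGroup (Cn m) := Pi.normedAddCommGroup

/-- A shortcut instance. -/
@[reducible] def cnNormedSpaceReal : NormedSpace ℝ (Cn m) := Pi.normedSpace

/-- A shortcut instance. -/
@[reducible] def cnNormedSpaceComplex : NormedSpace ℂ (Cn m) := Pi.normedSpace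

/-- A shortcut instance. -/
@[reducible] def cnDualNormedAddCommGroup : NormedAddCommGroup (Cn m →L[ℝ] ℝ) :=
  ContinuousLinearMap.toNormedAddCommGroup

/-- A shortcut instance. -/
@[reducible] def cnBilinNormedAddCommGroup : NormedAddCommGroup (Cn m →L[ℝ] Cn m →L[ℝ] ℝ) :=
  ContinuousLinearMap.toNormedAddCommGroup

end Instances

/-! ### Differential forms and the differential of `π` in charts -/

section ChartForms

attribute [local instance] cnNormedAddCommGroup cnNormedSpaceReal cnNormedSpaceComplex
  cnDualNormedAddCommGroup cnBilinNormedAddCommGroup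

variable {m : ℕ} {Y : Type*} [TopologicalSpace Y] [ChartedSpace (Cn m) Y]
  [IsManifold 𝓘(ℂ, Cn m) ω Y]

lemma DForm.apply_eq_inChart {k : ℕ} (β : DForm (m := m) Y k)
    {e : OpenPartialHomeomorph Y (Cn m)} (he : e ∈ IsManifold.maximalAtlas 𝓘(ℂ, Cn m) ω Y)
    {y : Y} (hy : y ∈ e.source) (v : Fin k → Cn m) :
    β y v = β.inChart e (e y) (fun i => chartD e y (v i)) := by
  -- The points `e.symm (e y)` and `y` are only propositionally equal, while the type of `β y`
  -- depends on the point. Both the point and the vectors are therefore replaced at once.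
  have key : ∀ y' : Y, y' = y → ∀ v' : Fin k → Cn m, v' = v → β y v = β y' v' := by
    rintro _ rfl _ rfl; rfl
  refine key _ (e.left_inv hy) (fun i => chartDinv e (e y) (chartD e y (v i))) ?_
  funext i
  exact chartDinv_chartD he hy _

/-- The complex differential of a function, as a functional on the model space. -/
def hd (π : Y → ℂ) (y : Y) : Cn m →L[ℂ] ℂ := mfderiv 𝓘(ℂ, Cn m) 𝓘(ℂ, ℂ) π y

lemma contDiffOn_comp_chart_symm {π : Y → ℂ} (hπ : ContMDiff 𝓘(ℂ, Cn m) 𝓘(ℂ, ℂ) ω π)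
    {e : OpenPartialHomeomorph Y (Cn m)} (he : e ∈ IsManifold.maximalAtlas 𝓘(ℂ, Cn m) ω Y) :
    ContDiffOn ℂ ω (π ∘ e.symm) e.target := by
  rw [← contMDiffOn_iff_contDiffOn]
  exact hπ.comp_contMDiffOn (contMDiffOn_symm_of_mem_maximalAtlas he)

lemma hasMFDerivAt_real_of_holomorphic {π : Y → ℂ} (hπ : ContMDiff 𝓘(ℂ, Cn m) 𝓘(ℂ, ℂ) ω π)
    (y : Y) : HasMFDerivAt 𝓘(ℝ, Cn m) 𝓘(ℝ, ℂ) π y ((hd π y).restrictScalars ℝ) :=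
  HasMFDerivAt.restrictScalars_real ((hπ.mdifferentiable (by simp)) y).hasMFDerivAt

lemma hasFDerivAt_of_hasMFDerivAt {E F : Type*} [NormedAddCommGroup E] [NormedSpace ℝ E]
    [NormedAddCommGroup F] [NormedSpace ℝ F] {f : E → F} {x : E} {L : E →L[ℝ] F}
    (h : HasMFDerivAt 𝓘(ℝ, E) 𝓘(ℝ, F) f x L) : HasFDerivAt f L x := h.hasFDerivAt

lemma fderiv_comp_chart_symm {π : Y → ℂ} (hπ : ContMDiff 𝓘(ℂ, Cn m) 𝓘(ℂ, ℂ) ω π)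
    {e : OpenPartialHomeomorph Y (Cn m)} (he : e ∈ IsManifold.maximalAtlas 𝓘(ℂ, Cn m) ω Y)
    {x : Cn m} (hx : x ∈ e.target) (v : Cn m) :
    fderiv ℝ (π ∘ e.symm) x v = hd π (e.symm x) (chartDinv e x v) := by
  have h := HasMFDerivAt.comp x (hasMFDerivAt_real_of_holomorphic hπ (e.symm x))
    (hasMFDerivAt_chart_symm he hx)
  rw [(hasFDerivAt_of_hasMFDerivAt h).fderiv]
  rfl

lemma hd_eq {π : Y → ℂ} (hπ : ContMDiff 𝓘(ℂ, Cn m) 𝓘(ℂ, ℂ) ω π)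
    {e : OpenPartialHomeomorph Y (Cn m)} (he : e ∈ IsManifold.maximalAtlas 𝓘(ℂ, Cn m) ω Y)
    {y : Y} (hy : y ∈ e.source) (v : Cn m) :
    hd π y v = fderiv ℝ (π ∘ e.symm) (e y) (chartD e y v) := by
  rw [fderiv_comp_chart_symm hπ he (e.map_source hy), chartDinv_chartD he hy, e.left_inv hy]

end ChartForms

/-! ### The Riemannian distance and closed tubes -/

section Distance

attribute [local instance] cnNormedAddCommGroup cnNormedSpaceReal cnNormedSpaceComplex
  cnDualNormedAddCommGroup cnBilinNormedAddCommGroup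

variable {m : ℕ} {Y : Type*} [TopologicalSpace Y] [ChartedSpace (Cn m) Y]
  [IsManifold 𝓘(ℂ, Cn m) ω Y] (γ : KahlerMetric m Y)

open scoped Bundle
open Manifold Metric

lemma KahlerMetric.edist_triangle (x y z : Y) : γ.edist x z ≤ γ.edist x y + γ.edist y z := by
  let : Bundle.RiemannianBundle (fun y : Y => TangentSpace 𝓘(ℝ, Cn m) y) :=
    ⟨γ.toRiemannianMetric⟩
  have : IsManifold 𝓘(ℝ, Cn m) 1 Y := IsManifold.of_le (n := ∞) (by simp)
  exact riemannianEDist_triangle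

lemma KahlerMetric.norm_eq_vnorm (y : Y) (v : TangentSpace 𝓘(ℝ, Cn m) y) :
    letI : Bundle.RiemannianBundle (fun y : Y => TangentSpace 𝓘(ℝ, Cn m) y) :=
      ⟨γ.toRiemannianMetric⟩
    ‖v‖ = γ.vnorm y v := by
  let : Bundle.RiemannianBundle (fun y : Y => TangentSpace 𝓘(ℝ, Cn m) y) :=
      ⟨γ.toRiemannianMetric⟩
  exact norm_eq_sqrt_real_inner v

lemma KahlerMetric.vnorm_chartDinv_le {e : OpenPartialHomeomorph Y (Cn m)} {x : Cn m} {K : ℝ}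
    (hK : ‖γ.inChart e x‖ ≤ K) (u : Cn m) :
    γ.vnorm (e.symm x) (chartDinv e x u) ≤ √K * ‖u‖ := by
  have hK0 : 0 ≤ K := (norm_nonneg _).trans hK
  change √(γ.inChart e x u u) ≤ _
  rw [Real.sqrt_le_left (by positivity), mul_pow, Real.sq_sqrt hK0]
  have h1 : ‖γ.inChart e x u u‖ ≤ ‖γ.inChart e x‖ * ‖u‖ * ‖u‖ := (γ.inChart e x).le_opNorm₂ u u
  calc γ.inChart e x u u ≤ ‖γ.inChart e x u u‖ := Real.le_norm_self _
    _ ≤ _ := h1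
    _ = ‖γ.inChart e x‖ * ‖u‖ ^ 2 := by ring
    _ ≤ _ := by gcongr

/-- Charts are locally Lipschitz with respect to the distance of a Kähler metric. -/
lemma KahlerMetric.exists_edist_chart_symm_le {e : OpenPartialHomeomorph Y (Cn m)}
    (he : e ∈ IsManifold.maximalAtlas 𝓘(ℂ, Cn m) ω Y) {x₀ : Cn m} (hx₀ : x₀ ∈ e.target) :
    ∃ r > 0, ∃ C > 0, ball x₀ r ⊆ e.target ∧ ∀ x ∈ ball x₀ r, ∀ x' ∈ ball x₀ r,
      γ.edist (e.symm x) (e.symm x') ≤ ENNReal.ofReal (C * ‖x - x'‖) := by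
  let : Bundle.RiemannianBundle (fun y : Y => TangentSpace 𝓘(ℝ, Cn m) y) :=
    ⟨γ.toRiemannianMetric⟩
  have : IsManifold 𝓘(ℝ, Cn m) 1 Y := IsManifold.of_le (n := ∞) (by simp)
  have hG := (γ.contDiffOn_inChart he).continuousOn
  obtain ⟨r₀, hr₀, hsub⟩ := Metric.isOpen_iff.1 e.open_target x₀ hx₀
  have hGx : ContinuousAt (γ.inChart e) x₀ := hG.continuousAt (e.open_target.mem_nhds hx₀)
  obtain ⟨r₁, hr₁, hb⟩ := Metric.mem_nhds_iff.1 (hGx.norm.eventually_lt_const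
    (show ‖γ.inChart e x₀‖ < ‖γ.inChart e x₀‖ + 1 by linarith))
  set K := ‖γ.inChart e x₀‖ + 1 with hK
  have hK0 : 0 < K := by positivity
  refine ⟨min r₀ r₁, lt_min hr₀ hr₁, √K, Real.sqrt_pos.2 hK0,
    (ball_subset_ball (min_le_left _ _)).trans hsub, fun x hx x' hx' => ?_⟩
  -- The image of the straight segment is a competitor for the distance. Its speed is at most `√K ‖x
  -- - x'‖`, because `K` bounds the metric on the ball.
  let η : ℝ →ᴬ[ℝ] Cn m := ContinuousAffineMap.lineMap (R := ℝ) x x'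
  have hη : ∀ t ∈ Icc (0 : ℝ) 1, η t ∈ ball x₀ (min r₀ r₁) := by
    intro t ht
    apply (convex_ball x₀ (min r₀ r₁)).segment_subset hx hx'
    rw [segment_eq_image_lineMap]
    exact ⟨t, ht, rfl⟩
  have hηt : ∀ t ∈ Icc (0 : ℝ) 1, η t ∈ e.target := fun t ht =>
    hsub (ball_subset_ball (min_le_left _ _) (hη t ht))
  have ηs : ContMDiffOn 𝓘(ℝ, ℝ) 𝓘(ℝ, Cn m) 1 η (Icc 0 1) := by
    apply ContMDiff.contMDiffOn
    rw [contMDiff_iff_contDiff]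
    exact ContinuousAffineMap.contDiff _
  have hes : ContMDiffOn 𝓘(ℝ, Cn m) 𝓘(ℝ, Cn m) 1 e.symm e.target :=
    (contMDiffOn_symm_of_mem_maximalAtlas (mem_maximalAtlas_real he)).of_le (by simp)
  have hle : riemannianEDist 𝓘(ℝ, Cn m) (e.symm x) (e.symm x') ≤
      pathELength 𝓘(ℝ, Cn m) (e.symm ∘ η) 0 1 := by
    apply riemannianEDist_le_pathELength _ _ _ zero_le_one
    · exact hes.comp ηs hηt
    · simp [η, ContinuousAffineMap.coe_lineMap_eq]
    · simp [η, ContinuousAffineMap.coe_lineMap_eq]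
  refine hle.trans ?_
  rw [pathELength_eq_lintegral_mfderivWithin_Icc]
  calc _ ≤ ∫⁻ t in Icc (0 : ℝ) 1, ENNReal.ofReal (√K * ‖x - x'‖) := by
        apply setLIntegral_mono' measurableSet_Icc (fun t ht ↦ ?_)
        have hηd : HasMFDerivWithinAt 𝓘(ℝ, ℝ) 𝓘(ℝ, Cn m) η (Icc 0 1) t
            ((1 : ℝ →L[ℝ] ℝ).smulRight (x' - x)) := by
          have : HasDerivAt η (x' - x) t := by
            simpa [η, ContinuousAffineMap.coe_lineMap_eq] using
              (AffineMap.hasDerivAt_lineMap (a := x) (b := x') (x := t))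
          exact (this.hasFDerivAt.hasMFDerivAt).hasMFDerivWithinAt
        have hcd := (hasMFDerivAt_chart_symm he (hηt t ht)).comp_hasMFDerivWithinAt t hηd
        have hu : UniqueMDiffWithinAt 𝓘(ℝ, ℝ) (Icc (0 : ℝ) 1) t := by
          rw [uniqueMDiffWithinAt_iff_uniqueDiffWithinAt]
          exact uniqueDiffOn_Icc zero_lt_one t ht
        have hv : mfderivWithin 𝓘(ℝ, ℝ) 𝓘(ℝ, Cn m) (e.symm ∘ η) (Icc 0 1) t (1 : ℝ) =
            (chartDinv e (η t) (x' - x) : Cn m) := by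
          rw [hcd.mfderivWithin hu]
          change chartDinv e (η t) ((1 : ℝ) • (x' - x)) = _
          rw [one_smul]
        have hn := γ.vnorm_chartDinv_le
          (le_of_lt (hb (ball_subset_ball (min_le_right _ _) (hη t ht)))) (x' - x)
        rw [norm_sub_rev x x', ← ofReal_norm, γ.norm_eq_vnorm]
        apply ENNReal.ofReal_le_ofReal
        refine le_trans (le_of_eq ?_) hn
        exact congrArg (fun v : TangentSpace 𝓘(ℝ, Cn m) (e.symm (η t)) => γ.vnorm _ v) hv
    _ ≤ _ := by simp

lemma KahlerMetric.eventually_edist_lt (x : Y) {c : ℝ≥0∞} (hc : 0 < c) :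
    ∀ᶠ y in 𝓝 x, γ.edist x y < c := by
  let e := chartAt (Cn m) x
  obtain ⟨r, hr, C, hC, hsub, h⟩ := γ.exists_edist_chart_symm_le
    (IsManifold.chart_mem_maximalAtlas x) (e.map_source (mem_chart_source _ x))
  have hcont : ContinuousAt e x := e.continuousAt (mem_chart_source _ x)
  have h0 : Filter.Tendsto (fun y => ENNReal.ofReal (C * ‖e x - e y‖)) (𝓝 x) (𝓝 0) := by
    have : Filter.Tendsto (fun y => C * ‖e x - e y‖) (𝓝 x) (𝓝 (C * ‖e x - e x‖)) :=
      (((tendsto_const_nhds (x := e x)).sub hcont.tendsto).norm).const_mul C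
    simpa using ENNReal.tendsto_ofReal this
  filter_upwards [hcont (Metric.ball_mem_nhds _ hr), h0.eventually_lt_const hc,
    e.open_source.mem_nhds (mem_chart_source _ x)] with y hy hy2 hy3
  have := h (e x) (mem_ball_self hr) (e y) hy
  rw [e.left_inv (mem_chart_source _ x), e.left_inv hy3] at this
  exact this.trans_lt hy2

lemma KahlerMetric.distTo_le (A : Set Y) (y z : Y) :
    γ.distTo y A ≤ γ.edist y z + γ.distTo z A := by
  simp only [KahlerMetric.distTo]
  rw [ENNReal.add_iInf]
  refine le_iInf fun p => ?_
  by_cases hp : p ∈ A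
  · simp only [hp, iInf_pos]
    exact (iInf₂_le p hp).trans (γ.edist_triangle y z p)
  · simp [hp]

/-- The distance to `A` obeys the triangle inequality, and points near `y` have small `γ.edist` from
`y`, so a strict inequality at `y` survives nearby. This makes `A_s` open in the central fibre. -/
lemma KahlerMetric.isClosed_closedTube (A : Set Y) (r : ℝ) : IsClosed (γ.closedTube A r) := by
  rw [← isOpen_compl_iff, isOpen_iff_mem_nhds]
  intro y hy
  have hy' : ENNReal.ofReal r < γ.distTo y A := not_le.1 hy
  obtain ⟨c, hc, hc'⟩ : ∃ c : ℝ≥0∞, 0 < c ∧ ENNReal.ofReal r + c < γ.distTo y A := by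
    obtain ⟨b, hb1, hb2⟩ := exists_between hy'
    refine ⟨b - ENNReal.ofReal r, tsub_pos_of_lt hb1, ?_⟩
    rwa [add_tsub_cancel_of_le hb1.le]
  filter_upwards [γ.eventually_edist_lt y hc] with z hz hz'
  have h1 : γ.distTo z A ≤ ENNReal.ofReal r := hz'
  have h2 := γ.distTo_le A y z
  refine absurd (h2.trans (add_le_add hz.le h1)) (not_le.2 ?_)
  rwa [add_comm]

end Distance

/-! ### Horizontal lifts in linear algebra and their bounds -/

section HorizontalLift

variable {E : Type*} [NormedAddCommGroup E] [NormedSpace ℝ E]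

/-- This is the Cauchy–Schwarz inequality, from the discriminant of `t ↦ g (u + t v) (u + t v)`. -/
lemma bilin_sq_le {g : E →L[ℝ] E →L[ℝ] ℝ} (hs : ∀ u v, g u v = g v u)
    (hp : ∀ u, 0 ≤ g u u) (u v : E) : g u v ^ 2 ≤ g u u * g v v := by
  have h : ∀ t : ℝ, 0 ≤ g v v * (t * t) + 2 * g u v * t + g u u := by
    intro t
    have := hp (u + t • v)
    simp only [map_add, map_smul, add_apply, smul_apply,
      smul_eq_mul, hs v u] at this
    linarith
  have := discrim_le_zero h
  rw [discrim] at this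
  nlinarith

/-- The continuous linear equivalence of a finite dimensional space with its dual defined by a
positive definite bilinear form. -/
lemma exists_equiv_of_posDef [FiniteDimensional ℝ E] (g : E →L[ℝ] E →L[ℝ] ℝ)
    (hp : ∀ u, u ≠ 0 → 0 < g u u) : ∃ T : E ≃L[ℝ] (E →L[ℝ] ℝ), (T : E →L[ℝ] E →L[ℝ] ℝ) = g := by
  have hinj : Function.Injective (g : E →ₗ[ℝ] E →L[ℝ] ℝ) := by
    rw [← LinearMap.ker_eq_bot, LinearMap.ker_eq_bot']
    intro u hu
    by_contra h
    have := hp u h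
    have h2 : g u = 0 := hu
    rw [h2] at this
    simp at this
  have hfr : Module.finrank ℝ E = Module.finrank ℝ (E →L[ℝ] ℝ) := by
    rw [← (LinearMap.toContinuousLinearMap (𝕜 := ℝ) (E := E) (F' := ℝ)).finrank_eq]
    exact (Subspace.dual_finrank_eq (K := ℝ) (V := E)).symm
  refine ⟨(LinearEquiv.ofInjectiveOfFinrankEq (g : E →ₗ[ℝ] E →L[ℝ] ℝ) hinj
    hfr).toContinuousLinearEquiv, ?_⟩
  ext u v
  simp
  rfl

/-- The real part of a complex valued functional. -/
def reForm (ℓ : E →L[ℝ] ℂ) : E →L[ℝ] ℝ := Complex.reCLM.comp ℓ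

/-- The vector dual to the real part of `ℓ`. -/
def dualVec (g : E →L[ℝ] E →L[ℝ] ℝ) (ℓ : E →L[ℝ] ℂ) : E :=
  ContinuousLinearMap.inverse g (reForm ℓ)

/-- The vector orthogonal to `ker ℓ` on which `ℓ` is `1`. -/
def horizLift (g : E →L[ℝ] E →L[ℝ] ℝ) (ℓ : E →L[ℝ] ℂ) : E :=
  (reForm ℓ (dualVec g ℓ))⁻¹ • dualVec g ℓ

lemma apply_dualVec [FiniteDimensional ℝ E] {g : E →L[ℝ] E →L[ℝ] ℝ}
    (hp : ∀ u, u ≠ 0 → 0 < g u u) (ℓ : E →L[ℝ] ℂ) : g (dualVec g ℓ) = reForm ℓ := by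
  obtain ⟨T, hT⟩ := exists_equiv_of_posDef g hp
  rw [dualVec, ← hT, ContinuousLinearMap.inverse_equiv]
  exact T.apply_symm_apply _

/-- The bound on the inverse gives `‖u‖ ≤ K ‖g u‖`, and Cauchy–Schwarz gives `‖g u‖ ^ 2 ≤ K * g u
u`. Coercivity thus depends only on bounds of `g` and its inverse, which are locally uniform. -/
lemma norm_sq_le_of_posDef [FiniteDimensional ℝ E] {g : E →L[ℝ] E →L[ℝ] ℝ}
    (hs : ∀ u v, g u v = g v u) (hp : ∀ u, u ≠ 0 → 0 < g u u) {K : ℝ} (hK : ‖g‖ ≤ K)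
    (hK' : ‖ContinuousLinearMap.inverse g‖ ≤ K) (u : E) : ‖u‖ ^ 2 ≤ K ^ 3 * g u u := by
  obtain ⟨T, hT⟩ := exists_equiv_of_posDef g hp
  have hK0 : 0 ≤ K := (norm_nonneg g).trans hK
  have hp' : ∀ u, 0 ≤ g u u := fun u => by
    by_cases h : u = 0
    · simp [h]
    · exact (hp u h).le
  have h1 : ‖u‖ ≤ K * ‖g u‖ := by
    have : ContinuousLinearMap.inverse g (g u) = u := by
      rw [← hT, ContinuousLinearMap.inverse_equiv]
      exact T.symm_apply_apply u
    calc ‖u‖ = ‖ContinuousLinearMap.inverse g (g u)‖ := by rw [this]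
      _ ≤ _ := ContinuousLinearMap.le_of_opNorm_le _ hK' _
  have h2 : ‖g u‖ ≤ √(K * g u u) := by
    refine ContinuousLinearMap.opNorm_le_bound _ (Real.sqrt_nonneg _) fun v => ?_
    apply abs_le_of_sq_le_sq _ (by positivity)
    rw [mul_pow, Real.sq_sqrt (mul_nonneg hK0 (hp' u))]
    have h3 : g v v ≤ K * ‖v‖ ^ 2 := by
      calc g v v ≤ ‖g v v‖ := Real.le_norm_self _
        _ ≤ ‖g‖ * ‖v‖ * ‖v‖ := g.le_opNorm₂ v v
        _ ≤ K * ‖v‖ * ‖v‖ := by gcongr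
        _ = _ := by ring
    nlinarith [bilin_sq_le hs hp' u v, hp' u, mul_le_mul_of_nonneg_left h3 (hp' u)]
  have h4 : ‖u‖ ^ 2 ≤ K ^ 2 * ‖g u‖ ^ 2 := by
    rw [← mul_pow]; gcongr
  have h5 : ‖g u‖ ^ 2 ≤ K * g u u := by
    rw [← Real.sq_sqrt (mul_nonneg hK0 (hp' u))]; gcongr
  calc _ ≤ K ^ 2 * (K * g u u) := h4.trans (by gcongr)
    _ = _ := by ring

section Complex

variable [NormedSpace ℂ E] [IsScalarTower ℝ ℂ E] [FiniteDimensional ℝ E]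
  {g : E →L[ℝ] E →L[ℝ] ℝ} (hs : ∀ u v, g u v = g v u) (hp : ∀ u, u ≠ 0 → 0 < g u u)
  (hJ : ∀ u v, g (Complex.I • u) (Complex.I • v) = g u v)
  {ℓ : E →L[ℝ] ℂ} (hℓ : ∀ (c : ℂ) v, ℓ (c • v) = c * ℓ v)

-- Complex linearity recovers the imaginary part of `ℓ v` from the real part of `ℓ (I v)`.
include hℓ in
lemma eq_zero_of_reForm_eq_zero (h : reForm ℓ = 0) : ℓ = 0 := by
  ext v
  have h1 : (ℓ v).re = 0 := congrArg (fun L : E →L[ℝ] ℝ => L v) h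
  have h2 : (ℓ (Complex.I • v)).re = 0 :=
    congrArg (fun L : E →L[ℝ] ℝ => L (Complex.I • v)) h
  rw [hℓ] at h2
  simp at h2
  exact Complex.ext h1 h2

-- For `w` dual to `Re ℓ`, symmetry and `J`-invariance force `g w (I w) = 0`. Hence `ℓ w` is real
-- and equal to `g w w`, and dividing by the real number `Re ℓ(w)` normalises the complex value as
-- well.
include hs hp hJ hℓ in
lemma apply_horizLift (h0 : reForm ℓ ≠ 0) : ℓ (horizLift g ℓ) = 1 := by
  set w := dualVec g ℓ with hw
  have hgw : ∀ v, g w v = (ℓ v).re := fun v => by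
    have := congrArg (fun L : E →L[ℝ] ℝ => L v) (apply_dualVec hp ℓ)
    exact this
  have hw0 : w ≠ 0 := by
    intro h
    have := apply_dualVec hp ℓ
    rw [← hw, h, map_zero] at this
    exact h0 this.symm
  have h1 : g w (Complex.I • w) = 0 := by
    have h2 := hJ w (Complex.I • w)
    rw [smul_smul, Complex.I_mul_I, neg_one_smul, map_neg, hs] at h2
    linarith
  have h3 : ℓ w = (g w w : ℝ) := by
    apply Complex.ext
    · simp [hgw]
    · rw [hgw, hℓ] at h1
      simpa using h1
  have h4 : reForm ℓ w = g w w := (hgw w).symm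
  have h5 := hp w hw0
  rw [horizLift, ← hw, h4, map_smul, h3]
  rw [Complex.real_smul]
  norm_cast
  exact inv_mul_cancel₀ h5.ne'

-- The kernel of `ℓ` is a complex subspace and `g` is `J`-invariant, so with `w` also `I w` is
-- orthogonal to it.
include hp hℓ hJ in
lemma horizLift_orthogonal (c : ℂ) {v : E} (hv : ℓ v = 0) : g (c • horizLift g ℓ) v = 0 := by
  set w := dualVec g ℓ with hw
  have hgw : ∀ v, g w v = (ℓ v).re := fun v =>
    congrArg (fun L : E →L[ℝ] ℝ => L v) (apply_dualVec hp ℓ)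
  have h1 : g w v = 0 := by rw [hgw, hv]; rfl
  have h2 : g (Complex.I • w) v = 0 := by
    have h3 := hJ w (-Complex.I • v)
    rw [neg_smul, smul_neg, smul_smul, Complex.I_mul_I, neg_one_smul, neg_neg] at h3
    rw [h3, map_neg, hgw, hℓ, hv]
    simp
  have h3 : c • horizLift g ℓ = (c.re * (reForm ℓ w)⁻¹) • w +
      (c.im * (reForm ℓ w)⁻¹) • (Complex.I • w) := by
    have hc : ∀ (r : ℝ) (u : E), r • u = (r : ℂ) • u := fun r u => (algebraMap_smul ℂ r u).symm
    rw [horizLift, ← hw, hc, hc, hc, smul_smul, smul_smul, ← add_smul]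
    congr 1
    nth_rewrite 1 [← Complex.re_add_im c]
    push_cast
    ring
  rw [h3, map_add, map_smul, map_smul]
  simp [h1, h2]

-- The difference of two lifts lies in `ker ℓ` and is orthogonal to `ker ℓ`, hence to itself. This
-- identifies abstract horizontal lifts with the explicit formula in a chart.
include hs hp hJ hℓ in
lemma eq_smul_horizLift (h0 : reForm ℓ ≠ 0) {c : ℂ} {w : E} (hw : ℓ w = c)
    (hwo : ∀ v, ℓ v = 0 → g w v = 0) : w = c • horizLift g ℓ := by
  by_contra h
  have h1 : ℓ (w - c • horizLift g ℓ) = 0 := by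
    rw [map_sub, hw, hℓ, apply_horizLift hs hp hJ hℓ h0]; simp
  have h2 := hp _ (sub_ne_zero.2 h)
  have h3 : g (w - c • horizLift g ℓ) (w - c • horizLift g ℓ) =
      g w (w - c • horizLift g ℓ) - g (c • horizLift g ℓ) (w - c • horizLift g ℓ) := by
    rw [map_sub g]; rfl
  rw [hwo _ h1, horizLift_orthogonal hp hJ hℓ c h1, sub_zero] at h3
  exact h2.ne' h3

end Complex

section Bounds

variable [FiniteDimensional ℝ E] {Ω : Set E} {G : E → E →L[ℝ] E →L[ℝ] ℝ} {L : E → E →L[ℝ] ℂ}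

lemma contDiffAt_dualVec {x : E} (hG : ContDiffAt ℝ ∞ G x) (hL : ContDiffAt ℝ ∞ L x)
    (hp : ∀ u, u ≠ 0 → 0 < G x u u) : ContDiffAt ℝ ∞ (fun x => dualVec (G x) (L x)) x := by
  obtain ⟨T, hT⟩ := exists_equiv_of_posDef (G x) hp
  have h1 : ContDiffAt ℝ ∞ (fun x => ContinuousLinearMap.inverse (G x)) x := by
    refine ContDiffAt.comp (g := ContinuousLinearMap.inverse) x ?_ hG
    rw [← hT]
    exact contDiffAt_map_inverse T
  have h2 : ContDiffAt ℝ ∞ (fun x => reForm (L x)) x :=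
    (ContinuousLinearMap.compL ℝ E ℂ ℝ Complex.reCLM).contDiff.contDiffAt.comp x hL
  exact h1.clm_apply h2

lemma norm_fderiv_le_of_eventually {F : Type*} [NormedAddCommGroup F] [NormedSpace ℝ F]
    {f : E → F} {x : E} (hf : ContDiffAt ℝ ∞ f x) :
    ∃ K : ℝ, ∀ᶠ y in 𝓝 x, ‖f y‖ ≤ K ∧ ‖fderiv ℝ f y‖ ≤ K := by
  have h1 : ContinuousAt (fderiv ℝ f) x := (hf.fderiv_right (m := 0) (by simp)).continuousAt
  refine ⟨max (‖f x‖ + 1) (‖fderiv ℝ f x‖ + 1), ?_⟩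
  filter_upwards [hf.continuousAt.norm.eventually_lt_const (lt_add_one _),
    h1.norm.eventually_lt_const (lt_add_one _)] with y hy hy'
  exact ⟨hy.le.trans (le_max_left _ _), hy'.le.trans (le_max_right _ _)⟩

/-- Estimates of the horizontal lift of a vector, and of its derivative. -/
theorem exists_horizLift_bound (hΩ : IsOpen Ω) (hG : ContDiffOn ℝ ∞ G Ω) (hL : ContDiffOn ℝ ∞ L Ω)
    (hs : ∀ x ∈ Ω, ∀ u v, G x u v = G x v u) (hp : ∀ x ∈ Ω, ∀ u, u ≠ 0 → 0 < G x u u)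
    {x₀ : E} (hx₀ : x₀ ∈ Ω) : ∃ C > 0, ∀ᶠ x in 𝓝 x₀, ‖G x‖ ≤ C ∧
      (∀ u, ‖u‖ ^ 2 ≤ C * G x u u) ∧ ‖fderiv ℝ (fun x => reForm (L x)) x‖ ≤ C ∧
      (reForm (L x) ≠ 0 → ContDiffAt ℝ ∞ (fun x => horizLift (G x) (L x)) x ∧
        ‖horizLift (G x) (L x)‖ ≤ C / ‖reForm (L x)‖ ∧
        ‖fderiv ℝ (fun x => horizLift (G x) (L x)) x‖ ≤ C / ‖reForm (L x)‖ ^ 2) := by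
  have hGa : ∀ x ∈ Ω, ContDiffAt ℝ ∞ G x := fun x hx => hG.contDiffAt (hΩ.mem_nhds hx)
  have hLa : ∀ x ∈ Ω, ContDiffAt ℝ ∞ L x := fun x hx => hL.contDiffAt (hΩ.mem_nhds hx)
  have hRa : ∀ x ∈ Ω, ContDiffAt ℝ ∞ (fun x => reForm (L x)) x := fun x hx =>
    (ContinuousLinearMap.compL ℝ E ℂ ℝ Complex.reCLM).contDiff.contDiffAt.comp x (hLa x hx)
  have hWa : ∀ x ∈ Ω, ContDiffAt ℝ ∞ (fun x => dualVec (G x) (L x)) x := fun x hx =>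
    contDiffAt_dualVec (hGa x hx) (hLa x hx) (hp x hx)
  have hIa : ContDiffAt ℝ ∞ (fun x => ContinuousLinearMap.inverse (G x)) x₀ := by
    obtain ⟨T, hT⟩ := exists_equiv_of_posDef (G x₀) (hp x₀ hx₀)
    refine ContDiffAt.comp (g := ContinuousLinearMap.inverse) x₀ ?_ (hGa x₀ hx₀)
    rw [← hT]
    exact contDiffAt_map_inverse T
  obtain ⟨K₁, h1⟩ := norm_fderiv_le_of_eventually (hGa x₀ hx₀)
  obtain ⟨K₂, h2⟩ := norm_fderiv_le_of_eventually (hRa x₀ hx₀)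
  obtain ⟨K₃, h3⟩ := norm_fderiv_le_of_eventually (hWa x₀ hx₀)
  obtain ⟨K₄, h4⟩ := norm_fderiv_le_of_eventually hIa
  obtain ⟨K, hK1, hKa, hKb, hKc, hKd⟩ : ∃ K : ℝ, 1 ≤ K ∧ K₁ ≤ K ∧ K₂ ≤ K ∧ K₃ ≤ K ∧ K₄ ≤ K :=
    ⟨max 1 (max K₁ (max K₂ (max K₃ K₄))), by simp, by simp, by simp, by simp, by simp⟩
  have hK0 : 0 < K := by linarith
  -- The powers come from `q⁻¹ ≤ K ^ 5 / ‖θ‖ ^ 2` and `‖w‖ ≤ K ‖θ‖`: the lift costs `K ^ 6`, its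
  -- derivative `K ^ 6 + K ^ 12 + K ^ 13`.
  refine ⟨K ^ 6 + 2 * K ^ 13, by positivity, ?_⟩
  filter_upwards [h1, h2, h3, h4, hΩ.mem_nhds hx₀] with x h1 h2 h3 h4 hx
  have hg1 : ‖G x‖ ≤ K := h1.1.trans hKa
  have hi1 : ‖ContinuousLinearMap.inverse (G x)‖ ≤ K := h4.1.trans hKd
  have hr1 : ‖fderiv ℝ (fun x => reForm (L x)) x‖ ≤ K := h2.2.trans hKb
  have hw1 : ‖fderiv ℝ (fun x => dualVec (G x) (L x)) x‖ ≤ K := h3.2.trans hKc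
  have hpow : ∀ i j : ℕ, i ≤ j → K ^ i ≤ K ^ j := fun i j h => pow_le_pow_right₀ hK1 h
  have h6 : K ^ 6 ≤ K ^ 6 + 2 * K ^ 13 := by linarith [pow_pos hK0 13]
  have hK6 : K ≤ K ^ 6 := by simpa using hpow 1 6 (by norm_num)
  have hcoer := norm_sq_le_of_posDef (hs x hx) (hp x hx) hg1 hi1
  have hnn : ∀ u, 0 ≤ G x u u := fun u => by
    by_cases h : u = 0
    · simp [h]
    · exact (hp x hx u h).le
  refine ⟨by linarith, fun u => (hcoer u).trans ?_, by linarith, fun h0 => ?_⟩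
  · gcongr
    · exact hnn u
    · exact (hpow 3 6 (by norm_num)).trans h6
  set θ := reForm (L x) with hθ
  set w := dualVec (G x) (L x) with hw
  have hθ0 : 0 < ‖θ‖ := norm_pos_iff.2 h0
  have hgw : G x w = θ := apply_dualVec (hp x hx) (L x)
  have hwθ : ‖w‖ ≤ K * ‖θ‖ := ContinuousLinearMap.le_of_opNorm_le _ hi1 θ
  have hθw : ‖θ‖ ≤ K * ‖w‖ := by rw [← hgw]; exact ContinuousLinearMap.le_of_opNorm_le _ hg1 w
  set q := θ w with hq
  have hqw : ‖w‖ ^ 2 ≤ K ^ 3 * q := by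
    have := hcoer w
    rwa [hgw] at this
  -- The normalising factor `q = θ w` is bounded below by a multiple of `‖θ‖ ^ 2`. Dividing the
  -- vector `w`, of size `‖θ‖`, by it costs one power of `‖θ‖`; the derivative costs two.
  have hqθ : ‖θ‖ ^ 2 ≤ K ^ 5 * q := by
    calc ‖θ‖ ^ 2 ≤ (K * ‖w‖) ^ 2 := by gcongr
      _ = K ^ 2 * ‖w‖ ^ 2 := by ring
      _ ≤ K ^ 2 * (K ^ 3 * q) := by gcongr
      _ = _ := by ring
  have hq0 : 0 < q := by
    by_contra h
    push Not at h
    nlinarith [pow_pos hK0 5, pow_pos hθ0 2]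
  have hqi : q⁻¹ ≤ K ^ 5 / ‖θ‖ ^ 2 := by
    rw [inv_eq_one_div, div_le_div_iff₀ hq0 (by positivity)]
    linarith
  have hRd := ((hRa x hx).differentiableAt (by simp)).hasFDerivAt
  have hWd := ((hWa x hx).differentiableAt (by simp)).hasFDerivAt
  have hqd := hRd.clm_apply hWd
  have hqid := (hasDerivAt_inv hq0.ne').comp_hasFDerivAt x hqd
  have hH := hqid.fun_smul hWd
  have hHc : ContDiffAt ℝ ∞ (fun x => horizLift (G x) (L x)) x :=
    ((((hRa x hx).clm_apply (hWa x hx))).inv hq0.ne').smul (hWa x hx)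
  refine ⟨hHc, ?_, ?_⟩
  · rw [horizLift, norm_smul, Real.norm_eq_abs, abs_of_pos (by positivity)]
    calc q⁻¹ * ‖w‖ ≤ (K ^ 5 / ‖θ‖ ^ 2) * (K * ‖θ‖) := by gcongr
      _ = K ^ 6 / ‖θ‖ := by field_simp
      _ ≤ _ := by gcongr
  · have hfd : fderiv ℝ (fun x => horizLift (G x) (L x)) x = _ := hH.fderiv
    rw [hfd]
    refine ContinuousLinearMap.opNorm_le_bound _ (by positivity) fun u => ?_
    set w' := fderiv ℝ (fun x => dualVec (G x) (L x)) x
    set θ' := fderiv ℝ (fun x => reForm (L x)) x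
    change ‖q⁻¹ • w' u + (-(q ^ 2)⁻¹ * (θ (w' u) + θ' u w)) • w‖ ≤ _
    have e1 : ‖w' u‖ ≤ K * ‖u‖ := ContinuousLinearMap.le_of_opNorm_le _ hw1 u
    have e2 : ‖θ (w' u)‖ ≤ ‖θ‖ * (K * ‖u‖) := ContinuousLinearMap.le_of_opNorm_le_of_le _ le_rfl e1
    have e3 : ‖θ' u w‖ ≤ K * ‖u‖ * (K * ‖θ‖) :=
      (θ' u).le_of_opNorm_le_of_le (ContinuousLinearMap.le_of_opNorm_le _ hr1 u) hwθ
    calc _ ≤ q⁻¹ * ‖w' u‖ + (q⁻¹ ^ 2 * (‖θ (w' u)‖ + ‖θ' u w‖)) * ‖w‖ := by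
          refine (norm_add_le _ _).trans ?_
          rw [norm_smul, norm_smul, Real.norm_eq_abs, abs_of_pos (inv_pos.2 hq0), norm_mul, norm_neg,
            Real.norm_eq_abs (q ^ 2)⁻¹, abs_of_pos (inv_pos.2 (pow_pos hq0 2)), inv_pow]
          gcongr
          exact norm_add_le _ _
      _ ≤ (K ^ 5 / ‖θ‖ ^ 2) * (K * ‖u‖) + ((K ^ 5 / ‖θ‖ ^ 2) ^ 2 *
            (‖θ‖ * (K * ‖u‖) + K * ‖u‖ * (K * ‖θ‖))) * (K * ‖θ‖) := by gcongr
      _ = (K ^ 6 + (K ^ 12 + K ^ 13)) / ‖θ‖ ^ 2 * ‖u‖ := by field_simp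
      _ ≤ (K ^ 6 + 2 * K ^ 13) / ‖θ‖ ^ 2 * ‖u‖ := by
          gcongr
          linarith [hpow 12 13 (by norm_num)]

end Bounds

end HorizontalLift

/-! ### Normal crossing coordinates and the decay of `dπ` -/

section NormalCrossings

attribute [local instance] cnNormedAddCommGroup cnNormedSpaceReal cnNormedSpaceComplex
  cnDualNormedAddCommGroup cnBilinNormedAddCommGroup

variable {n a : ℕ} {Y : Type*} [TopologicalSpace Y] [ChartedSpace (Cn (n + 1)) Y]
  [IsManifold 𝓘(ℂ, Cn (n + 1)) ω Y] {π : Y → ℂ} {D : Fin a → Set Y}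

lemma hasFDerivAt_prod_coord {m : ℕ} (S : Finset (Fin a)) (σ : Fin a → Fin m) (x : Cn m) :
    HasFDerivAt (𝕜 := ℝ) (fun x : Cn m => ∏ i ∈ S, x (σ i))
      (∑ i ∈ S, (∏ j ∈ S.erase i, x (σ j)) •
        (ContinuousLinearMap.proj (R := ℝ) (φ := fun _ => ℂ) (σ i) : Cn m →L[ℝ] ℂ)) x :=
  HasFDerivAt.finsetProd fun i _ =>
    (ContinuousLinearMap.proj (R := ℝ) (φ := fun _ => ℂ) (σ i) : Cn m →L[ℝ] ℂ).hasFDerivAt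

lemma hd_eq_sum (hπ : ContMDiff 𝓘(ℂ, Cn (n + 1)) 𝓘(ℂ, ℂ) ω π)
    {e : OpenPartialHomeomorph Y (Cn (n + 1))}
    (he : e ∈ IsManifold.maximalAtlas 𝓘(ℂ, Cn (n + 1)) ω Y) {S : Finset (Fin a)}
    {σ : Fin a → Fin (n + 1)} (hS : ∀ x ∈ e.source, π x = ∏ i ∈ S, e x (σ i))
    {y : Y} (hy : y ∈ e.source) (v : Cn (n + 1)) :
    hd π y v = ∑ i ∈ S, (∏ j ∈ S.erase i, e y (σ j)) * chartD e y v (σ i) := by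
  rw [hd_eq hπ he hy]
  have : π ∘ e.symm =ᶠ[𝓝 (e y)] fun x => ∏ i ∈ S, x (σ i) := by
    filter_upwards [e.open_target.mem_nhds (e.map_source hy)] with x hx
    rw [Function.comp, hS _ (e.map_target hx), e.right_inv hx]
  rw [this.fderiv_eq, (hasFDerivAt_prod_coord S σ (e y)).fderiv]
  simp

lemma isClosed_singLocus (h : IsSemistableDegeneration (n := n) π D) :
    IsClosed (singLocus D) := by
  rw [singLocus]
  refine isClosed_iUnion_of_finite fun i => isClosed_iUnion_of_finite fun j =>
    isClosed_iUnion_of_finite fun _ => (h.closed_component i).inter (h.closed_component j)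

lemma mem_singLocus_iff {y : Y} : y ∈ singLocus D ↔ ∃ i j, i ≠ j ∧ y ∈ D i ∧ y ∈ D j := by
  simp only [singLocus, mem_iUnion, mem_inter_iff]
  constructor
  · rintro ⟨i, j, hij, h1, h2⟩; exact ⟨i, j, hij.ne, h1, h2⟩
  · rintro ⟨i, j, hij, h1, h2⟩
    rcases lt_or_gt_of_ne hij with h | h
    · exact ⟨i, j, h, h1, h2⟩
    · exact ⟨j, i, h, h2, h1⟩

lemma eq_zero_of_mem_component (h : IsSemistableDegeneration (n := n) π D) {y : Y} {i : Fin a}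
    (hi : y ∈ D i) : π y = 0 := by
  have : y ∈ π ⁻¹' {0} := by rw [h.central_fibre]; exact mem_iUnion.2 ⟨i, hi⟩
  exact this

lemma exists_mem_component (h : IsSemistableDegeneration (n := n) π D) {y : Y}
    (hy : π y = 0) : ∃ i, y ∈ D i := by
  have : y ∈ π ⁻¹' {0} := hy
  rwa [h.central_fibre, mem_iUnion] at this

/-- The coordinates of a normal crossing chart. -/
lemma exists_normalCrossing_chart (h : IsSemistableDegeneration (n := n) π D) {y : Y}
    (hy : π y = 0) : ∃ e ∈ IsManifold.maximalAtlas 𝓘(ℂ, Cn (n + 1)) ω Y, y ∈ e.source ∧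
      ∃ (S : Finset (Fin a)) (σ : Fin a → Fin (n + 1)), (∀ i, i ∈ S ↔ y ∈ D i) ∧
        InjOn σ S ∧ (∀ i ∈ S, ∀ x ∈ e.source, x ∈ D i ↔ e x (σ i) = 0) ∧
        (∀ i ∉ S, ∀ x ∈ e.source, x ∉ D i) ∧ ∀ x ∈ e.source, π x = ∏ i ∈ S, e x (σ i) := by
  classical
  obtain ⟨e, he, hye, h1, σ, hσ, h2, h3⟩ := h.normal_crossings y hy
  refine ⟨e, he, hye, Finset.univ.filter fun i => y ∈ D i, σ, by simp, ?_, ?_, ?_, ?_⟩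
  · simpa using hσ
  · intro i hi; exact h2 i (by simpa using hi)
  · intro i hi x hx hxi
    exact (h1 i (by simpa using hi)).le_bot ⟨hxi, hx⟩
  · intro x hx
    rw [h3 x hx]

/-- At a crossing at least two coordinates vanish, so every term of the product rule keeps a
vanishing factor. It follows that curves along which `dπ ≠ 0` avoid the singular locus. -/
lemma hd_eq_zero_of_mem_singLocus (h : IsSemistableDegeneration (n := n) π D) {y : Y}
    (hy : y ∈ singLocus D) : hd (m := n + 1) π y = 0 := by
  obtain ⟨i, j, hij, hi, hj⟩ := mem_singLocus_iff.1 hy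
  obtain ⟨e, he, hye, S, σ, hS, -, hD, -, hprod⟩ :=
    exists_normalCrossing_chart h (eq_zero_of_mem_component h hi)
  ext v
  rw [hd_eq_sum h.holomorphic he hprod hye]
  refine Finset.sum_eq_zero fun k _ => ?_
  have : ∃ l ∈ S.erase k, e y (σ l) = 0 := by
    by_cases hk : k = i
    · exact ⟨j, Finset.mem_erase.2 ⟨by rw [hk]; exact hij.symm, (hS j).2 hj⟩,
        (hD j ((hS j).2 hj) y hye).1 hj⟩
    · exact ⟨i, Finset.mem_erase.2 ⟨fun h => hk h.symm, (hS i).2 hi⟩,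
        (hD i ((hS i).2 hi) y hye).1 hi⟩
  obtain ⟨l, hl, hl0⟩ := this
  rw [Finset.prod_eq_zero hl hl0, zero_mul]

/-- Over `0` only one component passes through the point, so `π` is locally one of the coordinates.
-/
lemma hd_ne_zero_of_mem_smoothFibre (h : IsSemistableDegeneration (n := n) π D) {y : Y} {s : ℂ}
    (hy : y ∈ smoothFibre π D s) : hd (m := n + 1) π y ≠ 0 := by
  by_cases hs : s = 0
  · subst hs
    have hy0 : π y = 0 := hy.1
    obtain ⟨e, he, hye, S, σ, hS, -, hD, -, hprod⟩ := exists_normalCrossing_chart h hy0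
    obtain ⟨i, hi⟩ := exists_mem_component h hy0
    have hSi : S = {i} := by
      ext j
      rw [hS, Finset.mem_singleton]
      constructor
      · intro hj; by_contra hij
        exact hy.2 (mem_singLocus_iff.2 ⟨j, i, hij, hj, hi⟩)
      · rintro rfl; exact hi
    intro h0
    have h1 := hd_eq_sum h.holomorphic he hprod hye (chartDinv e (e y) (Pi.single (σ i) 1))
    rw [h0, chartD_chartDinv' he hye, hSi] at h1
    simp at h1
  · obtain ⟨v, hv⟩ := h.submersive y (by rw [show π y = s from hy.1]; exact hs)
    intro h0
    apply hv
    change hd π y v = 0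
    rw [h0]; rfl

variable (γ : KahlerMetric (n + 1) Y)

/-- The differential of `π` decays at most like the `n`-th power of the distance to the singular
locus of the central fibre. -/
theorem exists_le_hd (h : IsSemistableDegeneration (n := n) π D) {y₀ : Y} (hy₀ : π y₀ = 0) :
    ∃ c > 0, ∀ᶠ y in 𝓝 y₀, y ∈ smoothFibre π D 0 → ∀ r : ℝ, 0 ≤ r → r ≤ 1 →
      ENNReal.ofReal r ≤ γ.distTo y (singLocus D) →
      ∃ v : Cn (n + 1), γ.vnorm y v ≤ 1 ∧ c * r ^ n ≤ ‖hd π y v‖ := by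
  obtain ⟨e, he, hye, S, σ, hS, hσ, hD, hD', hprod⟩ := exists_normalCrossing_chart h hy₀
  obtain ⟨r₀, hr₀, C, hC, hsub, hdist⟩ := γ.exists_edist_chart_symm_le he (e.map_source hye)
  have hGx : ContinuousAt (γ.inChart e) (e y₀) :=
    (γ.contDiffOn_inChart he).continuousOn.continuousAt (e.open_target.mem_nhds (e.map_source hye))
  set K := ‖γ.inChart e (e y₀)‖ + 1 with hK
  have hK0 : 0 < K := by positivity
  have hcont : ContinuousAt e y₀ := e.continuousAt hye
  set C' := max C 1 with hC'
  have hC'0 : 0 < C' := by positivity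
  refine ⟨(1 / √K) * (1 / C') ^ n, by positivity, ?_⟩
  filter_upwards [hcont (Metric.ball_mem_nhds _ hr₀), e.open_source.mem_nhds hye,
    (hGx.norm.comp hcont).eventually_lt_const (lt_add_one _)] with y hy1 hy2 hy3 hy r hr hr1 hdr
  change e y ∈ Metric.ball (e y₀) r₀ at hy1
  have hGK : ‖γ.inChart e (e y)‖ ≤ K := le_of_lt hy3
  have hy0 : π y = 0 := hy.1
  obtain ⟨i, hi⟩ := exists_mem_component h hy0
  have hiS : i ∈ S := by by_contra hc; exact hD' i hc y hy2 hi
  have hxi : e y (σ i) = 0 := (hD i hiS y hy2).1 hi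
  -- Replacing the coordinate `x_j` of a point of `D i` by zero produces a point of `D i ∩ D j` at
  -- chart distance at most `|x_j|`, so `|x_j|` bounds the distance to the singular locus from above
  -- up to `C'`.
  have hlow : ∀ j ∈ S.erase i, r / C' ≤ ‖e y (σ j)‖ := by
    intro j hj
    obtain ⟨hji, hjS⟩ := Finset.mem_erase.1 hj
    set x' : Cn (n + 1) := Function.update (e y) (σ j) 0 with hx'
    have hj0 : e y₀ (σ j) = 0 := (hD j hjS y₀ hye).1 ((hS j).1 hjS)
    have hx'b : x' ∈ Metric.ball (e y₀) r₀ := by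
      rw [mem_ball_iff_norm, pi_norm_lt_iff hr₀] at hy1 ⊢
      intro k
      by_cases hk : k = σ j
      · subst hk
        simp [hx', hj0, hr₀]
      · have := hy1 k
        simpa [hx', Function.update_of_ne hk] using this
    have hx't := hsub hx'b
    have hmem : e.symm x' ∈ singLocus D := by
      refine mem_singLocus_iff.2 ⟨i, j, fun hh => hji hh.symm, ?_, ?_⟩
      · rw [hD i hiS _ (e.map_target hx't), e.right_inv hx't, hx', Function.update_of_ne, hxi]
        exact fun hh => hji (hσ hjS hiS hh.symm)
      · rw [hD j hjS _ (e.map_target hx't), e.right_inv hx't, hx', Function.update_self]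
    have h1 : γ.distTo y (singLocus D) ≤ γ.edist y (e.symm x') := iInf₂_le _ hmem
    have h2 := hdist (e y) hy1 x' hx'b
    rw [e.left_inv hy2] at h2
    have h3 : ‖e y - x'‖ ≤ ‖e y (σ j)‖ := by
      rw [pi_norm_le_iff_of_nonneg (norm_nonneg _)]
      intro k
      by_cases hk : k = σ j
      · subst hk; simp [hx']
      · simp [hx', Function.update_of_ne hk]
    have h4 : r ≤ C * ‖e y - x'‖ := by
      have := (hdr.trans (h1.trans h2))
      rwa [ENNReal.ofReal_le_ofReal_iff (by positivity)] at this
    rw [div_le_iff₀ hC'0, mul_comm]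
    calc r ≤ C * ‖e y - x'‖ := h4
      _ ≤ C' * ‖e y (σ j)‖ := by gcongr; exact le_max_left _ _
  -- The coordinates attached to components are distinct, so at most `n` of them remain besides `σ
  -- i`. Since `r / C' ≤ 1`, fewer factors only help.
  have hcard : (S.erase i).card ≤ n := by
    have h1 : S.card ≤ n + 1 := by
      have := Finset.card_le_card_of_injOn (s := S) (t := Finset.univ) σ (by simp) hσ
      simpa using this
    rw [Finset.card_erase_of_mem hiS]
    omega
  have hrC : r / C' ≤ 1 := by
    rw [div_le_one hC'0]; exact hr1.trans (le_max_right _ _)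
  have hprodlow : (r / C') ^ n ≤ ∏ j ∈ S.erase i, ‖e y (σ j)‖ := by
    calc (r / C') ^ n ≤ (r / C') ^ (S.erase i).card :=
          pow_le_pow_of_le_one (by positivity) hrC hcard
      _ = ∏ j ∈ S.erase i, (r / C') := (Finset.prod_const _).symm
      _ ≤ _ := Finset.prod_le_prod (fun _ _ => by positivity) hlow
  -- On `D i` only the term in the direction `σ i` of `dπ` survives. The scaling makes the
  -- `γ`-length of this direction at most one.
  set u : Cn (n + 1) := chartDinv e (e y) ((1 / √K : ℝ) • Pi.single (σ i) 1) with hu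
  refine ⟨u, ?_, ?_⟩
  · have h1 := γ.vnorm_chartDinv_le hGK ((1 / √K : ℝ) • (Pi.single (σ i) 1 : Cn (n + 1)))
    have key : ∀ y', y' = y → γ.vnorm y' u = γ.vnorm y u := by rintro _ rfl; rfl
    rw [← key _ (e.left_inv hy2)]
    refine h1.trans ?_
    rw [norm_smul, Real.norm_eq_abs, abs_of_pos (by positivity), Pi.norm_single, norm_one, mul_one]
    rw [mul_one_div_cancel (Real.sqrt_pos.2 hK0).ne']
  · rw [hd_eq_sum h.holomorphic he hprod hy2, hu, chartD_chartDinv' he hy2,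
      Finset.sum_eq_single i]
    · rw [norm_mul, norm_prod]
      simp only [Pi.smul_apply, Pi.single_eq_same, norm_smul, norm_one, mul_one, Real.norm_eq_abs]
      rw [abs_of_pos (by positivity : 0 < 1 / √K)]
      calc 1 / √K * (1 / C') ^ n * r ^ n = (r / C') ^ n * (1 / √K) := by
            rw [div_pow, div_pow]; ring
        _ ≤ _ := by gcongr
    · intro k hk hki
      rw [Finset.prod_eq_zero (Finset.mem_erase.2 ⟨fun hh => hki hh.symm, hiS⟩) hxi, zero_mul]
    · intro hh; exact absurd hiS hh

end NormalCrossings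

/-! ### Horizontal curves over a segment and their uniqueness -/

section FlowCurves

attribute [local instance] cnNormedAddCommGroup cnNormedSpaceReal cnNormedSpaceComplex
  cnDualNormedAddCommGroup cnBilinNormedAddCommGroup

/-- Local uniqueness of integral curves on a closed interval. -/
lemma eventuallyEq_of_integral_curves {E : Type*} [NormedAddCommGroup E] [NormedSpace ℝ E]
    {X : E → E} {K : NNReal} {U : Set E} (hX : LipschitzOnWith K X U) {f g : ℝ → E} {t₁ : ℝ}
    (ht₁ : t₁ ∈ Icc (0 : ℝ) 1)
    (hf : ∀ᶠ t in 𝓝[Icc (0 : ℝ) 1] t₁, f t ∈ U ∧ HasDerivWithinAt f (X (f t)) (Icc 0 1) t)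
    (hg : ∀ᶠ t in 𝓝[Icc (0 : ℝ) 1] t₁, g t ∈ U ∧ HasDerivWithinAt g (X (g t)) (Icc 0 1) t)
    (h : f t₁ = g t₁) : ∀ᶠ t in 𝓝[Icc (0 : ℝ) 1] t₁, f t = g t := by
  obtain ⟨ε, hε, hball⟩ := Metric.mem_nhdsWithin_iff.1 (hf.and hg)
  have hmem : ∀ t ∈ Icc (0 : ℝ) 1, t₁ - ε / 2 ≤ t → t ≤ t₁ + ε / 2 →
      (f t ∈ U ∧ HasDerivWithinAt f (X (f t)) (Icc 0 1) t) ∧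
      (g t ∈ U ∧ HasDerivWithinAt g (X (g t)) (Icc 0 1) t) := fun t ht h1 h2 =>
    hball ⟨by rw [Metric.mem_ball, Real.dist_eq, abs_lt]; constructor <;> linarith, ht⟩
  have hR : EqOn f g (Icc t₁ (min 1 (t₁ + ε / 2))) := by
    have hm : ∀ t ∈ Icc t₁ (min 1 (t₁ + ε / 2)), t ∈ Icc (0 : ℝ) 1 ∧ t₁ - ε / 2 ≤ t ∧
        t ≤ t₁ + ε / 2 := fun t ht =>
      ⟨⟨ht₁.1.trans ht.1, ht.2.trans (min_le_left _ _)⟩, by linarith [ht.1],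
        ht.2.trans (min_le_right _ _)⟩
    have hd : ∀ t ∈ Ico t₁ (min 1 (t₁ + ε / 2)), Icc (0 : ℝ) 1 ∈ 𝓝[Ici t] t := fun t ht =>
      Filter.mem_of_superset (Icc_mem_nhdsGE (ht.2.trans_le (min_le_left _ _)))
        (Icc_subset_Icc_left (ht₁.1.trans ht.1))
    refine ODE_solution_unique_of_mem_Icc_right (v := fun _ => X) (s := fun _ => U)
      (fun _ _ => hX) ?_ ?_ ?_ ?_ ?_ ?_ h
    · exact fun t ht => (hmem t (hm t ht).1 (hm t ht).2.1 (hm t ht).2.2).1.2.continuousWithinAt.mono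
        fun x hx => (hm x hx).1
    · intro t ht
      have ht' := hm t ⟨ht.1, ht.2.le⟩
      exact (hmem t ht'.1 ht'.2.1 ht'.2.2).1.2.mono_of_mem_nhdsWithin (hd t ht)
    · intro t ht
      have ht' := hm t ⟨ht.1, ht.2.le⟩
      exact (hmem t ht'.1 ht'.2.1 ht'.2.2).1.1
    · exact fun t ht => (hmem t (hm t ht).1 (hm t ht).2.1 (hm t ht).2.2).2.2.continuousWithinAt.mono
        fun x hx => (hm x hx).1
    · intro t ht
      have ht' := hm t ⟨ht.1, ht.2.le⟩
      exact (hmem t ht'.1 ht'.2.1 ht'.2.2).2.2.mono_of_mem_nhdsWithin (hd t ht)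
    · intro t ht
      have ht' := hm t ⟨ht.1, ht.2.le⟩
      exact (hmem t ht'.1 ht'.2.1 ht'.2.2).2.1
  have hL : EqOn f g (Icc (max 0 (t₁ - ε / 2)) t₁) := by
    have hm : ∀ t ∈ Icc (max 0 (t₁ - ε / 2)) t₁, t ∈ Icc (0 : ℝ) 1 ∧ t₁ - ε / 2 ≤ t ∧
        t ≤ t₁ + ε / 2 := fun t ht =>
      ⟨⟨(le_max_left _ _).trans ht.1, ht.2.trans ht₁.2⟩, (le_max_right _ _).trans ht.1,
        by linarith [ht.2]⟩
    have hd : ∀ t ∈ Ioc (max 0 (t₁ - ε / 2)) t₁, Icc (0 : ℝ) 1 ∈ 𝓝[Iic t] t := fun t ht =>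
      Filter.mem_of_superset (Icc_mem_nhdsLE ((le_max_left _ _).trans_lt ht.1))
        (Icc_subset_Icc_right (ht.2.trans ht₁.2))
    refine ODE_solution_unique_of_mem_Icc_left (v := fun _ => X) (s := fun _ => U)
      (fun _ _ => hX) ?_ ?_ ?_ ?_ ?_ ?_ h
    · exact fun t ht => (hmem t (hm t ht).1 (hm t ht).2.1 (hm t ht).2.2).1.2.continuousWithinAt.mono
        fun x hx => (hm x hx).1
    · intro t ht
      have ht' := hm t ⟨ht.1.le, ht.2⟩
      exact (hmem t ht'.1 ht'.2.1 ht'.2.2).1.2.mono_of_mem_nhdsWithin (hd t ht)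
    · intro t ht
      have ht' := hm t ⟨ht.1.le, ht.2⟩
      exact (hmem t ht'.1 ht'.2.1 ht'.2.2).1.1
    · exact fun t ht => (hmem t (hm t ht).1 (hm t ht).2.1 (hm t ht).2.2).2.2.continuousWithinAt.mono
        fun x hx => (hm x hx).1
    · intro t ht
      have ht' := hm t ⟨ht.1.le, ht.2⟩
      exact (hmem t ht'.1 ht'.2.1 ht'.2.2).2.2.mono_of_mem_nhdsWithin (hd t ht)
    · intro t ht
      have ht' := hm t ⟨ht.1.le, ht.2⟩
      exact (hmem t ht'.1 ht'.2.1 ht'.2.2).2.1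
  filter_upwards [self_mem_nhdsWithin,
    mem_nhdsWithin_of_mem_nhds (Metric.ball_mem_nhds t₁ (half_pos hε))] with t ht ht'
  rw [Metric.mem_ball, Real.dist_eq, abs_lt] at ht'
  rcases le_total t₁ t with h1 | h1
  · exact hR ⟨h1, le_min ht.2 (by linarith)⟩
  · exact hL ⟨max_le ht.1 (by linarith), h1⟩

variable {n a : ℕ} {Y : Type*} [TopologicalSpace Y] [ChartedSpace (Cn (n + 1)) Y]
  [IsManifold 𝓘(ℂ, Cn (n + 1)) ω Y]

/-- The curves which lift horizontally the segment from `0` to `s` in the disc. -/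
def IsFlowCurve (π : Y → ℂ) (D : Fin a → Set Y) (γ : KahlerMetric (n + 1) Y) (s : ℂ)
    (c : ℝ → Y) : Prop :=
  ∀ t ∈ Icc (0 : ℝ) 1, c t ∈ smoothFibre π D ((t : ℂ) * s) ∧
    ∃ w : TangentSpace 𝓘(ℝ, Cn (n + 1)) (c t), IsHorizontalLift π γ (c t) s w ∧
      HasMFDerivWithinAt 𝓘(ℝ, ℝ) 𝓘(ℝ, Cn (n + 1)) c (Icc 0 1) t ((1 : ℝ →L[ℝ] ℝ).smulRight w)

variable {π : Y → ℂ} {D : Fin a → Set Y} {γ : KahlerMetric (n + 1) Y}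

/-- The expression in a chart of the horizontal lift of the vector `1`. -/
def chartLift (π : Y → ℂ) (γ : KahlerMetric (n + 1) Y) (e : OpenPartialHomeomorph Y (Cn (n + 1)))
    (x : Cn (n + 1)) : Cn (n + 1) :=
  horizLift (γ.inChart e x) (fderiv ℝ (π ∘ e.symm) x)

lemma contDiffOn_fderiv_chart (hπ : ContMDiff 𝓘(ℂ, Cn (n + 1)) 𝓘(ℂ, ℂ) ω π)
    {e : OpenPartialHomeomorph Y (Cn (n + 1))}
    (he : e ∈ IsManifold.maximalAtlas 𝓘(ℂ, Cn (n + 1)) ω Y) :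
    ContDiffOn ℝ ∞ (fderiv ℝ (π ∘ e.symm)) e.target := by
  have h : ContDiffOn ℝ ∞ (π ∘ e.symm) e.target :=
    ((contDiffOn_comp_chart_symm hπ he).restrict_scalars ℝ).of_le le_top
  exact h.fderiv_of_isOpen e.open_target (by simp)

lemma fderiv_chart_smul (hπ : ContMDiff 𝓘(ℂ, Cn (n + 1)) 𝓘(ℂ, ℂ) ω π)
    {e : OpenPartialHomeomorph Y (Cn (n + 1))}
    (he : e ∈ IsManifold.maximalAtlas 𝓘(ℂ, Cn (n + 1)) ω Y) {x : Cn (n + 1)} (hx : x ∈ e.target)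
    (c : ℂ) (v : Cn (n + 1)) :
    fderiv ℝ (π ∘ e.symm) x (c • v) = c * fderiv ℝ (π ∘ e.symm) x v := by
  rw [fderiv_comp_chart_symm hπ he hx, fderiv_comp_chart_symm hπ he hx, chartDinv_smul he hx]
  exact (hd π (e.symm x)).map_smul c _

lemma KahlerMetric.inChart_symm (γ : KahlerMetric (n + 1) Y)
    (e : OpenPartialHomeomorph Y (Cn (n + 1))) (x u v : Cn (n + 1)) :
    γ.inChart e x u v = γ.inChart e x v u := γ.gm_symm _ _ _

lemma KahlerMetric.inChart_pos (γ : KahlerMetric (n + 1) Y)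
    {e : OpenPartialHomeomorph Y (Cn (n + 1))}
    (he : e ∈ IsManifold.maximalAtlas 𝓘(ℂ, Cn (n + 1)) ω Y) {x : Cn (n + 1)} (hx : x ∈ e.target)
    {u : Cn (n + 1)} (hu : u ≠ 0) : 0 < γ.inChart e x u u := by
  refine γ.gm_pos _ fun h => hu ?_
  have h' : chartDinv e x u = 0 := h
  rw [← chartD_chartDinv he hx u, h', map_zero]

lemma KahlerMetric.inChart_I (γ : KahlerMetric (n + 1) Y)
    {e : OpenPartialHomeomorph Y (Cn (n + 1))}
    (he : e ∈ IsManifold.maximalAtlas 𝓘(ℂ, Cn (n + 1)) ω Y) {x : Cn (n + 1)} (hx : x ∈ e.target)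
    (u v : Cn (n + 1)) :
    γ.inChart e x (Complex.I • u) (Complex.I • v) = γ.inChart e x u v := by
  rw [γ.inChart_apply, chartDinv_smul he hx, chartDinv_smul he hx, γ.gm_I]
  rfl

lemma reForm_ne_zero_iff (hπ : ContMDiff 𝓘(ℂ, Cn (n + 1)) 𝓘(ℂ, ℂ) ω π)
    {e : OpenPartialHomeomorph Y (Cn (n + 1))}
    (he : e ∈ IsManifold.maximalAtlas 𝓘(ℂ, Cn (n + 1)) ω Y) {x : Cn (n + 1)}
    (hx : x ∈ e.target) : reForm (fderiv ℝ (π ∘ e.symm) x) ≠ 0 ↔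
      hd (m := n + 1) π (e.symm x) ≠ 0 := by
  rw [not_iff_not]
  constructor
  · intro h
    have h1 := eq_zero_of_reForm_eq_zero (fderiv_chart_smul hπ he hx) h
    ext v
    rw [hd_eq hπ he (e.map_target hx), e.right_inv hx, h1]
    rfl
  · intro h
    ext v
    change (fderiv ℝ (π ∘ e.symm) x v).re = 0
    rw [fderiv_comp_chart_symm hπ he hx, h]
    rfl

lemma hasDerivWithinAt_of_hasMFDerivWithinAt {E : Type*} [NormedAddCommGroup E] [NormedSpace ℝ E]
    {f : ℝ → E} {s : Set ℝ} {t : ℝ} {L : ℝ →L[ℝ] E}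
    (h : HasMFDerivWithinAt 𝓘(ℝ, ℝ) 𝓘(ℝ, E) f s t L) : HasDerivWithinAt f (L 1) s t :=
  HasFDerivWithinAt.hasDerivWithinAt (hasMFDerivWithinAt_iff_hasFDerivWithinAt.1 h)

/-- The velocity of a flow curve, read in a chart. -/
lemma IsFlowCurve.hasDerivWithinAt (hπ : IsSemistableDegeneration (n := n) π D) {s : ℂ}
    {c : ℝ → Y} (hc : IsFlowCurve π D γ s c) {e : OpenPartialHomeomorph Y (Cn (n + 1))}
    (he : e ∈ IsManifold.maximalAtlas 𝓘(ℂ, Cn (n + 1)) ω Y) {t : ℝ} (ht : t ∈ Icc (0 : ℝ) 1)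
    (hct : c t ∈ e.source) :
    HasDerivWithinAt (e ∘ c) (s • chartLift π γ e (e (c t))) (Icc 0 1) t := by
  obtain ⟨hf, w', ⟨hw1, hw2⟩, hw3⟩ := hc t ht
  let w : Cn (n + 1) := w'
  have hx := e.map_source hct
  have h1 := (hasMFDerivAt_chart he hct).comp_hasMFDerivWithinAt t hw3
  have h3 : HasDerivWithinAt (e ∘ c) _ (Icc 0 1) t := hasDerivWithinAt_of_hasMFDerivWithinAt h1
  have h4 : chartD e (c t) w = s • chartLift π γ e (e (c t)) := by
    refine eq_smul_horizLift (γ.inChart_symm e _) (fun u hu => γ.inChart_pos he hx hu)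
      (γ.inChart_I he hx) (fderiv_chart_smul hπ.holomorphic he hx) ?_ ?_ ?_
    · rw [reForm_ne_zero_iff hπ.holomorphic he hx, e.left_inv hct]
      exact hd_ne_zero_of_mem_smoothFibre hπ hf
    · rw [← hd_eq hπ.holomorphic he hct w]
      exact hw1
    · intro v hv
      rw [fderiv_comp_chart_symm hπ.holomorphic he hx, e.left_inv hct] at hv
      have h5 : γ.gm (c t) w (chartDinv e (e (c t)) v) = 0 := hw2 _ hv
      rw [γ.gm_eq he hct, chartD_chartDinv' he hct] at h5
      exact h5
  have h5 : (((chartD e (c t)).comp ((1 : ℝ →L[ℝ] ℝ).smulRight w) : ℝ →L[ℝ] Cn (n + 1))) 1 =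
      s • chartLift π γ e (e (c t)) := by
    rw [← h4]
    change chartD e (c t) ((1 : ℝ) • w) = _
    rw [one_smul]
  rw [← h5]
  exact h3

lemma IsFlowCurve.continuousWithinAt {s : ℂ} {c : ℝ → Y} (hc : IsFlowCurve π D γ s c) {t : ℝ}
    (ht : t ∈ Icc (0 : ℝ) 1) : ContinuousWithinAt c (Icc 0 1) t := by
  obtain ⟨-, w, -, hw⟩ := hc t ht
  exact hw.1

lemma contDiffAt_chartLift (hπ : IsSemistableDegeneration (n := n) π D)
    {e : OpenPartialHomeomorph Y (Cn (n + 1))}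
    (he : e ∈ IsManifold.maximalAtlas 𝓘(ℂ, Cn (n + 1)) ω Y) {x : Cn (n + 1)} (hx : x ∈ e.target)
    (h0 : reForm (fderiv ℝ (π ∘ e.symm) x) ≠ 0) : ContDiffAt ℝ ∞ (chartLift π γ e) x := by
  obtain ⟨C, -, h⟩ := exists_horizLift_bound e.open_target (γ.contDiffOn_inChart he)
    (contDiffOn_fderiv_chart hπ.holomorphic he) (fun x _ => γ.inChart_symm e x)
    (fun x hx u hu => γ.inChart_pos he hx hu) hx
  exact (h.self_of_nhds.2.2.2 h0).1

/-- Flow curves which meet at some time agree. -/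
theorem IsFlowCurve.eqOn [T2Space Y] (hπ : IsSemistableDegeneration (n := n) π D) {s : ℂ}
    {c c' : ℝ → Y} (hc : IsFlowCurve π D γ s c) (hc' : IsFlowCurve π D γ s c') {t₀ : ℝ}
    (ht₀ : t₀ ∈ Icc (0 : ℝ) 1) (h : c t₀ = c' t₀) : EqOn c c' (Icc 0 1) := by
  have hcont : ContinuousOn c (Icc 0 1) := fun t ht => hc.continuousWithinAt ht
  have hcont' : ContinuousOn c' (Icc 0 1) := fun t ht => hc'.continuousWithinAt ht
  -- The set of agreement is closed because `Y` is Hausdorff and open by local uniqueness in a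
  -- chart, and `[0, 1]` is connected.
  let S : Set (Icc (0 : ℝ) 1) := {t | c t = c' t}
  have hcl : IsClosed S := isClosed_eq hcont.domRestrict hcont'.domRestrict
  have hop : IsOpen S := by
    rw [isOpen_iff_mem_nhds]
    rintro ⟨t₁, ht₁⟩ h1
    change c t₁ = c' t₁ at h1
    let e := chartAt (Cn (n + 1)) (c t₁)
    have he : e ∈ IsManifold.maximalAtlas 𝓘(ℂ, Cn (n + 1)) ω Y :=
      IsManifold.chart_mem_maximalAtlas _
    have hmem : c t₁ ∈ e.source := mem_chart_source _ _
    have hx := e.map_source hmem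
    -- At a point of the smooth locus `dπ ≠ 0`, so the lift is smooth there and hence locally
    -- Lipschitz.
    have hsm : ContDiffAt ℝ ∞ (fun x => s • chartLift π γ e x) (e (c t₁)) := by
      refine (contDiffAt_chartLift hπ he hx ?_).const_smul s
      rw [reForm_ne_zero_iff hπ.holomorphic he hx, e.left_inv hmem]
      exact hd_ne_zero_of_mem_smoothFibre hπ (hc t₁ ht₁).1
    obtain ⟨K, U, hU, hlip⟩ := (hsm.of_le (m := 1) (by simp)).exists_lipschitzOnWith
    have key : ∀ c'' : ℝ → Y, IsFlowCurve π D γ s c'' → c'' t₁ = c t₁ →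
        ∀ᶠ t in 𝓝[Icc (0 : ℝ) 1] t₁, (e ∘ c'') t ∈ U ∧
          HasDerivWithinAt (e ∘ c'') (s • chartLift π γ e ((e ∘ c'') t)) (Icc 0 1) t := by
      intro c'' h'' heq
      have hcw := h''.continuousWithinAt ht₁
      have hce : ContinuousAt e (c'' t₁) := by rw [heq]; exact e.continuousAt hmem
      have hcomp : ContinuousWithinAt (e ∘ c'') (Icc 0 1) t₁ :=
        hce.comp_continuousWithinAt hcw
      filter_upwards [hcw.preimage_mem_nhdsWithin (by rw [heq]; exact e.open_source.mem_nhds hmem),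
        hcomp.preimage_mem_nhdsWithin (by rw [Function.comp, heq]; exact hU),
        self_mem_nhdsWithin] with t h1 h2 h3
      exact ⟨h2, h''.hasDerivWithinAt hπ he h3 h1⟩
    have hev := eventuallyEq_of_integral_curves hlip ht₁ (key c hc rfl) (key c' hc' h1.symm)
      (by simp [h1])
    have hsrc : ∀ c'' : ℝ → Y, IsFlowCurve π D γ s c'' → c'' t₁ = c t₁ →
        ∀ᶠ t in 𝓝[Icc (0 : ℝ) 1] t₁, c'' t ∈ e.source := fun c'' h'' heq =>
      (h''.continuousWithinAt ht₁).preimage_mem_nhdsWithin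
        (by rw [heq]; exact e.open_source.mem_nhds hmem)
    have hfin : ∀ᶠ t in 𝓝[Icc (0 : ℝ) 1] t₁, c t = c' t := by
      filter_upwards [hev, hsrc c hc rfl, hsrc c' hc' h1.symm] with t h2 h3 h4
      exact e.injOn h3 h4 h2
    rw [nhdsWithin_eq_map_subtype_coe ht₁] at hfin
    exact hfin
  have huniv : S = univ := IsClopen.eq_univ ⟨hcl, hop⟩ ⟨⟨t₀, ht₀⟩, h⟩
  intro t ht
  have : (⟨t, ht⟩ : Icc (0 : ℝ) 1) ∈ S := by rw [huniv]; trivial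
  exact this

end FlowCurves

/-! ### Flows of fields that blow up where a function vanishes -/

section SingularField

open Metric

variable {E : Type*} [NormedAddCommGroup E] [NormedSpace ℝ E]

/-- The time one map of the flow of a small multiple of a vector field whose singularities are
controlled by a function `P`. -/
theorem exists_smooth_time_one_map_of_bound [CompleteSpace E] [HasContDiffBump E]
    {V : Type*} [NormedAddCommGroup V] [NormedSpace ℝ V] {H : E → E} {P : E → V} {T : E →L[ℝ] E}
    {x₁ : E} {r C k τ : ℝ} (hr : 0 < r) (hC : 0 < C) (hk : 0 < k) (hτ : 0 ≤ τ)
    (hP : ∀ x ∈ ball x₁ r, DifferentiableAt ℝ P x ∧ ‖fderiv ℝ P x‖ ≤ C)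
    (hH : ∀ x ∈ ball x₁ r, P x ≠ 0 → ContDiffAt ℝ ∞ H x ∧ ‖H x‖ ≤ C / ‖P x‖ ∧
      ‖fderiv ℝ H x‖ ≤ C / ‖P x‖ ^ 2)
    (hT : ‖T‖ ≤ τ ^ 4) (hP1 : P x₁ ≠ 0) (hP2 : k * τ ≤ ‖P x₁‖)
    (h1 : 2 * C / k * τ ^ 3 ≤ r / 4) (h2 : 8 * C / k ^ 2 * τ ^ 2 ≤ 1)
    (h3 : 4 * C * τ ≤ k) :
    ∃ Φ : E → E, ContDiffAt ℝ ∞ Φ x₁ ∧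
      (∀ u, ‖fderiv ℝ Φ x₁ u - u‖ ≤ 8 * C / k ^ 2 * τ ^ 2 * ‖u‖) ∧
      ‖Φ x₁ - x₁‖ ≤ 2 * C / k * τ ^ 3 ∧
      ∀ᶠ x in 𝓝 x₁, ∃ c : ℝ → E, c 0 = x ∧ c 1 = Φ x ∧ ∀ t ∈ Icc (0 : ℝ) 1, c t ∈ ball x₁ r ∧
        P (c t) ≠ 0 ∧ HasDerivWithinAt c (T (H (c t))) (Icc 0 1) t := by
  set l := ‖P x₁‖ with hl
  have hl0 : 0 < l := norm_pos_iff.2 hP1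
  -- As `‖fderiv P‖ ≤ C`, the function `P` varies by at most `l / 2` over a distance `l / (2 * C)`.
  -- On this ball the bounds on `H` therefore hold with `l` in place of `‖P x‖`, up to constants.
  set R := min r (l / (2 * C)) with hR
  have hR0 : 0 < R := lt_min hr (by positivity)
  have hsub : ball x₁ R ⊆ ball x₁ r := ball_subset_ball (min_le_left _ _)
  have hPl : ∀ x ∈ ball x₁ R, l / 2 ≤ ‖P x‖ := by
    intro x hx
    have h4 : ‖P x - P x₁‖ ≤ C * ‖x - x₁‖ :=
      (convex_ball x₁ R).norm_image_sub_le_of_norm_fderiv_le (fun y hy => (hP y (hsub hy)).1)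
        (fun y hy => (hP y (hsub hy)).2) (mem_ball_self hR0) hx
    have h5 : ‖x - x₁‖ ≤ l / (2 * C) := (mem_ball_iff_norm.1 hx).le.trans (min_le_right _ _)
    have h6 : C * ‖x - x₁‖ ≤ l / 2 := by
      calc C * ‖x - x₁‖ ≤ C * (l / (2 * C)) := by gcongr
        _ = l / 2 := by field_simp
    have h7 := norm_sub_norm_le (P x₁) (P x)
    rw [norm_sub_rev] at h7
    linarith
  have hP0 : ∀ x ∈ ball x₁ R, P x ≠ 0 := fun x hx h => by
    have := hPl x hx
    rw [h, norm_zero] at this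
    linarith
  -- One of the four powers of `τ` is spent on `l ≥ k τ`, two of them in `hσ2`. With `τ = |s|^{1/4}`
  -- these are the exponents `3/4` for the displacement and `1/2` for the differential.
  have hσ1 : τ ^ 4 * (2 * C / l) ≤ 2 * C / k * τ ^ 3 := by
    rw [mul_div_assoc', div_mul_eq_mul_div, div_le_div_iff₀ hl0 hk]
    have := mul_le_mul_of_nonneg_left hP2 (by positivity : 0 ≤ 2 * C * τ ^ 3)
    linarith
  have hσ2 : τ ^ 4 * (4 * C / l ^ 2) ≤ 4 * C / k ^ 2 * τ ^ 2 := by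
    rw [mul_div_assoc', div_mul_eq_mul_div, div_le_div_iff₀ (by positivity) (by positivity)]
    have h4 : (k * τ) ^ 2 ≤ l ^ 2 := by gcongr
    have := mul_le_mul_of_nonneg_left h4 (by positivity : 0 ≤ 4 * C * τ ^ 2)
    linarith
  have hXc : ∀ x ∈ ball x₁ R, ContDiffAt ℝ ∞ (fun x => T (H x)) x := fun x hx =>
    T.contDiff.contDiffAt.comp x (hH x (hsub hx) (hP0 x hx)).1
  have hM : ∀ x ∈ ball x₁ R, ‖T (H x)‖ ≤ τ ^ 4 * (2 * C / l) := by
    intro x hx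
    have h4 := (hH x (hsub hx) (hP0 x hx)).2.1
    have h5 : C / ‖P x‖ ≤ 2 * C / l := by
      rw [div_le_div_iff₀ (norm_pos_iff.2 (hP0 x hx)) hl0]
      nlinarith [hPl x hx]
    exact (T.le_opNorm _).trans (mul_le_mul hT (h4.trans h5) (norm_nonneg _) (by positivity))
  have hδ : ∀ x ∈ ball x₁ R, ‖fderiv ℝ (fun x => T (H x)) x‖ ≤ τ ^ 4 * (4 * C / l ^ 2) := by
    intro x hx
    have hc := hH x (hsub hx) (hP0 x hx)
    have h5 : C / ‖P x‖ ^ 2 ≤ 4 * C / l ^ 2 := by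
      rw [div_le_div_iff₀ (pow_pos (norm_pos_iff.2 (hP0 x hx)) 2) (by positivity)]
      have : (l / 2) ^ 2 ≤ ‖P x‖ ^ 2 := by gcongr; exact hPl x hx
      nlinarith [mul_le_mul_of_nonneg_left this hC.le]
    have hd : fderiv ℝ (fun x => T (H x)) x = T.comp (fderiv ℝ H x) :=
      (T.hasFDerivAt.comp x (hc.1.differentiableAt (by simp)).hasFDerivAt).fderiv
    rw [hd]
    exact (T.opNorm_comp_le _).trans
      (mul_le_mul hT (hc.2.2.trans h5) (norm_nonneg _) (by positivity))
  -- The displacement must fit into a ball whose radius may be as small as `l / (2 * C)`. It does,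
  -- since `h3` gives `4 * C * τ ^ 2 ≤ k τ ≤ l`.
  have hMR : τ ^ 4 * (2 * C / l) ≤ R / 4 := by
    rw [hR, ← min_div_div_right (by norm_num : (0 : ℝ) ≤ 4), le_min_iff]
    refine ⟨hσ1.trans h1, ?_⟩
    rw [mul_div_assoc', div_div, div_le_div_iff₀ hl0 (by positivity)]
    have h4 : (4 * C * τ ^ 2) ^ 2 ≤ l ^ 2 := by
      have : 4 * C * τ ^ 2 ≤ l := by nlinarith
      gcongr
    nlinarith
  obtain ⟨Φ, hΦ1, hΦ2, hΦ3⟩ := exists_smooth_time_one_map hR0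
    (fun x hx => (hXc x hx).contDiffWithinAt) hM hMR hδ
    (by
      have : 4 * C / k ^ 2 * τ ^ 2 = 8 * C / k ^ 2 * τ ^ 2 / 2 := by ring
      linarith)
  refine ⟨Φ, hΦ1, fun u => (hΦ2 u).trans ?_, ?_, ?_⟩
  · have : 2 * (τ ^ 4 * (4 * C / l ^ 2)) ≤ 8 * C / k ^ 2 * τ ^ 2 := by
      have h4 : 8 * C / k ^ 2 * τ ^ 2 = 2 * (4 * C / k ^ 2 * τ ^ 2) := by ring
      linarith
    gcongr
  · obtain ⟨c, hc0, hc1, hc⟩ := hΦ3.self_of_nhds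
    have := norm_image_sub_le_of_norm_deriv_le_segment_01' (fun t ht => (hc t ht).2)
      (fun t ht => hM _ (hc t ⟨ht.1, ht.2.le⟩).1)
    rw [hc1, hc0] at this
    exact this.trans hσ1
  · filter_upwards [hΦ3] with x hx
    obtain ⟨c, hc0, hc1, hc⟩ := hx
    exact ⟨c, hc0, hc1, fun t ht => ⟨hsub (hc t ht).1, hP0 _ (hc t ht).1, (hc t ht).2⟩⟩

/-- Multiplying `v` by a complex number of modulus one makes `ℓ v` real and non-negative, where `ℓ`
and its real part agree. -/
lemma norm_apply_le_norm_reForm {E : Type*} [NormedAddCommGroup E] [NormedSpace ℂ E]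
    [NormedSpace ℝ E] {ℓ : E →L[ℝ] ℂ} (hℓ : ∀ (c : ℂ) v, ℓ (c • v) = c * ℓ v)
    (v : E) : ‖ℓ v‖ ≤ ‖reForm ℓ‖ * ‖v‖ := by
  by_cases h : ℓ v = 0
  · rw [h, norm_zero]; positivity
  have hn : (‖ℓ v‖ : ℂ) ≠ 0 := by exact_mod_cast norm_ne_zero_iff.2 h
  let c : ℂ := (starRingEnd ℂ) (ℓ v) / ‖ℓ v‖
  have hc : ‖c‖ = 1 := by
    simp only [c, norm_div, RCLike.norm_conj, Complex.norm_real, norm_norm]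
    exact div_self (norm_ne_zero_iff.2 h)
  have h1 : reForm ℓ (c • v) = ‖ℓ v‖ := by
    change (ℓ (c • v)).re = _
    rw [hℓ, div_mul_eq_mul_div, mul_comm, Complex.mul_conj, Complex.normSq_eq_norm_sq]
    push_cast
    rw [pow_two, mul_div_assoc, div_self hn, mul_one, Complex.ofReal_re]
  calc ‖ℓ v‖ = ‖reForm ℓ (c • v)‖ := by rw [h1, norm_norm]
    _ ≤ ‖reForm ℓ‖ * ‖c • v‖ := (reForm ℓ).le_opNorm _
    _ = ‖reForm ℓ‖ * ‖v‖ := by rw [norm_smul, hc, one_mul]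

end SingularField

/-! ### The flow near a point of the central fibre -/

section LocalFlow

attribute [local instance] cnNormedAddCommGroup cnNormedSpaceReal cnNormedSpaceComplex
  cnDualNormedAddCommGroup cnBilinNormedAddCommGroup

variable {n a : ℕ} {Y : Type*} [TopologicalSpace Y] [ChartedSpace (Cn (n + 1)) Y]
  [IsManifold 𝓘(ℂ, Cn (n + 1)) ω Y] {π : Y → ℂ} {D : Fin a → Set Y} {γ : KahlerMetric (n + 1) Y}

lemma hasMFDerivWithinAt_of_hasDerivWithinAt {E : Type*} [NormedAddCommGroup E] [NormedSpace ℝ E]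
    {f : ℝ → E} {s : Set ℝ} {t : ℝ} {w : E} (h : HasDerivWithinAt f w s t) :
    HasMFDerivWithinAt 𝓘(ℝ, ℝ) 𝓘(ℝ, E) f s t ((1 : ℝ →L[ℝ] ℝ).smulRight w) :=
  h.hasFDerivWithinAt.hasMFDerivWithinAt

/-- Along integral curves of the horizontal lift of `s` the function `π` grows like `t s`. -/
lemma chart_curve_apply (hπ : IsSemistableDegeneration (n := n) π D)
    {e : OpenPartialHomeomorph Y (Cn (n + 1))}
    (he : e ∈ IsManifold.maximalAtlas 𝓘(ℂ, Cn (n + 1)) ω Y) {s : ℂ} {c : ℝ → Cn (n + 1)}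
    (hc : ∀ t ∈ Icc (0 : ℝ) 1, c t ∈ e.target ∧ reForm (fderiv ℝ (π ∘ e.symm) (c t)) ≠ 0 ∧
      HasDerivWithinAt c (s • chartLift π γ e (c t)) (Icc 0 1) t) :
    ∀ t ∈ Icc (0 : ℝ) 1, π (e.symm (c t)) = π (e.symm (c 0)) + t * s := by
  have hp : ∀ x ∈ e.target, HasFDerivAt (π ∘ e.symm) (fderiv ℝ (π ∘ e.symm) x) x := fun x hx =>
    ((((contDiffOn_comp_chart_symm hπ.holomorphic he).restrict_scalars ℝ).contDiffAt
      (e.open_target.mem_nhds hx)).differentiableAt (by simp)).hasFDerivAt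
  -- The lift is normalised by `dπ = 1`, so `π` grows along the curve at the constant rate `s`.
  have hd : ∀ t ∈ Icc (0 : ℝ) 1,
      HasDerivWithinAt (fun t : ℝ => π (e.symm (c t)) - t * s) 0 (Icc 0 1) t := by
    intro t ht
    obtain ⟨h1, h2, h3⟩ := hc t ht
    have h4 := (hp _ h1).comp_hasDerivWithinAt t h3
    have h5 : fderiv ℝ (π ∘ e.symm) (c t) (s • chartLift π γ e (c t)) = s := by
      rw [fderiv_chart_smul hπ.holomorphic he h1, chartLift,
        apply_horizLift (γ.inChart_symm e _) (fun u hu => γ.inChart_pos he h1 hu) (γ.inChart_I he h1)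
        (fderiv_chart_smul hπ.holomorphic he h1) h2, mul_one]
    rw [h5] at h4
    have h6 : HasDerivWithinAt (fun t : ℝ => (t : ℂ) * s) (1 * s) (Icc 0 1) t :=
      (Complex.ofRealCLM.hasDerivAt (x := t)).hasDerivWithinAt.mul_const s
    have := h4.sub h6
    rw [one_mul, sub_self] at this
    exact this
  intro t ht
  have := constant_of_derivWithin_zero (fun t ht => (hd t ht).differentiableWithinAt)
    (fun t ht => (hd t (Ico_subset_Icc_self ht)).derivWithin
      (uniqueDiffOn_Icc zero_lt_one t (Ico_subset_Icc_self ht))) t ht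
  simp only [Complex.ofReal_zero, zero_mul, sub_zero] at this
  rw [← this]; ring

/-- This is the converse of `IsFlowCurve.hasDerivWithinAt` for curves starting on the central fibre.
The curve misses the singular locus because `dπ` vanishes there and not along the curve. -/
lemma isFlowCurve_of_chart (hπ : IsSemistableDegeneration (n := n) π D)
    {e : OpenPartialHomeomorph Y (Cn (n + 1))}
    (he : e ∈ IsManifold.maximalAtlas 𝓘(ℂ, Cn (n + 1)) ω Y) {s : ℂ} {c : ℝ → Cn (n + 1)}
    (hc : ∀ t ∈ Icc (0 : ℝ) 1, c t ∈ e.target ∧ reForm (fderiv ℝ (π ∘ e.symm) (c t)) ≠ 0 ∧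
      HasDerivWithinAt c (s • chartLift π γ e (c t)) (Icc 0 1) t)
    (h0 : π (e.symm (c 0)) = 0) : IsFlowCurve π D γ s (e.symm ∘ c) := by
  intro t ht
  obtain ⟨h1, h2, h3⟩ := hc t ht
  have h4 := chart_curve_apply hπ he hc t ht
  rw [h0, zero_add] at h4
  refine ⟨⟨h4, fun hs => ?_⟩, chartDinv e (c t) (s • chartLift π γ e (c t)), ⟨?_, ?_⟩, ?_⟩
  · exact (reForm_ne_zero_iff hπ.holomorphic he h1).1 h2 (hd_eq_zero_of_mem_singLocus hπ hs)
  · change hd (m := n + 1) π (e.symm (c t)) (chartDinv e (c t) (s • chartLift π γ e (c t))) = s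
    rw [← fderiv_comp_chart_symm hπ.holomorphic he h1, fderiv_chart_smul hπ.holomorphic he h1,
      chartLift, apply_horizLift (γ.inChart_symm e _) (fun u hu => γ.inChart_pos he h1 hu) (γ.inChart_I he h1)
        (fderiv_chart_smul hπ.holomorphic he h1) h2, mul_one]
  · intro v' hv'
    let v : Cn (n + 1) := v'
    have hmem := e.map_target h1
    have hv : hd (m := n + 1) π (e.symm (c t)) v = 0 := hv'
    rw [hd_eq hπ.holomorphic he hmem v, e.right_inv h1] at hv
    have key : γ.gm (e.symm (c t)) (chartDinv e (c t) (s • chartLift π γ e (c t))) v = 0 := by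
      rw [γ.gm_eq he hmem, e.right_inv h1, chartD_chartDinv he h1]
      exact horizLift_orthogonal (fun u hu => γ.inChart_pos he h1 hu) (γ.inChart_I he h1)
        (fderiv_chart_smul hπ.holomorphic he h1) s hv
    exact key
  · have h5 := (hasMFDerivAt_chart_symm he h1).comp_hasMFDerivWithinAt t
      (hasMFDerivWithinAt_of_hasDerivWithinAt h3)
    have h6 : (chartDinv e (c t)).comp
        ((1 : ℝ →L[ℝ] ℝ).smulRight (s • chartLift π γ e (c t))) =
        (1 : ℝ →L[ℝ] ℝ).smulRight (chartDinv e (c t) (s • chartLift π γ e (c t))) := by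
      ext1
      change chartDinv e (c t) ((1 : ℝ) • (s • chartLift π γ e (c t))) =
        (1 : ℝ) • chartDinv e (c t) (s • chartLift π γ e (c t))
      rw [one_smul, one_smul]
    have h7 : HasMFDerivWithinAt 𝓘(ℝ, ℝ) 𝓘(ℝ, Cn (n + 1)) (e.symm ∘ c) (Icc 0 1) t
        ((1 : ℝ →L[ℝ] ℝ).smulRight (chartDinv e (c t) (s • chartLift π γ e (c t))) :
          ℝ →L[ℝ] Cn (n + 1)) := by
      rw [← h6]
      exact h5
    exact h7

/-- Local description of the flow on the domains `A_s`, uniformly in `s`. -/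
theorem exists_local_flow (hn : 1 ≤ n) (hπ : IsSemistableDegeneration (n := n) π D)
    (γ : KahlerMetric (n + 1) Y) {ν : ℕ} (hν : n ≤ ν) {y₀ : Y} (hy₀ : π y₀ = 0)
    {e : OpenPartialHomeomorph Y (Cn (n + 1))}
    (he : e ∈ IsManifold.maximalAtlas 𝓘(ℂ, Cn (n + 1)) ω Y) (hye : y₀ ∈ e.source)
    {V : Set (Cn (n + 1))} (hV : V ∈ 𝓝 (e y₀)) :
    ∃ r > 0, ∃ K > 0, ∃ ρ > 0, Metric.ball (e y₀) (2 * r) ⊆ V ∩ e.target ∧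
      ∀ s : ℂ, ‖s‖ < ρ → K * ‖s‖ ^ (1 / 2 : ℝ) ≤ 1 / 2 ∧
      ∀ z ∈ retractDomain π D γ ν s, z ∈ e.source → e z ∈ Metric.ball (e y₀) r →
      ∃ Φ : Cn (n + 1) → Cn (n + 1), ContDiffAt ℝ ∞ Φ (e z) ∧
        (∀ u, ‖fderiv ℝ Φ (e z) u - u‖ ≤ K * ‖s‖ ^ (1 / 2 : ℝ) * ‖u‖) ∧
        ‖Φ (e z) - e z‖ ≤ K * ‖s‖ ^ (3 / 4 : ℝ) ∧
        ∀ᶠ x in 𝓝 (e z), Φ x ∈ Metric.ball (e y₀) (2 * r) ∧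
          π (e.symm (Φ x)) = π (e.symm x) + s ∧
          (π (e.symm x) = 0 → ∃ c : ℝ → Y, c 0 = e.symm x ∧ c 1 = e.symm (Φ x) ∧
            IsFlowCurve π D γ s c) := by
  have hx₀ := e.map_source hye
  obtain ⟨C, hC, hbd⟩ := exists_horizLift_bound e.open_target (γ.contDiffOn_inChart he)
    (contDiffOn_fderiv_chart hπ.holomorphic he) (fun x _ => γ.inChart_symm e x)
    (fun x hx u hu => γ.inChart_pos he hx hu) hx₀
  obtain ⟨c₀, hc₀, hlow⟩ := exists_le_hd γ hπ hy₀
  have hlow' : ∀ᶠ x in 𝓝 (e y₀), e.symm x ∈ smoothFibre π D 0 → ∀ r : ℝ, 0 ≤ r → r ≤ 1 →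
      ENNReal.ofReal r ≤ γ.distTo (e.symm x) (singLocus D) →
      ∃ v : Cn (n + 1), γ.vnorm (e.symm x) v ≤ 1 ∧ c₀ * r ^ n ≤ ‖hd π (e.symm x) v‖ := by
    have h1 : Filter.Tendsto e.symm (𝓝 (e y₀)) (𝓝 y₀) := by
      have := (e.continuousAt_symm hx₀).tendsto
      rwa [e.left_inv hye] at this
    exact h1.eventually hlow
  obtain ⟨r₁, hr₁, hball⟩ := Metric.eventually_nhds_iff_ball.1
    (hbd.and (hlow'.and ((Filter.eventually_mem_set.2 hV).and (e.open_target.mem_nhds hx₀))))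
  set r := r₁ / 2 with hr
  have hr0 : 0 < r := half_pos hr₁
  have h2r : 2 * r = r₁ := by rw [hr]; ring
  -- A vector of `γ`-length at most one has chart norm at most `√C`. This converts the lower bound
  -- `c₀` on such vectors into one for the norm of `dπ` in the chart.
  set k := c₀ / Real.sqrt C with hk
  have hk0 : 0 < k := div_pos hc₀ (Real.sqrt_pos.2 hC)
  set K := max (2 * C / k) (8 * C / k ^ 2) with hK
  have hK0 : 0 < K := lt_max_of_lt_left (by positivity)
  have hsmall : ∀ᶠ τ : ℝ in 𝓝 0, K * τ ^ 3 < r / 4 ∧ K * τ ^ 2 < 1 / 2 ∧ 4 * C * τ < k ∧ τ < 1 := by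
    refine .and ?_ (.and ?_ (.and ?_ ?_))
    · exact (Continuous.tendsto' (by fun_prop) 0 0 (by simp)).eventually_lt_const (by positivity)
    · exact (Continuous.tendsto' (by fun_prop) 0 0 (by simp)).eventually_lt_const (by positivity)
    · exact (Continuous.tendsto' (by fun_prop) 0 0 (by simp)).eventually_lt_const (by positivity)
    · exact (Continuous.tendsto' (by fun_prop) 0 0 (by simp)).eventually_lt_const (by positivity)
  obtain ⟨τ₀, hτ₀, hτ⟩ := Metric.eventually_nhds_iff_ball.1 hsmall
  refine ⟨r, hr0, K, hK0, τ₀ ^ 4, by positivity, ?_, ?_⟩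
  · rw [h2r]
    exact fun x hx => (hball x hx).2.2
  intro s hs
  -- The lower bound for `dπ` on `A_s` is a multiple of `τ`, while the factor `s` of the field has
  -- size `τ ^ 4`.
  set τ := ‖s‖ ^ (1 / 4 : ℝ) with hτs
  have hτ0 : 0 ≤ τ := by positivity
  have hp : ∀ j : ℕ, τ ^ j = ‖s‖ ^ ((j : ℝ) / 4) := fun j => by
    rw [hτs, ← Real.rpow_natCast, ← Real.rpow_mul (norm_nonneg _)]
    congr 1; ring
  have hp4 : τ ^ 4 = ‖s‖ := by rw [hp]; norm_num
  have hp2 : ‖s‖ ^ (1 / 2 : ℝ) = τ ^ 2 := by rw [hp]; norm_num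
  have hp3 : ‖s‖ ^ (3 / 4 : ℝ) = τ ^ 3 := by rw [hp]; norm_num
  have hττ₀ : τ < τ₀ := by
    refine lt_of_pow_lt_pow_left₀ 4 hτ₀.le ?_
    rwa [hp4]
  obtain ⟨hb3, hb2, hb1, hb0⟩ := hτ τ (by rwa [mem_ball_zero_iff, Real.norm_of_nonneg hτ0])
  rw [hp2, hp3]
  refine ⟨hb2.le, fun z hz hze hzr => ?_⟩
  have hsub : Metric.ball (e z) r ⊆ Metric.ball (e y₀) r₁ := by
    refine Metric.ball_subset_ball' ?_
    have := Metric.mem_ball.1 hzr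
    rw [hr] at *
    linarith
  have hzball : e z ∈ Metric.ball (e y₀) r₁ := hsub (Metric.mem_ball_self hr0)
  have hzt := e.map_source hze
  have hzπ : hd (m := n + 1) π z ≠ 0 := hd_ne_zero_of_mem_smoothFibre hπ hz.1
  have hRe : reForm (fderiv ℝ (π ∘ e.symm) (e z)) ≠ 0 := by
    rw [reForm_ne_zero_iff hπ.holomorphic he hzt, e.left_inv hze]
    exact hzπ
  have hRe2 : k * τ ≤ ‖reForm (fderiv ℝ (π ∘ e.symm) (e z))‖ := by
    have hs1 : ‖s‖ ≤ 1 := by rw [← hp4]; exact pow_le_one₀ hτ0 hb0.le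
    have hν0 : (0 : ℝ) < ν := by exact_mod_cast (hn.trans hν)
    have h1 : ENNReal.ofReal (‖s‖ ^ (1 / (4 * (ν : ℝ)))) ≤ γ.distTo z (singLocus D) := by
      refine le_trans (ENNReal.ofReal_le_ofReal ?_) (not_le.1 hz.2).le
      have : 0 ≤ ‖s‖ ^ (1 / (4 * (ν : ℝ))) := by positivity
      linarith
    have h2 := (hball _ hzball).2.1
    rw [e.left_inv hze] at h2
    obtain ⟨v, hv1, hv2⟩ := h2 hz.1 _ (by positivity)
      (Real.rpow_le_one (norm_nonneg _) hs1 (by positivity)) h1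
    -- This is where `n ≤ ν` is needed: `|s|^{n / (4ν)} ≥ |s|^{1/4}` because `|s| ≤ 1`.
    have h3 : τ ≤ (‖s‖ ^ (1 / (4 * (ν : ℝ)))) ^ n := by
      rw [← Real.rpow_natCast, ← Real.rpow_mul (norm_nonneg _)]
      refine Real.rpow_le_rpow_of_exponent_ge' (norm_nonneg _) hs1 (by positivity) ?_
      rw [one_div_mul_eq_div, div_le_div_iff₀ (by positivity) (by norm_num)]
      have : (n : ℝ) ≤ ν := by exact_mod_cast hν
      linarith
    have h4 : ‖hd (m := n + 1) π z v‖ ≤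
        ‖reForm (fderiv ℝ (π ∘ e.symm) (e z))‖ * ‖chartD e z v‖ := by
      rw [hd_eq hπ.holomorphic he hze v]
      exact norm_apply_le_norm_reForm (fderiv_chart_smul hπ.holomorphic he hzt) _
    have h5 : ‖chartD e z v‖ ≤ Real.sqrt C := by
      refine Real.le_sqrt_of_sq_le (((hball _ hzball).1.2.1 _).trans ?_)
      rw [← γ.gm_eq he hze]
      have h6 : γ.gm z v v ≤ 1 := by
        have h7 : Real.sqrt (γ.gm z v v) ≤ 1 := hv1
        rwa [Real.sqrt_le_one] at h7
      nlinarith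
    have h6 : c₀ * τ ≤ ‖reForm (fderiv ℝ (π ∘ e.symm) (e z))‖ * Real.sqrt C :=
      calc c₀ * τ ≤ c₀ * (‖s‖ ^ (1 / (4 * (ν : ℝ)))) ^ n := by gcongr
        _ ≤ _ := hv2.trans (h4.trans (by gcongr))
    rw [hk, div_mul_eq_mul_div, div_le_iff₀ (Real.sqrt_pos.2 hC)]
    exact h6
  have hPd : ∀ x ∈ Metric.ball (e z) r,
      DifferentiableAt ℝ (fun x => reForm (fderiv ℝ (π ∘ e.symm) x)) x := fun x hx =>
    ((ContinuousLinearMap.compL ℝ (Cn (n + 1)) ℂ ℝ Complex.reCLM).contDiff.contDiffAt.comp x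
      ((contDiffOn_fderiv_chart hπ.holomorphic he).contDiffAt
        (e.open_target.mem_nhds (hball x (hsub hx)).2.2.2))).differentiableAt (n := ∞) (by simp)
  have hT : ‖s • ContinuousLinearMap.id ℝ (Cn (n + 1))‖ ≤ τ ^ 4 := by
    rw [hp4]
    refine ContinuousLinearMap.opNorm_le_bound _ (norm_nonneg _) fun u => ?_
    rw [smul_apply, norm_smul]
    rfl
  have hK1 : 2 * C / k * τ ^ 3 ≤ r / 4 := by
    refine le_trans ?_ hb3.le
    gcongr; exact le_max_left _ _
  have hK2 : 8 * C / k ^ 2 * τ ^ 2 ≤ 1 := by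
    have : 8 * C / k ^ 2 * τ ^ 2 ≤ K * τ ^ 2 := by gcongr; exact le_max_right _ _
    linarith
  obtain ⟨Φ, hΦ1, hΦ2, hΦ3, hΦ4⟩ := exists_smooth_time_one_map_of_bound
    (H := chartLift π γ e) (P := fun x => reForm (fderiv ℝ (π ∘ e.symm) x))
    (T := s • ContinuousLinearMap.id ℝ (Cn (n + 1))) (x₁ := e z) hr0 hC hk0 hτ0
    (fun x hx => ⟨hPd x hx, (hball x (hsub hx)).1.2.2.1⟩)
    (fun x hx => (hball x (hsub hx)).1.2.2.2) hT hRe hRe2 hK1 hK2 hb1.le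
  refine ⟨Φ, hΦ1, fun u => (hΦ2 u).trans ?_, hΦ3.trans ?_, ?_⟩
  · gcongr; exact le_max_right _ _
  · gcongr; exact le_max_left _ _
  -- The starting point ranges over a full neighbourhood in the total space. On every fibre the flow
  -- raises `π` by `s`; only curves issuing from the central fibre are flow curves in the sense of
  -- `IsFlowCurve`.
  · filter_upwards [hΦ4] with x hx
    obtain ⟨c, hc0, hc1, hc⟩ := hx
    have hc' : ∀ t ∈ Icc (0 : ℝ) 1, c t ∈ e.target ∧
        reForm (fderiv ℝ (π ∘ e.symm) (c t)) ≠ 0 ∧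
        HasDerivWithinAt c (s • chartLift π γ e (c t)) (Icc 0 1) t := fun t ht =>
      ⟨(hball _ (hsub (hc t ht).1)).2.2.2, (hc t ht).2.1, (hc t ht).2.2⟩
    refine ⟨?_, ?_, fun h => ⟨e.symm ∘ c, by rw [Function.comp, hc0], by rw [Function.comp, hc1],
      isFlowCurve_of_chart hπ he hc' (by rwa [hc0])⟩⟩
    · rw [← hc1, h2r]
      exact hsub (hc 1 (by simp)).1
    · have := chart_curve_apply hπ he hc' 1 (by simp)
      rw [hc0, hc1] at this
      rw [this]; simp
end LocalFlow

/-! ### Coordinates in which a submersion is a projection -/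

section Straightening

variable {n : ℕ}

/-- Local coordinates on `ℂ^{n+1}` with a given submersive first coordinate. -/
lemma exists_straightening {f : Cn (n + 1) → ℂ} {x₀ : Cn (n + 1)} (hf : ContDiffAt ℂ ω f x₀)
    (h : fderiv ℂ f x₀ ≠ 0) : ∃ Ψ : OpenPartialHomeomorph (Cn (n + 1)) (ℂ × Cn n),
      x₀ ∈ Ψ.source ∧ (∀ x, (Ψ x).1 = f x) ∧ ContDiffOn ℂ ω Ψ Ψ.source ∧
      ContDiffOn ℂ ω Ψ.symm Ψ.target := by
  set ℓ := fderiv ℂ f x₀ with hℓ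
  -- Some partial derivative is non-zero; `f` together with the remaining coordinates is then a
  -- local coordinate system.
  obtain ⟨j, hj⟩ : ∃ j, ℓ (Pi.single j 1) ≠ 0 := by
    by_contra! h0
    refine h (ContinuousLinearMap.coe_injective (LinearMap.pi_ext' fun i => ?_))
    ext
    exact h0 i
  let P : Cn (n + 1) →L[ℂ] Cn n :=
    ContinuousLinearMap.pi fun i => ContinuousLinearMap.proj (j.succAbove i)
  let L : Cn (n + 1) →L[ℂ] ℂ × Cn n := ℓ.prod P
  have hLinj : Function.Injective L := by
    rw [injective_iff_map_eq_zero]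
    intro x hx
    have h1 : ℓ x = 0 := congrArg Prod.fst hx
    have h2 : ∀ i, x (j.succAbove i) = 0 := fun i => congrFun (congrArg Prod.snd hx) i
    have h3 : x = x j • (Pi.single j 1 : Cn (n + 1)) := by
      funext i
      rcases Fin.eq_self_or_eq_succAbove j i with rfl | ⟨i, rfl⟩
      · simp
      · simp [h2]
    rw [h3, map_smul, smul_eq_mul, mul_eq_zero, or_iff_left hj] at h1
    rw [h3, h1, zero_smul]
  have hdim : Module.finrank ℂ (Cn (n + 1)) = Module.finrank ℂ (ℂ × Cn n) := by
    simp [Module.finrank_prod, add_comm]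
  let L' : Cn (n + 1) ≃L[ℂ] ℂ × Cn n :=
    (LinearEquiv.ofInjectiveOfFinrankEq L.toLinearMap hLinj hdim).toContinuousLinearEquiv
  have hL' : (L' : Cn (n + 1) →L[ℂ] ℂ × Cn n) = L := by ext x <;> rfl
  let Ψ₀ : Cn (n + 1) → ℂ × Cn n := fun x => (f x, P x)
  have hΨc : ∀ {x}, ContDiffAt ℂ ω f x → ContDiffAt ℂ ω Ψ₀ x := fun hx =>
    hx.prodMk P.contDiff.contDiffAt
  have hd : HasFDerivAt Ψ₀ (L' : Cn (n + 1) →L[ℂ] ℂ × Cn n) x₀ := by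
    rw [hL']
    exact (hf.differentiableAt (by simp)).hasFDerivAt.prodMk P.hasFDerivAt
  let Q := (hΨc hf).toOpenPartialHomeomorph Ψ₀ hd (by simp)
  have hQx : x₀ ∈ Q.source := (hΨc hf).mem_toOpenPartialHomeomorph_source hd (by simp)
  have hsymm : ContDiffAt ℂ ω Q.symm (Q x₀) := (hΨc hf).to_localInverse hd (by simp)
  -- The inverse function theorem gives analyticity of the inverse only at one point. The domain is
  -- shrunk so that both maps are analytic throughout.
  have h1 : ∀ᶠ x in 𝓝 x₀, ContDiffAt ℂ ω f x ∧ ContDiffAt ℂ ω Q.symm (Q x) :=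
    (hf.eventually (by simp)).and ((Q.continuousAt hQx).eventually (hsymm.eventually (by simp)))
  obtain ⟨U, hU, hUo, hxU⟩ := mem_nhds_iff.1 h1
  refine ⟨Q.restrOpen U hUo, ⟨hQx, hxU⟩, fun _ => rfl, ?_, ?_⟩
  · intro x hx
    exact (hΨc (hU hx.2).1).contDiffWithinAt
  · intro y hy
    have h2 := (hU hy.2).2
    have h3 : y ∈ Q.target := hy.1
    rw [Q.right_inv h3] at h2
    exact h2.contDiffWithinAt

end Straightening

/-! ### Holomorphic parametrisations of the fibres -/

section FibreParams

attribute [local instance] cnNormedAddCommGroup cnNormedSpaceReal cnNormedSpaceComplex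
  cnDualNormedAddCommGroup cnBilinNormedAddCommGroup

variable {n a : ℕ} {Y : Type*} [TopologicalSpace Y] [ChartedSpace (Cn (n + 1)) Y]
  {π : Y → ℂ} {D : Fin a → Set Y} {s : ℂ}

/-- The differential of a parametrisation, with values in the model space. -/
def FibreParam.d (φ : FibreParam (n := n) π D s) (x : Cn n) : Cn n →L[ℝ] Cn (n + 1) :=
  mfderiv 𝓘(ℝ, Cn n) 𝓘(ℝ, Cn (n + 1)) φ.map x

/-- The differential of a parametrisation, as a complex linear map. -/
def FibreParam.dc (φ : FibreParam (n := n) π D s) (x : Cn n) : Cn n →L[ℂ] Cn (n + 1) :=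
  mfderiv 𝓘(ℂ, Cn n) 𝓘(ℂ, Cn (n + 1)) φ.map x

/-- The domain of a parametrisation. -/
abbrev FibreParam.dom (φ : FibreParam (n := n) π D s) : Set (Cn n) := φ.toHomeo.source

/-- The image of a parametrisation. -/
abbrev FibreParam.ran (φ : FibreParam (n := n) π D s) : Set Y := φ.map '' φ.dom

lemma FibreParam.isOpen_dom (φ : FibreParam (n := n) π D s) : IsOpen φ.dom := φ.toHomeo.open_source

lemma FibreParam.map_mem (φ : FibreParam (n := n) π D s) (x : Cn n) :
    φ.map x ∈ smoothFibre π D s := (φ.toHomeo x).2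

lemma FibreParam.continuousOn (φ : FibreParam (n := n) π D s) : ContinuousOn φ.map φ.dom :=
  continuous_subtype_val.comp_continuousOn φ.toHomeo.continuousOn

lemma FibreParam.injOn (φ : FibreParam (n := n) π D s) : InjOn φ.map φ.dom :=
  fun _ hx _ hy h => φ.toHomeo.injOn hx hy (Subtype.ext h)

/-- The inverse of a parametrisation. -/
def FibreParam.inv (φ : FibreParam (n := n) π D s) (y : Y) : Cn n :=
  Function.invFunOn φ.map φ.dom y

lemma FibreParam.inv_map (φ : FibreParam (n := n) π D s) {x : Cn n} (hx : x ∈ φ.dom) :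
    φ.inv (φ.map x) = x := φ.injOn.leftInvOn_invFunOn hx

lemma FibreParam.inv_mem (φ : FibreParam (n := n) π D s) {y : Y} (hy : y ∈ φ.ran) :
    φ.inv y ∈ φ.dom := Function.invFunOn_mem hy

lemma FibreParam.map_inv (φ : FibreParam (n := n) π D s) {y : Y} (hy : y ∈ φ.ran) :
    φ.map (φ.inv y) = y := Function.invFunOn_eq hy

/-- Images of open subsets of the domain are relatively open in the fibre. -/
lemma FibreParam.exists_isOpen_image (φ : FibreParam (n := n) π D s) {U : Set (Cn n)}
    (hU : IsOpen U) (hUd : U ⊆ φ.dom) :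
    ∃ O : Set Y, IsOpen O ∧ φ.map '' U = smoothFibre π D s ∩ O := by
  obtain ⟨O, hO, h⟩ := isOpen_induced_iff.1 (φ.toHomeo.isOpen_image_of_subset_source hU hUd)
  refine ⟨O, hO, ?_⟩
  have h1 : φ.map '' U = Subtype.val '' (φ.toHomeo '' U) := by rw [image_image]; rfl
  rw [h1, ← h, Subtype.image_preimage_coe]

lemma FibreParam.continuousOn_inv (φ : FibreParam (n := n) π D s) :
    ContinuousOn φ.inv φ.ran := by
  rintro y ⟨x, hx, rfl⟩
  rw [ContinuousWithinAt, φ.inv_map hx]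
  intro U hU
  obtain ⟨V, hV, hVo, hxV⟩ := mem_nhds_iff.1 (Filter.inter_mem hU (φ.isOpen_dom.mem_nhds hx))
  obtain ⟨O, hO, h⟩ := φ.exists_isOpen_image hVo (fun z hz => (hV hz).2)
  have hxO : φ.map x ∈ O := by
    have : φ.map x ∈ smoothFibre π D s ∩ O := h ▸ mem_image_of_mem _ hxV
    exact this.2
  refine Filter.mem_map.2 (Filter.mem_of_superset (inter_mem_nhdsWithin _ (hO.mem_nhds hxO)) ?_)
  rintro y' ⟨⟨x', hx', rfl⟩, hy'⟩
  obtain ⟨x'', hx'', h''⟩ : φ.map x' ∈ φ.map '' V := h ▸ ⟨φ.map_mem x', hy'⟩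
  rw [φ.injOn (hV hx'').2 hx' h''] at hx''
  change φ.inv (φ.map x') ∈ U
  rw [φ.inv_map hx']
  exact (hV hx'').1

lemma FibreParam.hasMFDerivAt_complex (φ : FibreParam (n := n) π D s) {x : Cn n} (hx : x ∈ φ.dom) :
    HasMFDerivAt 𝓘(ℂ, Cn n) 𝓘(ℂ, Cn (n + 1)) φ.map x (φ.dc x) :=
  (((φ.holomorphic x hx).contMDiffAt (φ.isOpen_dom.mem_nhds hx)).mdifferentiableAt
    (by simp)).hasMFDerivAt

lemma FibreParam.d_eq (φ : FibreParam (n := n) π D s) {x : Cn n} (hx : x ∈ φ.dom) (u : Cn n) :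
    φ.d x u = φ.dc x u := by
  have := (φ.hasMFDerivAt_complex hx).restrictScalars_real.mfderiv
  exact DFunLike.congr_fun this u

lemma FibreParam.hasMFDerivAt (φ : FibreParam (n := n) π D s) {x : Cn n} (hx : x ∈ φ.dom) :
    HasMFDerivAt 𝓘(ℝ, Cn n) 𝓘(ℝ, Cn (n + 1)) φ.map x (φ.d x) :=
  (φ.hasMFDerivAt_complex hx).restrictScalars_real.mdifferentiableAt.hasMFDerivAt

lemma FibreParam.d_smul (φ : FibreParam (n := n) π D s) {x : Cn n} (hx : x ∈ φ.dom) (c : ℂ)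
    (u : Cn n) : φ.d x (c • u) = c • φ.d x u := by
  rw [φ.d_eq hx, φ.d_eq hx, map_smul]

lemma FibreParam.d_injective (φ : FibreParam (n := n) π D s) {x : Cn n} (hx : x ∈ φ.dom) :
    Function.Injective (φ.d x) := by
  intro u v h
  rw [φ.d_eq hx, φ.d_eq hx] at h
  exact φ.immersive x hx h

variable [IsManifold 𝓘(ℂ, Cn (n + 1)) ω Y]

lemma hasFDerivAt_complex_of_hasMFDerivAt {E F : Type*} [NormedAddCommGroup E] [NormedSpace ℂ E]
    [NormedAddCommGroup F] [NormedSpace ℂ F] {f : E → F} {x : E} {L : E →L[ℂ] F}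
    (h : HasMFDerivAt 𝓘(ℂ, E) 𝓘(ℂ, F) f x L) : HasFDerivAt f L x := h.hasFDerivAt

lemma FibreParam.hd_d (φ : FibreParam (n := n) π D s)
    (hπ : ContMDiff 𝓘(ℂ, Cn (n + 1)) 𝓘(ℂ, ℂ) ω π) {x : Cn n} (hx : x ∈ φ.dom) (u : Cn n) :
    hd (m := n + 1) π (φ.map x) (φ.d x u) = 0 := by
  have h1 := hasFDerivAt_of_hasMFDerivAt
    ((hasMFDerivAt_real_of_holomorphic hπ (φ.map x)).comp x (φ.hasMFDerivAt hx))
  have h2 : π ∘ φ.map = fun _ => s := funext fun x => (φ.map_mem x).1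
  rw [h2] at h1
  exact DFunLike.congr_fun (h1.unique (hasFDerivAt_const s x)) u

/-- The differential is an injective complex linear map from a space of dimension `n` into `ker dπ`,
whose dimension is also `n`. -/
lemma FibreParam.exists_d_eq (φ : FibreParam (n := n) π D s)
    (hπ : ContMDiff 𝓘(ℂ, Cn (n + 1)) 𝓘(ℂ, ℂ) ω π) {x : Cn n} (hx : x ∈ φ.dom)
    (hne : hd (m := n + 1) π (φ.map x) ≠ 0) {v : Cn (n + 1)}
    (hv : hd (m := n + 1) π (φ.map x) v = 0) : ∃ u, φ.d x u = v := by
  have hr : LinearMap.range (φ.dc x).toLinearMap ≤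
      LinearMap.ker (hd (m := n + 1) π (φ.map x)).toLinearMap := by
    rintro _ ⟨u, rfl⟩
    have := φ.hd_d hπ hx u
    rw [φ.d_eq hx] at this
    exact this
  have hinj : Function.Injective (φ.dc x).toLinearMap := φ.immersive x hx
  have h1 : Module.finrank ℂ (LinearMap.range (φ.dc x).toLinearMap) = n := by
    rw [LinearMap.finrank_range_of_inj hinj]; simp
  have h2 : Module.finrank ℂ (LinearMap.ker (hd (m := n + 1) π (φ.map x)).toLinearMap) = n := by
    have h3 := LinearMap.finrank_range_add_finrank_ker (hd (m := n + 1) π (φ.map x)).toLinearMap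
    have h4 : LinearMap.range (hd (m := n + 1) π (φ.map x)).toLinearMap = ⊤ := by
      refine LinearMap.range_eq_top.2 (LinearMap.surjective fun h => hne ?_)
      ext v
      exact DFunLike.congr_fun h v
    rw [h4, finrank_top] at h3
    simp at h3
    omega
  have h3 := Submodule.eq_of_le_of_finrank_eq hr (h1.trans h2.symm)
  have h4 : v ∈ LinearMap.ker (hd (m := n + 1) π (φ.map x)).toLinearMap := hv
  rw [← h3] at h4
  obtain ⟨u, hu⟩ := h4
  exact ⟨u, by rw [φ.d_eq hx]; exact hu⟩

lemma FibreParam.contDiffAt_chart (φ : FibreParam (n := n) π D s) {x : Cn n} (hx : x ∈ φ.dom)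
    {e : OpenPartialHomeomorph Y (Cn (n + 1))}
    (he : e ∈ IsManifold.maximalAtlas 𝓘(ℂ, Cn (n + 1)) ω Y) (hxe : φ.map x ∈ e.source) :
    ContDiffAt ℝ ∞ (e ∘ φ.map) x := by
  have h1 : ContMDiffAt 𝓘(ℂ, Cn n) 𝓘(ℂ, Cn (n + 1)) ω (e ∘ φ.map) x :=
    ((contMDiffOn_of_mem_maximalAtlas he).contMDiffAt (e.open_source.mem_nhds hxe)).comp x
      ((φ.holomorphic x hx).contMDiffAt (φ.isOpen_dom.mem_nhds hx))
  exact (ContDiffAt.restrict_scalars ℝ (contMDiffAt_iff_contDiffAt.1 h1)).of_le le_top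

/-- A parametrisation has smooth local left inverses on the total space. -/
lemma FibreParam.exists_leftInverse (φ : FibreParam (n := n) π D s) {x : Cn n} (hx : x ∈ φ.dom)
    {e : OpenPartialHomeomorph Y (Cn (n + 1))}
    (he : e ∈ IsManifold.maximalAtlas 𝓘(ℂ, Cn (n + 1)) ω Y) (hxe : φ.map x ∈ e.source) :
    ∃ g : Cn (n + 1) → Cn n, ContDiffAt ℝ ∞ g (e (φ.map x)) ∧
      ∀ᶠ x' in 𝓝 x, g (e (φ.map x')) = x' := by
  let L : Cn n →L[ℝ] Cn (n + 1) := (chartD e (φ.map x)).comp (φ.d x)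
  have hL : HasFDerivAt (e ∘ φ.map) L x := hasFDerivAt_of_hasMFDerivAt
    ((hasMFDerivAt_chart he hxe).comp x (φ.hasMFDerivAt hx))
  have hinj : Function.Injective L.toLinearMap := by
    have h1 : Function.Injective (chartD e (φ.map x)) :=
      Function.LeftInverse.injective (chartDinv_chartD he hxe)
    exact h1.comp (φ.d_injective hx)
  -- Composing with a linear left inverse of the differential reduces the claim to the inverse
  -- function theorem on `ℂⁿ`.
  obtain ⟨P, hP⟩ := LinearMap.exists_leftInverse_of_injective L.toLinearMap
    (LinearMap.ker_eq_bot.2 hinj)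
  let P' : Cn (n + 1) →L[ℝ] Cn n := LinearMap.toContinuousLinearMap P
  have hk : ContDiffAt ℝ ∞ (P' ∘ e ∘ φ.map) x :=
    P'.contDiff.contDiffAt.comp x (φ.contDiffAt_chart hx he hxe)
  have hkd : HasFDerivAt (P' ∘ e ∘ φ.map)
      (ContinuousLinearEquiv.refl ℝ (Cn n) : Cn n →L[ℝ] Cn n) x := by
    have h1 := P'.hasFDerivAt.comp x hL
    have h2 : P'.comp L = (ContinuousLinearEquiv.refl ℝ (Cn n) : Cn n →L[ℝ] Cn n) := by
      ext1 u
      exact DFunLike.congr_fun hP u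
    rwa [h2] at h1
  refine ⟨hk.localInverse hkd (by simp) ∘ P', ?_, ?_⟩
  · exact ContDiffAt.comp (g := hk.localInverse hkd (by simp)) (f := P') (e (φ.map x))
      (hk.to_localInverse hkd (by simp)) P'.contDiff.contDiffAt
  · exact (hk.hasStrictFDerivAt' hkd (by simp)).eventually_left_inverse

open scoped Classical in
/-- The smooth locus of a fibre has parametrisations around each point. -/
theorem exists_fibreParam (hπ : IsSemistableDegeneration (n := n) π D) {y : Y}
    (hy : y ∈ smoothFibre π D s) : ∃ φ : FibreParam (n := n) π D s, y ∈ φ.ran := by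
  let e := chartAt (Cn (n + 1)) y
  have he : e ∈ IsManifold.maximalAtlas 𝓘(ℂ, Cn (n + 1)) ω Y := IsManifold.chart_mem_maximalAtlas _
  have hye : y ∈ e.source := mem_chart_source _ _
  have hf : ContDiffAt ℂ ω (π ∘ e.symm) (e y) :=
    (contDiffOn_comp_chart_symm hπ.holomorphic he).contDiffAt
      (e.open_target.mem_nhds (e.map_source hye))
  have hne : fderiv ℂ (π ∘ e.symm) (e y) ≠ 0 := by
    intro h0
    refine hd_ne_zero_of_mem_smoothFibre hπ hy ?_
    have h1 := ((hf.differentiableAt (by simp)).hasFDerivAt.restrictScalars ℝ).fderiv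
    ext v
    rw [hd_eq hπ.holomorphic he hye, h1, h0]
    rfl
  obtain ⟨Ψ, hΨ1, hΨ2, hΨ3, hΨ4⟩ := exists_straightening hf hne
  -- This chart avoids the singular locus and has `π` as first coordinate, so the fibre over `s` is
  -- the slice where that coordinate equals `s`.
  let E : OpenPartialHomeomorph Y (ℂ × Cn n) :=
    (e.restrOpen (singLocus D)ᶜ (isClosed_singLocus hπ).isOpen_compl).trans Ψ
  have hEs : ∀ y' ∈ E.source, y' ∈ e.source ∧ y' ∉ singLocus D ∧ e y' ∈ Ψ.source := by
    intro y' h'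
    simp only [E, OpenPartialHomeomorph.trans_source] at h'
    exact ⟨h'.1.1, h'.1.2, h'.2⟩
  have hEt : ∀ p ∈ E.target, p ∈ Ψ.target ∧ Ψ.symm p ∈ e.target := by
    intro p hp
    simp only [E, OpenPartialHomeomorph.trans_target] at hp
    exact ⟨hp.1, hp.2.1⟩
  have hEπ : ∀ y' ∈ E.source, (E y').1 = π y' := fun y' h' => by
    change (Ψ (e y')).1 = _
    rw [hΨ2, Function.comp, e.left_inv (hEs y' h').1]
  have hyE : y ∈ E.source := by
    simp only [E, OpenPartialHomeomorph.trans_source]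
    exact ⟨⟨hye, hy.2⟩, hΨ1⟩
  have hmem : ∀ x, (s, x) ∈ E.target → E.symm (s, x) ∈ smoothFibre π D s := fun x hx => by
    have h1 := E.map_target hx
    refine ⟨?_, (hEs _ h1).2.1⟩
    change π _ = s
    rw [← hEπ _ h1, E.right_inv hx]
  have hfst : ∀ y' : smoothFibre π D s, (y' : Y) ∈ E.source → (s, (E y').2) = E y' := fun y' h' =>
    Prod.ext (by rw [hEπ _ h']; exact y'.2.1.symm) rfl
  let φ₀ : OpenPartialHomeomorph (Cn n) (smoothFibre π D s) :=
    -- Outside the slice the value is immaterial; `y` serves as a default.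
    { toFun := fun x => if h : E.symm (s, x) ∈ smoothFibre π D s then ⟨_, h⟩ else ⟨y, hy⟩
      invFun := fun y' => (E y').2
      source := {x | (s, x) ∈ E.target}
      target := {y' | (y' : Y) ∈ E.source}
      map_source' := fun x hx => by
        rw [dif_pos (hmem x hx)]
        exact E.map_target hx
      map_target' := fun y' h' => by
        change (s, (E y').2) ∈ E.target
        rw [hfst y' h']
        exact E.map_source h'
      left_inv' := fun x hx => by
        rw [dif_pos (hmem x hx), E.right_inv hx]
      right_inv' := fun y' h' => by
        have h1 : E.symm (s, (E y').2) = y' := by rw [hfst y' h', E.left_inv h']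
        rw [dif_pos (by rw [h1]; exact y'.2)]
        exact Subtype.ext h1
      open_source := E.open_target.preimage (by fun_prop)
      open_target := E.open_source.preimage continuous_subtype_val
      continuousOn_toFun := by
        rw [Topology.IsInducing.subtypeVal.continuousOn_iff]
        refine ContinuousOn.congr (f := fun x => E.symm (s, x)) ?_ ?_
        · exact E.continuousOn_symm.comp (by fun_prop) (fun x hx => hx)
        · intro x hx
          rw [Function.comp, dif_pos (hmem x hx)]
      continuousOn_invFun := continuous_snd.comp_continuousOn
        (E.continuousOn.comp continuous_subtype_val.continuousOn fun y' h' => h') }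
  have hφ : ∀ x ∈ φ₀.source, (φ₀ x : Y) = e.symm (Ψ.symm (s, x)) := by
    intro x hx
    change ((if h : E.symm (s, x) ∈ smoothFibre π D s then (⟨_, h⟩ : smoothFibre π D s)
      else ⟨y, hy⟩ : smoothFibre π D s) : Y) = _
    rw [dif_pos (hmem x hx)]
    rfl
  have hcont : ContDiffOn ℂ ω (fun x => Ψ.symm (s, x)) φ₀.source :=
    hΨ4.comp (contDiff_const.prodMk contDiff_id).contDiffOn (fun x hx => (hEt _ hx).1)
  have hhol : ContMDiffOn 𝓘(ℂ, Cn n) 𝓘(ℂ, Cn (n + 1)) ω (fun x => (φ₀ x : Y)) φ₀.source := by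
    refine ContMDiffOn.congr ?_ hφ
    exact (contMDiffOn_symm_of_mem_maximalAtlas he).comp hcont.contMDiffOn
      (fun x hx => (hEt _ hx).2)
  refine ⟨⟨φ₀, hhol, ?_⟩, (E y).2, ?_, ?_⟩
  · intro x hx
    have h1 : MDifferentiableAt 𝓘(ℂ, Cn n) 𝓘(ℂ, Cn (n + 1)) (fun x => (φ₀ x : Y)) x :=
      ((hhol x hx).contMDiffAt (φ₀.open_source.mem_nhds hx)).mdifferentiableAt (by simp)
    have hxE : (φ₀ x : Y) ∈ E.source := φ₀.map_source hx
    have h2 : MDifferentiableAt 𝓘(ℂ, Cn (n + 1)) 𝓘(ℂ, Cn (n + 1)) e (φ₀ x : Y) :=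
      ((contMDiffOn_of_mem_maximalAtlas he).contMDiffAt
        (e.open_source.mem_nhds (hEs _ hxE).1)).mdifferentiableAt (by simp)
    have h3 := hasFDerivAt_complex_of_hasMFDerivAt (h2.hasMFDerivAt.comp x h1.hasMFDerivAt)
    have h4 : HasFDerivAt Ψ (fderiv ℂ Ψ (e (φ₀ x))) (e (φ₀ x)) :=
      ((hΨ3.contDiffAt (Ψ.open_source.mem_nhds (hEs _ hxE).2.2)).differentiableAt
        (by simp)).hasFDerivAt
    -- The second component of the chart is a differentiable left inverse of the parametrisation, so
    -- the differential is injective.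
    have h5 := (ContinuousLinearMap.snd ℂ ℂ (Cn n)).hasFDerivAt.comp x (h4.comp x h3)
    have h6 : (ContinuousLinearMap.snd ℂ ℂ (Cn n)) ∘ Ψ ∘ (e ∘ fun x => (φ₀ x : Y)) =ᶠ[𝓝 x] id := by
      filter_upwards [φ₀.open_source.mem_nhds hx] with x' hx'
      exact φ₀.left_inv hx'
    have h7 := (h5.congr_of_eventuallyEq h6.symm).unique (hasFDerivAt_id x)
    intro u v huv
    have h8 := DFunLike.congr_fun h7 u
    have h9 := DFunLike.congr_fun h7 v
    refine h8.symm.trans (Eq.trans ?_ h9)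
    change (fderiv ℂ Ψ (e (φ₀ x)) (mfderiv 𝓘(ℂ, Cn (n + 1)) 𝓘(ℂ, Cn (n + 1)) e (φ₀ x : Y)
      (mfderiv 𝓘(ℂ, Cn n) 𝓘(ℂ, Cn (n + 1)) (fun x => (φ₀ x : Y)) x u))).2 = _
    rw [huv]
    rfl
  · change (s, (E y).2) ∈ E.target
    rw [hfst ⟨y, hy⟩ hyE]
    exact E.map_source hyE
  · have := φ₀.right_inv (x := ⟨y, hy⟩) hyE
    exact congrArg Subtype.val this

end FibreParams

/-! ### Maps between fibres induced by local diffeomorphisms of the total space -/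

section LocalRepresentations

attribute [local instance] cnNormedAddCommGroup cnNormedSpaceReal cnNormedSpaceComplex
  cnDualNormedAddCommGroup cnBilinNormedAddCommGroup

variable {n a : ℕ} {Y : Type*} [TopologicalSpace Y] [ChartedSpace (Cn (n + 1)) Y]
  [IsManifold 𝓘(ℂ, Cn (n + 1)) ω Y] {π : Y → ℂ} {D : Fin a → Set Y} {s : ℂ}

/-- The map `F` on `A ⊆ Y₀` is represented around `z` in the chart `e` by the local diffeomorphism
`Φ` of the total space, which maps fibres to fibres. -/
structure IsLocalRep (π : Y → ℂ) (A : Set Y) (F : Y → Y) (s : ℂ)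
    (e : OpenPartialHomeomorph Y (Cn (n + 1))) (z : Y) (Φ : Cn (n + 1) → Cn (n + 1)) : Prop where
  mem_source : z ∈ e.source
  contDiffAt : ContDiffAt ℝ ∞ Φ (e z)
  bijective : Function.Bijective (fderiv ℝ Φ (e z))
  eventually : ∀ᶠ x in 𝓝 (e z), x ∈ e.target ∧ Φ x ∈ e.target ∧
    π (e.symm (Φ x)) = π (e.symm x) + s ∧
    (π (e.symm x) = 0 → e.symm x ∈ A ∧ F (e.symm x) = e.symm (Φ x))

variable {A : Set Y} {F : Y → Y} {e : OpenPartialHomeomorph Y (Cn (n + 1))} {z : Y}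
  {Φ : Cn (n + 1) → Cn (n + 1)}

lemma contMDiffAt_conj_chart (he : e ∈ IsManifold.maximalAtlas 𝓘(ℂ, Cn (n + 1)) ω Y)
    (hz : z ∈ e.source) (hΦ : ContDiffAt ℝ ∞ Φ (e z)) (hΦz : Φ (e z) ∈ e.target) :
    ContMDiffAt 𝓘(ℝ, Cn (n + 1)) 𝓘(ℝ, Cn (n + 1)) ∞ (e.symm ∘ Φ ∘ e) z := by
  have h1 : ContMDiffAt 𝓘(ℝ, Cn (n + 1)) 𝓘(ℝ, Cn (n + 1)) ∞ e z :=
    (contMDiffOn_of_mem_maximalAtlas (mem_maximalAtlas_real he)).contMDiffAt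
      (e.open_source.mem_nhds hz)
  have h2 : ContMDiffAt 𝓘(ℝ, Cn (n + 1)) 𝓘(ℝ, Cn (n + 1)) ∞ e.symm (Φ (e z)) :=
    (contMDiffOn_symm_of_mem_maximalAtlas (mem_maximalAtlas_real he)).contMDiffAt
      (e.open_target.mem_nhds hΦz)
  exact ContMDiffAt.comp (g := e.symm) z h2 (ContMDiffAt.comp (g := Φ) z hΦ.contMDiffAt h1)

namespace IsLocalRep

lemma eventually_source (h : IsLocalRep π A F s e z Φ) :
    ∀ᶠ y in 𝓝 z, y ∈ e.source ∧ (π y = 0 → y ∈ A ∧ F y = e.symm (Φ (e y))) := by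
  filter_upwards [e.open_source.mem_nhds h.mem_source,
    (e.continuousAt h.mem_source).eventually h.eventually] with y h1 h2
  refine ⟨h1, fun h3 => ?_⟩
  rw [e.left_inv h1] at h2
  exact h2.2.2.2 h3

lemma mapsTo_target (h : IsLocalRep π A F s e z Φ) : Φ (e z) ∈ e.target :=
  h.eventually.self_of_nhds.2.1

lemma apply (h : IsLocalRep π A F s e z Φ) (hz : π z = 0) : F z = e.symm (Φ (e z)) :=
  (h.eventually_source.self_of_nhds.2 hz).2

lemma chart_apply (h : IsLocalRep π A F s e z Φ) (hz : π z = 0) : e (F z) = Φ (e z) := by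
  rw [h.apply hz, e.right_inv h.mapsTo_target]

lemma apply_mem_source (h : IsLocalRep π A F s e z Φ) (hz : π z = 0) : F z ∈ e.source := by
  rw [h.apply hz]; exact e.map_target h.mapsTo_target

lemma eventuallyEq (h : IsLocalRep π A F s e z Φ) (hA : A ⊆ smoothFibre π D 0) :
    F =ᶠ[𝓝[A] z] e.symm ∘ Φ ∘ e := by
  filter_upwards [self_mem_nhdsWithin, mem_nhdsWithin_of_mem_nhds h.eventually_source] with y h1 h2
  exact (h2.2 (hA h1).1).2

lemma contMDiffWithinAt (h : IsLocalRep π A F s e z Φ)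
    (he : e ∈ IsManifold.maximalAtlas 𝓘(ℂ, Cn (n + 1)) ω Y) (hA : A ⊆ smoothFibre π D 0)
    (hz : z ∈ A) : ContMDiffWithinAt 𝓘(ℝ, Cn (n + 1)) 𝓘(ℝ, Cn (n + 1)) ∞ F A z :=
  (contMDiffAt_conj_chart he h.mem_source h.contDiffAt h.mapsTo_target).contMDiffWithinAt
    |>.congr_of_eventuallyEq (h.eventuallyEq hA) (h.apply (hA hz).1)

/-- The fibre over `s` is contained in the image of `F` near `F z`. -/
lemma exists_inverse (h : IsLocalRep π A F s e z Φ) (hz : π z = 0) :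
    ∃ Φ' : Cn (n + 1) → Cn (n + 1), ContDiffAt ℝ ∞ Φ' (e (F z)) ∧ Φ' (e (F z)) = e z ∧
      ∀ᶠ y in 𝓝 (F z), y ∈ e.source ∧ (π y = s → e.symm (Φ' (e y)) ∈ A ∧
        F (e.symm (Φ' (e y))) = y) := by
  let T : Cn (n + 1) ≃L[ℝ] Cn (n + 1) :=
    (LinearEquiv.ofBijective (fderiv ℝ Φ (e z)).toLinearMap h.bijective).toContinuousLinearEquiv
  have hT : HasFDerivAt Φ (T : Cn (n + 1) →L[ℝ] Cn (n + 1)) (e z) := by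
    have h1 : (T : Cn (n + 1) →L[ℝ] Cn (n + 1)) = fderiv ℝ Φ (e z) := by ext x : 1; rfl
    rw [h1]
    exact (h.contDiffAt.differentiableAt (by simp)).hasFDerivAt
  have hs := h.contDiffAt.hasStrictFDerivAt' hT (by simp)
  have hcont : ContinuousAt e (F z) := e.continuousAt (h.apply_mem_source hz)
  rw [h.chart_apply hz]
  refine ⟨h.contDiffAt.localInverse hT (by simp), h.contDiffAt.to_localInverse hT (by simp),
    h.contDiffAt.localInverse_apply_image hT (by simp), ?_⟩
  have h1 : ∀ᶠ y in 𝓝 (F z), Φ (hs.localInverse Φ T (e z) (e y)) = e y := by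
    have := hs.eventually_right_inverse
    rw [← h.chart_apply hz] at this
    exact hcont.eventually this
  have h2 : Filter.Tendsto (fun y => hs.localInverse Φ T (e z) (e y)) (𝓝 (F z)) (𝓝 (e z)) := by
    refine hs.localInverse_tendsto.comp ?_
    rw [← h.chart_apply hz]
    exact hcont
  -- If `π y = s`, the point which `Φ` maps to `e y` satisfies `π + s = s`. It therefore lies on the
  -- central fibre, where `Φ` represents `F`.
  filter_upwards [h1, h2.eventually h.eventually,
    e.open_source.mem_nhds (h.apply_mem_source hz)] with y h3 h4 h5
  refine ⟨h5, fun h6 => ?_⟩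
  obtain ⟨-, -, h7, h8⟩ := h4
  rw [h3, e.left_inv h5, h6] at h7
  obtain ⟨h9, h10⟩ := h8 (by simpa using h7)
  refine ⟨h9, h10.trans ?_⟩
  rw [h3, e.left_inv h5]

end IsLocalRep

/-- Maps which are locally represented by fibre preserving diffeomorphisms of the total space are
diffeomorphisms onto open subsets of the fibre if they are injective. -/
theorem isFibreDiffeo_of_localRep (hA : A ⊆ smoothFibre π D 0) (hmaps : MapsTo F A (smoothFibre π D s))
    (hinj : InjOn F A) (hrep : ∀ z ∈ A, ∃ e ∈ IsManifold.maximalAtlas 𝓘(ℂ, Cn (n + 1)) ω Y,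
      ∃ Φ, IsLocalRep π A F s e z Φ) : IsFibreDiffeo (n := n) π D s A F := by
  obtain ⟨G, hG⟩ : ∃ G : Y → Y, LeftInvOn G F A := by
    rcases isEmpty_or_nonempty Y with h | h
    · exact ⟨id, fun y => isEmptyElim y⟩
    · exact ⟨_, hinj.leftInvOn_invFunOn⟩
  refine ⟨hmaps, ⟨interior {y | y ∈ smoothFibre π D s → y ∈ F '' A}, isOpen_interior, ?_⟩, ?_,
    G, hG, ?_⟩
  · refine Subset.antisymm ?_ fun y hy => interior_subset hy.2 hy.1
    rintro _ ⟨z, hz, rfl⟩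
    refine ⟨hmaps hz, mem_interior_iff_mem_nhds.2 ?_⟩
    obtain ⟨e, -, Φ, h⟩ := hrep z hz
    obtain ⟨Φ', -, -, h3⟩ := h.exists_inverse (hA hz).1
    filter_upwards [h3] with y h4 h5
    exact ⟨_, h4.2 h5.1⟩
  · intro z hz
    obtain ⟨e, he, Φ, h⟩ := hrep z hz
    exact h.contMDiffWithinAt he hA hz
  · rintro _ ⟨z, hz, rfl⟩
    obtain ⟨e, he, Φ, h⟩ := hrep z hz
    obtain ⟨Φ', h1, h2, h3⟩ := h.exists_inverse (hA hz).1
    have h4 : ContMDiffWithinAt 𝓘(ℝ, Cn (n + 1)) 𝓘(ℝ, Cn (n + 1)) ∞ (e.symm ∘ Φ' ∘ e) (F '' A)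
        (F z) := (contMDiffAt_conj_chart he (h.apply_mem_source (hA hz).1) h1
          (by rw [h2]; exact e.map_source h.mem_source)).contMDiffWithinAt
    -- The local inverse yields some preimage in `A`. Global injectivity identifies it with the one
    -- chosen by `G`.
    have h5 : ∀ y ∈ F '' A, (y ∈ e.source ∧ (π y = s → e.symm (Φ' (e y)) ∈ A ∧
        F (e.symm (Φ' (e y))) = y)) → G y = (e.symm ∘ Φ' ∘ e) y := by
      rintro _ ⟨z', hz', rfl⟩ h6
      obtain ⟨h7, h8⟩ := h6.2 (hmaps hz').1
      exact (hG hz').trans (hinj hz' h7 h8.symm)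
    refine h4.congr_of_eventuallyEq ?_ (h5 _ (mem_image_of_mem _ hz) h3.self_of_nhds)
    filter_upwards [self_mem_nhdsWithin, mem_nhdsWithin_of_mem_nhds h3] with y h6 h7
    exact h5 y h6 h7

section Derivatives

variable {E M : Type*} [NormedAddCommGroup E] [NormedSpace ℝ E] [TopologicalSpace M]
  [ChartedSpace E M]

lemma hasMFDerivAt_comp_fibreParam {s' : ℂ} (φ : FibreParam (n := n) π D s') {x : Cn n}
    (hx : x ∈ φ.dom) {S : Set Y} (hS : ∀ᶠ x' in 𝓝 x, φ.map x' ∈ S) {f : Y → M}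
    {L : Cn (n + 1) →L[ℝ] E}
    (hf : HasMFDerivWithinAt 𝓘(ℝ, Cn (n + 1)) 𝓘(ℝ, E) f S (φ.map x) L) :
    HasMFDerivAt 𝓘(ℝ, Cn n) 𝓘(ℝ, E) (f ∘ φ.map) x (L.comp (φ.d x)) := by
  have h1 := HasMFDerivWithinAt.comp (I := 𝓘(ℝ, Cn n)) (I' := 𝓘(ℝ, Cn (n + 1)))
    (I'' := 𝓘(ℝ, E)) (s := φ.map ⁻¹' S) x hf ((φ.hasMFDerivAt hx).hasMFDerivWithinAt) subset_rfl
  exact h1.hasMFDerivAt hS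

/-- Derivatives along the fibre do not depend on any choice. -/
lemma hasMFDerivWithinAt_unique_on_fibre (hπ : IsSemistableDegeneration (n := n) π D) {s' : ℂ}
    {y : Y} (hy : y ∈ smoothFibre π D s') {S : Set Y}
    (hS : ∀ᶠ y' in 𝓝 y, y' ∈ smoothFibre π D s' → y' ∈ S) {f : Y → M}
    {L L' : Cn (n + 1) →L[ℝ] E}
    (hf : HasMFDerivWithinAt 𝓘(ℝ, Cn (n + 1)) 𝓘(ℝ, E) f S y L)
    (hf' : HasMFDerivWithinAt 𝓘(ℝ, Cn (n + 1)) 𝓘(ℝ, E) f S y L') {v : Cn (n + 1)}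
    (hv : hd (m := n + 1) π y v = 0) : L v = L' v := by
  obtain ⟨φ, x, hx, rfl⟩ := exists_fibreParam hπ hy
  obtain ⟨u, rfl⟩ := φ.exists_d_eq hπ.holomorphic hx (hd_ne_zero_of_mem_smoothFibre hπ hy) hv
  have hS' : ∀ᶠ x' in 𝓝 x, φ.map x' ∈ S := by
    filter_upwards [(φ.continuousOn.continuousAt (φ.isOpen_dom.mem_nhds hx)).eventually hS]
      with x' hx'
    exact hx' (φ.map_mem x')
  -- After composition with a parametrisation the derivative is unique, and its directions exhaust
  -- `ker dπ`.
  have h1 := hasMFDerivAt_comp_fibreParam φ hx hS' hf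
  have h2 := hasMFDerivAt_comp_fibreParam φ hx hS' hf'
  exact DFunLike.congr_fun (hasMFDerivAt_unique h1 h2) u

end Derivatives

namespace IsLocalRep

lemma hasMFDerivWithinAt (h : IsLocalRep π A F s e z Φ)
    (he : e ∈ IsManifold.maximalAtlas 𝓘(ℂ, Cn (n + 1)) ω Y) (hA : A ⊆ smoothFibre π D 0)
    (hz : z ∈ A) : HasMFDerivWithinAt 𝓘(ℝ, Cn (n + 1)) 𝓘(ℝ, Cn (n + 1)) F A z
      ((chartDinv e (Φ (e z))).comp ((fderiv ℝ Φ (e z)).comp (chartD e z)) :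
        Cn (n + 1) →L[ℝ] Cn (n + 1)) := by
  have h1 : HasMFDerivAt 𝓘(ℝ, Cn (n + 1)) 𝓘(ℝ, Cn (n + 1)) Φ (e z) (fderiv ℝ Φ (e z)) :=
    (h.contDiffAt.differentiableAt (by simp)).hasFDerivAt.hasMFDerivAt
  have h2 := (hasMFDerivAt_chart_symm he h.mapsTo_target).comp z
    (h1.comp z (hasMFDerivAt_chart he h.mem_source))
  have h3 := h2.hasMFDerivWithinAt (s := A)
  exact h3.congr_of_eventuallyEq (h.eventuallyEq hA) (h.apply (hA hz).1)

lemma eventually_mem (h : IsLocalRep π A F s e z Φ) :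
    ∀ᶠ y in 𝓝 z, y ∈ smoothFibre π D 0 → y ∈ A := by
  filter_upwards [h.eventually_source] with y h1 h2
  exact (h1.2 h2.1).1

/-- The differential of `F` in a chart. -/
lemma mapDiff_eq (h : IsLocalRep π A F s e z Φ) (hπ : IsSemistableDegeneration (n := n) π D)
    (he : e ∈ IsManifold.maximalAtlas 𝓘(ℂ, Cn (n + 1)) ω Y) (hA : A ⊆ smoothFibre π D 0)
    (hz : z ∈ A) {v : Cn (n + 1)} (hv : hd (m := n + 1) π z v = 0) :
    (mapDiff F A z v : Cn (n + 1)) = chartDinv e (Φ (e z)) (fderiv ℝ Φ (e z) (chartD e z v)) := by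
  have h1 := h.hasMFDerivWithinAt he hA hz
  exact hasMFDerivWithinAt_unique_on_fibre hπ (hA hz) h.eventually_mem
    h1.mdifferentiableWithinAt.hasMFDerivWithinAt h1 hv

/-- With one chart for both `z` and `F z`, the differential becomes `fderiv ℝ Φ`, which is close to
the identity. All estimates on the differential of the flow use this form. -/
lemma chartD_mapDiff (h : IsLocalRep π A F s e z Φ) (hπ : IsSemistableDegeneration (n := n) π D)
    (he : e ∈ IsManifold.maximalAtlas 𝓘(ℂ, Cn (n + 1)) ω Y) (hA : A ⊆ smoothFibre π D 0)
    (hz : z ∈ A) {v : Cn (n + 1)} (hv : hd (m := n + 1) π z v = 0) :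
    chartD e (F z) (mapDiff F A z v : Cn (n + 1)) = fderiv ℝ Φ (e z) (chartD e z v) := by
  have h1 : F z = e.symm (Φ (e z)) := h.apply (hA hz).1
  have h2 : chartD e (F z) (chartDinv e (Φ (e z)) (fderiv ℝ Φ (e z) (chartD e z v))) =
      fderiv ℝ Φ (e z) (chartD e z v) := by
    rw [h1, chartD_chartDinv he h.mapsTo_target]
  rw [← h2]
  exact congrArg (chartD e (F z)) (h.mapDiff_eq hπ he hA hz hv)

end IsLocalRep

end LocalRepresentations

/-! ### Perturbation of multilinear forms by maps close to the identity -/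

section Perturbation

lemma exists_bound_lipschitz {E F : Type*} [NormedAddCommGroup E] [NormedSpace ℝ E]
    [NormedAddCommGroup F] [NormedSpace ℝ F] {Ω Q : Set E} {g : E → F} (hΩ : IsOpen Ω)
    (hg : ContDiffOn ℝ ∞ g Ω) (hQ : IsCompact Q) (hQc : Convex ℝ Q) (hQΩ : Q ⊆ Ω) :
    ∃ C > 0, ∀ x ∈ Q, ‖g x‖ ≤ C ∧ ∀ x' ∈ Q, ‖g x' - g x‖ ≤ C * ‖x' - x‖ := by
  have h1 : ContinuousOn (fderiv ℝ g) Q :=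
    (hg.continuousOn_fderiv_of_isOpen hΩ (by simp)).mono hQΩ
  obtain ⟨C₁, hC₁⟩ := hQ.exists_bound_of_continuousOn h1
  obtain ⟨C₂, hC₂⟩ := hQ.exists_bound_of_continuousOn (hg.continuousOn.mono hQΩ)
  refine ⟨max 1 (max C₁ C₂), by positivity, fun x hx =>
    ⟨(hC₂ x hx).trans ((le_max_right _ _).trans (le_max_right _ _)), fun x' hx' => ?_⟩⟩
  refine hQc.norm_image_sub_le_of_norm_fderiv_le (𝕜 := ℝ) (fun y hy => ?_) (fun y hy => ?_) hx hx'
  · exact (hg.contDiffAt (hΩ.mem_nhds (hQΩ hy))).differentiableAt (by simp)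
  · exact (hC₁ y hy).trans ((le_max_left _ _).trans (le_max_right _ _))

/-- The arguments are exchanged one slot at a time. Each of the `k` steps gains a factor `ε`, and `ε
≤ 1` bounds the exchanged arguments by `2 * ‖u i‖`, whence `2 ^ k`. The summand `1` is the change of
the form itself. -/
lemma norm_alternating_perturbation {E : Type*} [NormedAddCommGroup E] [NormedSpace ℝ E] {k : ℕ}
    {M M' : E [⋀^Fin k]→L[ℝ] ℂ} {C ε : ℝ} (hC : 0 ≤ C) (hM' : ‖M'‖ ≤ C)
    (hMM : ‖M' - M‖ ≤ C * ε) {T : E →L[ℝ] E} (hε : 0 ≤ ε) (hε1 : ε ≤ 1)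
    (hT : ∀ u, ‖T u - u‖ ≤ ε * ‖u‖) (u : Fin k → E) :
    ‖M' (fun i => T (u i)) - M u‖ ≤ C * (k * 2 ^ k + 1) * ε * ∏ i, ‖u i‖ := by
  have hTn : ∀ v, ‖T v‖ ≤ 2 * ‖v‖ := fun v => by
    have h1 := norm_add_le (T v - v) v
    rw [sub_add_cancel] at h1
    have h2 := mul_le_mul_of_nonneg_right hε1 (norm_nonneg v)
    linarith [hT v]
  have h1 : ‖M' (fun i => T (u i)) - M' u‖ ≤ C * (k * 2 ^ k) * ε * ∏ i, ‖u i‖ := by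
    have h2 := MultilinearMap.norm_image_sub_le_of_bound' M'.toMultilinearMap hC
      (fun m => (M'.le_opNorm m).trans (by gcongr)) (fun i => T (u i)) u
    refine h2.trans ?_
    have h3 : ∀ i ∈ Finset.univ, (∏ j, if j = i then ‖T (u i) - u i‖ else
        max ‖T (u j)‖ ‖u j‖) ≤ 2 ^ k * ε * ∏ j, ‖u j‖ := by
      intro i _
      calc (∏ j, if j = i then ‖T (u i) - u i‖ else max ‖T (u j)‖ ‖u j‖)
          ≤ ∏ j, ((2 * if j = i then ε else 1) * ‖u j‖) := by
            refine Finset.prod_le_prod (fun j _ => by split_ifs <;> positivity) fun j _ => ?_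
            split_ifs with hj
            · subst hj
              have := mul_nonneg hε (norm_nonneg (u j))
              linarith [hT (u j)]
            · rw [mul_one]
              exact max_le (hTn _) (by linarith [norm_nonneg (u j)])
        _ = 2 ^ k * ε * ∏ j, ‖u j‖ := by
            rw [Finset.prod_mul_distrib, Finset.prod_mul_distrib]
            simp
    calc C * ∑ i, (∏ j, if j = i then ‖T (u i) - u i‖ else max ‖T (u j)‖ ‖u j‖)
        ≤ C * ∑ _i : Fin k, 2 ^ k * ε * ∏ j, ‖u j‖ := by
          gcongr with i hi
          exact h3 i hi
      _ = C * (k * 2 ^ k) * ε * ∏ i, ‖u i‖ := by simp; ring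
  have h2 : ‖M' u - M u‖ ≤ C * ε * ∏ i, ‖u i‖ :=
    ((M' - M).le_opNorm u).trans (by gcongr)
  calc ‖M' (fun i => T (u i)) - M u‖ ≤ ‖M' (fun i => T (u i)) - M' u‖ + ‖M' u - M u‖ := by
        have := norm_add_le (M' (fun i => T (u i)) - M' u) (M' u - M u)
        rwa [sub_add_sub_cancel] at this
    _ ≤ _ := by linarith

lemma abs_bilin_perturbation {E : Type*} [NormedAddCommGroup E] [NormedSpace ℝ E]
    {G G' : E →L[ℝ] E →L[ℝ] ℝ} {C ε : ℝ} (hC : 0 ≤ C) (hG' : ‖G'‖ ≤ C)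
    (hGG : ‖G' - G‖ ≤ C * ε) {T : E →L[ℝ] E} (hε : 0 ≤ ε) (hε1 : ε ≤ 1)
    (hT : ∀ u, ‖T u - u‖ ≤ ε * ‖u‖) (u v : E) :
    |G' (T u) (T v) - G u v| ≤ 4 * C * ε * (‖u‖ * ‖v‖) := by
  have hTn : ∀ v, ‖T v‖ ≤ 2 * ‖v‖ := fun v => by
    have h1 := norm_add_le (T v - v) v
    rw [sub_add_cancel] at h1
    have h2 := mul_le_mul_of_nonneg_right hε1 (norm_nonneg v)
    linarith [hT v]
  have hb : ∀ x y, ‖G' x y‖ ≤ C * ‖x‖ * ‖y‖ := fun x y => (G'.le_opNorm₂ x y).trans (by gcongr)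
  have h1 : ‖G' (T u - u) (T v)‖ ≤ C * (ε * ‖u‖) * (2 * ‖v‖) := (hb _ _).trans (by
    gcongr
    · exact hT u
    · exact hTn v)
  have h2 : ‖G' u (T v - v)‖ ≤ C * ‖u‖ * (ε * ‖v‖) := (hb _ _).trans (by gcongr; exact hT v)
  have h3 : ‖(G' - G) u v‖ ≤ C * ε * ‖u‖ * ‖v‖ := ((G' - G).le_opNorm₂ u v).trans (by gcongr)
  have h4 : G' (T u) (T v) - G u v = G' (T u - u) (T v) + G' u (T v - v) + (G' - G) u v := by
    simp only [map_sub, sub_apply]; ring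
  rw [h4, ← Real.norm_eq_abs]
  refine (norm_add₃_le).trans ?_
  nlinarith

end Perturbation

/-! ### The time one map, flow charts and compactness -/

section FlowMap

attribute [local instance] cnNormedAddCommGroup cnNormedSpaceReal cnNormedSpaceComplex
  cnDualNormedAddCommGroup cnBilinNormedAddCommGroup

variable {n a : ℕ} {Y : Type*} [TopologicalSpace Y] [ChartedSpace (Cn (n + 1)) Y]
  [IsManifold 𝓘(ℂ, Cn (n + 1)) ω Y] {π : Y → ℂ} {D : Fin a → Set Y} {γ : KahlerMetric (n + 1) Y}
  {ν : ℕ} {s : ℂ}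

open scoped Classical in
/-- The time one map of the flow along the horizontal lift of `s`, starting from the central
fibre. -/
def flowMap (π : Y → ℂ) (D : Fin a → Set Y) (γ : KahlerMetric (n + 1) Y) (s : ℂ) (z : Y) : Y :=
  -- By uniqueness of flow curves the choice does not matter. The value `z` is a default where no
  -- lift exists.
  if h : ∃ c : ℝ → Y, c 0 = z ∧ IsFlowCurve π D γ s c then h.choose 1 else z

lemma flowMap_eq [T2Space Y] (hπ : IsSemistableDegeneration (n := n) π D) {c : ℝ → Y}
    (hc : IsFlowCurve π D γ s c) : flowMap π D γ s (c 0) = c 1 := by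
  have h : ∃ c' : ℝ → Y, c' 0 = c 0 ∧ IsFlowCurve π D γ s c' := ⟨c, rfl, hc⟩
  rw [flowMap, dif_pos h]
  exact h.choose_spec.2.eqOn hπ hc (by simp) h.choose_spec.1 (by simp)

lemma hasMFDerivWithinAt_const' {E M : Type*} [NormedAddCommGroup E] [NormedSpace ℝ E]
    [TopologicalSpace M] [ChartedSpace E M] (z : M) (S : Set ℝ) (t : ℝ) :
    HasMFDerivWithinAt 𝓘(ℝ, ℝ) 𝓘(ℝ, E) (fun _ : ℝ => z) S t
      ((1 : ℝ →L[ℝ] ℝ).smulRight (0 : E)) := by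
  have h : (1 : ℝ →L[ℝ] ℝ).smulRight (0 : E) = 0 := by ext; simp
  have key : HasMFDerivWithinAt 𝓘(ℝ, ℝ) 𝓘(ℝ, E) (fun _ : ℝ => z) S t (0 : ℝ →L[ℝ] E) :=
    hasMFDerivWithinAt_const _ _ _
  rw [← h] at key
  exact key

lemma isFlowCurve_const {z : Y} (hz : z ∈ smoothFibre π D 0) :
    IsFlowCurve π D γ 0 (fun _ => z) := by
  intro t ht
  refine ⟨by rwa [mul_zero], (0 : Cn (n + 1)), ⟨?_, fun v _ => ?_⟩,
    hasMFDerivWithinAt_const' z (Icc 0 1) t⟩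
  · exact map_zero (hd (m := n + 1) π z)
  · exact DFunLike.congr_fun (map_zero (γ.gm z)) (v : Cn (n + 1))

lemma flowMap_zero [T2Space Y] (hπ : IsSemistableDegeneration (n := n) π D) {z : Y}
    (hz : z ∈ smoothFibre π D 0) : flowMap π D γ 0 z = z :=
  flowMap_eq hπ (isFlowCurve_const hz)

/-- Uniqueness is applied at time one: curves with a common end point have a common starting point.
-/
lemma flowMap_injOn [T2Space Y] (hπ : IsSemistableDegeneration (n := n) π D) {A : Set Y}
    (hA : ∀ z ∈ A, ∃ c : ℝ → Y, c 0 = z ∧ IsFlowCurve π D γ s c) :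
    InjOn (flowMap π D γ s) A := by
  intro z hz z' hz' h
  obtain ⟨c, rfl, hc⟩ := hA z hz
  obtain ⟨c', rfl, hc'⟩ := hA z' hz'
  rw [flowMap_eq hπ hc, flowMap_eq hπ hc'] at h
  exact hc.eqOn hπ hc' (by simp) h (by simp)

lemma IsFlowCurve.apply_one_mem {c : ℝ → Y} (hc : IsFlowCurve π D γ s c) :
    c 1 ∈ smoothFibre π D s := by
  have := (hc 1 (by simp)).1
  rwa [Complex.ofReal_one, one_mul] at this

/-- A chart in which the flow is controlled on the part `U`, for all `s` with `|s| < ρ`. -/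
structure FlowChart (π : Y → ℂ) (D : Fin a → Set Y) (γ : KahlerMetric (n + 1) Y) (ν : ℕ) (ρ : ℝ)
    (e : OpenPartialHomeomorph Y (Cn (n + 1))) (U : Set Y) (Q : Set (Cn (n + 1))) (K : ℝ) :
    Prop where
  mem_atlas : e ∈ atlas (Cn (n + 1)) Y
  isCompact : IsCompact Q
  convex : Convex ℝ Q
  subset_target : Q ⊆ e.target
  pos : 0 < K
  sq_norm_le : ∀ x ∈ Q, ∀ u, ‖u‖ ^ 2 ≤ K * γ.inChart e x u u
  edist_le : ∀ x ∈ Q, ∀ x' ∈ Q, γ.edist (e.symm x) (e.symm x') ≤ ENNReal.ofReal (K * ‖x - x'‖)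
  flow : ∀ s : ℂ, ‖s‖ < ρ → ∀ z ∈ retractDomain π D γ ν s, z ∈ U →
    (∃ c : ℝ → Y, c 0 = z ∧ IsFlowCurve π D γ s c) ∧ e z ∈ Q ∧
    K * ‖s‖ ^ (1 / 2 : ℝ) ≤ 1 / 2 ∧
    ∃ Φ, IsLocalRep π (retractDomain π D γ ν s) (flowMap π D γ s) s e z Φ ∧ Φ (e z) ∈ Q ∧
      (∀ u, ‖fderiv ℝ Φ (e z) u - u‖ ≤ K * ‖s‖ ^ (1 / 2 : ℝ) * ‖u‖) ∧
      ‖Φ (e z) - e z‖ ≤ K * ‖s‖ ^ (3 / 4 : ℝ)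

lemma FlowChart.mono {ρ ρ' : ℝ} (hρ : ρ' ≤ ρ) {e : OpenPartialHomeomorph Y (Cn (n + 1))}
    {U : Set Y} {Q : Set (Cn (n + 1))} {K : ℝ} (h : FlowChart π D γ ν ρ e U Q K) :
    FlowChart π D γ ν ρ' e U Q K :=
  { h with flow := fun s hs => h.flow s (hs.trans_le hρ) }

lemma bijective_of_norm_sub_le {T : Cn (n + 1) →L[ℝ] Cn (n + 1)} {ε : ℝ} (hε : ε ≤ 1 / 2)
    (hT : ∀ u, ‖T u - u‖ ≤ ε * ‖u‖) : Function.Bijective T := by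
  have h1 : Function.Injective T := by
    rw [injective_iff_map_eq_zero]
    intro u hu
    have h2 := hT u
    rw [hu, zero_sub, norm_neg] at h2
    have h3 := mul_le_mul_of_nonneg_right hε (norm_nonneg u)
    rw [← norm_eq_zero]
    linarith [norm_nonneg u]
  exact ⟨h1, LinearMap.surjective_of_injective (f := T.toLinearMap) h1⟩

/-- The chart comes from the atlas, because smoothness of forms is tested on its members. Normal
crossing coordinates enter only through the lower bound for `dπ`. The point `y₀` may be singular,
which compactness of the whole central fibre requires. -/
theorem exists_flowChart [T2Space Y] (hn : 1 ≤ n) (hπ : IsSemistableDegeneration (n := n) π D)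
    (hν : n ≤ ν) {y₀ : Y} (hy₀ : π y₀ = 0) : ∃ ρ > 0, ∃ e, ∃ U ∈ 𝓝 y₀, ∃ Q K,
      FlowChart π D γ ν ρ e U Q K := by
  let e := chartAt (Cn (n + 1)) y₀
  have he : e ∈ IsManifold.maximalAtlas 𝓘(ℂ, Cn (n + 1)) ω Y := IsManifold.chart_mem_maximalAtlas _
  have hye : y₀ ∈ e.source := mem_chart_source _ _
  have hx₀ := e.map_source hye
  obtain ⟨C, hC, hbd⟩ := exists_horizLift_bound e.open_target (γ.contDiffOn_inChart he)
    (contDiffOn_fderiv_chart hπ.holomorphic he) (fun x _ => γ.inChart_symm e x)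
    (fun x hx u hu => γ.inChart_pos he hx hu) hx₀
  obtain ⟨r₁, hr₁, C', hC', hsub, hdist⟩ := γ.exists_edist_chart_symm_le he hx₀
  obtain ⟨r₂, hr₂, hball⟩ := Metric.eventually_nhds_iff_ball.1
    (hbd.and (Metric.ball_mem_nhds _ hr₁))
  let Q := Metric.closedBall (e y₀) (r₂ / 2)
  have hQ : ∀ x ∈ Q, x ∈ Metric.ball (e y₀) r₂ := fun x hx =>
    Metric.closedBall_subset_ball (by linarith) hx
  obtain ⟨r, hr, K, hK, ρ, hρ, hsubr, hflow⟩ := exists_local_flow hn hπ γ hν hy₀ he hye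
    (V := Q) (Metric.closedBall_mem_nhds _ (by positivity))
  obtain ⟨K', h1, h2, h3⟩ : ∃ K' : ℝ, K ≤ K' ∧ C ≤ K' ∧ C' ≤ K' :=
    ⟨max K (max C C'), le_max_left _ _, (le_max_left _ _).trans (le_max_right _ _),
      (le_max_right _ _).trans (le_max_right _ _)⟩
  have hK' : 0 < K' := hK.trans_le h1
  -- The second bound on `|s|` ensures `K' |s|^{1/2} ≤ 1/2`.
  refine ⟨min ρ ((1 / (2 * K')) ^ 2), by positivity, e,
    e.source ∩ e ⁻¹' (Metric.ball (e y₀) r),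
    Filter.inter_mem (e.open_source.mem_nhds hye)
      ((e.continuousAt hye) (Metric.ball_mem_nhds _ hr)), Q, K',
    chart_mem_atlas _ _, isCompact_closedBall _ _, convex_closedBall _ _,
    fun x hx => hsub (hball x (hQ x hx)).2, hK', ?_, ?_, ?_⟩
  · intro x hx u
    refine ((hball x (hQ x hx)).1.2.1 u).trans ?_
    have : 0 ≤ γ.inChart e x u u := by
      by_contra! h
      have h4 := (hball x (hQ x hx)).1.2.1 u
      nlinarith [sq_nonneg ‖u‖]
    gcongr
  · intro x hx x' hx'
    refine (hdist x (hball x (hQ x hx)).2 x' (hball x' (hQ x' hx')).2).trans ?_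
    gcongr
  · intro s hs z hz hzU
    obtain ⟨hzs, hzr⟩ := hzU
    obtain ⟨h4, h5⟩ := hflow s (hs.trans_le (min_le_left _ _))
    obtain ⟨Φ, hΦ1, hΦ2, hΦ3, hΦ4⟩ := h5 z hz hzs hzr
    have hz0 : π z = 0 := hz.1.1
    have hle : K * ‖s‖ ^ (1 / 2 : ℝ) ≤ K' * ‖s‖ ^ (1 / 2 : ℝ) := by gcongr
    refine ⟨?_, (hsubr (Metric.ball_subset_ball (by linarith) hzr)).1, ?_, Φ,
      ⟨hzs, hΦ1, bijective_of_norm_sub_le h4 hΦ2, ?_⟩, (hsubr hΦ4.self_of_nhds.1).1,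
      fun u => (hΦ2 u).trans (by gcongr), hΦ3.trans (by gcongr)⟩
    · have h6 := hΦ4.self_of_nhds.2.2
      rw [e.left_inv hzs] at h6
      obtain ⟨c, hc0, -, hc⟩ := h6 hz0
      exact ⟨c, hc0, hc⟩
    · rw [← Real.sqrt_eq_rpow]
      have : Real.sqrt ‖s‖ ≤ 1 / (2 * K') :=
        Real.sqrt_le_iff.2 ⟨by positivity, (hs.trans_le (min_le_right _ _)).le⟩
      calc K' * Real.sqrt ‖s‖ ≤ K' * (1 / (2 * K')) := by gcongr
        _ = 1 / 2 := by field_simp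
    -- The set `A_s` is open in the central fibre, because both the singular locus and the tube are
    -- closed.
    · have hopen : ∀ᶠ y in 𝓝 z, y ∉ singLocus D ∧
          y ∉ γ.closedTube (singLocus D) (2 * ‖s‖ ^ (1 / (4 * (ν : ℝ)))) := by
        filter_upwards [(isClosed_singLocus hπ).isOpen_compl.mem_nhds hz.1.2,
          (γ.isClosed_closedTube _ _).isOpen_compl.mem_nhds hz.2] with y h6 h7 using ⟨h6, h7⟩
      have hsymm : Filter.Tendsto e.symm (𝓝 (e z)) (𝓝 z) := by
        have := (e.continuousAt_symm (e.map_source hzs)).tendsto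
        rwa [e.left_inv hzs] at this
      filter_upwards [hΦ4, e.open_target.mem_nhds (e.map_source hzs), hsymm.eventually hopen]
        with x hx hxt hxo
      refine ⟨hxt, (hsubr hx.1).2, hx.2.1, fun h6 => ⟨⟨⟨h6, hxo.1⟩, hxo.2⟩, ?_⟩⟩
      obtain ⟨c, hc0, hc1, hc⟩ := hx.2.2 h6
      rw [← hc0, ← hc1]
      exact flowMap_eq hπ hc

/-- The reduction of uniform statements about the flow to flow charts, by compactness of the central
fibre. -/
theorem exists_uniform_flow [T2Space Y] (hn : 1 ≤ n) (hπ : IsSemistableDegeneration (n := n) π D)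
    (γ : KahlerMetric (n + 1) Y) (hν : n ≤ ν) : ∃ ρ : ℝ, 0 < ρ ∧ ρ ≤ 1 ∧
      ∀ P : ℝ → ℂ → Y → Prop, (∀ K K' s z, K ≤ K' → P K s z → P K' s z) →
        (∀ e U Q K, FlowChart π D γ ν ρ e U Q K → ∃ K', ∀ s : ℂ, ‖s‖ < ρ →
          ∀ z ∈ retractDomain π D γ ν s, z ∈ U → P K' s z) →
        ∃ K' : ℝ, 0 ≤ K' ∧ ∀ s : ℂ, ‖s‖ < ρ → ∀ z ∈ retractDomain π D γ ν s, P K' s z := by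
  have hcpt : IsCompact (π ⁻¹' {0}) := hπ.proper {0} (by simp) isCompact_singleton
  have h : ∀ y : Y, ∃ ρ > 0, ∃ e, ∃ U ∈ 𝓝 y, ∃ Q K, π y = 0 → FlowChart π D γ ν ρ e U Q K := by
    intro y
    by_cases hy : π y = 0
    · obtain ⟨ρ, hρ, e, U, hU, Q, K, hF⟩ := exists_flowChart (γ := γ) hn hπ hν hy
      exact ⟨ρ, hρ, e, U, hU, Q, K, fun _ => hF⟩
    · exact ⟨1, one_pos, chartAt _ y, univ, Filter.univ_mem, ∅, 0, fun h => absurd h hy⟩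
  choose ρ hρ e U hU Q K hF using h
  obtain ⟨T, hT, hcov⟩ := hcpt.elim_nhds_subcover U (fun y _ => hU y)
  obtain ⟨ρ₀, hρ₀, hρ₁, hle⟩ : ∃ ρ₀ : ℝ, 0 < ρ₀ ∧ ρ₀ ≤ 1 ∧ ∀ y ∈ T, ρ₀ ≤ ρ y := by
    have hne : (insert (1 : ℝ) (T.image ρ)).Nonempty := Finset.insert_nonempty _ _
    refine ⟨(insert (1 : ℝ) (T.image ρ)).min' hne, ?_,
      Finset.min'_le _ _ (Finset.mem_insert_self _ _), fun y hy =>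
      Finset.min'_le _ _ (Finset.mem_insert_of_mem (Finset.mem_image_of_mem _ hy))⟩
    rw [Finset.lt_min'_iff]
    intro x hx
    rcases Finset.mem_insert.1 hx with rfl | hx
    · exact one_pos
    · obtain ⟨y, -, rfl⟩ := Finset.mem_image.1 hx
      exact hρ y
  -- The radius is fixed before the property `P` is given, so one disc serves all forms and only the
  -- constant depends on the property.
  refine ⟨ρ₀, hρ₀, hρ₁, fun P hP hloc => ?_⟩
  have h : ∀ y : Y, ∃ K', y ∈ T → ∀ s : ℂ, ‖s‖ < ρ₀ →
      ∀ z ∈ retractDomain π D γ ν s, z ∈ U y → P K' s z := by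
    intro y
    by_cases hy : y ∈ T
    · obtain ⟨K', hK'⟩ := hloc _ _ _ _ ((hF y (hT y hy)).mono (hle y hy))
      exact ⟨K', fun _ => hK'⟩
    · exact ⟨0, fun h => absurd h hy⟩
  choose K' hK' using h
  -- The sum dominates each local constant, and `P` is monotone in its constant.
  refine ⟨∑ y ∈ T, |K' y|, Finset.sum_nonneg fun _ _ => abs_nonneg _, fun s hs z hz => ?_⟩
  obtain ⟨y, hy, hzy⟩ := mem_iUnion₂.1 (hcov (show z ∈ π ⁻¹' {0} from hz.1.1))
  exact hP _ _ _ _ ((le_abs_self _).trans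
    (Finset.single_le_sum (f := fun y => |K' y|) (fun _ _ => abs_nonneg _) hy))
    (hK' y hy s hs z hz hzy)

end FlowMap

/-! ### Displacement, pull-backs of forms and of the metric in a flow chart -/

section FlowEstimates

attribute [local instance] cnNormedAddCommGroup cnNormedSpaceReal cnNormedSpaceComplex
  cnDualNormedAddCommGroup cnBilinNormedAddCommGroup

variable {n a : ℕ} {Y : Type*} [TopologicalSpace Y] [ChartedSpace (Cn (n + 1)) Y]
  [IsManifold 𝓘(ℂ, Cn (n + 1)) ω Y] {π : Y → ℂ} {D : Fin a → Set Y} {γ : KahlerMetric (n + 1) Y}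
  {ν : ℕ} {ρ K : ℝ} {e : OpenPartialHomeomorph Y (Cn (n + 1))} {U : Set Y}
  {Q : Set (Cn (n + 1))}

lemma retractDomain_subset (π : Y → ℂ) (D : Fin a → Set Y) (γ : KahlerMetric (n + 1) Y) (ν : ℕ)
    (s : ℂ) : retractDomain π D γ ν s ⊆ smoothFibre π D 0 := sdiff_subset

/-- The differential of a map on the central fibre, with values in the model space. -/
def mapD (F : Y → Y) (A : Set Y) (z : Y) (v : Cn (n + 1)) : Cn (n + 1) := mapDiff F A z v

namespace FlowChart

lemma mem_maximalAtlas (h : FlowChart π D γ ν ρ e U Q K) :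
    e ∈ IsManifold.maximalAtlas 𝓘(ℂ, Cn (n + 1)) ω Y :=
  IsManifold.subset_maximalAtlas h.mem_atlas

lemma norm_chartD_le (h : FlowChart π D γ ν ρ e U Q K) {z : Y} (hz : z ∈ e.source)
    (hzQ : e z ∈ Q) (v : Cn (n + 1)) : ‖chartD e z v‖ ≤ Real.sqrt K * γ.vnorm z v := by
  have h1 := h.sq_norm_le _ hzQ (chartD e z v)
  rw [← γ.gm_eq h.mem_maximalAtlas hz] at h1
  have h2 : Real.sqrt K * γ.vnorm z v = Real.sqrt (K * γ.gm z v v) :=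
    (Real.sqrt_mul h.pos.le _).symm
  rw [h2]
  exact Real.le_sqrt_of_sq_le h1

lemma rpow_le (h : FlowChart π D γ ν ρ e U Q K) {s : ℂ} (hs : ‖s‖ ≤ 1) :
    K * ‖s‖ ^ (3 / 4 : ℝ) ≤ K * ‖s‖ ^ (1 / 2 : ℝ) :=
  mul_le_mul_of_nonneg_left
    (Real.rpow_le_rpow_of_exponent_ge' (norm_nonneg s) hs (by norm_num) (by norm_num)) h.pos.le

lemma edist_flowMap_le (h : FlowChart π D γ ν ρ e U Q K) {s : ℂ} (hs : ‖s‖ < ρ) {z : Y}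
    (hz : z ∈ retractDomain π D γ ν s) (hzU : z ∈ U) :
    γ.edist (flowMap π D γ s z) z ≤ ENNReal.ofReal (K * K * ‖s‖ ^ (3 / 4 : ℝ)) := by
  obtain ⟨-, hzQ, -, Φ, hΦ, hΦQ, -, hd⟩ := h.flow s hs z hz hzU
  have h1 := h.edist_le _ hΦQ _ hzQ
  rw [← hΦ.apply hz.1.1, e.left_inv hΦ.mem_source] at h1
  refine h1.trans (ENNReal.ofReal_le_ofReal ?_)
  rw [mul_assoc]
  exact mul_le_mul_of_nonneg_left hd h.pos.le

/-- The deviation of pull-backs of forms by the flow. -/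
lemma exists_form_bound (hπ : IsSemistableDegeneration (n := n) π D) (hρ : ρ ≤ 1)
    (h : FlowChart π D γ ν ρ e U Q K) {k : ℕ} {β : DForm (m := n + 1) Y k} (hβ : β.IsSmooth) :
    ∃ K' : ℝ, ∀ s : ℂ, ‖s‖ < ρ → ∀ z ∈ retractDomain π D γ ν s, z ∈ U →
      ∀ v : Fin k → TangentSpace 𝓘(ℝ, Cn (n + 1)) z, (∀ i, hdiff π z (v i) = 0) →
      ‖β (flowMap π D γ s z)
          (fun i => mapDiff (flowMap π D γ s) (retractDomain π D γ ν s) z (v i)) - β z v‖ ≤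
        K' * ‖s‖ ^ (1 / 2 : ℝ) * ∏ i, γ.vnorm z (v i) := by
  have he := h.mem_maximalAtlas
  obtain ⟨C, hC, hbd⟩ := exists_bound_lipschitz e.open_target (hβ e h.mem_atlas) h.isCompact
    h.convex h.subset_target
  refine ⟨C * (k * 2 ^ k + 1) * K * Real.sqrt K ^ k, fun s hs z hz hzU v' hv => ?_⟩
  obtain ⟨-, hzQ, hsm, Φ, hΦ, hΦQ, hΦd, hdp⟩ := h.flow s hs z hz hzU
  let v : Fin k → Cn (n + 1) := v'
  let w : Fin k → Cn (n + 1) := fun i =>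
    mapDiff (flowMap π D γ s) (retractDomain π D γ ν s) z (v' i)
  have hw : ∀ i, chartD e (flowMap π D γ s z) (w i) = fderiv ℝ Φ (e z) (chartD e z (v i)) :=
    fun i => hΦ.chartD_mapDiff hπ he (retractDomain_subset π D γ ν s) hz (hv i)
  have h1 : β (flowMap π D γ s z) w =
      β.inChart e (Φ (e z)) (fun i => fderiv ℝ Φ (e z) (chartD e z (v i))) := by
    rw [β.apply_eq_inChart he (hΦ.apply_mem_source hz.1.1) w, hΦ.chart_apply hz.1.1]
    congr 1
    funext i
    exact hw i
  have h2 : β z v = β.inChart e (e z) (fun i => chartD e z (v i)) :=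
    β.apply_eq_inChart he hΦ.mem_source v
  have key : ‖β (flowMap π D γ s z) w - β z v‖ ≤
      C * (k * 2 ^ k + 1) * K * Real.sqrt K ^ k * ‖s‖ ^ (1 / 2 : ℝ) * ∏ i, γ.vnorm z (v i) := by
    rw [h1, h2]
    -- One `ε` serves both errors: that of the differential, and the displacement of order
    -- `|s|^{3/4} ≤ |s|^{1/2}`.
    have h3 := norm_alternating_perturbation (M := β.inChart e (e z)) hC.le (hbd _ hΦQ).1
      (ε := K * ‖s‖ ^ (1 / 2 : ℝ))
      (((hbd _ hzQ).2 _ hΦQ).trans (mul_le_mul_of_nonneg_left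
        (hdp.trans (h.rpow_le (hs.le.trans hρ))) hC.le))
      (mul_nonneg h.pos.le (by positivity)) (by linarith) hΦd (fun i => chartD e z (v i))
    refine h3.trans ?_
    have h4 : ∏ i, ‖chartD e z (v i)‖ ≤ Real.sqrt K ^ k * ∏ i, γ.vnorm z (v i) := by
      calc ∏ i, ‖chartD e z (v i)‖ ≤ ∏ i, Real.sqrt K * γ.vnorm z (v i) :=
            Finset.prod_le_prod (fun _ _ => norm_nonneg _)
              fun i _ => h.norm_chartD_le hΦ.mem_source hzQ (v i)
        _ = _ := by rw [Finset.prod_mul_distrib]; simp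
    have hpos := h.pos
    calc _ ≤ C * (k * 2 ^ k + 1) * (K * ‖s‖ ^ (1 / 2 : ℝ)) *
          (Real.sqrt K ^ k * ∏ i, γ.vnorm z (v i)) := by gcongr
      _ = _ := by ring
  exact key

/-- The deviation of the metric and of its fundamental form under the flow. -/
lemma exists_metric_bound (hπ : IsSemistableDegeneration (n := n) π D) (hρ : ρ ≤ 1)
    (h : FlowChart π D γ ν ρ e U Q K) {c : ℂ} (hc : ‖c‖ ≤ 1) :
    ∃ K' : ℝ, ∀ s : ℂ, ‖s‖ < ρ → ∀ z ∈ retractDomain π D γ ν s, z ∈ U →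
      ∀ u v : Cn (n + 1), hd (m := n + 1) π z u = 0 → hd (m := n + 1) π z v = 0 →
      |γ.gm (flowMap π D γ s z)
          (c • mapD (flowMap π D γ s) (retractDomain π D γ ν s) z u)
          (mapD (flowMap π D γ s) (retractDomain π D γ ν s) z v) -
        γ.gm z (c • u) v| ≤
        K' * ‖s‖ ^ (1 / 2 : ℝ) * (γ.vnorm z u * γ.vnorm z v) := by
  have he := h.mem_maximalAtlas
  obtain ⟨C, hC, hbd⟩ := exists_bound_lipschitz e.open_target (γ.contDiffOn_inChart he) h.isCompact
    h.convex h.subset_target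
  refine ⟨4 * C * K * K, fun s hs z hz hzU u v hu hv => ?_⟩
  obtain ⟨-, hzQ, hsm, Φ, hΦ, hΦQ, hΦd, hdp⟩ := h.flow s hs z hz hzU
  have hA := retractDomain_subset π D γ ν s
  have hFs := hΦ.apply_mem_source hz.1.1
  have hw : ∀ u, hd (m := n + 1) π z u = 0 → chartD e (flowMap π D γ s z)
      (mapD (flowMap π D γ s) (retractDomain π D γ ν s) z u) =
      fderiv ℝ Φ (e z) (chartD e z u) := fun u hu => hΦ.chartD_mapDiff hπ he hA hz hu
  -- The scalar `c` treats two forms at once: `c = 1` gives the metric, `c = I` its fundamental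
  -- form.
  let M : Cn (n + 1) →L[ℝ] Cn (n + 1) := c • ContinuousLinearMap.id ℝ (Cn (n + 1))
  have hM : ‖M‖ ≤ 1 := ContinuousLinearMap.opNorm_le_bound _ zero_le_one fun x => by
    change ‖c • x‖ ≤ _
    rw [norm_smul]
    gcongr
  have hcomp : ∀ B : Cn (n + 1) →L[ℝ] Cn (n + 1) →L[ℝ] ℝ, ‖B.comp M‖ ≤ ‖B‖ := fun B =>
    (B.opNorm_comp_le M).trans (mul_le_of_le_one_right (norm_nonneg _) hM)
  rw [γ.gm_eq he hFs, γ.gm_eq he hΦ.mem_source, chartD_smul he hFs, chartD_smul he hΦ.mem_source,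
    hw u hu, hw v hv, hΦ.chart_apply hz.1.1]
  have hsub : ‖(γ.inChart e (Φ (e z))).comp M - (γ.inChart e (e z)).comp M‖ ≤
      C * (K * ‖s‖ ^ (1 / 2 : ℝ)) := by
    rw [← ContinuousLinearMap.sub_comp]
    exact (hcomp _).trans (((hbd _ hzQ).2 _ hΦQ).trans (mul_le_mul_of_nonneg_left
        (hdp.trans (h.rpow_le (hs.le.trans hρ))) hC.le))
  have h3 := abs_bilin_perturbation (G := (γ.inChart e (e z)).comp M) hC.le
    ((hcomp _).trans (hbd _ hΦQ).1) hsub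
    (mul_nonneg h.pos.le (by positivity)) (by linarith) hΦd (chartD e z u) (chartD e z v)
  refine h3.trans ?_
  have hpos := h.pos
  have h4 := h.norm_chartD_le hΦ.mem_source hzQ u
  have h5 := h.norm_chartD_le hΦ.mem_source hzQ v
  have h6 : 0 ≤ γ.vnorm z u := Real.sqrt_nonneg _
  calc _ ≤ 4 * C * (K * ‖s‖ ^ (1 / 2 : ℝ)) *
        ((Real.sqrt K * γ.vnorm z u) * (Real.sqrt K * γ.vnorm z v)) := by gcongr
    _ = 4 * C * (K * ‖s‖ ^ (1 / 2 : ℝ)) * ((Real.sqrt K * Real.sqrt K) *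
        (γ.vnorm z u * γ.vnorm z v)) := by ring
    _ = _ := by rw [Real.mul_self_sqrt hpos.le]; ring

end FlowChart

end FlowEstimates

/-! ### Wedge products of two-forms as alternating maps and as polynomials in matrices -/

section Wedge

variable {n : ℕ} {V : Type*} [AddCommGroup V] [Module ℝ V]

/-- The product of bilinear forms as a multilinear map. -/
def prodBilin (w : Fin n → V →ₗ[ℝ] V →ₗ[ℝ] ℂ) :
    MultilinearMap ℝ (fun _ : Fin n × Fin 2 => V) ℂ :=
  MultilinearMap.mk' (fun v => ∏ j, w j (v (j, 0)) (v (j, 1)))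
    (by
      intro v i x y
      -- The slot `i` occurs only in the factor with index `i.1`, so the other factors can be split
      -- off.
      have h : ∀ u : V, (∏ j, w j (Function.update v i u (j, 0)) (Function.update v i u (j, 1))) =
          w i.1 (Function.update v i u (i.1, 0)) (Function.update v i u (i.1, 1)) *
            ∏ j ∈ Finset.univ.erase i.1, w j (v (j, 0)) (v (j, 1)) := by
        intro u
        rw [← Finset.mul_prod_erase _ _ (Finset.mem_univ i.1)]
        congr 1
        refine Finset.prod_congr rfl fun j hj => ?_
        have h0 : ∀ b, (j, b) ≠ i := fun b hb => (Finset.ne_of_mem_erase hj) (congrArg Prod.fst hb)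
        rw [Function.update_of_ne (h0 0), Function.update_of_ne (h0 1)]
      rw [h, h, h, ← add_mul]
      congr 1
      obtain ⟨j, b⟩ := i
      fin_cases b <;> simp)
    (by
      intro v i c x
      have h : ∀ u : V, (∏ j, w j (Function.update v i u (j, 0)) (Function.update v i u (j, 1))) =
          w i.1 (Function.update v i u (i.1, 0)) (Function.update v i u (i.1, 1)) *
            ∏ j ∈ Finset.univ.erase i.1, w j (v (j, 0)) (v (j, 1)) := by
        intro u
        rw [← Finset.mul_prod_erase _ _ (Finset.mem_univ i.1)]
        congr 1
        refine Finset.prod_congr rfl fun j hj => ?_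
        have h0 : ∀ b, (j, b) ≠ i := fun b hb => (Finset.ne_of_mem_erase hj) (congrArg Prod.fst hb)
        rw [Function.update_of_ne (h0 0), Function.update_of_ne (h0 1)]
      rw [h, h, ← smul_mul_assoc]
      congr 1
      obtain ⟨j, b⟩ := i
      fin_cases b <;> simp)

/-- The wedge product of bilinear forms as an alternating map. -/
def wedgeAlt (w : Fin n → V →ₗ[ℝ] V →ₗ[ℝ] ℂ) : V [⋀^Fin n × Fin 2]→ₗ[ℝ] ℂ :=
  (1 / 2 ^ n : ℝ) • MultilinearMap.alternatization (prodBilin w)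

lemma wedgeAlt_apply (w : Fin n → V →ₗ[ℝ] V →ₗ[ℝ] ℂ) (v : Fin n × Fin 2 → V) :
    wedgeAlt w v = wedgeTwo (fun j u u' => w j u u') v := by
  rw [wedgeAlt, AlternatingMap.smul_apply, MultilinearMap.alternatization_apply, wedgeTwo,
    Complex.real_smul]
  push_cast
  congr 1
  refine Finset.sum_congr rfl fun σ _ => ?_
  rw [Units.smul_def, zsmul_eq_mul]
  rfl

/-- The standard real basis of `ℂⁿ`. -/
def stdB (n : ℕ) : Module.Basis (Fin n × Fin 2) ℝ (Cn n) :=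
  (Pi.basis fun _ : Fin n => Complex.basisOneI).reindex (Equiv.sigmaEquivProd _ _)

lemma stdB_apply (p : Fin n × Fin 2) :
    stdB n p = Pi.single p.1 (if p.2 = 0 then 1 else Complex.I) := by
  obtain ⟨j, b⟩ := p
  rw [stdB, Module.Basis.reindex_apply]
  change (Pi.basis fun _ : Fin n => Complex.basisOneI) ⟨j, b⟩ = _
  rw [Pi.basis_apply]
  congr 1
  fin_cases b <;> simp

lemma alternating_real_det {W : Type*} [AddCommGroup W] [Module ℝ W] {ι : Type*} [Fintype ι]
    [DecidableEq ι] (b : Module.Basis ι ℝ W) (f : W [⋀^ι]→ₗ[ℝ] ℝ) (T : W →ₗ[ℝ] W) :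
    f (fun p => T (b p)) = LinearMap.det T * f b := by
  have h := b.det_comp T b
  rw [b.det_self, mul_one] at h
  have h2 := congrArg (fun g : W [⋀^ι]→ₗ[ℝ] ℝ => g (fun p => T (b p))) (f.eq_smul_basis_det b)
  refine h2.trans ?_
  rw [AlternatingMap.smul_apply, smul_eq_mul, mul_comm]
  congr 1

/-- Forms of top degree are multiplied by the determinant. -/
lemma alternating_comp_det {f : V [⋀^Fin n × Fin 2]→ₗ[ℝ] ℂ} (S : Cn n →ₗ[ℝ] V)
    (T : Cn n →ₗ[ℝ] Cn n) :
    f (fun p => S (T (stdB n p))) = ((LinearMap.det T : ℝ) : ℂ) * f (fun p => S (stdB n p)) := by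
  have h1 := alternating_real_det (stdB n) (Complex.reLm.compAlternatingMap (f.compLinearMap S)) T
  have h2 := alternating_real_det (stdB n) (Complex.imLm.compAlternatingMap (f.compLinearMap S)) T
  refine Complex.ext ?_ ?_
  · rw [Complex.re_ofReal_mul]; exact h1
  · rw [Complex.im_ofReal_mul]; exact h2

/-- The real determinant of a complex linear map is the squared modulus of its complex determinant.
This is the source of the positivity of volume forms. -/
lemma det_complex_nonneg (T : Cn n →ₗ[ℂ] Cn n) : 0 ≤ LinearMap.det (T.restrictScalars ℝ) := by
  have h : LinearMap.det (T.restrictScalars ℝ) = ‖LinearMap.det T‖ ^ 2 := by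
    rw [LinearMap.det_restrictScalars, Algebra.norm_complex_apply, Complex.normSq_eq_norm_sq]
  rw [h]; positivity

/-- The matrix of the standard symplectic form. -/
def stdSympl (p q : Fin n × Fin 2) : ℝ :=
  if p.1 = q.1 then (if p.2 = q.2 then 0 else if p.2 = 0 then 1 else -1) else 0

/-- The wedge product of matrices of two-forms. -/
def wedgeM (W : Fin n → Fin n × Fin 2 → Fin n × Fin 2 → ℂ) : ℂ :=
  (1 / 2 ^ n) * ∑ σ : Equiv.Perm (Fin n × Fin 2),
    ((Equiv.Perm.sign σ : ℤ) : ℂ) * ∏ j, W j (σ (j, 0)) (σ (j, 1))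

lemma wedgeTwo_eq_wedgeM {V : Type*} (w : Fin n → V → V → ℂ) (v : Fin n × Fin 2 → V) :
    wedgeTwo w v = wedgeM fun j p q => w j (v p) (v q) := rfl

/-- A non-zero term forces `σ` to permute the pairs `{(j, 0), (j, 1)}`, so it is a permutation `τ`
of the indices combined with flips `f j` within the pairs. Acting on two copies, `τ` contributes
sign one; the sign of `σ` is the product of the signs of the `f j`, and so is the product of
entries. The term is a product of squares. -/
lemma symplectic_term_nonneg (σ : Equiv.Perm (Fin n × Fin 2)) :
    0 ≤ ((Equiv.Perm.sign σ : ℤ) : ℝ) * ∏ j, stdSympl (σ (j, 0)) (σ (j, 1)) := by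
  by_cases h : ∏ j, stdSympl (σ (j, 0)) (σ (j, 1)) = 0
  · rw [h, mul_zero]
  have h1 : ∀ j, (σ (j, 0)).1 = (σ (j, 1)).1 := by
    intro j
    have := Finset.prod_ne_zero_iff.1 h j (Finset.mem_univ j)
    by_contra h2
    exact this (if_neg h2)
  have h2 : ∀ j b, (σ (j, b)).1 = (σ (j, 0)).1 := by
    intro j b
    fin_cases b
    · rfl
    · exact (h1 j).symm
  have hf : ∀ j, Function.Injective fun b => (σ (j, b)).2 := by
    intro j b b' hb
    have : σ (j, b) = σ (j, b') := Prod.ext ((h2 j b).trans (h2 j b').symm) hb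
    exact congrArg Prod.snd (σ.injective this)
  let f : Fin n → Equiv.Perm (Fin 2) := fun j =>
    Equiv.ofBijective _ (Finite.injective_iff_bijective.1 (hf j))
  have hτ : Function.Injective fun j => (σ (j, 0)).1 := by
    intro j k hjk
    obtain ⟨b, hb⟩ := (f k).surjective ((σ (j, 0)).2)
    have h3 : σ (j, 0) = σ (k, b) := Prod.ext (hjk.trans (h2 k b).symm) hb.symm
    exact congrArg Prod.fst (σ.injective h3)
  let τ : Equiv.Perm (Fin n) := Equiv.ofBijective _ (Finite.injective_iff_bijective.1 hτ)
  have hσ : σ = Equiv.prodCongrLeft (fun _ : Fin 2 => τ) * Equiv.prodCongrRight f := by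
    ext1 ⟨j, b⟩
    exact Prod.ext (h2 j b) rfl
  have hsign : Equiv.Perm.sign σ = ∏ j, Equiv.Perm.sign (f j) := by
    rw [hσ, map_mul, Equiv.Perm.sign_prodCongrLeft, Equiv.Perm.sign_prodCongrRight]
    simp
  have hterm : ∀ j, stdSympl (σ (j, 0)) (σ (j, 1)) = ((Equiv.Perm.sign (f j) : ℤ) : ℝ) := by
    intro j
    have key : ∀ g : Equiv.Perm (Fin 2), (if g 0 = g 1 then (0 : ℤ) else if g 0 = 0 then 1 else -1) =
        (Equiv.Perm.sign g : ℤ) := by decide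
    rw [stdSympl, if_pos (h1 j), ← key (f j)]
    change (if (f j) 0 = (f j) 1 then (0 : ℝ) else if (f j) 0 = 0 then 1 else -1) = _
    split_ifs <;> simp
  rw [hsign, Finset.prod_congr rfl fun j _ => hterm j]
  push_cast
  rw [← Finset.prod_mul_distrib]
  exact Finset.prod_nonneg fun j _ => mul_self_nonneg _

/-- The value of `ωⁿ` on unitary frames. -/
def volConst (n : ℕ) : ℝ :=
  (1 / 2 ^ n) * ∑ σ : Equiv.Perm (Fin n × Fin 2),
    ((Equiv.Perm.sign σ : ℤ) : ℝ) * ∏ j, stdSympl (σ (j, 0)) (σ (j, 1))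

/-- No term is negative, and the identity permutation contributes one. -/
lemma volConst_pos (n : ℕ) : 0 < volConst n := by
  refine mul_pos (by positivity) (Finset.sum_pos' (fun σ _ => symplectic_term_nonneg σ)
    ⟨1, Finset.mem_univ _, ?_⟩)
  simp [stdSympl]

lemma wedgeM_stdSympl : wedgeM (fun (_ : Fin n) p q => (stdSympl p q : ℂ)) = volConst n := by
  rw [wedgeM, volConst]
  push_cast
  rfl

/-- The errors are relative to the bounds `M i`. Exchanging one factor at a time therefore costs `δ
* ∏ M i` at each step, even when some `M i` vanish. -/
lemma norm_prod_sub_prod_le {ι : Type*} (s : Finset ι) {x y : ι → ℂ} {M : ι → ℝ} {δ : ℝ}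
    (hδ : 0 ≤ δ) (hx : ∀ i ∈ s, ‖x i‖ ≤ M i) (hy : ∀ i ∈ s, ‖y i‖ ≤ M i)
    (h : ∀ i ∈ s, ‖x i - y i‖ ≤ δ * M i) :
    ‖∏ i ∈ s, x i - ∏ i ∈ s, y i‖ ≤ s.card * δ * ∏ i ∈ s, M i := by
  classical
  induction s using Finset.induction_on with
  | empty => simp
  | insert i s hi ih =>
    rw [Finset.prod_insert hi, Finset.prod_insert hi, Finset.prod_insert hi,
      Finset.card_insert_of_notMem hi]
    have h1 := ih (fun j hj => hx j (Finset.mem_insert_of_mem hj))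
      (fun j hj => hy j (Finset.mem_insert_of_mem hj))
      (fun j hj => h j (Finset.mem_insert_of_mem hj))
    have hM : ∀ j ∈ insert i s, 0 ≤ M j := fun j hj => (norm_nonneg _).trans (hx j hj)
    have hM0 := hM i (Finset.mem_insert_self _ _)
    have hMp : 0 ≤ ∏ j ∈ s, M j :=
      Finset.prod_nonneg fun j hj => hM j (Finset.mem_insert_of_mem hj)
    have h2 : ‖∏ j ∈ s, y j‖ ≤ ∏ j ∈ s, M j := by
      rw [norm_prod]
      exact Finset.prod_le_prod (fun _ _ => norm_nonneg _)
        fun j hj => hy j (Finset.mem_insert_of_mem hj)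
    have h3 : x i * ∏ j ∈ s, x j - y i * ∏ j ∈ s, y j =
        x i * (∏ j ∈ s, x j - ∏ j ∈ s, y j) + (x i - y i) * ∏ j ∈ s, y j := by ring
    rw [h3]
    calc _ ≤ ‖x i‖ * ‖∏ j ∈ s, x j - ∏ j ∈ s, y j‖ + ‖x i - y i‖ * ‖∏ j ∈ s, y j‖ := by
          refine (norm_add_le _ _).trans_eq ?_
          rw [norm_mul, norm_mul]
      _ ≤ M i * (s.card * δ * ∏ j ∈ s, M j) + δ * M i * ∏ j ∈ s, M j := by
          gcongr
          · exact hx i (Finset.mem_insert_self _ _)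
          · exact h i (Finset.mem_insert_self _ _)
      _ = _ := by push_cast; ring

/-- Lipschitz continuity of the wedge product of matrices. -/
lemma norm_wedgeM_sub_le {W W' : Fin n → Fin n × Fin 2 → Fin n × Fin 2 → ℂ} {M : Fin n → ℝ} {δ : ℝ}
    (hδ : 0 ≤ δ) (hW : ∀ j p q, ‖W j p q‖ ≤ M j) (hW' : ∀ j p q, ‖W' j p q‖ ≤ M j)
    (h : ∀ j p q, ‖W j p q - W' j p q‖ ≤ δ * M j) :
    ‖wedgeM W - wedgeM W'‖ ≤
      (1 / 2 ^ n * Fintype.card (Equiv.Perm (Fin n × Fin 2)) * n) * δ * ∏ j, M j := by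
  rw [wedgeM, wedgeM, ← mul_sub, ← Finset.sum_sub_distrib, norm_mul]
  have h1 : ∀ σ ∈ Finset.univ, ‖((Equiv.Perm.sign σ : ℤ) : ℂ) * ∏ j, W j (σ (j, 0)) (σ (j, 1)) -
      ((Equiv.Perm.sign σ : ℤ) : ℂ) * ∏ j, W' j (σ (j, 0)) (σ (j, 1))‖ ≤ n * δ * ∏ j, M j := by
    intro σ _
    rw [← mul_sub, norm_mul]
    have h2 : ‖((Equiv.Perm.sign σ : ℤ) : ℂ)‖ = 1 := by
      rcases Int.units_eq_one_or (Equiv.Perm.sign σ) with h | h <;> rw [h] <;> simp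
    rw [h2, one_mul]
    have h3 := norm_prod_sub_prod_le Finset.univ hδ
      (fun j _ => hW j (σ (j, 0)) (σ (j, 1))) (fun j _ => hW' j (σ (j, 0)) (σ (j, 1)))
      (fun j _ => h j (σ (j, 0)) (σ (j, 1)))
    simpa using h3
  have h4 := norm_sum_le_of_le _ h1
  have h5 : ‖(1 / 2 ^ n : ℂ)‖ = 1 / 2 ^ n := by simp
  rw [h5]
  calc _ ≤ 1 / 2 ^ n * ∑ _σ : Equiv.Perm (Fin n × Fin 2), n * δ * ∏ j, M j := by gcongr
    _ = _ := by rw [Finset.sum_const, Finset.card_univ, nsmul_eq_mul]; ring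

end Wedge

/-! ### Unitary bases -/

section UnitaryBasis

/-- Unitary bases for the hermitian form attached to a `J`-invariant scalar product. -/
lemma exists_unitary_basis {n : ℕ} {V : Type*} [AddCommGroup V] [Module ℂ V]
    [FiniteDimensional ℂ V] (hV : Module.finrank ℂ V = n) (g : V → V → ℝ)
    (hadd : ∀ x y z, g (x + y) z = g x z + g y z) (hsmul : ∀ (c : ℝ) x y, g ((c : ℂ) • x) y = c * g x y)
    (hsymm : ∀ x y, g x y = g y x) (hpos : ∀ x, x ≠ 0 → 0 < g x x)
    (hJ : ∀ x y, g (Complex.I • x) (Complex.I • y) = g x y) :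
    ∃ b : Module.Basis (Fin n) ℂ V, (∀ i j, g (b i) (b j) = if i = j then 1 else 0) ∧
      ∀ i j, g (Complex.I • b i) (b j) = 0 := by
  have hneg : ∀ x y, g (-x) y = -g x y := fun x y => by
    have := hsmul (-1) x y
    simpa using this
  have hJ2 : ∀ x y, g x (Complex.I • y) = -g (Complex.I • x) y := fun x y => by
    rw [← hJ x, smul_smul, Complex.I_mul_I, neg_one_smul, hsymm, hneg, hsymm]
  have h0 : g 0 0 = 0 := by
    have := hsmul 0 (0 : V) 0
    simpa using this
  have hself : ∀ x, g (Complex.I • x) x = 0 := fun x => by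
    have := hJ2 x x
    rw [hsymm] at this
    linarith
  -- The hermitian form has real part `g x y` and imaginary part `g (I x) y`, so orthonormality for
  -- it encodes both required identities.
  let core : InnerProductSpace.Core ℂ V :=
    { inner := fun x y => ⟨g x y, g (Complex.I • x) y⟩
      conj_inner_symm := fun x y => by
        refine Complex.ext (hsymm y x) ?_
        change -g (Complex.I • y) x = g (Complex.I • x) y
        rw [← hJ2, hsymm]
      re_inner_nonneg := fun x => by
        change 0 ≤ g x x
        by_cases hx : x = 0
        · rw [hx, h0]
        · exact (hpos x hx).le
      add_left := fun x y z => by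
        refine Complex.ext (hadd x y z) ?_
        change g (Complex.I • (x + y)) z = g (Complex.I • x) z + g (Complex.I • y) z
        rw [smul_add, hadd]
      smul_left := fun x y r => by
        have h1 : ∀ r : ℂ, g (r • x) y = r.re * g x y + r.im * g (Complex.I • x) y := fun r => by
          conv_lhs => rw [← Complex.re_add_im r, add_smul, hadd, hsmul, mul_smul, hsmul]
        refine Complex.ext ?_ ?_
        · change g (r • x) y = (((starRingEnd ℂ) r) * (⟨g x y, g (Complex.I • x) y⟩ : ℂ)).re
          rw [h1, Complex.mul_re]
          simp
        · change g (Complex.I • r • x) y =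
            (((starRingEnd ℂ) r) * (⟨g x y, g (Complex.I • x) y⟩ : ℂ)).im
          rw [smul_smul, h1, Complex.mul_im]
          simp [add_comm]
      definite := fun x hx => by
        by_contra h
        exact (hpos x h).ne' (congrArg Complex.re hx) }
  let : NormedAddCommGroup V := core.toNormedAddCommGroup
  let : InnerProductSpace ℂ V := InnerProductSpace.ofCore core.toCore
  let b := (stdOrthonormalBasis ℂ V).reindex (finCongr hV)
  have hb : ∀ i j, (⟨g (b i) (b j), g (Complex.I • b i) (b j)⟩ : ℂ) = if i = j then 1 else 0 :=
    fun i j => orthonormal_iff_ite.1 b.orthonormal i j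
  refine ⟨b.toBasis, fun i j => ?_, fun i j => ?_⟩
  · rw [b.coe_toBasis]
    have := congrArg Complex.re (hb i j)
    rw [apply_ite Complex.re] at this
    exact this
  · rw [b.coe_toBasis]
    have := congrArg Complex.im (hb i j)
    rw [apply_ite Complex.im] at this
    simpa using this

end UnitaryBasis

/-! ### Changes of frame by real matrices -/

section MatrixFrames

variable {ι : Type*} [Fintype ι] [DecidableEq ι] {V : Type*} [AddCommGroup V] [Module ℝ V]

lemma alternating_matrix_det (f : V [⋀^ι]→ₗ[ℝ] ℂ) (A : Matrix ι ι ℝ) (u : ι → V) :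
    f (fun p => ∑ q, A p q • u q) = (A.det : ℂ) * f u := by
  let S : (ι → ℝ) →ₗ[ℝ] V := Fintype.linearCombination ℝ u
  have key : ∀ g : V [⋀^ι]→ₗ[ℝ] ℝ, g (fun p => ∑ q, A p q • u q) = A.det * g u := by
    intro g
    have h := congrArg (fun h : (ι → ℝ) [⋀^ι]→ₗ[ℝ] ℝ => h A)
      ((g.compLinearMap S).eq_smul_basis_det (Pi.basisFun ℝ ι))
    have h1 : (g.compLinearMap S) A = g (fun p => ∑ q, A p q • u q) := rfl
    have h2 : (g.compLinearMap S) (Pi.basisFun ℝ ι) = g u := by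
      rw [AlternatingMap.compLinearMap_apply]
      congr 1
      funext p
      simp [S, Fintype.linearCombination_apply_single]
    rw [← h1, ← h2]
    have h3 : (Pi.basisFun ℝ ι).det A = A.det := by rw [Pi.basisFun_det]; rfl
    refine h.trans ?_
    rw [mul_comm, ← h3]
    rfl
  refine Complex.ext ?_ ?_
  · rw [Complex.re_ofReal_mul]; exact key (Complex.reLm.compAlternatingMap f)
  · rw [Complex.im_ofReal_mul]; exact key (Complex.imLm.compAlternatingMap f)

/-- Only `Cᵀ C` enters. When `C` takes a frame back to an orthonormal one, this is the inverse of
the Gram matrix of the frame. -/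
lemma sum_norm_sq_matrix (C : Matrix ι ι ℝ) (ℓ : ι → ℂ) :
    ∑ p, ‖∑ q, (C p q : ℂ) * ℓ q‖ ^ 2 =
      ∑ q, ∑ r, (C.transpose * C) q r * (ℓ q * (starRingEnd ℂ) (ℓ r)).re := by
  have h : ∀ p, ‖∑ q, (C p q : ℂ) * ℓ q‖ ^ 2 =
      ∑ q, ∑ r, C p q * C p r * (ℓ q * (starRingEnd ℂ) (ℓ r)).re := by
    intro p
    have h1 : ((‖∑ q, (C p q : ℂ) * ℓ q‖ ^ 2 : ℝ) : ℂ) =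
        ∑ q, ∑ r, ((C p q * C p r : ℝ) : ℂ) * (ℓ q * (starRingEnd ℂ) (ℓ r)) := by
      rw [← Complex.normSq_eq_norm_sq, Complex.normSq_eq_conj_mul_self, mul_comm, map_sum,
        Finset.sum_mul_sum]
      refine Finset.sum_congr rfl fun q _ => Finset.sum_congr rfl fun r _ => ?_
      rw [map_mul, Complex.conj_ofReal]
      push_cast
      ring
    have h2 := congrArg Complex.re h1
    rw [Complex.ofReal_re] at h2
    rw [h2, Complex.re_sum]
    refine Finset.sum_congr rfl fun q _ => ?_
    rw [Complex.re_sum]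
    exact Finset.sum_congr rfl fun r _ => Complex.re_ofReal_mul _ _
  simp only [h]
  rw [Finset.sum_comm]
  refine Finset.sum_congr rfl fun q _ => ?_
  rw [Finset.sum_comm]
  refine Finset.sum_congr rfl fun r _ => ?_
  rw [Matrix.mul_apply, Finset.sum_mul]
  rfl

lemma sum_norm_sq_orthogonal {C : Matrix ι ι ℝ} (hC : C * C.transpose = 1) (ℓ : ι → ℂ) :
    ∑ p, ‖∑ q, (C p q : ℂ) * ℓ q‖ ^ 2 = ∑ q, ‖ℓ q‖ ^ 2 := by
  rw [sum_norm_sq_matrix, mul_eq_one_comm.1 hC]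
  refine Finset.sum_congr rfl fun q _ => ?_
  rw [Finset.sum_eq_single q (fun r _ hr => by rw [Matrix.one_apply_ne hr.symm, zero_mul])
    (fun h => absurd (Finset.mem_univ q) h), Matrix.one_apply_eq, one_mul, Complex.mul_conj,
    Complex.ofReal_re, Complex.normSq_eq_norm_sq]

end MatrixFrames

/-! ### Frames of the tangent spaces of the fibres -/

section FibreFrames

attribute [local instance] cnNormedAddCommGroup cnNormedSpaceReal cnNormedSpaceComplex
  cnDualNormedAddCommGroup cnBilinNormedAddCommGroup

variable {n a : ℕ} {Y : Type*} [TopologicalSpace Y] [ChartedSpace (Cn (n + 1)) Y]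
  {π : Y → ℂ} {D : Fin a → Set Y} {s : ℂ}

/-- A two-form at a point as a bilinear map. -/
def DForm.bil (α : DForm (m := n + 1) Y 2) (y : Y) : Cn (n + 1) →ₗ[ℝ] Cn (n + 1) →ₗ[ℝ] ℂ :=
  let α' : Cn (n + 1) [⋀^Fin 2]→L[ℝ] ℂ := α y
  have hadd : ∀ u u' w, α' ![u + u', w] = α' ![u, w] + α' ![u', w] := fun u u' w =>
    α'.vecCons_add ![w] u u'
  have hsmul : ∀ (c : ℝ) u w, α' ![c • u, w] = c • α' ![u, w] := fun c u w =>
    α'.vecCons_smul ![w] c u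
  have hswap : ∀ u w, α' ![u, w] = -α' ![w, u] := fun u w => by
    have h := α'.toAlternatingMap.map_swap ![u, w] (show (0 : Fin 2) ≠ 1 by decide)
    have h2 : ![u, w] ∘ Equiv.swap (0 : Fin 2) 1 = ![w, u] := by
      funext i; fin_cases i <;> simp
    rw [h2] at h
    have h3 : α' ![w, u] = -α' ![u, w] := h
    rw [h3, neg_neg]
  LinearMap.mk₂ ℝ (fun u w => α' ![u, w]) hadd hsmul
    (fun u w w' => by rw [hswap, hadd, hswap u w, hswap u w', neg_add])
    (fun c u w => by rw [hswap, hsmul, hswap u w, smul_neg])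

lemma DForm.bil_apply (α : DForm (m := n + 1) Y 2) (y : Y) (u w : Cn (n + 1)) :
    α.bil y u w = α y ![u, w] := rfl

variable [IsManifold 𝓘(ℂ, Cn (n + 1)) ω Y] {γ : KahlerMetric (n + 1) Y}

/-- The form `γⁿ` at a point as an alternating map. -/
def gammaAlt (γ : KahlerMetric (n + 1) Y) (y : Y) : Cn (n + 1) [⋀^Fin n × Fin 2]→ₗ[ℝ] ℂ :=
  wedgeAlt fun _ => γ.form.bil y

lemma gammaPow_eq (y : Y) (v : Fin n × Fin 2 → Cn (n + 1)) : gammaPow γ y v = gammaAlt γ y v :=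
  (wedgeAlt_apply (fun _ => γ.form.bil y) v).symm

lemma form_bil_eq (y : Y) (u w : Cn (n + 1)) : γ.form.bil y u w = γ.gm y (Complex.I • u) w :=
  γ.form_apply y u w

lemma gammaPow_eq_wedgeM (y : Y) (v : Fin n × Fin 2 → Cn (n + 1)) :
    gammaPow γ y v = wedgeM fun _ p q => ((γ.gm y (Complex.I • v p) (v q) : ℝ) : ℂ) := by
  change wedgeM (fun _ p q => γ.form.bil y (v p) (v q)) = _
  congr 1
  funext j p q
  exact form_bil_eq y (v p) (v q)

/-- Real frames of the tangent space of the fibre. -/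
structure IsFrame (π : Y → ℂ) (y : Y) (w : Fin n × Fin 2 → Cn (n + 1)) : Prop where
  mem : ∀ p, hd (m := n + 1) π y (w p) = 0
  span : ∀ v, hd (m := n + 1) π y v = 0 → ∃ c : Fin n × Fin 2 → ℝ, v = ∑ p, c p • w p

lemma IsFrame.exists_matrix {y : Y} {w v : Fin n × Fin 2 → Cn (n + 1)} (hw : IsFrame π y w)
    (hv : ∀ p, hd (m := n + 1) π y (v p) = 0) :
    ∃ A : Matrix (Fin n × Fin 2) (Fin n × Fin 2) ℝ, v = fun p => ∑ q, A p q • w q := by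
  choose c hc using fun p => hw.span (v p) (hv p)
  exact ⟨Matrix.of c, funext hc⟩

/-- Expressing arbitrary tangent vectors by the frame multiplies both forms by the same determinant.
A quotient therefore exists, and its value is determined on the frame. -/
lemma IsFrame.topQuotient_eq {y : Y} {w : Fin n × Fin 2 → Cn (n + 1)} (hw : IsFrame π y w)
    (hne : gammaPow γ y w ≠ 0) (Ψ : Cn (n + 1) [⋀^Fin n × Fin 2]→ₗ[ℝ] ℂ) :
    topQuotient π γ y Ψ = Ψ w / gammaPow γ y w := by
  have hex : ∃ c : ℂ, ∀ v : Fin n × Fin 2 → TangentSpace 𝓘(ℝ, Cn (n + 1)) y,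
      (∀ p, hdiff π y (v p) = 0) → Ψ v = c * gammaPow γ y v := by
    refine ⟨Ψ w / gammaPow γ y w, fun v' hv => ?_⟩
    let v : Fin n × Fin 2 → Cn (n + 1) := v'
    obtain ⟨A, hA⟩ := hw.exists_matrix (v := v) hv
    have h1 : Ψ v = A.det * Ψ w := by rw [hA, alternating_matrix_det]
    have h2 : gammaPow γ y v = A.det * gammaPow γ y w := by
      rw [gammaPow_eq y v, gammaPow_eq, hA, alternating_matrix_det]
    change Ψ v = _ * gammaPow γ y v
    rw [h1, h2, mul_left_comm, div_mul_cancel₀ _ hne]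
  have h := Classical.epsilon_spec hex w hw.mem
  rw [eq_div_iff hne]
  exact h.symm

/-- Unitary bases of the tangent space of the fibre. -/
structure IsUnitary (π : Y → ℂ) (γ : KahlerMetric (n + 1) Y) (y : Y) (b : Fin n → Cn (n + 1)) :
    Prop where
  mem : ∀ i, hd (m := n + 1) π y (b i) = 0
  span : ∀ v, hd (m := n + 1) π y v = 0 → ∃ c : Fin n → ℂ, v = ∑ i, c i • b i
  gm_eq : ∀ i j, γ.gm y (b i) (b j) = if i = j then 1 else 0
  gm_I_eq : ∀ i j, γ.gm y (Complex.I • b i) (b j) = 0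

/-- The real frame `b₁, i b₁, b₂, …` attached to a complex basis. -/
def realFrame (b : Fin n → Cn (n + 1)) (p : Fin n × Fin 2) : Cn (n + 1) :=
  if p.2 = 0 then b p.1 else Complex.I • b p.1

theorem exists_isUnitary (hπ : IsSemistableDegeneration (n := n) π D) (γ : KahlerMetric (n + 1) Y)
    {y : Y} (hy : y ∈ smoothFibre π D s) : ∃ b, IsUnitary π γ y b := by
  have hne : hd (m := n + 1) π y ≠ 0 := hd_ne_zero_of_mem_smoothFibre hπ hy
  let K := LinearMap.ker (hd (m := n + 1) π y).toLinearMap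
  have hdim : Module.finrank ℂ K = n := by
    have h3 := LinearMap.finrank_range_add_finrank_ker (hd (m := n + 1) π y).toLinearMap
    have h4 : LinearMap.range (hd (m := n + 1) π y).toLinearMap = ⊤ := by
      refine LinearMap.range_eq_top.2 (LinearMap.surjective fun h => hne ?_)
      ext v
      exact DFunLike.congr_fun h v
    rw [h4, finrank_top] at h3
    simp at h3
    change Module.finrank ℂ (LinearMap.ker (hd (m := n + 1) π y).toLinearMap) = n
    omega
  obtain ⟨b, hb1, hb2⟩ := exists_unitary_basis hdim (fun x y' => γ.gm y x y')
    (fun x x' z => by simp) (fun c x x' => by simp)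
    (fun x x' => γ.gm_symm y _ _) (fun x hx => γ.gm_pos y (by simpa using hx))
    (fun x x' => γ.gm_I y _ _)
  refine ⟨fun i => b i, fun i => (b i).2, fun v hv => ?_, hb1, hb2⟩
  have hvK : v ∈ K := hv
  refine ⟨b.repr ⟨v, hvK⟩, ?_⟩
  have := congrArg Subtype.val (b.sum_repr ⟨v, hvK⟩)
  rw [Submodule.coe_sum] at this
  exact this.symm

namespace IsUnitary

variable {y : Y} {b : Fin n → Cn (n + 1)}

lemma isFrame (hb : IsUnitary π γ y b) : IsFrame π y (realFrame b) where
  mem := fun p => by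
    rw [realFrame]
    split_ifs
    · exact hb.mem _
    · rw [map_smul, hb.mem, smul_zero]
  span := fun v hv => by
    obtain ⟨c, rfl⟩ := hb.span v hv
    refine ⟨fun p => if p.2 = 0 then (c p.1).re else (c p.1).im, ?_⟩
    rw [Fintype.sum_prod_type]
    refine Finset.sum_congr rfl fun i _ => ?_
    rw [Fin.sum_univ_two]
    ext k
    simp only [realFrame, if_true, if_neg (show (1 : Fin 2) ≠ 0 by decide), Pi.smul_apply,
      Pi.add_apply, smul_eq_mul, Complex.real_smul]
    rw [← mul_assoc, ← add_mul, Complex.re_add_im]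

lemma gram (hb : IsUnitary π γ y b) (p q : Fin n × Fin 2) :
    γ.gm y (realFrame b p) (realFrame b q) = (1 : Matrix (Fin n × Fin 2) (Fin n × Fin 2) ℝ) p q := by
  obtain ⟨i, k⟩ := p
  obtain ⟨j, l⟩ := q
  rw [Matrix.one_apply]
  fin_cases k <;> fin_cases l <;> simp [realFrame, hb.gm_eq, hb.gm_I_eq, γ.gm_I]
  rw [γ.gm_symm, hb.gm_I_eq]

lemma sympl (hb : IsUnitary π γ y b) (p q : Fin n × Fin 2) :
    γ.gm y (Complex.I • realFrame b p) (realFrame b q) = stdSympl p q := by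
  have hI : ∀ v : Cn (n + 1), Complex.I • Complex.I • v = -v := fun v => by
    rw [smul_smul, Complex.I_mul_I, neg_one_smul]
  obtain ⟨i, k⟩ := p
  obtain ⟨j, l⟩ := q
  fin_cases k <;> fin_cases l <;>
    simp [realFrame, stdSympl, hb.gm_eq, hb.gm_I_eq, γ.gm_I, hI]
  · split_ifs <;> simp
  · rw [γ.gm_symm, hb.gm_I_eq]

lemma I_smul (p : Fin n × Fin 2) :
    Complex.I • realFrame b p = ∑ q, stdSympl p q • realFrame b q := by
  have hI : ∀ v : Cn (n + 1), Complex.I • Complex.I • v = -v := fun v => by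
    rw [smul_smul, Complex.I_mul_I, neg_one_smul]
  obtain ⟨i, k⟩ := p
  rw [Fintype.sum_prod_type, Finset.sum_eq_single i ?_ (by simp)]
  · rw [Fin.sum_univ_two]
    fin_cases k <;> simp [realFrame, stdSympl, hI]
  · intro j _ hj
    simp [stdSympl, hj.symm]

lemma gammaPow_eq (hb : IsUnitary π γ y b) : gammaPow γ y (realFrame b) = volConst n := by
  rw [gammaPow_eq_wedgeM, ← wedgeM_stdSympl]
  congr 1
  funext _ p q
  rw [hb.sympl]

lemma gammaPow_ne_zero (hb : IsUnitary π γ y b) : gammaPow γ y (realFrame b) ≠ 0 := by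
  rw [hb.gammaPow_eq]
  exact_mod_cast (volConst_pos n).ne'

lemma vnorm_eq_one (hb : IsUnitary π γ y b) (p : Fin n × Fin 2) :
    γ.vnorm y (realFrame b p) = 1 := by
  have h : γ.gm y (realFrame b p) (realFrame b p) = 1 := by rw [hb.gram, Matrix.one_apply_eq]
  change Real.sqrt (γ.gm y (realFrame b p) (realFrame b p)) = 1
  rw [h, Real.sqrt_one]

end IsUnitary

/-- The differential of a function along the fibre, as a linear form on the model space. -/
def fibreDiffL (π : Y → ℂ) (D : Fin a → Set Y) (s : ℂ) (f : Y → ℂ) (y : Y) :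
    Cn (n + 1) →L[ℝ] ℂ :=
  mfderivWithin 𝓘(ℝ, Cn (n + 1)) 𝓘(ℝ, ℂ) f (smoothFibre π D s) y

/-- Any orthonormal frame arises from the unitary one by an orthogonal matrix, which preserves the
sum. The supremum is over a constant family. -/
lemma IsUnitary.fibreDiffNormSq_eq {y : Y} {b : Fin n → Cn (n + 1)} (hb : IsUnitary π γ y b)
    (f : Y → ℂ) : fibreDiffNormSq π D γ s f y =
      (1 / 2) * ∑ p, ‖fibreDiffL π D s f y (realFrame b p)‖ ^ 2 := by
  rw [fibreDiffNormSq]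
  congr 1
  have hne : Nonempty {e : Fin n × Fin 2 → TangentSpace 𝓘(ℝ, Cn (n + 1)) y //
      (∀ p, hdiff π y (e p) = 0) ∧ ∀ p q, γ.inner y (e p) (e q) = if p = q then 1 else 0} :=
    ⟨realFrame b, hb.isFrame.mem, fun p q => (hb.gram p q).trans (Matrix.one_apply)⟩
  refine (iSup_congr fun e => ?_).trans ciSup_const
  obtain ⟨e', h1, h2⟩ := e
  let e : Fin n × Fin 2 → Cn (n + 1) := e'
  obtain ⟨A, hA⟩ := hb.isFrame.exists_matrix (v := e) h1
  have hAA : A * A.transpose = 1 := by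
    ext p q
    have h3 : γ.gm y (e p) (e q) = if p = q then 1 else 0 := h2 p q
    rw [Matrix.one_apply, ← h3, hA]
    simp only [map_sum, map_smul, sum_apply, smul_apply, hb.gram, Matrix.one_apply,
      Matrix.mul_apply, smul_eq_mul, mul_ite, mul_one, mul_zero, Finset.sum_ite_eq',
      Finset.mem_univ, if_true, Matrix.transpose_apply]
    exact Finset.sum_congr rfl fun _ _ => mul_comm _ _
  rw [← sum_norm_sq_orthogonal hAA fun q => fibreDiffL π D s f y (realFrame b q)]
  refine Finset.sum_congr rfl fun p _ => ?_
  change ‖fibreDiffL π D s f y (e p)‖ ^ 2 = _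
  rw [hA]
  simp only [map_sum, map_smul, Complex.real_smul]

lemma FibreParam.frame_eq (φ : FibreParam (n := n) π D s) (x : Cn n) (p : Fin n × Fin 2) :
    φ.frame x p = φ.d x (stdB n p) := by
  rw [stdB_apply]; rfl

lemma FibreParam.isFrame (hπ : IsSemistableDegeneration (n := n) π D)
    (φ : FibreParam (n := n) π D s) {x : Cn n} (hx : x ∈ φ.dom) :
    IsFrame π (φ.map x) (fun p => φ.d x (stdB n p)) where
  mem := fun p => φ.hd_d hπ.holomorphic hx _
  span := fun v hv => by
    obtain ⟨u, rfl⟩ := φ.exists_d_eq hπ.holomorphic hx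
      (hd_ne_zero_of_mem_smoothFibre hπ (φ.map_mem x)) hv
    refine ⟨(stdB n).repr u, ?_⟩
    conv_lhs => rw [← (stdB n).sum_repr u]
    simp only [map_sum, map_smul]

/-- The volume form is positive on holomorphic frames. -/
lemma FibreParam.exists_gammaPow_eq (hπ : IsSemistableDegeneration (n := n) π D)
    (φ : FibreParam (n := n) π D s) {x : Cn n} (hx : x ∈ φ.dom) (γ : KahlerMetric (n + 1) Y) :
    ∃ r : ℝ, 0 < r ∧ gammaPow γ (φ.map x) (fun p => φ.d x (stdB n p)) = r := by
  obtain ⟨b, hb⟩ := exists_isUnitary hπ γ (φ.map_mem x)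
  -- Both the parametrisation and the unitary basis are complex linear, so the differential factors
  -- as `E ∘ T` with `T` complex linear and hence of non-negative real determinant.
  let E : Cn n →ₗ[ℂ] Cn (n + 1) := Fintype.linearCombination ℂ b
  have hE : ∀ p, E (stdB n p) = realFrame b p := by
    rintro ⟨i, k⟩
    rw [stdB_apply, Fintype.linearCombination_apply_single]
    fin_cases k <;> simp [realFrame]
  choose c hc using fun k : Fin n => hb.span _ (φ.hd_d hπ.holomorphic hx (Pi.single k 1))
  let T : Cn n →ₗ[ℂ] Cn n := Fintype.linearCombination ℂ c
  have hT : ∀ v, φ.d x v = E (T v) := by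
    have h1 : (φ.dc x).toLinearMap = E.comp T := by
      refine LinearMap.pi_ext' fun k => ?_
      ext1
      change φ.dc x (Pi.single k 1) = E (T (Pi.single k 1))
      rw [← φ.d_eq hx, hc, Fintype.linearCombination_apply_single, one_smul,
        Fintype.linearCombination_apply]
    intro v
    rw [φ.d_eq hx]
    exact DFunLike.congr_fun h1 v
  have h2 : gammaPow γ (φ.map x) (fun p => φ.d x (stdB n p)) =
      ((LinearMap.det (T.restrictScalars ℝ) * volConst n : ℝ) : ℂ) := by
    rw [_root_.gammaPow_eq]
    have h3 := alternating_comp_det (f := gammaAlt γ (φ.map x)) (E.restrictScalars ℝ)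
      (T.restrictScalars ℝ)
    have h4 : gammaAlt γ (φ.map x) (fun p => (E.restrictScalars ℝ) (stdB n p)) = volConst n := by
      rw [← hb.gammaPow_eq, _root_.gammaPow_eq]
      congr 1
      funext p
      exact hE p
    rw [h4] at h3
    push_cast
    rw [← h3]
    congr 1
    funext p
    exact hT _
  refine ⟨_, lt_of_le_of_ne (mul_nonneg (det_complex_nonneg T) (volConst_pos n).le) ?_, h2⟩
  -- If the value were zero, the determinant rule would make `γⁿ` vanish on the unitary frame too.
  intro h0
  rw [← h0] at h2
  obtain ⟨A, hA⟩ := (φ.isFrame hπ hx).exists_matrix hb.isFrame.mem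
  refine hb.gammaPow_ne_zero ?_
  rw [_root_.gammaPow_eq, hA, alternating_matrix_det, ← _root_.gammaPow_eq, h2]
  simp

end FibreFrames

/-! ### Matrices close to the identity -/

section MatrixPerturbation

variable {ι : Type*} [Fintype ι] [DecidableEq ι]

/-- Such a matrix is strictly diagonally dominant. -/
lemma det_ne_zero_of_near_one {G : Matrix ι ι ℝ} {δ : ℝ} (hδ : Fintype.card ι * δ ≤ 1 / 2)
    (hG : ∀ p q, |G p q - (1 : Matrix ι ι ℝ) p q| ≤ δ) : G.det ≠ 0 := by
  refine det_ne_zero_of_sum_row_lt_diag fun k => ?_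
  have h1 : ∀ j ∈ Finset.univ.erase k, ‖G k j‖ ≤ δ := fun j hj => by
    have := hG k j
    rwa [Matrix.one_apply_ne (Finset.ne_of_mem_erase hj).symm, sub_zero] at this
  have h2 := Finset.sum_le_sum h1
  rw [Finset.sum_const, Finset.card_erase_of_mem (Finset.mem_univ k), Finset.card_univ,
    nsmul_eq_mul] at h2
  have h3 : ((Fintype.card ι - 1 : ℕ) : ℝ) = Fintype.card ι - 1 := by
    rw [Nat.cast_sub (Fintype.card_pos_iff.2 ⟨k⟩)]; simp
  rw [h3] at h2
  have h4 : 1 - δ ≤ ‖G k k‖ := by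
    have := hG k k
    rw [Matrix.one_apply_eq] at this
    have h5 := abs_le.1 this
    exact le_trans (by linarith) (le_abs_self _)
  linarith

/-- From `B - 1 = B * (1 - G)`, each entry of `B - 1` is at most half the largest entry of `B` in
absolute value. The largest entry is therefore at most `2`, and inserting this again gives the
second bound. -/
lemma inverse_near_one {G B : Matrix ι ι ℝ} {δ : ℝ} (hδ0 : 0 ≤ δ)
    (hδ : Fintype.card ι * δ ≤ 1 / 2) (hG : ∀ p q, |G p q - (1 : Matrix ι ι ℝ) p q| ≤ δ)
    (hBG : B * G = 1) (p q : ι) :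
    |B p q| ≤ 2 ∧ |B p q - (1 : Matrix ι ι ℝ) p q| ≤ 2 * Fintype.card ι * δ := by
  have hne : (Finset.univ : Finset (ι × ι)).Nonempty := ⟨(p, q), Finset.mem_univ _⟩
  obtain ⟨⟨p₀, q₀⟩, -, hmax⟩ := Finset.exists_max_image Finset.univ (fun x : ι × ι => |B x.1 x.2|) hne
  have hm : ∀ p q, |B p q| ≤ |B p₀ q₀| := fun p q => hmax (p, q) (Finset.mem_univ _)
  have hdiff : ∀ p q, |B p q - (1 : Matrix ι ι ℝ) p q| ≤ Fintype.card ι * (|B p₀ q₀| * δ) := by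
    intro p q
    have h1 : B p q - (1 : Matrix ι ι ℝ) p q = ∑ r, B p r * ((1 : Matrix ι ι ℝ) r q - G r q) := by
      have h2 : B * (1 - G) = B - 1 := by rw [mul_sub, mul_one, hBG]
      have h3 := congrFun (congrFun h2 p) q
      rw [Matrix.mul_apply] at h3
      exact h3.symm
    rw [h1]
    refine (Finset.abs_sum_le_sum_abs _ _).trans ?_
    calc ∑ r, |B p r * ((1 : Matrix ι ι ℝ) r q - G r q)| ≤ ∑ _r : ι, |B p₀ q₀| * δ := by
          refine Finset.sum_le_sum fun r _ => ?_
          rw [abs_mul, abs_sub_comm]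
          exact mul_le_mul (hm p r) (hG r q) (abs_nonneg _) (abs_nonneg _)
      _ = _ := by rw [Finset.sum_const, Finset.card_univ, nsmul_eq_mul]
  have h2 : |B p₀ q₀| ≤ 2 := by
    have h3 := hdiff p₀ q₀
    have h4 : |(1 : Matrix ι ι ℝ) p₀ q₀| ≤ 1 := by
      rw [Matrix.one_apply]; split_ifs <;> simp
    have h5 := abs_add_le (B p₀ q₀ - (1 : Matrix ι ι ℝ) p₀ q₀) ((1 : Matrix ι ι ℝ) p₀ q₀)
    rw [sub_add_cancel] at h5
    nlinarith [abs_nonneg (B p₀ q₀)]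
  refine ⟨(hm p q).trans h2, (hdiff p q).trans ?_⟩
  have : Fintype.card ι * (|B p₀ q₀| * δ) ≤ Fintype.card ι * (2 * δ) := by gcongr
  linarith

lemma norm_mul_norm_le_sum_sq (ℓ : ι → ℂ) (p q : ι) : ‖ℓ p‖ * ‖ℓ q‖ ≤ ∑ r, ‖ℓ r‖ ^ 2 := by
  have h : ∀ p, ‖ℓ p‖ ^ 2 ≤ ∑ r, ‖ℓ r‖ ^ 2 := fun p =>
    Finset.single_le_sum (f := fun r => ‖ℓ r‖ ^ 2) (fun _ _ => by positivity) (Finset.mem_univ p)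
  nlinarith [h p, h q, sq_nonneg (‖ℓ p‖ - ‖ℓ q‖)]

lemma abs_quadratic_sub_le {B : Matrix ι ι ℝ} {δ : ℝ}
    (hB : ∀ p q, |B p q - (1 : Matrix ι ι ℝ) p q| ≤ δ) (ℓ : ι → ℂ) :
    |∑ q, ∑ r, B q r * (ℓ q * (starRingEnd ℂ) (ℓ r)).re - ∑ q, ‖ℓ q‖ ^ 2| ≤
      Fintype.card ι ^ 2 * δ * ∑ r, ‖ℓ r‖ ^ 2 := by
  have h1 : ∑ q, ‖ℓ q‖ ^ 2 =
      ∑ q, ∑ r, (1 : Matrix ι ι ℝ) q r * (ℓ q * (starRingEnd ℂ) (ℓ r)).re := by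
    refine Finset.sum_congr rfl fun q _ => ?_
    rw [Finset.sum_eq_single q (fun r _ hr => by rw [Matrix.one_apply_ne hr.symm, zero_mul])
      (fun h => absurd (Finset.mem_univ q) h), Matrix.one_apply_eq, one_mul, Complex.mul_conj,
      Complex.ofReal_re, Complex.normSq_eq_norm_sq]
  have h2 : ∀ q r, |B q r * (ℓ q * (starRingEnd ℂ) (ℓ r)).re -
      (1 : Matrix ι ι ℝ) q r * (ℓ q * (starRingEnd ℂ) (ℓ r)).re| ≤ δ * ∑ r, ‖ℓ r‖ ^ 2 := by
    intro q r
    rw [← sub_mul, abs_mul]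
    refine mul_le_mul (hB q r) ?_ (abs_nonneg _) ((abs_nonneg _).trans (hB q r))
    refine (Complex.abs_re_le_norm _).trans ?_
    rw [norm_mul, RCLike.norm_conj]
    exact norm_mul_norm_le_sum_sq ℓ q r
  conv_lhs => rw [h1]
  simp only [← Finset.sum_sub_distrib]
  refine (Finset.abs_sum_le_sum_abs _ _).trans ?_
  calc _ ≤ ∑ _q : ι, ∑ _r : ι, δ * ∑ r, ‖ℓ r‖ ^ 2 := Finset.sum_le_sum fun q _ =>
        (Finset.abs_sum_le_sum_abs _ _).trans (Finset.sum_le_sum fun r _ => h2 q r)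
    _ = _ := by simp only [Finset.sum_const, Finset.card_univ, nsmul_eq_mul]; ring

end MatrixPerturbation

/-! ### Almost unitary frames -/

section FramePerturbation

attribute [local instance] cnNormedAddCommGroup cnNormedSpaceReal cnNormedSpaceComplex
  cnDualNormedAddCommGroup cnBilinNormedAddCommGroup

variable {n a : ℕ} {Y : Type*} [TopologicalSpace Y] [ChartedSpace (Cn (n + 1)) Y]
  {π : Y → ℂ} {D : Fin a → Set Y} {s : ℂ} [IsManifold 𝓘(ℂ, Cn (n + 1)) ω Y]
  {γ : KahlerMetric (n + 1) Y}

/-- The number of elements of a real frame of the fibre. -/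
abbrev frameCard (n : ℕ) : ℝ := Fintype.card (Fin n × Fin 2)

/-- Almost unitary frames. -/
structure IsAlmostUnitary (π : Y → ℂ) (γ : KahlerMetric (n + 1) Y) (y : Y) (δ : ℝ)
    (w : Fin n × Fin 2 → Cn (n + 1)) : Prop where
  nonneg : 0 ≤ δ
  small : frameCard n * δ ≤ 1 / 2
  mem : ∀ p, hd (m := n + 1) π y (w p) = 0
  gram : ∀ p q, |γ.gm y (w p) (w q) -
    (1 : Matrix (Fin n × Fin 2) (Fin n × Fin 2) ℝ) p q| ≤ δ
  sympl : ∀ p q, |γ.gm y (Complex.I • w p) (w q) - stdSympl p q| ≤ δ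

lemma abs_stdSympl_le (p q : Fin n × Fin 2) : |stdSympl p q| ≤ 1 := by
  rw [stdSympl]; split_ifs <;> simp

/-- Frames of the fibre and the inverses of their Gram matrices. -/
lemma IsUnitary.exists_inverse_gram {y : Y} {w : Fin n × Fin 2 → Cn (n + 1)} {b : Fin n → Cn (n + 1)}
    (hb : IsUnitary π γ y b) (hw : ∀ p, hd (m := n + 1) π y (w p) = 0)
    (hdet : (Matrix.of fun p q => γ.gm y (w p) (w q)).det ≠ 0) :
    IsFrame π y w ∧ ∃ B : Matrix (Fin n × Fin 2) (Fin n × Fin 2) ℝ,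
      B * (Matrix.of fun p q => γ.gm y (w p) (w q)) = 1 ∧
      (∀ p, Complex.I • w p = ∑ q, (∑ r, γ.gm y (Complex.I • w p) (w r) * B r q) • w q) ∧
      ∀ s f, fibreDiffNormSq π D γ s f y = (1 / 2) * ∑ q, ∑ r, B q r *
        (fibreDiffL π D s f y (w q) * (starRingEnd ℂ) (fibreDiffL π D s f y (w r))).re := by
  obtain ⟨A, hA⟩ := hb.isFrame.exists_matrix hw
  set u := realFrame b with hu
  set G : Matrix (Fin n × Fin 2) (Fin n × Fin 2) ℝ := A * A.transpose with hG
  have hGe : ∀ p q, γ.gm y (w p) (w q) = G p q := by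
    intro p q
    rw [hA]
    simp only [map_sum, map_smul, sum_apply, smul_apply, hu, hb.gram, Matrix.one_apply,
      Matrix.mul_apply, smul_eq_mul, mul_ite, mul_one, mul_zero, Finset.sum_ite_eq',
      Finset.mem_univ, if_true, Matrix.transpose_apply, hG]
    exact Finset.sum_congr rfl fun _ _ => mul_comm _ _
  have hGof : (Matrix.of fun p q => γ.gm y (w p) (w q)) = G := by
    ext p q
    exact hGe p q
  rw [hGof] at hdet ⊢
  have hdetA : IsUnit A.det := by
    rw [hG, Matrix.det_mul] at hdet
    exact isUnit_iff_ne_zero.2 (left_ne_zero_of_mul hdet)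
  -- The matrix `C` expresses the unitary frame by `w`, and `Cᵀ C` is the inverse Gram matrix.
  set C := A⁻¹ with hC
  have hCA : C * A = 1 := Matrix.nonsing_inv_mul A hdetA
  have hAC : A * C = 1 := Matrix.mul_nonsing_inv A hdetA
  have huw : ∀ q, u q = ∑ p, C q p • w p := by
    intro q
    have h1 : ∑ p, C q p • w p = ∑ r, (C * A) q r • u r := by
      simp only [hA, Matrix.mul_apply, Finset.smul_sum, Finset.sum_smul, smul_smul]
      exact Finset.sum_comm
    rw [h1, hCA, Finset.sum_eq_single q (fun r _ hr => by rw [Matrix.one_apply_ne hr.symm, zero_smul])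
      (fun h => absurd (Finset.mem_univ q) h), Matrix.one_apply_eq, one_smul]
  have hBG : (C.transpose * C) * G = 1 := by
    rw [hG, Matrix.mul_assoc, ← Matrix.mul_assoc C, hCA, Matrix.one_mul, ← Matrix.transpose_mul,
      hAC, Matrix.transpose_one]
  refine ⟨⟨hw, fun v hv => ?_⟩, C.transpose * C, hBG, fun p => ?_, fun s f => ?_⟩
  · obtain ⟨c, rfl⟩ := hb.isFrame.span v hv
    refine ⟨fun p => ∑ q, c q * C q p, ?_⟩
    change ∑ q, c q • u q = _
    simp only [huw, Finset.smul_sum, Finset.sum_smul, smul_smul]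
    exact Finset.sum_comm
  -- The coefficients of `I • w p` in the frame `w` are recovered by pairing with the frame and
  -- applying the inverse Gram matrix.
  · have hmem : hd (m := n + 1) π y (Complex.I • w p) = 0 := by
      rw [map_smul, hw, smul_zero]
    obtain ⟨c, hc⟩ := hb.isFrame.span _ hmem
    have hexp : Complex.I • w p = ∑ q, (∑ r, c r * C r q) • w q := by
      rw [hc]
      change ∑ q, c q • u q = _
      simp only [huw, Finset.smul_sum, Finset.sum_smul, smul_smul]
      exact Finset.sum_comm
    set d : Fin n × Fin 2 → ℝ := fun q => ∑ r, c r * C r q with hd'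
    have hS : ∀ r, γ.gm y (Complex.I • w p) (w r) = ∑ q, d q * G q r := by
      intro r
      rw [hexp]
      simp only [map_sum, map_smul, sum_apply, smul_apply, hGe, smul_eq_mul]
      rfl
    have hGB : G * (C.transpose * C) = 1 := mul_eq_one_comm.1 hBG
    have hdq : ∀ q, ∑ r, γ.gm y (Complex.I • w p) (w r) * (C.transpose * C) r q = d q := by
      intro q
      simp only [hS, Finset.sum_mul]
      rw [Finset.sum_comm]
      have h3 : ∀ t, ∑ r, d t * G t r * (C.transpose * C) r q =
          d t * (1 : Matrix (Fin n × Fin 2) (Fin n × Fin 2) ℝ) t q := by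
        intro t
        rw [← hGB, Matrix.mul_apply, Finset.mul_sum]
        exact Finset.sum_congr rfl fun r _ => mul_assoc _ _ _
      simp only [h3, Matrix.one_apply, mul_ite, mul_one, mul_zero, Finset.sum_ite_eq',
        Finset.mem_univ, if_true]
    rw [hexp]
    refine Finset.sum_congr rfl fun q _ => ?_
    rw [← hexp, hdq]
  · rw [hb.fibreDiffNormSq_eq, ← sum_norm_sq_matrix]
    congr 1
    refine Finset.sum_congr rfl fun p _ => ?_
    change ‖fibreDiffL π D s f y (u p)‖ ^ 2 = _
    rw [huw]
    simp only [map_sum, map_smul, Complex.real_smul]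

lemma IsAlmostUnitary.exists_inverse_gram {y : Y} {δ : ℝ} {w : Fin n × Fin 2 → Cn (n + 1)}
    (hw : IsAlmostUnitary π γ y δ w) {b : Fin n → Cn (n + 1)} (hb : IsUnitary π γ y b) :
    IsFrame π y w ∧ ∃ B : Matrix (Fin n × Fin 2) (Fin n × Fin 2) ℝ,
      (∀ p q, |B p q| ≤ 2) ∧
      (∀ p q, |B p q - (1 : Matrix (Fin n × Fin 2) (Fin n × Fin 2) ℝ) p q| ≤
        2 * frameCard n * δ) ∧
      (∀ p, Complex.I • w p = ∑ q, (∑ r, γ.gm y (Complex.I • w p) (w r) * B r q) • w q) ∧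
      ∀ s f, fibreDiffNormSq π D γ s f y = (1 / 2) * ∑ q, ∑ r, B q r *
        (fibreDiffL π D s f y (w q) * (starRingEnd ℂ) (fibreDiffL π D s f y (w r))).re := by
  obtain ⟨h1, B, hB, h2, h3⟩ := hb.exists_inverse_gram (D := D) hw.mem
    (det_ne_zero_of_near_one hw.small hw.gram)
  have h4 := inverse_near_one hw.nonneg hw.small hw.gram hB
  exact ⟨h1, B, fun p q => (h4 p q).1, fun p q => (h4 p q).2, h2, h3⟩

/-- The constant in the Lipschitz estimate for wedge products. -/
def wedgeConst (n : ℕ) : ℝ := 1 / 2 ^ n * Fintype.card (Equiv.Perm (Fin n × Fin 2)) * n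

lemma wedgeConst_nonneg (n : ℕ) : 0 ≤ wedgeConst n := by unfold wedgeConst; positivity

lemma IsAlmostUnitary.delta_le_one {y : Y} {δ : ℝ} {w : Fin n × Fin 2 → Cn (n + 1)} (hn : 1 ≤ n)
    (hw : IsAlmostUnitary π γ y δ w) : δ ≤ 1 := by
  have h1 : (1 : ℝ) ≤ frameCard n := by
    have : 1 ≤ Fintype.card (Fin n × Fin 2) := by simp; omega
    exact_mod_cast this
  nlinarith [hw.small, hw.nonneg]

/-- The value of `γⁿ` is a polynomial in the entries `γ(J w_p, w_q)`. These and the standard ones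
are bounded by `2`, whence the factor `2 ^ n`. -/
lemma IsAlmostUnitary.exists_gammaPow_eq {y : Y} {δ : ℝ} {w : Fin n × Fin 2 → Cn (n + 1)}
    (hn : 1 ≤ n) (hw : IsAlmostUnitary π γ y δ w) :
    ∃ r : ℝ, gammaPow γ y w = r ∧ |r - volConst n| ≤ wedgeConst n * 2 ^ n * δ := by
  have hδ := hw.delta_le_one hn
  obtain ⟨r, hr⟩ : ∃ r : ℝ, gammaPow γ y w = r := by
    refine ⟨(1 / 2 ^ n) * ∑ σ : Equiv.Perm (Fin n × Fin 2), ((Equiv.Perm.sign σ : ℤ) : ℝ) *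
      ∏ j, γ.gm y (Complex.I • w (σ (j, 0))) (w (σ (j, 1))), ?_⟩
    rw [gammaPow_eq_wedgeM, wedgeM]
    push_cast
    rfl
  refine ⟨r, hr, ?_⟩
  have h1 : ‖gammaPow γ y w - volConst n‖ ≤ wedgeConst n * δ * ∏ _j : Fin n, (2 : ℝ) := by
    rw [gammaPow_eq_wedgeM, ← wedgeM_stdSympl]
    refine norm_wedgeM_sub_le hw.nonneg (fun _ p q => ?_) (fun _ p q => ?_) (fun _ p q => ?_)
    · rw [Complex.norm_real]
      have h2 := abs_add_le (γ.gm y (Complex.I • w p) (w q) - stdSympl p q) (stdSympl p q)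
      rw [sub_add_cancel] at h2
      have h3 := hw.sympl p q
      have h4 := abs_stdSympl_le p q
      rw [Real.norm_eq_abs]
      linarith
    · rw [Complex.norm_real]
      exact (abs_stdSympl_le p q).trans one_le_two
    · rw [← Complex.ofReal_sub, Complex.norm_real]
      have := hw.sympl p q
      have h5 := hw.nonneg
      rw [Real.norm_eq_abs]
      linarith
  rw [hr, ← Complex.ofReal_sub, Complex.norm_real, Real.norm_eq_abs, Finset.prod_const,
    Finset.card_univ, Fintype.card_fin] at h1
  linarith

end FramePerturbation

/-! ### Pointwise comparison of integrands on two fibres -/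

section PointwiseEstimates

attribute [local instance] cnNormedAddCommGroup cnNormedSpaceReal cnNormedSpaceComplex
  cnDualNormedAddCommGroup cnBilinNormedAddCommGroup

variable {n a : ℕ} {Y : Type*} [TopologicalSpace Y] [ChartedSpace (Cn (n + 1)) Y]
  {π : Y → ℂ} {D : Fin a → Set Y} {s s' : ℂ}

/-- The two-form `df ∧ dᶜf` on the tangent space, in terms of `df`. -/
def dcBil (ℓ : Cn (n + 1) →L[ℝ] ℂ) : Cn (n + 1) →ₗ[ℝ] Cn (n + 1) →ₗ[ℝ] ℂ :=
  LinearMap.mk₂ ℝ (fun u w => ℓ u * (-(1 / 2) * ℓ (Complex.I • w)) -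
      ℓ w * (-(1 / 2) * ℓ (Complex.I • u)))
    (fun u u' w => by rw [map_add, smul_add, map_add]; ring)
    (fun c u w => by
      rw [smul_comm Complex.I c u, map_smul ℓ c u, map_smul ℓ c (Complex.I • u)]
      simp only [Complex.real_smul]; ring)
    (fun u w w' => by rw [map_add, smul_add, map_add]; ring)
    (fun c u w => by
      rw [smul_comm Complex.I c w, map_smul ℓ c w, map_smul ℓ c (Complex.I • w)]
      simp only [Complex.real_smul]; ring)

lemma dcBil_apply (ℓ : Cn (n + 1) →L[ℝ] ℂ) (u w : Cn (n + 1)) : dcBil ℓ u w =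
    ℓ u * (-(1 / 2) * ℓ (Complex.I • w)) - ℓ w * (-(1 / 2) * ℓ (Complex.I • u)) := rfl

/-- The form `df ∧ dᶜf ∧ α^{n-1}` at a point as an alternating map. -/
def dcAlt (ℓ : Cn (n + 1) →L[ℝ] ℂ) (α : DForm (m := n + 1) Y 2) (y : Y) :
    Cn (n + 1) [⋀^Fin n × Fin 2]→ₗ[ℝ] ℂ :=
  wedgeAlt fun j => if (j : ℕ) = 0 then dcBil ℓ else α.bil y

lemma dWedgeDcPow_eq (f : Y → ℂ) (α : DForm (m := n + 1) Y 2) (y : Y) :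
    dWedgeDcPow π D s f α y = dcAlt (fibreDiffL π D s f y) α y := by
  funext v
  refine Eq.trans ?_ (wedgeAlt_apply _ v).symm
  rw [dWedgeDcPow]
  congr 1
  funext j u w
  split_ifs
  · rfl
  · rfl

lemma mulPow_eq (f : Y → ℂ) (α : DForm (m := n + 1) Y 2) (y : Y) :
    mulPow f α y = (f y • wedgeAlt (fun _ => α.bil y) : Cn (n + 1) [⋀^Fin n × Fin 2]→ₗ[ℝ] ℂ) := by
  funext v
  refine congrArg (f y * ·) ?_
  exact (wedgeAlt_apply (fun _ => α.bil y) v).symm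

variable [IsManifold 𝓘(ℂ, Cn (n + 1)) ω Y] {γ : KahlerMetric (n + 1) Y}

lemma prod_ite_zero (hn : 1 ≤ n) (x y : ℝ) :
    ∏ j : Fin n, (if (j : ℕ) = 0 then x else y) = x * y ^ (n - 1) := by
  obtain ⟨k, rfl⟩ := Nat.exists_eq_add_of_le' hn
  rw [Fin.prod_univ_succ]
  simp

lemma frameCard_nonneg (n : ℕ) : 0 ≤ frameCard n := Nat.cast_nonneg _

variable {z y : Y} {b b' : Fin n → Cn (n + 1)} {w : Fin n × Fin 2 → Cn (n + 1)} {δ : ℝ}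
  {f χ : Y → ℂ}

/-- The two differentials take the same values on corresponding frames, so only the deviation of the
inverse Gram matrix from the identity counts. -/
lemma IsAlmostUnitary.abs_fibreDiffNormSq_sub_le (hw : IsAlmostUnitary π γ y δ w)
    (hb' : IsUnitary π γ y b') (hb : IsUnitary π γ z b)
    (hf : ∀ p, fibreDiffL π D s f y (w p) = fibreDiffL π D s' χ z (realFrame b p)) :
    |fibreDiffNormSq π D γ s f y - fibreDiffNormSq π D γ s' χ z| ≤
      2 * frameCard n ^ 3 * δ * fibreDiffNormSq π D γ s' χ z := by
  obtain ⟨-, B, -, hB, -, h⟩ := hw.exists_inverse_gram (D := D) hb'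
  rw [h, hb.fibreDiffNormSq_eq, ← mul_sub, abs_mul]
  simp only [hf]
  have h1 := abs_quadratic_sub_le hB fun p => fibreDiffL π D s' χ z (realFrame b p)
  have h2 : |(1 / 2 : ℝ)| = 1 / 2 := abs_of_pos (by norm_num)
  rw [h2]
  refine (mul_le_mul_of_nonneg_left h1 (by norm_num)).trans_eq ?_
  change 1 / 2 * (frameCard n ^ 2 * (2 * frameCard n * δ) * _) = _
  ring

/-- The ratio of the volume forms. -/
def volRatio (γ : KahlerMetric (n + 1) Y) (y : Y) (w : Fin n × Fin 2 → Cn (n + 1)) : ℝ :=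
  (gammaPow γ y w).re / volConst n

lemma IsAlmostUnitary.abs_volRatio_sub_le (hn : 1 ≤ n) (hw : IsAlmostUnitary π γ y δ w) :
    |volRatio γ y w - 1| ≤ wedgeConst n * 2 ^ n / volConst n * δ := by
  obtain ⟨r, hr, h⟩ := hw.exists_gammaPow_eq hn
  have hv := volConst_pos n
  rw [volRatio, hr, Complex.ofReal_re, div_sub_one hv.ne', abs_div, abs_of_pos hv, div_le_iff₀ hv]
  refine h.trans_eq ?_
  field_simp

/-- The common estimate for quotients by the volume form. -/
lemma IsAlmostUnitary.norm_topQuotient_sub_le (hn : 1 ≤ n) (hw : IsAlmostUnitary π γ y δ w)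
    (hvol : wedgeConst n * 2 ^ n / volConst n * δ ≤ 1 / 2)
    (hb' : IsUnitary π γ y b') (hb : IsUnitary π γ z b)
    (Ψ' Ψ : Cn (n + 1) [⋀^Fin n × Fin 2]→ₗ[ℝ] ℂ) :
    ‖volRatio γ y w * topQuotient π γ y Ψ' - topQuotient π γ z Ψ‖ =
      ‖Ψ' w - Ψ (realFrame b)‖ / volConst n := by
  obtain ⟨r, hr, -⟩ := hw.exists_gammaPow_eq hn
  obtain ⟨hfr, -⟩ := hw.exists_inverse_gram (D := (fun i => i.elim0 : Fin 0 → Set Y)) hb'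
  have h1 := hw.abs_volRatio_sub_le hn
  have hv := volConst_pos n
  have hvC : (volConst n : ℂ) ≠ 0 := by exact_mod_cast hv.ne'
  have hr0 : (r : ℂ) ≠ 0 := by
    intro h0
    have h2 : r = 0 := by exact_mod_cast h0
    rw [volRatio, hr, Complex.ofReal_re, h2, zero_div, zero_sub, abs_neg, abs_one] at h1
    linarith
  rw [hfr.topQuotient_eq (by rw [hr]; exact hr0), hb.isFrame.topQuotient_eq hb.gammaPow_ne_zero,
    volRatio, hr, hb.gammaPow_eq, Complex.ofReal_re]
  have h3 : ((r / volConst n : ℝ) : ℂ) * (Ψ' w / r) - Ψ (realFrame b) / volConst n =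
      (Ψ' w - Ψ (realFrame b)) / volConst n := by
    push_cast
    field_simp
  rw [h3, norm_div, Complex.norm_real, Real.norm_eq_abs, abs_of_pos hv]

variable {α : DForm (m := n + 1) Y 2} {M : ℝ}

/-- Multiplication by the volume ratio cancels the division by `γⁿ` up to `volConst n`. What remains
is the difference of the values of `αⁿ` on the two frames. -/
lemma IsAlmostUnitary.norm_mulPow_sub_le (hn : 1 ≤ n) (hw : IsAlmostUnitary π γ y δ w)
    (hvol : wedgeConst n * 2 ^ n / volConst n * δ ≤ 1 / 2)
    (hb' : IsUnitary π γ y b') (hb : IsUnitary π γ z b)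
    (hα : ∀ p q, ‖α.bil z (realFrame b p) (realFrame b q)‖ ≤ M)
    (hα' : ∀ p q, ‖α.bil y (w p) (w q) - α.bil z (realFrame b p) (realFrame b q)‖ ≤ δ * M)
    (hf : f y = χ z) :
    ‖volRatio γ y w * topQuotient π γ y (mulPow f α y) - topQuotient π γ z (mulPow χ α z)‖ ≤
      wedgeConst n * (2 * M) ^ n / volConst n * δ * ‖χ z‖ := by
  have hδ := hw.delta_le_one hn
  rw [mulPow_eq, mulPow_eq, hw.norm_topQuotient_sub_le hn hvol hb' hb]
  have h1 : ‖wedgeAlt (fun _ => α.bil y) w - wedgeAlt (fun _ => α.bil z) (realFrame b)‖ ≤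
      wedgeConst n * δ * ∏ _j : Fin n, (2 * M) := by
    rw [wedgeAlt_apply, wedgeAlt_apply, wedgeTwo_eq_wedgeM, wedgeTwo_eq_wedgeM]
    refine norm_wedgeM_sub_le hw.nonneg (fun _ p q => ?_) (fun _ p q => ?_) (fun _ p q => ?_)
    · have h2 := norm_add_le (α.bil y (w p) (w q) - α.bil z (realFrame b p) (realFrame b q))
        (α.bil z (realFrame b p) (realFrame b q))
      rw [sub_add_cancel] at h2
      have h3 := hα p q
      have h4 := hα' p q
      have h5 : δ * M ≤ 1 * M := by
        gcongr
        exact (norm_nonneg _).trans h3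
      linarith
    · have h3 := hα p q
      have h4 := norm_nonneg (α.bil z (realFrame b p) (realFrame b q))
      linarith
    · have h3 := hα p q
      have h4 := norm_nonneg (α.bil z (realFrame b p) (realFrame b q))
      refine (hα' p q).trans ?_
      have := hw.nonneg
      gcongr
      linarith
  rw [Finset.prod_const, Finset.card_univ, Fintype.card_fin] at h1
  have h2 : (f y • wedgeAlt (fun _ => α.bil y) : Cn (n + 1) [⋀^Fin n × Fin 2]→ₗ[ℝ] ℂ) w -
      (χ z • wedgeAlt (fun _ => α.bil z) : Cn (n + 1) [⋀^Fin n × Fin 2]→ₗ[ℝ] ℂ) (realFrame b) =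
      χ z * (wedgeAlt (fun _ => α.bil y) w - wedgeAlt (fun _ => α.bil z) (realFrame b)) := by
    rw [hf, AlternatingMap.smul_apply, AlternatingMap.smul_apply, smul_eq_mul, smul_eq_mul, mul_sub]
  have hv := volConst_pos n
  rw [h2, norm_mul, div_le_iff₀ hv]
  calc _ ≤ ‖χ z‖ * (wedgeConst n * δ * (2 * M) ^ n) := by gcongr
    _ = _ := by field_simp

/-- The constant in the estimate of `df ∧ dᶜf ∧ α^{n-1}`. -/
def dcConst (n : ℕ) : ℝ := frameCard n + 2 * frameCard n ^ 2 * (1 + frameCard n)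

/-- The operator `dᶜ` evaluates the differential on `I • w p`, which need not be the image of `I • u
p`. It is expanded in the frame `w`, with coefficients within `O(δ)` of the standard symplectic
matrix. Only the first factor of the wedge product carries the energy `S`, so the bound is linear in
`S`; the factor `2` in the constant offsets the `1 / 2` in the norm. -/
lemma IsAlmostUnitary.norm_dWedgeDcPow_sub_le (hn : 1 ≤ n) (hw : IsAlmostUnitary π γ y δ w)
    (hvol : wedgeConst n * 2 ^ n / volConst n * δ ≤ 1 / 2)
    (hb' : IsUnitary π γ y b') (hb : IsUnitary π γ z b)
    (hα : ∀ p q, ‖α.bil z (realFrame b p) (realFrame b q)‖ ≤ M)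
    (hα' : ∀ p q, ‖α.bil y (w p) (w q) - α.bil z (realFrame b p) (realFrame b q)‖ ≤ δ * M)
    (hf : ∀ p, fibreDiffL π D s f y (w p) = fibreDiffL π D s' χ z (realFrame b p)) :
    ‖volRatio γ y w * topQuotient π γ y (dWedgeDcPow π D s f α y) -
        topQuotient π γ z (dWedgeDcPow π D s' χ α z)‖ ≤
      wedgeConst n * (2 * dcConst n * (2 * M) ^ (n - 1)) / volConst n * δ *
        fibreDiffNormSq π D γ s' χ z := by
  have hδ := hw.delta_le_one hn
  have hδ0 := hw.nonneg
  obtain ⟨-, B, hB2, hB, hI, -⟩ := hw.exists_inverse_gram (D := D) hb'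
  rw [dWedgeDcPow_eq, dWedgeDcPow_eq, hw.norm_topQuotient_sub_le hn hvol hb' hb,
    hb.fibreDiffNormSq_eq]
  set ℓ' := fibreDiffL (n := n) π D s f y
  set ℓ := fibreDiffL (n := n) π D s' χ z
  set u := realFrame b
  set N := frameCard n
  have hN : 0 ≤ N := frameCard_nonneg n
  set S := ∑ p, ‖ℓ (u p)‖ ^ 2 with hS
  have hS0 : 0 ≤ S := Finset.sum_nonneg fun _ _ => by positivity
  -- These are the coefficients of `I • w p` in the frame `w`.
  let T : Fin n × Fin 2 → Fin n × Fin 2 → ℝ := fun p q =>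
    ∑ r, γ.gm y (Complex.I • w p) (w r) * B r q
  have hT : ∀ p q, |T p q - stdSympl p q| ≤ 2 * N * (1 + N) * δ := by
    intro p q
    have h1 : stdSympl p q =
        ∑ r, stdSympl p r * (1 : Matrix (Fin n × Fin 2) (Fin n × Fin 2) ℝ) r q := by
      simp [Matrix.one_apply]
    rw [h1, ← Finset.sum_sub_distrib]
    refine (Finset.abs_sum_le_sum_abs _ _).trans ?_
    calc _ ≤ ∑ _r : Fin n × Fin 2, (δ * 2 + 1 * (2 * N * δ)) := by
          refine Finset.sum_le_sum fun r _ => ?_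
          have h2 : γ.gm y (Complex.I • w p) (w r) * B r q -
              stdSympl p r * (1 : Matrix (Fin n × Fin 2) (Fin n × Fin 2) ℝ) r q =
              (γ.gm y (Complex.I • w p) (w r) - stdSympl p r) * B r q +
              stdSympl p r * (B r q - (1 : Matrix (Fin n × Fin 2) (Fin n × Fin 2) ℝ) r q) := by ring
          rw [h2]
          refine (abs_add_le _ _).trans ?_
          rw [abs_mul, abs_mul]
          exact add_le_add (mul_le_mul (hw.sympl p r) (hB2 r q) (abs_nonneg _) hδ0)
            (mul_le_mul (abs_stdSympl_le p r) (hB r q) (abs_nonneg _) zero_le_one)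
      _ = _ := by
          rw [Finset.sum_const, Finset.card_univ, nsmul_eq_mul]
          change N * _ = _
          ring
  have hw' : ∀ p, ℓ' (Complex.I • w p) = ∑ q, (T p q : ℂ) * ℓ (u q) := by
    intro p
    rw [hI p]
    simp only [map_sum, map_smul, hf, Complex.real_smul]
    rfl
  have hu' : ∀ p, ℓ (Complex.I • u p) = ∑ q, (stdSympl p q : ℂ) * ℓ (u q) := by
    intro p
    rw [IsUnitary.I_smul (b := b)]
    simp only [map_sum, map_smul, Complex.real_smul]
    rfl
  -- A product of two values of `ℓ` on the frame is at most `S`, so a combination of `N` of them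
  -- with coefficients bounded by `c` is at most `N * c * S`.
  have hlin : ∀ (X : Fin n × Fin 2 → ℝ) (c : ℝ) (p : Fin n × Fin 2), (∀ q, |X q| ≤ c) →
      ‖ℓ (u p)‖ * ‖∑ q, (X q : ℂ) * ℓ (u q)‖ ≤ N * c * S := by
    intro X c p hX
    calc _ ≤ ‖ℓ (u p)‖ * ∑ q, ‖(X q : ℂ) * ℓ (u q)‖ := by gcongr; exact norm_sum_le _ _
      _ = ∑ q, |X q| * (‖ℓ (u p)‖ * ‖ℓ (u q)‖) := by
          rw [Finset.mul_sum]
          refine Finset.sum_congr rfl fun q _ => ?_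
          rw [norm_mul, Complex.norm_real, Real.norm_eq_abs]
          ring
      _ ≤ ∑ _q : Fin n × Fin 2, c * S := by
          refine Finset.sum_le_sum fun q _ => mul_le_mul (hX q)
            (norm_mul_norm_le_sum_sq (fun p => ℓ (u p)) p q) (by positivity)
            ((abs_nonneg _).trans (hX q))
      _ = _ := by
          rw [Finset.sum_const, Finset.card_univ, nsmul_eq_mul]
          change N * _ = _
          ring
  have hd1 : ∀ p q, ‖dcBil ℓ (u p) (u q)‖ ≤ N * S := by
    intro p q
    rw [dcBil_apply]
    have h1 := hlin (fun r => stdSympl q r) 1 p (fun r => abs_stdSympl_le q r)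
    have h2 := hlin (fun r => stdSympl p r) 1 q (fun r => abs_stdSympl_le p r)
    rw [← hu'] at h1 h2
    refine (norm_sub_le _ _).trans ?_
    rw [norm_mul, norm_mul, norm_mul, norm_mul]
    have h3 : ‖(-(1 / 2) : ℂ)‖ = 1 / 2 := by simp
    rw [h3]
    linarith
  have hd2 : ∀ p q, ‖dcBil ℓ' (w p) (w q) - dcBil ℓ (u p) (u q)‖ ≤
      δ * (2 * N ^ 2 * (1 + N) * S) := by
    intro p q
    have h0 : ∀ p, ℓ' (Complex.I • w p) - ℓ (Complex.I • u p) =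
        ∑ r, ((T p r - stdSympl p r : ℝ) : ℂ) * ℓ (u r) := by
      intro p
      rw [hw', hu', ← Finset.sum_sub_distrib]
      refine Finset.sum_congr rfl fun r _ => ?_
      push_cast
      ring
    have h1 := hlin (fun r => T q r - stdSympl q r) _ p (fun r => hT q r)
    have h2 := hlin (fun r => T p r - stdSympl p r) _ q (fun r => hT p r)
    rw [← h0] at h1 h2
    rw [dcBil_apply, dcBil_apply, hf, hf]
    have h4 : ℓ (u p) * (-(1 / 2) * ℓ' (Complex.I • w q)) -
          ℓ (u q) * (-(1 / 2) * ℓ' (Complex.I • w p)) -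
        (ℓ (u p) * (-(1 / 2) * ℓ (Complex.I • u q)) - ℓ (u q) * (-(1 / 2) * ℓ (Complex.I • u p))) =
        (-(1 / 2)) * (ℓ (u p) * (ℓ' (Complex.I • w q) - ℓ (Complex.I • u q))) -
        (-(1 / 2)) * (ℓ (u q) * (ℓ' (Complex.I • w p) - ℓ (Complex.I • u p))) := by ring
    rw [h4]
    refine (norm_sub_le _ _).trans ?_
    rw [norm_mul, norm_mul, norm_mul, norm_mul]
    have h3 : ‖(-(1 / 2) : ℂ)‖ = 1 / 2 := by simp
    rw [h3]
    linarith
  have hM : 0 ≤ M := (norm_nonneg _).trans (hα (⟨0, hn⟩, 0) (⟨0, hn⟩, 0))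
  have hc0 : 0 ≤ 2 * N ^ 2 * (1 + N) * S := by positivity
  have hdc : dcConst n * S = N * S + 2 * N ^ 2 * (1 + N) * S := by
    rw [dcConst]; ring
  have h1 : ‖dcAlt ℓ' α y w - dcAlt ℓ α z u‖ ≤
      wedgeConst n * δ * ∏ j : Fin n, (if (j : ℕ) = 0 then dcConst n * S else 2 * M) := by
    rw [dcAlt, dcAlt, wedgeAlt_apply, wedgeAlt_apply, wedgeTwo_eq_wedgeM, wedgeTwo_eq_wedgeM]
    have hNS : 0 ≤ N * S := by positivity
    have h5 : δ * (2 * N ^ 2 * (1 + N) * S) ≤ 1 * (2 * N ^ 2 * (1 + N) * S) := by gcongr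
    have h6 : δ * M ≤ 1 * M := by gcongr
    refine norm_wedgeM_sub_le hw.nonneg (fun j p q => ?_) (fun j p q => ?_) (fun j p q => ?_)
    · split_ifs with hj
      · have h2 := norm_add_le (dcBil ℓ' (w p) (w q) - dcBil ℓ (u p) (u q)) (dcBil ℓ (u p) (u q))
        rw [sub_add_cancel] at h2
        have h3 := hd1 p q
        have h4 := hd2 p q
        linarith
      · have h2 := norm_add_le (α.bil y (w p) (w q) - α.bil z (u p) (u q)) (α.bil z (u p) (u q))
        rw [sub_add_cancel] at h2
        have h3 := hα p q
        have h4 := hα' p q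
        linarith
    · split_ifs with hj
      · have h3 := hd1 p q
        linarith
      · have h3 := hα p q
        linarith
    · split_ifs with hj
      · exact (hd2 p q).trans (mul_le_mul_of_nonneg_left (by linarith) hδ0)
      · refine (hα' p q).trans ?_
        gcongr
        linarith
  rw [prod_ite_zero hn] at h1
  have hv := volConst_pos n
  rw [div_le_iff₀ hv]
  refine h1.trans_eq ?_
  field_simp

end PointwiseEstimates

/-! ### Continuity of the integrands along the fibres -/

section Continuity

attribute [local instance] cnNormedAddCommGroup cnNormedSpaceReal cnNormedSpaceComplex
  cnDualNormedAddCommGroup cnBilinNormedAddCommGroup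

variable {n a : ℕ} {Y : Type*} [TopologicalSpace Y] [ChartedSpace (Cn (n + 1)) Y]
  {π : Y → ℂ} {D : Fin a → Set Y} {s s' : ℂ}

/-- The real differential of a map from `ℂⁿ` to the total space. -/
def paramD (ψ : Cn n → Y) (x : Cn n) : Cn n →L[ℝ] Cn (n + 1) :=
  mfderiv 𝓘(ℝ, Cn n) 𝓘(ℝ, Cn (n + 1)) ψ x

variable [IsManifold 𝓘(ℂ, Cn (n + 1)) ω Y] {γ : KahlerMetric (n + 1) Y}

lemma contDiffAt_chart_comp {ψ : Cn n → Y} {x : Cn n} {e : OpenPartialHomeomorph Y (Cn (n + 1))}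
    (hψ : ContMDiffAt 𝓘(ℝ, Cn n) 𝓘(ℝ, Cn (n + 1)) ∞ ψ x)
    (he : e ∈ IsManifold.maximalAtlas 𝓘(ℂ, Cn (n + 1)) ω Y) (hx : ψ x ∈ e.source) :
    ContDiffAt ℝ ∞ (e ∘ ψ) x := by
  have h1 : ContMDiffAt 𝓘(ℝ, Cn (n + 1)) 𝓘(ℝ, Cn (n + 1)) ∞ e (ψ x) :=
    (contMDiffOn_of_mem_maximalAtlas (mem_maximalAtlas_real he)).contMDiffAt
      (e.open_source.mem_nhds hx)
  exact (ContMDiffAt.comp (g := e) x h1 hψ).contDiffAt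

lemma contMDiffAt_of_chart_comp {ψ : Cn n → Y} {x : Cn n} {e : OpenPartialHomeomorph Y (Cn (n + 1))}
    (hψ : ContDiffAt ℝ ∞ (e ∘ ψ) x)
    (he : e ∈ IsManifold.maximalAtlas 𝓘(ℂ, Cn (n + 1)) ω Y) (hx : ∀ᶠ x' in 𝓝 x, ψ x' ∈ e.source) :
    ContMDiffAt 𝓘(ℝ, Cn n) 𝓘(ℝ, Cn (n + 1)) ∞ ψ x := by
  have h1 : ContMDiffAt 𝓘(ℝ, Cn (n + 1)) 𝓘(ℝ, Cn (n + 1)) ∞ e.symm ((e ∘ ψ) x) :=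
    (contMDiffOn_symm_of_mem_maximalAtlas (mem_maximalAtlas_real he)).contMDiffAt
      (e.open_target.mem_nhds (e.map_source hx.self_of_nhds))
  refine (ContMDiffAt.comp (g := e.symm) x h1 hψ.contMDiffAt).congr_of_eventuallyEq ?_
  filter_upwards [hx] with x' hx'
  exact (e.left_inv hx').symm

lemma FibreParam.continuousAt (φ : FibreParam (n := n) π D s) {x : Cn n} (hx : x ∈ φ.dom) :
    ContinuousAt φ.map x := φ.continuousOn.continuousAt (φ.isOpen_dom.mem_nhds hx)

lemma FibreParam.contMDiffAt (φ : FibreParam (n := n) π D s) {x : Cn n} (hx : x ∈ φ.dom) :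
    ContMDiffAt 𝓘(ℝ, Cn n) 𝓘(ℝ, Cn (n + 1)) ∞ φ.map x := by
  have he : chartAt (Cn (n + 1)) (φ.map x) ∈ IsManifold.maximalAtlas 𝓘(ℂ, Cn (n + 1)) ω Y :=
    IsManifold.chart_mem_maximalAtlas _
  have hs := mem_chart_source (Cn (n + 1)) (φ.map x)
  exact contMDiffAt_of_chart_comp (φ.contDiffAt_chart hx he hs) he
    ((φ.continuousAt hx).eventually ((chartAt (Cn (n + 1)) (φ.map x)).open_source.mem_nhds hs))

lemma chartD_paramD {ψ : Cn n → Y} {x : Cn n} {e : OpenPartialHomeomorph Y (Cn (n + 1))}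
    (hψ : MDifferentiableAt 𝓘(ℝ, Cn n) 𝓘(ℝ, Cn (n + 1)) ψ x)
    (he : e ∈ IsManifold.maximalAtlas 𝓘(ℂ, Cn (n + 1)) ω Y) (hx : ψ x ∈ e.source) (u : Cn n) :
    chartD e (ψ x) (paramD ψ x u) = fderiv ℝ (e ∘ ψ) x u := by
  have h := hasFDerivAt_of_hasMFDerivAt ((hasMFDerivAt_chart he hx).comp x hψ.hasMFDerivAt)
  rw [h.fderiv]
  rfl

lemma ContMDiffAt.eventually_chart {ψ : Cn n → Y} {x : Cn n}
    {e : OpenPartialHomeomorph Y (Cn (n + 1))}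
    (hψ : ContMDiffAt 𝓘(ℝ, Cn n) 𝓘(ℝ, Cn (n + 1)) ∞ ψ x)
    (he : e ∈ IsManifold.maximalAtlas 𝓘(ℂ, Cn (n + 1)) ω Y) (hx : ψ x ∈ e.source) :
    ∀ᶠ x' in 𝓝 x, ψ x' ∈ e.source ∧
      ∀ u, chartD e (ψ x') (paramD ψ x' u) = fderiv ℝ (e ∘ ψ) x' u := by
  have h1 : ∀ᶠ x' in 𝓝 x, ContMDiffAt 𝓘(ℝ, Cn n) 𝓘(ℝ, Cn (n + 1)) 1 ψ x' :=
    (contMDiffAt_iff_contMDiffAt_nhds (by simp)).1 (hψ.of_le (by simp))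
  filter_upwards [h1, hψ.continuousAt.eventually (e.open_source.mem_nhds hx)] with x' h2 h3
  exact ⟨h3, chartD_paramD (h2.mdifferentiableAt (by simp)) he h3⟩

lemma ContDiffAt.continuousAt_fderiv_apply {E F : Type*} [NormedAddCommGroup E] [NormedSpace ℝ E]
    [NormedAddCommGroup F] [NormedSpace ℝ F] {f : E → F} {x : E} (hf : ContDiffAt ℝ ∞ f x) (u : E) :
    ContinuousAt (fun x' => fderiv ℝ f x' u) x := by
  have h : ContDiffAt ℝ 0 (fderiv ℝ f) x := hf.fderiv_right (by simp)
  exact h.continuousAt.clm_apply continuousAt_const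

/-- The coefficients of a Kähler metric along a smooth map are continuous. -/
lemma KahlerMetric.continuousAt_gm {ψ : Cn n → Y} {x : Cn n}
    (hψ : ContMDiffAt 𝓘(ℝ, Cn n) 𝓘(ℝ, Cn (n + 1)) ∞ ψ x) (c : ℂ) (u v : Cn n) :
    ContinuousAt (fun x' => γ.gm (ψ x') (c • paramD ψ x' u) (paramD ψ x' v)) x := by
  let e := chartAt (Cn (n + 1)) (ψ x)
  have he : e ∈ IsManifold.maximalAtlas 𝓘(ℂ, Cn (n + 1)) ω Y := IsManifold.chart_mem_maximalAtlas _
  have hs : ψ x ∈ e.source := mem_chart_source _ _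
  have hc := contDiffAt_chart_comp hψ he hs
  have h1 : ContinuousAt (fun x' => γ.inChart e ((e ∘ ψ) x')) x :=
    ContinuousAt.comp (g := γ.inChart e) ((γ.contDiffOn_inChart he).continuousOn.continuousAt
      (e.open_target.mem_nhds (e.map_source hs))) hc.continuousAt
  have h2 : ContinuousAt (fun x' => γ.inChart e ((e ∘ ψ) x') (c • fderiv ℝ (e ∘ ψ) x' u)
      (fderiv ℝ (e ∘ ψ) x' v)) x :=
    (h1.clm_apply ((hc.continuousAt_fderiv_apply u).const_smul c)).clm_apply
      (hc.continuousAt_fderiv_apply v)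
  refine h2.congr ?_
  filter_upwards [hψ.eventually_chart he hs] with x' hx'
  rw [γ.gm_eq he hx'.1, chartD_smul he hx'.1, hx'.2, hx'.2]
  rfl

lemma DForm.continuousAt_bil {α : DForm (m := n + 1) Y 2} (hα : α.IsSmooth) {ψ : Cn n → Y}
    {x : Cn n} (hψ : ContMDiffAt 𝓘(ℝ, Cn n) 𝓘(ℝ, Cn (n + 1)) ∞ ψ x) (u v : Cn n) :
    ContinuousAt (fun x' => α.bil (ψ x') (paramD ψ x' u) (paramD ψ x' v)) x := by
  let e := chartAt (Cn (n + 1)) (ψ x)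
  have he : e ∈ IsManifold.maximalAtlas 𝓘(ℂ, Cn (n + 1)) ω Y := IsManifold.chart_mem_maximalAtlas _
  have hs : ψ x ∈ e.source := mem_chart_source _ _
  have hc := contDiffAt_chart_comp hψ he hs
  have h1 : ContinuousAt (fun x' => α.inChart e ((e ∘ ψ) x')) x :=
    ContinuousAt.comp (g := α.inChart e) ((hα e (chart_mem_atlas _ _)).continuousOn.continuousAt
      (e.open_target.mem_nhds (e.map_source hs))) hc.continuousAt
  have h2 : ContinuousAt (fun x' => α.inChart e ((e ∘ ψ) x')
      (fun i => fderiv ℝ (e ∘ ψ) x' (![u, v] i))) x :=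
    h1.eval (continuousAt_pi.2 fun i => hc.continuousAt_fderiv_apply _)
  refine h2.congr ?_
  filter_upwards [hψ.eventually_chart he hs] with x' hx'
  rw [DForm.bil_apply]
  refine Eq.trans ?_ (α.apply_eq_inChart he hx'.1 ![paramD ψ x' u, paramD ψ x' v]).symm
  congr 1
  funext i
  rw [← hx'.2]
  fin_cases i <;> rfl

lemma continuousAt_wedgeTwo {X V : Type*} [TopologicalSpace X] {x : X} {w : X → Fin n → V → V → ℂ}
    {v : X → Fin n × Fin 2 → V}
    (h : ∀ j p q, ContinuousAt (fun x' => w x' j (v x' p) (v x' q)) x) :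
    ContinuousAt (fun x' => wedgeTwo (w x') (v x')) x := by
  unfold wedgeTwo
  refine continuousAt_const.mul (tendsto_finsetSum _ fun σ _ => continuousAt_const.mul
    (tendsto_finsetProd _ fun j _ => h _ _ _))

lemma continuousAt_gammaPow {ψ : Cn n → Y} {x : Cn n}
    (hψ : ContMDiffAt 𝓘(ℝ, Cn n) 𝓘(ℝ, Cn (n + 1)) ∞ ψ x) :
    ContinuousAt (fun x' => gammaPow γ (ψ x') (fun p => paramD ψ x' (stdB n p))) x := by
  refine ContinuousAt.congr (continuousAt_wedgeTwo (V := Cn (n + 1))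
    (w := fun x' _ u v => ((γ.gm (ψ x') (Complex.I • u) v : ℝ) : ℂ))
    (v := fun x' p => paramD ψ x' (stdB n p)) fun j p q => ?_) (Filter.Eventually.of_forall ?_)
  · exact Complex.continuous_ofReal.continuousAt.comp
      (KahlerMetric.continuousAt_gm hψ Complex.I (stdB n p) (stdB n q))
  · intro x'
    exact (gammaPow_eq_wedgeM (ψ x') (fun p => paramD ψ x' (stdB n p))).symm

/-- Continuity on subsets of a fibre can be checked in parametrisations. -/
lemma continuousOn_of_fibreParam {X : Type*} [TopologicalSpace X]
    (hπ : IsSemistableDegeneration (n := n) π D) {A : Set Y} (hA : A ⊆ smoothFibre π D s) {g : Y → X}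
    (h : ∀ (φ : FibreParam (n := n) π D s) (x : Cn n), x ∈ φ.dom → φ.map x ∈ A →
      ContinuousAt (g ∘ φ.map) x) : ContinuousOn g A := by
  intro y hy
  obtain ⟨φ, x, hx, rfl⟩ := exists_fibreParam hπ (hA hy)
  refine ContinuousWithinAt.mono ?_ hA
  obtain ⟨O, hO, hOr⟩ := φ.exists_isOpen_image φ.isOpen_dom subset_rfl
  have hxO : φ.map x ∈ O := by
    have : φ.map x ∈ smoothFibre π D s ∩ O := hOr ▸ mem_image_of_mem _ hx
    exact this.2
  have h1 : 𝓝[smoothFibre π D s] (φ.map x) = 𝓝[φ.ran] (φ.map x) := by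
    change _ = 𝓝[φ.map '' φ.dom] (φ.map x)
    rw [hOr]
    exact (nhdsWithin_inter_of_mem' (mem_nhdsWithin_of_mem_nhds (hO.mem_nhds hxO))).symm
  have h2 : ContinuousWithinAt ((g ∘ φ.map) ∘ φ.inv) φ.ran (φ.map x) := by
    refine ContinuousAt.comp_continuousWithinAt ?_ (φ.continuousOn_inv _ (mem_image_of_mem _ hx))
    rw [φ.inv_map hx]
    exact h φ x hx hy
  have h3 : ((g ∘ φ.map) ∘ φ.inv) (φ.map x) = g (φ.map x) :=
    congrArg (fun x => g (φ.map x)) (φ.inv_map hx)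
  rw [ContinuousWithinAt, h3] at h2
  rw [ContinuousWithinAt, h1]
  refine Filter.Tendsto.congr' ?_ h2
  filter_upwards [self_mem_nhdsWithin] with y' hy'
  change g (φ.map (φ.inv y')) = g y'
  rw [φ.map_inv hy']

/-- Relatively open subsets of a fibre. -/
structure IsFibreOpen (π : Y → ℂ) (D : Fin a → Set Y) (s : ℂ) (A : Set Y) : Prop where
  subset : A ⊆ smoothFibre π D s
  eventually : ∀ y ∈ A, ∀ᶠ y' in 𝓝 y, y' ∈ smoothFibre π D s → y' ∈ A

variable {A : Set Y} {f : Y → ℂ}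

lemma IsFibreOpen.hasMFDerivWithinAt (hA : IsFibreOpen π D s A)
    (hf : ContMDiffOn 𝓘(ℝ, Cn (n + 1)) 𝓘(ℝ, ℂ) ∞ f A) {y : Y} (hy : y ∈ A) :
    HasMFDerivWithinAt 𝓘(ℝ, Cn (n + 1)) 𝓘(ℝ, ℂ) f (smoothFibre π D s) y
      (fibreDiffL π D s f y) := by
  have h1 : MDifferentiableWithinAt 𝓘(ℝ, Cn (n + 1)) 𝓘(ℝ, ℂ) f A y :=
    (hf y hy).mdifferentiableWithinAt (by simp)
  have h2 : A ∈ 𝓝[smoothFibre π D s] y := by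
    rw [mem_nhdsWithin_iff_eventually]
    exact hA.eventually y hy
  exact (h1.mono_of_mem_nhdsWithin h2).hasMFDerivWithinAt

lemma IsFibreOpen.eventually_map_mem (hA : IsFibreOpen π D s A) (φ : FibreParam (n := n) π D s)
    {x : Cn n} (hx : x ∈ φ.dom) (hxA : φ.map x ∈ A) : ∀ᶠ x' in 𝓝 x, x' ∈ φ.dom ∧ φ.map x' ∈ A := by
  filter_upwards [(φ.continuousAt hx).eventually (hA.eventually _ hxA), φ.isOpen_dom.mem_nhds hx]
    with x' h1 h2
  exact ⟨h2, h1 (φ.map_mem x')⟩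

lemma IsFibreOpen.contDiffAt_comp (hA : IsFibreOpen π D s A)
    (hf : ContMDiffOn 𝓘(ℝ, Cn (n + 1)) 𝓘(ℝ, ℂ) ∞ f A) (φ : FibreParam (n := n) π D s)
    {x : Cn n} (hx : x ∈ φ.dom) (hxA : φ.map x ∈ A) : ContDiffAt ℝ ∞ (f ∘ φ.map) x := by
  have h1 : ContMDiffWithinAt 𝓘(ℝ, Cn n) 𝓘(ℝ, ℂ) ∞ (f ∘ φ.map) (φ.map ⁻¹' A) x :=
    (hf _ hxA).comp x (φ.contMDiffAt hx).contMDiffWithinAt (mapsTo_preimage _ _)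
  exact (h1.contMDiffAt ((hA.eventually_map_mem φ hx hxA).mono fun _ h => h.2)).contDiffAt

lemma IsFibreOpen.fibreDiffL_d (hA : IsFibreOpen π D s A)
    (hf : ContMDiffOn 𝓘(ℝ, Cn (n + 1)) 𝓘(ℝ, ℂ) ∞ f A) (φ : FibreParam (n := n) π D s)
    {x : Cn n} (hx : x ∈ φ.dom) (hxA : φ.map x ∈ A) (u : Cn n) :
    fibreDiffL π D s f (φ.map x) (φ.d x u) = fderiv ℝ (f ∘ φ.map) x u := by
  have h := hasFDerivAt_of_hasMFDerivAt (hasMFDerivAt_comp_fibreParam φ hx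
    (Filter.Eventually.of_forall φ.map_mem) (hA.hasMFDerivWithinAt hf hxA))
  rw [h.fderiv]
  rfl

lemma IsFibreOpen.continuousAt_fibreDiffL (hA : IsFibreOpen π D s A)
    (hf : ContMDiffOn 𝓘(ℝ, Cn (n + 1)) 𝓘(ℝ, ℂ) ∞ f A) (φ : FibreParam (n := n) π D s)
    {x : Cn n} (hx : x ∈ φ.dom) (hxA : φ.map x ∈ A) (u : Cn n) :
    ContinuousAt (fun x' => fibreDiffL π D s f (φ.map x') (φ.d x' u)) x := by
  refine ((hA.contDiffAt_comp hf φ hx hxA).continuousAt_fderiv_apply u).congr ?_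
  filter_upwards [hA.eventually_map_mem φ hx hxA] with x' hx'
  exact (hA.fibreDiffL_d hf φ hx'.1 hx'.2 u).symm

/-- Continuity of the quotient of a form of top degree by the volume form. -/
lemma IsFibreOpen.continuousOn_topQuotient (hπ : IsSemistableDegeneration (n := n) π D)
    (hA : IsFibreOpen π D s A) (Ψ : ∀ _ : Y, Cn (n + 1) [⋀^Fin n × Fin 2]→ₗ[ℝ] ℂ)
    (h : ∀ (φ : FibreParam (n := n) π D s) (x : Cn n), x ∈ φ.dom → φ.map x ∈ A →
      ContinuousAt (fun x' => Ψ (φ.map x') (fun p => φ.d x' (stdB n p))) x) :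
    ContinuousOn (fun y => topQuotient π γ y (Ψ y)) A := by
  refine continuousOn_of_fibreParam hπ hA.subset fun φ x hx hxA => ?_
  obtain ⟨r, hr, hrx⟩ := φ.exists_gammaPow_eq hπ hx γ
  have h1 := (h φ x hx hxA).div (continuousAt_gammaPow (γ := γ) (φ.contMDiffAt hx)) (by
    change gammaPow γ (φ.map x) (fun p => φ.d x (stdB n p)) ≠ 0
    rw [hrx]
    exact_mod_cast hr.ne')
  refine h1.congr ?_
  filter_upwards [hA.eventually_map_mem φ hx hxA] with x' hx'
  obtain ⟨r', hr', hrx'⟩ := φ.exists_gammaPow_eq hπ hx'.1 γ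
  exact ((φ.isFrame hπ hx'.1).topQuotient_eq (by rw [hrx']; exact_mod_cast hr'.ne') _).symm

lemma IsFibreOpen.continuousOn_mulPow (hπ : IsSemistableDegeneration (n := n) π D)
    (hA : IsFibreOpen π D s A) (hf : ContMDiffOn 𝓘(ℝ, Cn (n + 1)) 𝓘(ℝ, ℂ) ∞ f A)
    {α : DForm (m := n + 1) Y 2} (hα : α.IsSmooth) :
    ContinuousOn (fun y => topQuotient π γ y (mulPow f α y)) A := by
  have h1 : (fun y => topQuotient π γ y (mulPow f α y)) = fun y => topQuotient π γ y
      (f y • wedgeAlt (fun _ => α.bil y) : Cn (n + 1) [⋀^Fin n × Fin 2]→ₗ[ℝ] ℂ) := by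
    funext y
    rw [← mulPow_eq]
  rw [h1]
  refine hA.continuousOn_topQuotient hπ
    (fun y => (f y • wedgeAlt (fun _ => α.bil y) : Cn (n + 1) [⋀^Fin n × Fin 2]→ₗ[ℝ] ℂ))
    fun φ x hx hxA => ?_
  simp only [AlternatingMap.smul_apply, wedgeAlt_apply, smul_eq_mul]
  exact (hA.contDiffAt_comp hf φ hx hxA).continuousAt.mul
    (continuousAt_wedgeTwo fun j p q => DForm.continuousAt_bil hα (φ.contMDiffAt hx) _ _)

lemma IsFibreOpen.continuousOn_dWedgeDcPow (hπ : IsSemistableDegeneration (n := n) π D)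
    (hA : IsFibreOpen π D s A) (hf : ContMDiffOn 𝓘(ℝ, Cn (n + 1)) 𝓘(ℝ, ℂ) ∞ f A)
    {α : DForm (m := n + 1) Y 2} (hα : α.IsSmooth) :
    ContinuousOn (fun y => topQuotient π γ y (dWedgeDcPow π D s f α y)) A := by
  simp only [dWedgeDcPow_eq]
  refine hA.continuousOn_topQuotient hπ (fun y => dcAlt (fibreDiffL π D s f y) α y)
    fun φ x hx hxA => ?_
  simp only [dcAlt, wedgeAlt_apply]
  refine continuousAt_wedgeTwo fun j p q => ?_
  split_ifs
  · simp only [dcBil_apply]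
    have h2 : ∀ p, ContinuousAt (fun x' => fibreDiffL π D s f (φ.map x')
        (Complex.I • φ.d x' (stdB n p))) x := fun p => by
      refine (hA.continuousAt_fibreDiffL hf φ hx hxA (Complex.I • stdB n p)).congr ?_
      filter_upwards [φ.isOpen_dom.mem_nhds hx] with x' hx'
      rw [φ.d_smul hx']
    have h3 := fun p => hA.continuousAt_fibreDiffL hf φ hx hxA (stdB n p)
    exact ((h3 p).mul (continuousAt_const.mul (h2 q))).sub
      ((h3 q).mul (continuousAt_const.mul (h2 p)))
  · exact DForm.continuousAt_bil hα (φ.contMDiffAt hx) _ _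

lemma IsFrame.det_gram_ne_zero {y : Y} {w : Fin n × Fin 2 → Cn (n + 1)} (hw : IsFrame π y w)
    {b : Fin n → Cn (n + 1)} (hb : IsUnitary π γ y b) :
    (Matrix.of fun p q => γ.gm y (w p) (w q)).det ≠ 0 := by
  obtain ⟨A, hA⟩ := hw.exists_matrix hb.isFrame.mem
  have h1 : A * (Matrix.of fun p q => γ.gm y (w p) (w q)) * A.transpose = 1 := by
    ext p q
    rw [← hb.gram p q, hA]
    simp only [map_sum, map_smul, sum_apply, smul_apply, smul_eq_mul, Matrix.mul_apply,
      Matrix.of_apply, Matrix.transpose_apply]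
    exact Finset.sum_congr rfl fun j _ => mul_comm _ _
  intro h0
  have h2 := congrArg Matrix.det h1
  rw [Matrix.det_mul, Matrix.det_mul, h0] at h2
  simp at h2

/-- Unitary frames are only chosen pointwise. The formula through the inverse Gram matrix of the
coordinate frame, written with determinant and adjugate, is visibly continuous. -/
lemma IsFibreOpen.continuousOn_fibreDiffNormSq (hπ : IsSemistableDegeneration (n := n) π D)
    (hA : IsFibreOpen π D s A) (hf : ContMDiffOn 𝓘(ℝ, Cn (n + 1)) 𝓘(ℝ, ℂ) ∞ f A) :
    ContinuousOn (fibreDiffNormSq π D γ s f) A := by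
  refine continuousOn_of_fibreParam hπ hA.subset fun φ x hx hxA => ?_
  let G : Cn n → Matrix (Fin n × Fin 2) (Fin n × Fin 2) ℝ := fun x' =>
    Matrix.of fun p q => γ.gm (φ.map x') (φ.d x' (stdB n p)) (φ.d x' (stdB n q))
  have hdet : ∀ x' ∈ φ.dom, (G x').det ≠ 0 := fun x' hx' => by
    obtain ⟨b, hb⟩ := exists_isUnitary hπ γ (φ.map_mem x')
    exact (φ.isFrame hπ hx').det_gram_ne_zero hb
  have hG : ContinuousAt G x := by
    refine continuousAt_pi.2 fun p => continuousAt_pi.2 fun q => ?_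
    have h1 := KahlerMetric.continuousAt_gm (γ := γ) (φ.contMDiffAt hx) 1 (stdB n p) (stdB n q)
    simp only [one_smul] at h1
    exact h1
  have hGi : ∀ q r, ContinuousAt (fun x' => (G x')⁻¹ q r) x := by
    intro q r
    have h1 : ContinuousAt (fun x' => (G x').det⁻¹ * (G x').adjugate q r) x := by
      refine ContinuousAt.mul (ContinuousAt.inv₀ ?_ (hdet x hx)) ?_
      · exact ContinuousAt.comp (g := Matrix.det) (continuous_id.matrix_det).continuousAt hG
      · exact ContinuousAt.comp
          (g := fun M : Matrix (Fin n × Fin 2) (Fin n × Fin 2) ℝ => M.adjugate q r)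
          (continuous_id.matrix_adjugate.matrix_elem q r).continuousAt hG
    refine h1.congr (Filter.Eventually.of_forall fun x' => ?_)
    simp [Matrix.inv_def]
  have h2 : ContinuousAt (fun x' => (1 / 2 : ℝ) * ∑ q, ∑ r, (G x')⁻¹ q r *
      (fibreDiffL π D s f (φ.map x') (φ.d x' (stdB n q)) *
        (starRingEnd ℂ) (fibreDiffL π D s f (φ.map x') (φ.d x' (stdB n r)))).re) x := by
    refine continuousAt_const.mul (tendsto_finsetSum _ fun q _ => tendsto_finsetSum _ fun r _ => ?_)
    exact (hGi q r).mul (Complex.continuous_re.continuousAt.comp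
      ((hA.continuousAt_fibreDiffL hf φ hx hxA _).mul (Complex.continuous_conj.continuousAt.comp
        (hA.continuousAt_fibreDiffL hf φ hx hxA _))))
  refine h2.congr ?_
  filter_upwards [φ.isOpen_dom.mem_nhds hx] with x' hx'
  obtain ⟨b, hb⟩ := exists_isUnitary hπ γ (φ.map_mem x')
  obtain ⟨-, B, hB, -, h3⟩ := hb.exists_inverse_gram (D := D) (φ.isFrame hπ hx').mem (hdet x' hx')
  have h4 : B = (G x')⁻¹ := (Matrix.inv_eq_left_inv hB).symm
  refine Eq.trans ?_ (h3 s f).symm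
  rw [h4]

end Continuity

lemma ContinuousOn.measurableSet_inter_preimage {X Z : Type*} [TopologicalSpace X]
    [MeasurableSpace X] [BorelSpace X] [TopologicalSpace Z] [MeasurableSpace Z] [BorelSpace Z]
    {f : X → Z} {U : Set X} (hf : ContinuousOn f U) (hU : MeasurableSet U) {E : Set Z}
    (hE : MeasurableSet E) : MeasurableSet (U ∩ f ⁻¹' E) := by
  have h : U ∩ f ⁻¹' E = Subtype.val '' ((U.domRestrict f) ⁻¹' E) := by
    ext x
    constructor
    · exact fun hx => ⟨⟨x, hx.1⟩, hx.2, rfl⟩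
    · rintro ⟨y, hy, rfl⟩
      exact ⟨y.2, hy⟩
  rw [h]
  exact hU.subtype_image (hf.domRestrict.measurable hE)

/-! ### The volume measure of a fibre in parametrisations -/

section FibreMeasure

attribute [local instance] cnNormedAddCommGroup cnNormedSpaceReal cnNormedSpaceComplex
  cnDualNormedAddCommGroup cnBilinNormedAddCommGroup

variable {n a : ℕ} {Y : Type*} [TopologicalSpace Y] [ChartedSpace (Cn (n + 1)) Y]
  {π : Y → ℂ} {D : Fin a → Set Y} {s : ℂ} [IsManifold 𝓘(ℂ, Cn (n + 1)) ω Y]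
  {γ : KahlerMetric (n + 1) Y}

/-- The density of the volume form in a parametrisation. -/
def FibreParam.density (φ : FibreParam (n := n) π D s) (γ : KahlerMetric (n + 1) Y) (x : Cn n) :
    ℝ≥0∞ := ENNReal.ofReal (gammaPow γ (φ.map x) (φ.frame x)).re

lemma FibreParam.gammaPow_frame (φ : FibreParam (n := n) π D s) (x : Cn n) :
    gammaPow γ (φ.map x) (φ.frame x) = gammaPow γ (φ.map x) (fun p => φ.d x (stdB n p)) := by
  congr 1
  funext p
  exact φ.frame_eq x p

lemma FibreParam.continuousOn_gammaPow (φ : FibreParam (n := n) π D s)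
    (γ : KahlerMetric (n + 1) Y) :
    ContinuousOn (fun x => (gammaPow γ (φ.map x) (φ.frame x)).re) φ.dom := by
  intro x hx
  have h := continuousAt_gammaPow (γ := γ) (φ.contMDiffAt hx)
  refine ContinuousAt.continuousWithinAt (Complex.continuous_re.continuousAt.comp (h.congr ?_))
  exact Filter.Eventually.of_forall fun x' => (φ.gammaPow_frame x').symm

lemma FibreParam.measurableSet_dom (φ : FibreParam (n := n) π D s) : MeasurableSet φ.dom :=
  φ.isOpen_dom.measurableSet

lemma FibreParam.aemeasurable_density (φ : FibreParam (n := n) π D s)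
    (γ : KahlerMetric (n + 1) Y) : AEMeasurable (φ.density γ) (volume.restrict φ.dom) :=
  ((φ.continuousOn_gammaPow γ).aemeasurable φ.measurableSet_dom).ennreal_ofReal

variable [MeasurableSpace Y] [BorelSpace Y]

/-- The volume measure of a parametrised part of the fibre. -/
def FibreParam.measure (φ : FibreParam (n := n) π D s) (γ : KahlerMetric (n + 1) Y) : Measure Y :=
  Measure.map φ.map ((volume.restrict φ.dom).withDensity (φ.density γ))

lemma fibreVolume_eq (π : Y → ℂ) (D : Fin a → Set Y) (γ : KahlerMetric (n + 1) Y) (s : ℂ) :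
    fibreVolume π D γ s = ⨆ φ : FibreParam (n := n) π D s, φ.measure γ := rfl

lemma FibreParam.aemeasurable_map (φ : FibreParam (n := n) π D s) (γ : KahlerMetric (n + 1) Y) :
    AEMeasurable φ.map ((volume.restrict φ.dom).withDensity (φ.density γ)) :=
  (φ.continuousOn.aemeasurable φ.measurableSet_dom).mono_ac (withDensity_absolutelyContinuous _ _)

lemma FibreParam.measure_apply (φ : FibreParam (n := n) π D s) (γ : KahlerMetric (n + 1) Y)
    {E : Set Y} (hE : MeasurableSet E) :
    φ.measure γ E = ∫⁻ x in φ.map ⁻¹' E ∩ φ.dom, φ.density γ x := by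
  rw [FibreParam.measure, Measure.map_apply_of_aemeasurable (φ.aemeasurable_map γ) hE,
    withDensity_apply', Measure.restrict_restrict' φ.measurableSet_dom]

lemma FibreParam.measurableSet_preimage (φ : FibreParam (n := n) π D s) {E : Set Y}
    (hE : MeasurableSet E) : MeasurableSet (φ.map ⁻¹' E ∩ φ.dom) := by
  rw [inter_comm]
  exact φ.continuousOn.measurableSet_inter_preimage φ.measurableSet_dom hE

lemma measurableSet_smoothFibre (hπ : IsSemistableDegeneration (n := n) π D) (s : ℂ) :
    MeasurableSet (smoothFibre π D s) := by
  have h1 : IsClosed (π ⁻¹' {s}) := isClosed_singleton.preimage hπ.holomorphic.continuous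
  exact h1.measurableSet.diff (isClosed_singLocus hπ).measurableSet

lemma FibreParam.measurableSet_ran (hπ : IsSemistableDegeneration (n := n) π D)
    (φ : FibreParam (n := n) π D s) : MeasurableSet φ.ran := by
  obtain ⟨O, hO, h⟩ := φ.exists_isOpen_image φ.isOpen_dom subset_rfl
  change MeasurableSet (φ.map '' φ.dom)
  rw [h]
  exact (measurableSet_smoothFibre hπ s).inter hO.measurableSet

/-- Smooth maps into a fibre are smooth in the parametrisations of the fibre. -/
lemma FibreParam.exists_hasFDerivWithinAt (hπ : IsSemistableDegeneration (n := n) π D)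
    (φ : FibreParam (n := n) π D s) {ψ : Cn n → Y} {W : Set (Cn n)} (hW : MapsTo ψ W φ.ran)
    {x : Cn n} (hx : x ∈ W) (hψ : MDifferentiableAt 𝓘(ℝ, Cn n) 𝓘(ℝ, Cn (n + 1)) ψ x)
    (hker : ∀ u, hd (m := n + 1) π (ψ x) (paramD ψ x u) = 0) :
    ∃ h' : Cn n →L[ℝ] Cn n, HasFDerivWithinAt (φ.inv ∘ ψ) h' W x ∧
      ∀ u, φ.d (φ.inv (ψ x)) (h' u) = paramD ψ x u := by
  set x₀ := φ.inv (ψ x) with hx₀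
  have hx₀d : x₀ ∈ φ.dom := φ.inv_mem (hW hx)
  have hmap : φ.map x₀ = ψ x := φ.map_inv (hW hx)
  let e := chartAt (Cn (n + 1)) (ψ x)
  have he : e ∈ IsManifold.maximalAtlas 𝓘(ℂ, Cn (n + 1)) ω Y := IsManifold.chart_mem_maximalAtlas _
  have hes : ψ x ∈ e.source := mem_chart_source _ _
  have hes' : φ.map x₀ ∈ e.source := by rw [hmap]; exact hes
  -- The map `φ.inv` is only set-theoretic; near the point it agrees along the fibre with the smooth
  -- function `g ∘ e`, which can be differentiated.
  obtain ⟨g, hg, hgi⟩ := φ.exists_leftInverse hx₀d he hes'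
  have hge : HasFDerivAt g (fderiv ℝ g (e (ψ x))) (e (ψ x)) := by
    rw [← hmap]
    exact (hg.differentiableAt (by simp)).hasFDerivAt
  have h1 : HasFDerivAt (e ∘ ψ) ((chartD e (ψ x)).comp (paramD ψ x)) x :=
    hasFDerivAt_of_hasMFDerivAt ((hasMFDerivAt_chart he hes).comp x hψ.hasMFDerivAt)
  have h2 : HasFDerivAt (e ∘ φ.map) ((chartD e (φ.map x₀)).comp (φ.d x₀)) x₀ :=
    hasFDerivAt_of_hasMFDerivAt ((hasMFDerivAt_chart he hes').comp x₀ (φ.hasMFDerivAt hx₀d))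
  have hge' : HasFDerivAt g (fderiv ℝ g (e (ψ x))) ((e ∘ φ.map) x₀) := by
    change HasFDerivAt g _ (e (φ.map x₀))
    rw [hmap]; exact hge
  have h3 : ∀ u, fderiv ℝ g (e (ψ x)) (chartD e (ψ x) (φ.d x₀ u)) = u := by
    intro u
    have h4 := hge'.comp x₀ h2
    have h5 : g ∘ e ∘ φ.map =ᶠ[𝓝 x₀] id := hgi
    have h6 := h4.unique ((hasFDerivAt_id x₀).congr_of_eventuallyEq h5)
    have h7 := DFunLike.congr_fun h6 u
    rw [← hmap]
    rw [hmap] at h7 ⊢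
    exact h7
  refine ⟨(fderiv ℝ g (e (ψ x))).comp ((chartD e (ψ x)).comp (paramD ψ x)), ?_, fun u => ?_⟩
  · have h4 := (hge.comp x h1).hasFDerivWithinAt (s := W)
    have h5 : ContinuousWithinAt (φ.inv ∘ ψ) W x :=
      (φ.continuousOn_inv _ (hW hx)).comp hψ.continuousAt.continuousWithinAt hW
    refine h4.congr_of_eventuallyEq ?_ ?_
    · filter_upwards [h5.eventually hgi, self_mem_nhdsWithin] with x' hx' hx'W
      have h6 : φ.map ((φ.inv ∘ ψ) x') = ψ x' := φ.map_inv (hW hx'W)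
      rw [h6] at hx'
      exact hx'.symm
    · have h6 := hgi.self_of_nhds
      rw [hmap] at h6
      exact h6.symm
  · have hne : hd (m := n + 1) π (φ.map x₀) ≠ 0 :=
      hd_ne_zero_of_mem_smoothFibre hπ (φ.map_mem x₀)
    obtain ⟨v, hv⟩ := φ.exists_d_eq hπ.holomorphic hx₀d hne (v := paramD ψ x u)
      (by rw [hmap]; exact hker u)
    change φ.d x₀ (fderiv ℝ g (e (ψ x)) (chartD e (ψ x) (paramD ψ x u))) = _
    rw [← hv, h3]

lemma alternating_comp_det_abs (γ : KahlerMetric (n + 1) Y) (y : Y) (S : Cn n →L[ℝ] Cn (n + 1))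
    (T : Cn n →L[ℝ] Cn n) :
    (gammaPow γ y (fun p => S (T (stdB n p)))).re =
      T.det * (gammaPow γ y (fun p => S (stdB n p))).re := by
  have h := alternating_comp_det (f := gammaAlt γ y) S.toLinearMap T.toLinearMap
  have h2 := congrArg Complex.re h
  rw [Complex.re_ofReal_mul] at h2
  rw [gammaPow_eq, gammaPow_eq]
  exact h2

/-- Change of variables between a parametrisation of the fibre and another smooth map. -/
theorem FibreParam.lintegral_image (hπ : IsSemistableDegeneration (n := n) π D)
    (φ : FibreParam (n := n) π D s) (γ : KahlerMetric (n + 1) Y) {ψ : Cn n → Y} {W : Set (Cn n)}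
    (hWm : MeasurableSet W) (hW : MapsTo ψ W φ.ran) (hinj : InjOn ψ W)
    (hψ : ∀ x ∈ W, MDifferentiableAt 𝓘(ℝ, Cn n) 𝓘(ℝ, Cn (n + 1)) ψ x)
    (hker : ∀ x ∈ W, ∀ u, hd (m := n + 1) π (ψ x) (paramD ψ x u) = 0) :
    MeasurableSet (ψ '' W) ∧ φ.map ⁻¹' (ψ '' W) ∩ φ.dom = (φ.inv ∘ ψ) '' W ∧
      ∫⁻ x in (φ.inv ∘ ψ) '' W, φ.density γ x =
        ∫⁻ x in W, ENNReal.ofReal |(gammaPow γ (ψ x) (fun p => paramD ψ x (stdB n p))).re| := by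
  have hex : ∀ x, ∃ h' : Cn n →L[ℝ] Cn n, x ∈ W → HasFDerivWithinAt (φ.inv ∘ ψ) h' W x ∧
      ∀ u, φ.d (φ.inv (ψ x)) (h' u) = paramD ψ x u := by
    intro x
    by_cases hx : x ∈ W
    · obtain ⟨h', h1⟩ := φ.exists_hasFDerivWithinAt hπ hW hx (hψ x hx) (hker x hx)
      exact ⟨h', fun _ => h1⟩
    · exact ⟨0, fun h => absurd h hx⟩
  choose h' hh using hex
  have hinj' : InjOn (φ.inv ∘ ψ) W := fun x hx x' hx' hxx' => hinj hx hx' (by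
    rw [← φ.map_inv (hW hx), ← φ.map_inv (hW hx')]
    exact congrArg φ.map hxx')
  have himg : φ.map ⁻¹' (ψ '' W) ∩ φ.dom = (φ.inv ∘ ψ) '' W := by
    ext x
    constructor
    · rintro ⟨⟨x', hx', h⟩, hx⟩
      refine ⟨x', hx', ?_⟩
      change φ.inv (ψ x') = x
      rw [h, φ.inv_map hx]
    · rintro ⟨x', hx', rfl⟩
      exact ⟨⟨x', hx', (φ.map_inv (hW hx')).symm⟩, φ.inv_mem (hW hx')⟩
  refine ⟨?_, himg, ?_⟩
  · have h1 : MeasurableSet ((φ.inv ∘ ψ) '' W) :=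
      measurable_image_of_fderivWithin hWm (fun x hx => (hh x hx).1) hinj'
    have h2 : ψ '' W = φ.ran ∩ φ.inv ⁻¹' ((φ.inv ∘ ψ) '' W) := by
      ext y
      constructor
      · rintro ⟨x, hx, rfl⟩
        exact ⟨hW hx, x, hx, rfl⟩
      · rintro ⟨hy, x, hx, hxy⟩
        refine ⟨x, hx, ?_⟩
        rw [← φ.map_inv (hW hx), ← φ.map_inv hy]
        exact congrArg φ.map hxy
    rw [h2]
    exact φ.continuousOn_inv.measurableSet_inter_preimage (φ.measurableSet_ran hπ) h1
  · rw [lintegral_image_eq_lintegral_abs_det_fderiv_mul volume hWm (fun x hx => (hh x hx).1) hinj']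
    refine setLIntegral_congr_fun hWm fun x hx => ?_
    obtain ⟨r, hr, hrx⟩ := φ.exists_gammaPow_eq hπ (φ.inv_mem (hW hx)) γ
    have h1 : (gammaPow γ (ψ x) (fun p => paramD ψ x (stdB n p))).re = (h' x).det * r := by
      have h2 := alternating_comp_det_abs γ (φ.map (φ.inv (ψ x))) (φ.d (φ.inv (ψ x))) (h' x)
      rw [hrx, Complex.ofReal_re, φ.map_inv (hW hx)] at h2
      rw [← h2]
      congr 2
      funext p
      exact ((hh x hx).2 _).symm
    change ENNReal.ofReal |(h' x).det| * φ.density γ (φ.inv (ψ x)) = _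
    rw [FibreParam.density, φ.gammaPow_frame, hrx, Complex.ofReal_re,
      ← ENNReal.ofReal_mul (abs_nonneg _), h1, abs_mul, abs_of_pos hr]

lemma FibreParam.density_eq (hπ : IsSemistableDegeneration (n := n) π D)
    (φ : FibreParam (n := n) π D s) (γ : KahlerMetric (n + 1) Y) {x : Cn n} (hx : x ∈ φ.dom) :
    φ.density γ x =
      ENNReal.ofReal |(gammaPow γ (φ.map x) (fun p => paramD φ.map x (stdB n p))).re| := by
  obtain ⟨r, hr, hrx⟩ := φ.exists_gammaPow_eq hπ hx γ
  rw [FibreParam.density, φ.gammaPow_frame]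
  change _ = ENNReal.ofReal |(gammaPow γ (φ.map x) (fun p => φ.d x (stdB n p))).re|
  rw [hrx, Complex.ofReal_re, abs_of_pos hr]

/-- On the common range both measures agree by change of variables, while `φ'` need not cover all of
`E`. Hence the supremum defining the volume is attained by `φ` on its range. -/
lemma FibreParam.measure_le (hπ : IsSemistableDegeneration (n := n) π D)
    (φ φ' : FibreParam (n := n) π D s) (γ : KahlerMetric (n + 1) Y) {E : Set Y}
    (hE : MeasurableSet E) (hEr : E ⊆ φ.ran) : φ'.measure γ E ≤ φ.measure γ E := by
  rw [φ'.measure_apply γ hE, φ.measure_apply γ hE]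
  have hWm := φ'.measurableSet_preimage hE
  obtain ⟨-, h1, h2⟩ := φ.lintegral_image hπ γ (ψ := φ'.map) hWm (fun x hx => hEr hx.1)
    (φ'.injOn.mono inter_subset_right) (fun x hx => (φ'.hasMFDerivAt hx.2).mdifferentiableAt)
    (fun x hx u => φ'.hd_d hπ.holomorphic hx.2 u)
  rw [setLIntegral_congr_fun hWm fun x hx => φ'.density_eq hπ γ hx.2, ← h2, ← h1]
  refine lintegral_mono_set ?_
  rintro x ⟨⟨x', hx', h⟩, hx⟩
  exact ⟨by rw [mem_preimage, ← h]; exact hx'.1, hx⟩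

/-- The volume measure of the fibre in a parametrisation. -/
theorem fibreVolume_apply_of_subset_ran (hπ : IsSemistableDegeneration (n := n) π D)
    (φ : FibreParam (n := n) π D s) (γ : KahlerMetric (n + 1) Y) {E : Set Y}
    (hE : MeasurableSet E) (hEr : E ⊆ φ.ran) : fibreVolume π D γ s E = φ.measure γ E := by
  refine le_antisymm ?_ ?_
  · have hran := φ.measurableSet_ran hπ
    -- The right side is the measure of `φ` on its range and the full volume elsewhere. It dominates
    -- every member of the family, hence also the supremum.
    have h1 : fibreVolume π D γ s ≤
        (φ.measure γ).restrict φ.ran + (fibreVolume π D γ s).restrict φ.ranᶜ := by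
      rw [fibreVolume_eq]
      refine iSup_le fun φ' => Measure.le_iff.2 fun B hB => ?_
      rw [Measure.add_apply, Measure.restrict_apply hB, Measure.restrict_apply hB,
        ← measure_inter_add_sdiff B hran]
      refine add_le_add (φ.measure_le hπ φ' γ (hB.inter hran) inter_subset_right) ?_
      exact (le_iSup (fun φ : FibreParam (n := n) π D s => φ.measure γ) φ') _
    refine (h1 E).trans ?_
    rw [Measure.add_apply, Measure.restrict_apply hE, Measure.restrict_apply hE,
      inter_eq_self_of_subset_left hEr, ← sdiff_eq, sdiff_eq_empty.2 hEr, measure_empty, add_zero]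
  · rw [fibreVolume_eq]
    exact (le_iSup (fun φ : FibreParam (n := n) π D s => φ.measure γ) φ) E

lemma fibreVolume_compl_smoothFibre (hπ : IsSemistableDegeneration (n := n) π D)
    (γ : KahlerMetric (n + 1) Y) (s : ℂ) :
    fibreVolume π D γ s (smoothFibre π D s)ᶜ = 0 := by
  have hm := measurableSet_smoothFibre hπ s
  have h1 : fibreVolume π D γ s ≤ (fibreVolume π D γ s).restrict (smoothFibre π D s) := by
    rw [fibreVolume_eq]
    refine iSup_le fun φ => Measure.le_iff.2 fun B hB => ?_
    rw [Measure.restrict_apply hB]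
    have h2 : φ.measure γ B = φ.measure γ (B ∩ smoothFibre π D s) := by
      rw [φ.measure_apply γ hB, φ.measure_apply γ (hB.inter hm)]
      congr 2
      ext x
      exact ⟨fun h => ⟨⟨h.1, φ.map_mem x⟩, h.2⟩, fun h => ⟨h.1.1, h.2⟩⟩
    rw [h2]
    exact (le_iSup (fun φ : FibreParam (n := n) π D s => φ.measure γ) φ) _
  refine le_antisymm ((h1 _).trans ?_) bot_le
  rw [Measure.restrict_apply hm.compl, compl_inter_self, measure_empty]

/-- Finiteness is local: closed balls in a parametrisation have finite Lebesgue measure and bounded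
density. -/
lemma fibreVolume_lt_top_of_isCompact (hπ : IsSemistableDegeneration (n := n) π D)
    [T2Space Y] (γ : KahlerMetric (n + 1) Y) {K : Set Y} (hK : IsCompact K)
    (hKs : K ⊆ smoothFibre π D s) : fibreVolume π D γ s K < ⊤ := by
  refine hK.measure_lt_top_of_nhdsWithin fun y hy => ?_
  obtain ⟨φ, x, hx, rfl⟩ := exists_fibreParam hπ (hKs hy)
  obtain ⟨r, hr, hball⟩ := Metric.isOpen_iff.1 φ.isOpen_dom x hx
  let B := Metric.closedBall x (r / 2)
  have hBd : B ⊆ φ.dom := (Metric.closedBall_subset_ball (by linarith)).trans hball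
  have hBc : IsCompact B := isCompact_closedBall _ _
  obtain ⟨O, hO, hOe⟩ := φ.exists_isOpen_image (Metric.isOpen_ball (x := x) (ε := r / 2))
    (Metric.ball_subset_closedBall.trans hBd)
  have hxO : φ.map x ∈ O := by
    have : φ.map x ∈ smoothFibre π D s ∩ O :=
      hOe ▸ mem_image_of_mem _ (Metric.mem_ball_self (by positivity))
    exact this.2
  refine ⟨φ.map '' B, ?_, ?_⟩
  · refine Filter.mem_of_superset (inter_mem_nhdsWithin _ (hO.mem_nhds hxO)) ?_
    rintro y' ⟨h1, h2⟩
    have h3 : y' ∈ smoothFibre π D s ∩ O := ⟨hKs h1, h2⟩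
    rw [← hOe] at h3
    exact image_mono Metric.ball_subset_closedBall h3
  · have hcpt : IsCompact (φ.map '' B) := hBc.image_of_continuousOn (φ.continuousOn.mono hBd)
    rw [fibreVolume_apply_of_subset_ran hπ φ γ hcpt.measurableSet (image_mono hBd),
      φ.measure_apply γ hcpt.measurableSet]
    have h1 : φ.map ⁻¹' (φ.map '' B) ∩ φ.dom = B := by
      ext x'
      constructor
      · rintro ⟨⟨x'', h2, h3⟩, h4⟩
        rwa [← φ.injOn (hBd h2) h4 h3]
      · exact fun h => ⟨mem_image_of_mem _ h, hBd h⟩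
    rw [h1]
    obtain ⟨C, hC⟩ := (hBc.image_of_continuousOn ((φ.continuousOn_gammaPow γ).mono hBd)).bddAbove
    calc ∫⁻ x in B, φ.density γ x ≤ ∫⁻ _x in B, ENNReal.ofReal C := by
          refine setLIntegral_mono' hBc.measurableSet fun x' hx' => ?_
          exact ENNReal.ofReal_le_ofReal (hC (mem_image_of_mem _ hx'))
      _ < ⊤ := by
          rw [setLIntegral_const]
          exact ENNReal.mul_lt_top ENNReal.ofReal_lt_top hBc.measure_lt_top

end FibreMeasure

/-! ### The area formula and change of variables between fibres -/

section Transfer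

attribute [local instance] cnNormedAddCommGroup cnNormedSpaceReal cnNormedSpaceComplex
  cnDualNormedAddCommGroup cnBilinNormedAddCommGroup

variable {n a : ℕ} {Y : Type*} [TopologicalSpace Y] [ChartedSpace (Cn (n + 1)) Y]
  {π : Y → ℂ} {D : Fin a → Set Y} {s : ℂ}

/-- The differential of a map on the central fibre as a linear map of the model space. -/
def mapDL (F : Y → Y) (A : Set Y) (z : Y) : Cn (n + 1) →L[ℝ] Cn (n + 1) :=
  mfderivWithin 𝓘(ℝ, Cn (n + 1)) 𝓘(ℝ, Cn (n + 1)) F A z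

variable [IsManifold 𝓘(ℂ, Cn (n + 1)) ω Y] {γ : KahlerMetric (n + 1) Y}

/-- Injective smooth maps from an open subset of the smooth locus of the central fibre to
another fibre. -/
structure IsFibreMap (π : Y → ℂ) (D : Fin a → Set Y) (s : ℂ) (A : Set Y) (F : Y → Y) : Prop where
  isOpen : IsFibreOpen π D 0 A
  mapsTo : MapsTo F A (smoothFibre π D s)
  injOn : InjOn F A
  smooth : ContMDiffOn 𝓘(ℝ, Cn (n + 1)) 𝓘(ℝ, Cn (n + 1)) ∞ F A

lemma FibreParam.ran_mem_nhdsWithin (φ : FibreParam (n := n) π D s) {y : Y} (hy : y ∈ φ.ran) :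
    φ.ran ∈ 𝓝[smoothFibre π D s] y := by
  obtain ⟨O, hO, h⟩ := φ.exists_isOpen_image φ.isOpen_dom subset_rfl
  change φ.map '' φ.dom ∈ _
  have hy' : y ∈ φ.map '' φ.dom := hy
  rw [h] at hy' ⊢
  exact inter_mem_nhdsWithin _ (hO.mem_nhds hy'.2)

/-- The Jacobian of a map on the central fibre. -/
def fibreJac (π : Y → ℂ) (γ : KahlerMetric (n + 1) Y) (F : Y → Y) (A : Set Y) (z : Y) : ℝ :=
  |(topQuotient π γ z ((gammaAlt γ (F z)).compLinearMap (mapDL F A z).toLinearMap)).re|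

lemma fibreJac_nonneg (π : Y → ℂ) (γ : KahlerMetric (n + 1) Y) (F : Y → Y) (A : Set Y) (z : Y) :
    0 ≤ fibreJac π γ F A z := abs_nonneg _

namespace IsFibreMap

variable {A : Set Y} {F : Y → Y}

lemma hasMFDerivWithinAt (hF : IsFibreMap (n := n) π D s A F) {z : Y} (hz : z ∈ A) :
    HasMFDerivWithinAt 𝓘(ℝ, Cn (n + 1)) 𝓘(ℝ, Cn (n + 1)) F A z (mapDL F A z) :=
  ((hF.smooth z hz).mdifferentiableWithinAt (by simp)).hasMFDerivWithinAt

lemma contMDiffAt_comp (hF : IsFibreMap (n := n) π D s A F) (φ : FibreParam (n := n) π D 0)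
    {x : Cn n} (hx : x ∈ φ.dom) (hxA : φ.map x ∈ A) :
    ContMDiffAt 𝓘(ℝ, Cn n) 𝓘(ℝ, Cn (n + 1)) ∞ (F ∘ φ.map) x := by
  have h1 : ContMDiffWithinAt 𝓘(ℝ, Cn n) 𝓘(ℝ, Cn (n + 1)) ∞ (F ∘ φ.map) (φ.map ⁻¹' A) x :=
    (hF.smooth _ hxA).comp x (φ.contMDiffAt hx).contMDiffWithinAt (mapsTo_preimage _ _)
  exact h1.contMDiffAt ((hF.isOpen.eventually_map_mem φ hx hxA).mono fun _ h => h.2)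

lemma paramD_comp (hF : IsFibreMap (n := n) π D s A F) (φ : FibreParam (n := n) π D 0)
    {x : Cn n} (hx : x ∈ φ.dom) (hxA : φ.map x ∈ A) (u : Cn n) :
    paramD (F ∘ φ.map) x u = mapDL F A (φ.map x) (φ.d x u) := by
  have h := hasMFDerivAt_comp_fibreParam φ hx
    ((hF.isOpen.eventually_map_mem φ hx hxA).mono fun _ h => h.2) (hF.hasMFDerivWithinAt hxA)
  exact DFunLike.congr_fun h.mfderiv u

lemma hd_paramD_comp (hπ : IsSemistableDegeneration (n := n) π D)
    (hF : IsFibreMap (n := n) π D s A F) (φ : FibreParam (n := n) π D 0)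
    {x : Cn n} (hx : x ∈ φ.dom) (hxA : φ.map x ∈ A) (u : Cn n) :
    hd (m := n + 1) π (F (φ.map x)) (paramD (F ∘ φ.map) x u) = 0 := by
  have h1 := hasFDerivAt_of_hasMFDerivAt
    ((hasMFDerivAt_real_of_holomorphic hπ.holomorphic ((F ∘ φ.map) x)).comp x
      ((hF.contMDiffAt_comp φ hx hxA).mdifferentiableAt (by simp)).hasMFDerivAt)
  have h2 : π ∘ F ∘ φ.map =ᶠ[𝓝 x] fun _ => s := by
    filter_upwards [hF.isOpen.eventually_map_mem φ hx hxA] with x' hx'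
    exact (hF.mapsTo hx'.2).1
  exact DFunLike.congr_fun (h1.unique ((hasFDerivAt_const s x).congr_of_eventuallyEq h2)) u

lemma fibreJac_mul (hπ : IsSemistableDegeneration (n := n) π D)
    (hF : IsFibreMap (n := n) π D s A F) (φ : FibreParam (n := n) π D 0)
    {x : Cn n} (hx : x ∈ φ.dom) (hxA : φ.map x ∈ A) :
    φ.density γ x * ENNReal.ofReal (fibreJac π γ F A (φ.map x)) = ENNReal.ofReal
      |(gammaPow γ ((F ∘ φ.map) x) (fun p => paramD (F ∘ φ.map) x (stdB n p))).re| := by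
  obtain ⟨r, hr, hrx⟩ := φ.exists_gammaPow_eq hπ hx γ
  have h1 : topQuotient π γ (φ.map x)
      ((gammaAlt γ (F (φ.map x))).compLinearMap (mapDL F A (φ.map x)).toLinearMap) =
      gammaPow γ ((F ∘ φ.map) x) (fun p => paramD (F ∘ φ.map) x (stdB n p)) / r := by
    rw [(φ.isFrame hπ hx).topQuotient_eq (by rw [hrx]; exact_mod_cast hr.ne'), hrx]
    congr 1
    rw [gammaPow_eq]
    refine congrArg (gammaAlt γ (F (φ.map x))) (funext fun p => ?_)
    exact (hF.paramD_comp φ hx hxA (stdB n p)).symm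
  rw [FibreParam.density, φ.gammaPow_frame, hrx, Complex.ofReal_re, ← ENNReal.ofReal_mul hr.le,
    fibreJac, h1, Complex.div_ofReal_re, abs_div, abs_of_pos hr, mul_div_cancel₀ _ hr.ne']

lemma continuousOn_fibreJac (hπ : IsSemistableDegeneration (n := n) π D)
    (hF : IsFibreMap (n := n) π D s A F) : ContinuousOn (fibreJac π γ F A) A := by
  have h := hF.isOpen.continuousOn_topQuotient (γ := γ) hπ
    (fun z => (gammaAlt γ (F z)).compLinearMap (mapDL F A z).toLinearMap) fun φ x hx hxA => by
      refine (continuousAt_gammaPow (γ := γ) (hF.contMDiffAt_comp φ hx hxA)).congr ?_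
      filter_upwards [hF.isOpen.eventually_map_mem φ hx hxA] with x' hx'
      rw [gammaPow_eq]
      refine congrArg (gammaAlt γ (F (φ.map x'))) (funext fun p => ?_)
      exact hF.paramD_comp φ hx'.1 hx'.2 (stdB n p)
  exact (Complex.continuous_re.comp_continuousOn h).abs

end IsFibreMap

variable [MeasurableSpace Y] [BorelSpace Y]

lemma IsFibreOpen.measurableSet (hπ : IsSemistableDegeneration (n := n) π D) {A : Set Y}
    (hA : IsFibreOpen π D s A) : MeasurableSet A := by
  have h : A = smoothFibre π D s ∩ interior {y | y ∈ smoothFibre π D s → y ∈ A} := by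
    refine Subset.antisymm (fun y hy => ⟨hA.subset hy, ?_⟩) fun y hy => interior_subset hy.2 hy.1
    exact mem_interior_iff_mem_nhds.2 (hA.eventually y hy)
  rw [h]
  exact (measurableSet_smoothFibre hπ s).inter isOpen_interior.measurableSet

lemma FibreParam.setLIntegral_fibreVolume (hπ : IsSemistableDegeneration (n := n) π D)
    (φ : FibreParam (n := n) π D s) (γ : KahlerMetric (n + 1) Y) {E : Set Y} (hE : MeasurableSet E)
    (hEr : E ⊆ φ.ran) {J : Y → ℝ≥0∞} (hJ : AEMeasurable J ((fibreVolume π D γ s).restrict E)) :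
    ∫⁻ y in E, J y ∂fibreVolume π D γ s =
      ∫⁻ x in φ.map ⁻¹' E ∩ φ.dom, φ.density γ x * J (φ.map x) := by
  have h1 : (fibreVolume π D γ s).restrict E = (φ.measure γ).restrict E := by
    ext B hB
    rw [Measure.restrict_apply hB, Measure.restrict_apply hB,
      fibreVolume_apply_of_subset_ran hπ φ γ (hB.inter hE) (inter_subset_right.trans hEr)]
  rw [h1] at hJ ⊢
  have hJ' : AEMeasurable (E.indicator J) (φ.measure γ) := (aemeasurable_indicator_iff hE).2 hJ
  have hW := φ.measurableSet_preimage hE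
  rw [← lintegral_indicator hE, FibreParam.measure, lintegral_map' hJ' (φ.aemeasurable_map γ)]
  change ∫⁻ x, (E.indicator J ∘ φ.map) x ∂_ = _
  rw [lintegral_withDensity_eq_lintegral_mul₀' (φ.aemeasurable_density γ)
      (hJ'.comp_aemeasurable (φ.aemeasurable_map γ)),
    ← inter_eq_self_of_subset_left (inter_subset_right (s := φ.map ⁻¹' E) (t := φ.dom)),
    ← Measure.restrict_restrict hW, ← lintegral_indicator hW]
  refine setLIntegral_congr_fun φ.measurableSet_dom fun x hx => ?_
  by_cases h : φ.map x ∈ E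
  · have h2 : x ∈ φ.map ⁻¹' E ∩ φ.dom := ⟨h, hx⟩
    rw [indicator_of_mem h2]
    change φ.density γ x * E.indicator J (φ.map x) = _
    rw [indicator_of_mem h]
  · have h2 : x ∉ φ.map ⁻¹' E ∩ φ.dom := fun h3 => h h3.1
    rw [indicator_of_notMem h2]
    change φ.density γ x * E.indicator J (φ.map x) = _
    rw [indicator_of_notMem h, mul_zero]

namespace IsFibreMap

variable {A : Set Y} {F : Y → Y}

/-- Both sides are computed in parametrisations around `z` and `F z`. The claim is made for all
measurable subsets of `N`, so that it applies to the disjoint pieces of a countable cover. -/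
lemma exists_local_measure_image (hπ : IsSemistableDegeneration (n := n) π D)
    (hF : IsFibreMap (n := n) π D s A F) (γ : KahlerMetric (n + 1) Y) {z : Y} (hz : z ∈ A) :
    ∃ N ⊆ A, MeasurableSet N ∧ N ∈ 𝓝[A] z ∧ ∀ E ⊆ N, MeasurableSet E → MeasurableSet (F '' E) ∧
      fibreVolume π D γ s (F '' E) =
        ∫⁻ y in E, ENNReal.ofReal (fibreJac π γ F A y) ∂fibreVolume π D γ 0 := by
  have hAm := hF.isOpen.measurableSet hπ
  obtain ⟨φ, x, hx, hxz⟩ := exists_fibreParam hπ (hF.isOpen.subset hz)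
  obtain ⟨φ', x', hx', hxz'⟩ := exists_fibreParam hπ (hF.mapsTo hz)
  have hzr : z ∈ φ.ran := hxz ▸ mem_image_of_mem _ hx
  have hzr' : F z ∈ φ'.ran := hxz' ▸ mem_image_of_mem _ hx'
  refine ⟨(A ∩ F ⁻¹' φ'.ran) ∩ φ.ran, fun y hy => hy.1.1,
    (hF.smooth.continuousOn.measurableSet_inter_preimage hAm (φ'.measurableSet_ran hπ)).inter
      (φ.measurableSet_ran hπ), ?_, fun E hEN hE => ?_⟩
  · refine Filter.inter_mem (Filter.inter_mem self_mem_nhdsWithin ?_)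
      (nhdsWithin_mono _ hF.isOpen.subset (φ.ran_mem_nhdsWithin hzr))
    exact (hF.smooth.continuousOn z hz).tendsto_nhdsWithin hF.mapsTo (φ'.ran_mem_nhdsWithin hzr')
  · have hEA : E ⊆ A := fun y hy => (hEN hy).1.1
    have hEr : E ⊆ φ.ran := fun y hy => (hEN hy).2
    have hW := φ.measurableSet_preimage hE
    have himg : (F ∘ φ.map) '' (φ.map ⁻¹' E ∩ φ.dom) = F '' E := by
      rw [image_comp]
      congr 1
      refine Subset.antisymm (by rintro _ ⟨x, h, rfl⟩; exact h.1) fun y hy => ?_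
      obtain ⟨x, hx, rfl⟩ := hEr hy
      exact ⟨x, ⟨hy, hx⟩, rfl⟩
    obtain ⟨h1, h2, h3⟩ := φ'.lintegral_image hπ γ (ψ := F ∘ φ.map) hW
      (fun x hx => (hEN hx.1).1.2)
      (fun x hx x' hx' h => φ.injOn hx.2 hx'.2 (hF.injOn (hEA hx.1) (hEA hx'.1) h))
      (fun x hx => (hF.contMDiffAt_comp φ hx.2 (hEA hx.1)).mdifferentiableAt (by simp))
      (fun x hx u => hF.hd_paramD_comp hπ φ hx.2 (hEA hx.1) u)
    rw [himg] at h1 h2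
    refine ⟨h1, ?_⟩
    rw [fibreVolume_apply_of_subset_ran hπ φ' γ h1
      (by rintro _ ⟨y, hy, rfl⟩; exact (hEN hy).1.2), φ'.measure_apply γ h1, h2, h3,
      φ.setLIntegral_fibreVolume hπ γ hE hEr
        (((hF.continuousOn_fibreJac hπ).mono hEA).aemeasurable hE).ennreal_ofReal]
    exact setLIntegral_congr_fun hW fun x hx => (hF.fibreJac_mul hπ φ hx.2 (hEA hx.1)).symm

/-- The area formula for maps between fibres. -/
theorem measure_image [SecondCountableTopology Y] (hπ : IsSemistableDegeneration (n := n) π D)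
    (hF : IsFibreMap (n := n) π D s A F) (γ : KahlerMetric (n + 1) Y) {E : Set Y} (hEA : E ⊆ A)
    (hE : MeasurableSet E) : MeasurableSet (F '' E) ∧
      fibreVolume π D γ s (F '' E) =
        ∫⁻ y in E, ENNReal.ofReal (fibreJac π γ F A y) ∂fibreVolume π D γ 0 := by
  have hex : ∀ z, ∃ N : Set Y, z ∈ A → N ⊆ A ∧ MeasurableSet N ∧ N ∈ 𝓝[A] z ∧
      ∀ E ⊆ N, MeasurableSet E → MeasurableSet (F '' E) ∧ fibreVolume π D γ s (F '' E) =
        ∫⁻ y in E, ENNReal.ofReal (fibreJac π γ F A y) ∂fibreVolume π D γ 0 := by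
    intro z
    by_cases hz : z ∈ A
    · obtain ⟨N, h⟩ := hF.exists_local_measure_image hπ γ hz
      exact ⟨N, fun _ => h⟩
    · exact ⟨∅, fun h => absurd h hz⟩
  choose N hN using hex
  obtain ⟨T, hTA, hTc, hT⟩ := TopologicalSpace.countable_cover_nhdsWithin fun z hz => (hN z hz).2.2.1
  rcases T.eq_empty_or_nonempty with rfl | hTne
  · have hE0 : E = ∅ := by
      refine subset_empty_iff.1 (hEA.trans (hT.trans ?_))
      simp
    subst hE0
    simp
  obtain ⟨t, rfl⟩ := hTc.exists_eq_range hTne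
  have ht : ∀ i, t i ∈ A := fun i => hTA (mem_range_self i)
  -- Making the countable cover disjoint lets both sides be summed; injectivity of `F` keeps the
  -- images disjoint.
  let B : ℕ → Set Y := fun i => E ∩ disjointed (fun i => N (t i)) i
  have hBm : ∀ i, MeasurableSet (B i) := fun i =>
    hE.inter (MeasurableSet.disjointed (fun i => (hN _ (ht i)).2.1) i)
  have hBN : ∀ i, B i ⊆ N (t i) := fun i => inter_subset_right.trans (disjointed_subset _ _)
  have hBA : ∀ i, B i ⊆ A := fun i => inter_subset_left.trans hEA
  have hBd : Pairwise (Function.onFun Disjoint B) := fun i j hij =>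
    (disjoint_disjointed (fun i => N (t i)) hij).mono inter_subset_right inter_subset_right
  have hBU : E = ⋃ i, B i := by
    rw [← inter_iUnion, iUnion_disjointed, inter_eq_self_of_subset_left]
    refine hEA.trans (hT.trans ?_)
    simp
  have hloc := fun i => (hN _ (ht i)).2.2.2 (B i) (hBN i) (hBm i)
  rw [hBU, image_iUnion]
  refine ⟨MeasurableSet.iUnion fun i => (hloc i).1, ?_⟩
  rw [measure_iUnion ?_ fun i => (hloc i).1, lintegral_iUnion hBm hBd]
  · exact tsum_congr fun i => (hloc i).2
  · intro i j hij
    exact disjoint_image_image fun x hx y hy hxy =>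
      (hBd hij).ne_of_mem hx hy (hF.injOn (hBA i hx) (hBA j hy) hxy)

/-- The area formula for all measurable subsets is an identity of measures, from which every
integral formula follows. -/
theorem restrict_fibreVolume_image [SecondCountableTopology Y]
    (hπ : IsSemistableDegeneration (n := n) π D)
    (hF : IsFibreMap (n := n) π D s A F) (γ : KahlerMetric (n + 1) Y) :
    (fibreVolume π D γ s).restrict (F '' A) =
      Measure.map F (((fibreVolume π D γ 0).restrict A).withDensity
        fun z => ENNReal.ofReal (fibreJac π γ F A z)) := by
  have hAm := hF.isOpen.measurableSet hπ
  have hFm : AEMeasurable F (((fibreVolume π D γ 0).restrict A).withDensity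
      fun z => ENNReal.ofReal (fibreJac π γ F A z)) :=
    (hF.smooth.continuousOn.aemeasurable hAm).mono_ac (withDensity_absolutelyContinuous _ _)
  ext B hB
  have hBA := hF.smooth.continuousOn.measurableSet_inter_preimage hAm hB
  have h1 : B ∩ F '' A = F '' (A ∩ F ⁻¹' B) := by
    rw [image_inter_preimage, inter_comm]
  rw [Measure.restrict_apply hB, h1, (hF.measure_image hπ γ inter_subset_left hBA).2,
    Measure.map_apply_of_aemeasurable hFm hB]
  have h2 : ((fibreVolume π D γ 0).restrict A).withDensity
      (fun z => ENNReal.ofReal (fibreJac π γ F A z)) (F ⁻¹' B) =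
      ((fibreVolume π D γ 0).restrict A).withDensity
      (fun z => ENNReal.ofReal (fibreJac π γ F A z)) (A ∩ F ⁻¹' B) := by
    have h3 : ((fibreVolume π D γ 0).restrict A).withDensity
        (fun z => ENNReal.ofReal (fibreJac π γ F A z)) Aᶜ = 0 :=
      withDensity_absolutelyContinuous _ _ (by
        rw [Measure.restrict_apply hAm.compl, compl_inter_self, measure_empty])
    refine measure_congr ?_
    filter_upwards [compl_mem_ae_iff.2 h3] with y hy
    rw [compl_compl] at hy
    exact propext ⟨fun h => ⟨hy, h⟩, fun h => h.2⟩
  rw [h2, withDensity_apply _ hBA, Measure.restrict_restrict hBA,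
    inter_eq_self_of_subset_left inter_subset_left]

/-- Change of variables for maps between fibres. -/
theorem setIntegral_image [SecondCountableTopology Y] (hπ : IsSemistableDegeneration (n := n) π D)
    (hF : IsFibreMap (n := n) π D s A F) (γ : KahlerMetric (n + 1) Y)
    {E : Type*} [NormedAddCommGroup E] [NormedSpace ℝ E] {g : Y → E}
    (hg : ContinuousOn g (F '' A)) :
    ∫ y in F '' A, g y ∂fibreVolume π D γ s =
      ∫ z in A, fibreJac π γ F A z • g (F z) ∂fibreVolume π D γ 0 := by
  have hAm := hF.isOpen.measurableSet hπ
  have hFm : AEMeasurable F (((fibreVolume π D γ 0).restrict A).withDensity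
      fun z => ENNReal.ofReal (fibreJac π γ F A z)) :=
    (hF.smooth.continuousOn.aemeasurable hAm).mono_ac (withDensity_absolutelyContinuous _ _)
  have hgm := hg.aestronglyMeasurable (μ := fibreVolume π D γ s)
    (hF.measure_image hπ γ subset_rfl hAm).1
  rw [hF.restrict_fibreVolume_image hπ γ] at hgm ⊢
  rw [integral_map hFm hgm, integral_withDensity_eq_integral_toReal_smul₀
    ((hF.continuousOn_fibreJac hπ).aemeasurable hAm).ennreal_ofReal
    (Filter.Eventually.of_forall fun _ => ENNReal.ofReal_lt_top)]
  simp only [ENNReal.toReal_ofReal (fibreJac_nonneg _ _ _ _ _)]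

end IsFibreMap

/-- Continuous functions with compact support in an open subset of a fibre are integrable. -/
lemma IsFibreOpen.integrableOn [T2Space Y] [SecondCountableTopology Y]
    (hπ : IsSemistableDegeneration (n := n) π D)
    {A K : Set Y} (hA : IsFibreOpen π D s A) (γ : KahlerMetric (n + 1) Y)
    {E : Type*} [NormedAddCommGroup E] {g : Y → E} (hg : ContinuousOn g A) (hK : IsCompact K)
    (hKA : K ⊆ A) (h0 : ∀ y ∈ A, y ∉ K → g y = 0) : IntegrableOn g A (fibreVolume π D γ s) := by
  have hAm := hA.measurableSet hπ
  have h1 : IntegrableOn g K (fibreVolume π D γ s) := by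
    obtain ⟨C, hC⟩ := (hK.image_of_continuousOn (hg.mono hKA).norm).bddAbove
    refine IntegrableOn.of_bound (fibreVolume_lt_top_of_isCompact hπ γ hK (hKA.trans hA.subset))
      ((hg.mono hKA).aestronglyMeasurable hK.measurableSet) C ?_
    filter_upwards [ae_restrict_mem hK.measurableSet] with y hy
    exact hC (mem_image_of_mem _ hy)
  refine h1.of_forall_sdiff_eq_zero hAm fun y hy => h0 y hy.1 hy.2

end Transfer

/-! ### Push-forwards of test functions and comparison of integrals -/

section PushForward

attribute [local instance] cnNormedAddCommGroup cnNormedSpaceReal cnNormedSpaceComplex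
  cnDualNormedAddCommGroup cnBilinNormedAddCommGroup

variable {n a : ℕ} {Y : Type*} [TopologicalSpace Y] [ChartedSpace (Cn (n + 1)) Y]
  {π : Y → ℂ} {D : Fin a → Set Y} {s : ℂ} {A : Set Y} {F : Y → Y}

lemma pushFwd_apply (hF : InjOn F A) {z : Y} (hz : z ∈ A) (χ : Y → ℂ) :
    pushFwd F A χ (F z) = χ z :=
  Function.Injective.extend_apply (f := fun z : A => F z) (injOn_iff_injective.1 hF)
    (fun z : A => χ z) 0 ⟨z, hz⟩

lemma pushFwd_eq_zero (hF : InjOn F A) {K : Set Y} {χ : Y → ℂ} (hχ : ∀ z ∉ K, χ z = 0) {y : Y}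
    (hy : y ∉ F '' K) : pushFwd F A χ y = 0 := by
  by_cases h : y ∈ F '' A
  · obtain ⟨z, hz, rfl⟩ := h
    rw [pushFwd_apply hF hz]
    exact hχ z fun hzK => hy (mem_image_of_mem _ hzK)
  · exact Function.extend_apply' _ _ _ fun ⟨z, hz⟩ => h ⟨z, z.2, hz⟩

variable [IsManifold 𝓘(ℂ, Cn (n + 1)) ω Y] {γ : KahlerMetric (n + 1) Y}

lemma IsFibreDiffeo.isFibreMap (h : IsFibreDiffeo (n := n) π D s A F) (hA : IsFibreOpen π D 0 A) :
    IsFibreMap (n := n) π D s A F :=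
  ⟨hA, h.1, h.2.2.2.choose_spec.1.injOn, h.2.2.1⟩

lemma IsFibreDiffeo.isFibreOpen_image (h : IsFibreDiffeo (n := n) π D s A F) :
    IsFibreOpen π D s (F '' A) := by
  obtain ⟨h1, ⟨O, hO, hOe⟩, -⟩ := h
  refine ⟨h1.image_subset, fun y hy => ?_⟩
  rw [hOe] at hy ⊢
  filter_upwards [hO.mem_nhds hy.2] with y' h2 h3
  exact ⟨h3, h2⟩

lemma IsFibreDiffeo.contMDiffOn_pushFwd (h : IsFibreDiffeo (n := n) π D s A F) {χ : Y → ℂ}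
    (hχ : ContMDiffOn 𝓘(ℝ, Cn (n + 1)) 𝓘(ℝ, ℂ) ∞ χ A) :
    ContMDiffOn 𝓘(ℝ, Cn (n + 1)) 𝓘(ℝ, ℂ) ∞ (pushFwd F A χ) (F '' A) := by
  obtain ⟨G, hG, hGs⟩ := h.2.2.2
  refine (hχ.comp hGs ?_).congr ?_
  · rintro _ ⟨z, hz, rfl⟩
    rw [mem_preimage, hG hz]
    exact hz
  · rintro _ ⟨z, hz, rfl⟩
    rw [pushFwd_apply hG.injOn hz, Function.comp_apply, hG hz]

/-- The chain rule for push-forwards. -/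
lemma IsFibreDiffeo.fibreDiffL_pushFwd (hπ : IsSemistableDegeneration (n := n) π D)
    (h : IsFibreDiffeo (n := n) π D s A F) (hA : IsFibreOpen π D 0 A) {χ : Y → ℂ}
    (hχ : ContMDiffOn 𝓘(ℝ, Cn (n + 1)) 𝓘(ℝ, ℂ) ∞ χ A) {z : Y} (hz : z ∈ A) {v : Cn (n + 1)}
    (hv : hd (m := n + 1) π z v = 0) :
    fibreDiffL π D s (pushFwd F A χ) (F z) (mapDL F A z v) = fibreDiffL π D 0 χ z v := by
  have hF := h.isFibreMap hA
  have h1 := (h.isFibreOpen_image.hasMFDerivWithinAt (h.contMDiffOn_pushFwd hχ)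
    (mem_image_of_mem F hz)).comp z (hF.hasMFDerivWithinAt hz) hF.mapsTo
  have h2 : HasMFDerivWithinAt 𝓘(ℝ, Cn (n + 1)) 𝓘(ℝ, ℂ) χ A z
      ((fibreDiffL π D s (pushFwd F A χ) (F z)).comp (mapDL F A z)) :=
    HasMFDerivWithinAt.congr_of_eventuallyEq h1 (Filter.eventually_of_mem self_mem_nhdsWithin
      fun z' hz' => (pushFwd_apply hF.injOn hz' χ).symm) (pushFwd_apply hF.injOn hz χ).symm
  exact hasMFDerivWithinAt_unique_on_fibre hπ (hA.subset hz) (hA.eventually z hz) h2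
    ((hA.hasMFDerivWithinAt hχ hz).mono hA.subset) hv

lemma fibreDiffL_eq_zero {f : Y → ℂ} {y : Y} (h : ∀ᶠ y' in 𝓝 y, f y' = 0) :
    fibreDiffL (n := n) π D s f y = 0 := by
  have h1 : f =ᶠ[𝓝[smoothFibre π D s] y] fun _ => 0 := Filter.Eventually.filter_mono
    nhdsWithin_le_nhds h
  have h2 : mfderivWithin 𝓘(ℝ, Cn (n + 1)) 𝓘(ℝ, ℂ) f (smoothFibre π D s) y =
      mfderivWithin 𝓘(ℝ, Cn (n + 1)) 𝓘(ℝ, ℂ) (fun _ => (0 : ℂ)) (smoothFibre π D s) y :=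
    h1.mfderivWithin_eq h.self_of_nhds
  rw [mfderivWithin_const] at h2
  exact h2

lemma fibreDiffNormSq_eq_zero (hπ : IsSemistableDegeneration (n := n) π D) {f : Y → ℂ} {y : Y}
    (hy : y ∈ smoothFibre π D s) (h : ∀ᶠ y' in 𝓝 y, f y' = 0) :
    fibreDiffNormSq π D γ s f y = 0 := by
  obtain ⟨b, hb⟩ := exists_isUnitary hπ γ hy
  rw [hb.fibreDiffNormSq_eq, fibreDiffL_eq_zero h]
  simp

lemma fibreDiffNormSq_nonneg (γ : KahlerMetric (n + 1) Y) (f : Y → ℂ) (y : Y) :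
    0 ≤ fibreDiffNormSq π D γ s f y :=
  mul_nonneg (by norm_num) (Real.iSup_nonneg fun _ => Finset.sum_nonneg fun _ _ => by positivity)

lemma topQuotient_mulPow_eq_zero (hπ : IsSemistableDegeneration (n := n) π D) {f : Y → ℂ} {y : Y}
    (hy : y ∈ smoothFibre π D s) (h : f y = 0) (α : DForm (m := n + 1) Y 2) :
    topQuotient π γ y (mulPow f α y) = 0 := by
  obtain ⟨b, hb⟩ := exists_isUnitary hπ γ hy
  rw [mulPow_eq, hb.isFrame.topQuotient_eq hb.gammaPow_ne_zero, h]
  simp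

lemma topQuotient_dWedgeDcPow_eq_zero (hn : 1 ≤ n) (hπ : IsSemistableDegeneration (n := n) π D)
    {f : Y → ℂ} {y : Y} (hy : y ∈ smoothFibre π D s) (h : ∀ᶠ y' in 𝓝 y, f y' = 0)
    (α : DForm (m := n + 1) Y 2) : topQuotient π γ y (dWedgeDcPow π D s f α y) = 0 := by
  obtain ⟨b, hb⟩ := exists_isUnitary hπ γ hy
  rw [dWedgeDcPow_eq, hb.isFrame.topQuotient_eq hb.gammaPow_ne_zero, fibreDiffL_eq_zero h]
  have h1 : dcAlt 0 α y (realFrame b) = 0 := by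
    rw [dcAlt, wedgeAlt_apply, wedgeTwo]
    refine mul_eq_zero_of_right _ (Finset.sum_eq_zero fun σ _ => mul_eq_zero_of_right _
      (Finset.prod_eq_zero (Finset.mem_univ ⟨0, hn⟩) ?_))
    simp [dcBil_apply]
  rw [h1, zero_div]

lemma IsFibreMap.hd_mapDL (hπ : IsSemistableDegeneration (n := n) π D)
    (hF : IsFibreMap (n := n) π D s A F) {z : Y} (hz : z ∈ A) {v : Cn (n + 1)}
    (hv : hd (m := n + 1) π z v = 0) : hd (m := n + 1) π (F z) (mapDL F A z v) = 0 := by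
  obtain ⟨φ, x, hx, rfl⟩ := exists_fibreParam hπ (hF.isOpen.subset hz)
  obtain ⟨u, rfl⟩ := φ.exists_d_eq hπ.holomorphic hx
    (hd_ne_zero_of_mem_smoothFibre hπ (φ.map_mem x)) hv
  rw [← hF.paramD_comp φ hx hz]
  exact hF.hd_paramD_comp hπ φ hx hz u

lemma IsUnitary.fibreJac_eq {z : Y} {b : Fin n → Cn (n + 1)} (hb : IsUnitary π γ z b) :
    fibreJac π γ F A z = |volRatio γ (F z) (fun p => mapDL F A z (realFrame b p))| := by
  rw [fibreJac, hb.isFrame.topQuotient_eq hb.gammaPow_ne_zero, hb.gammaPow_eq, volRatio,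
    Complex.div_ofReal_re, _root_.gammaPow_eq]
  rfl

variable [MeasurableSpace Y] [BorelSpace Y]

lemma integral_fibreVolume_eq_setIntegral (hπ : IsSemistableDegeneration (n := n) π D)
    (γ : KahlerMetric (n + 1) Y) {E : Type*} [NormedAddCommGroup E] [NormedSpace ℝ E] {g : Y → E}
    {B : Set Y} (hg : ∀ y ∈ smoothFibre π D s, y ∉ B → g y = 0) :
    ∫ y, g y ∂fibreVolume π D γ s = ∫ y in B, g y ∂fibreVolume π D γ s := by
  refine (setIntegral_eq_integral_of_ae_compl_eq_zero ?_).symm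
  filter_upwards [compl_mem_ae_iff.2 (fibreVolume_compl_smoothFibre hπ γ s)] with y hy hyB
  rw [compl_compl] at hy
  exact hg y hy hyB

/-- Comparison of integrals over two fibres. -/
theorem IsFibreMap.norm_integral_sub_le [T2Space Y] [SecondCountableTopology Y]
    (hπ : IsSemistableDegeneration (n := n) π D)
    (hF : IsFibreMap (n := n) π D s A F) (γ : KahlerMetric (n + 1) Y)
    {E : Type*} [NormedAddCommGroup E] [NormedSpace ℝ E] {g g' : Y → E} {h : Y → ℝ} {K : Set Y}
    {C : ℝ} (hK : IsCompact K) (hKA : K ⊆ A)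
    (hg' : ContinuousOn g' (F '' A)) (hg'0 : ∀ y ∈ smoothFibre π D s, y ∉ F '' A → g' y = 0)
    (hg : ContinuousOn g A) (hg0 : ∀ y ∈ smoothFibre π D 0, y ∉ K → g y = 0)
    (hh : ContinuousOn h A) (hh0 : ∀ y ∈ smoothFibre π D 0, y ∉ K → h y = 0)
    (hbd : ∀ z ∈ A, ‖fibreJac π γ F A z • g' (F z) - g z‖ ≤ C * h z) :
    ‖∫ y, g' y ∂fibreVolume π D γ s - ∫ z, g z ∂fibreVolume π D γ 0‖ ≤
      C * ∫ z, h z ∂fibreVolume π D γ 0 := by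
  have hAm := hF.isOpen.measurableSet hπ
  rw [integral_fibreVolume_eq_setIntegral hπ γ hg'0, hF.setIntegral_image hπ γ hg',
    integral_fibreVolume_eq_setIntegral hπ γ (B := A) fun y hy hyA => hg0 y hy fun h => hyA (hKA h),
    integral_fibreVolume_eq_setIntegral hπ γ (B := A) fun y hy hyA => hh0 y hy fun h => hyA (hKA h)]
  have h1 : ContinuousOn (fun z => fibreJac π γ F A z • g' (F z)) A :=
    (hF.continuousOn_fibreJac hπ).smul
      (hg'.comp hF.smooth.continuousOn (mapsTo_image F A))
  have h2 : IntegrableOn (fun z => fibreJac π γ F A z • g' (F z)) A (fibreVolume π D γ 0) := by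
    -- Off `K` both `g` and `h` vanish, so the bound `hbd` itself forces the transported integrand
    -- to vanish.
    refine hF.isOpen.integrableOn hπ γ h1 hK hKA fun y hy hyK => ?_
    have h3 := hbd y hy
    rw [hg0 y (hF.isOpen.subset hy) hyK, hh0 y (hF.isOpen.subset hy) hyK, sub_zero, mul_zero] at h3
    exact norm_le_zero_iff.1 h3
  have h3 := hF.isOpen.integrableOn hπ γ hg hK hKA fun y hy => hg0 y (hF.isOpen.subset hy)
  have h4 := hF.isOpen.integrableOn hπ γ hh hK hKA fun y hy => hh0 y (hF.isOpen.subset hy)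
  rw [← integral_sub h2 h3, ← integral_const_mul]
  refine norm_integral_le_of_norm_le (h4.const_mul C) ?_
  filter_upwards [ae_restrict_mem hAm] with z hz
  exact hbd z hz

end PushForward

lemma integral_norm_mul_norm_le {X : Type*} [MeasurableSpace X] {μ : Measure X} {f g : X → ℂ}
    (hf : AEStronglyMeasurable f μ) (hg : AEStronglyMeasurable g μ)
    (hf2 : Integrable (fun x => ‖f x‖ ^ 2) μ) (hg2 : Integrable (fun x => ‖g x‖ ^ 2) μ) :
    ∫ x, ‖f x‖ * ‖g x‖ ∂μ ≤ Real.sqrt (∫ x, ‖f x‖ ^ 2 ∂μ) * Real.sqrt (∫ x, ‖g x‖ ^ 2 ∂μ) := by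
  have h := integral_mul_le_Lp_mul_Lq_of_nonneg (μ := μ) (p := 2) (q := 2)
    (Real.HolderConjugate.two_two) (f := fun x => ‖f x‖) (g := fun x => ‖g x‖)
    (Filter.Eventually.of_forall fun _ => norm_nonneg _)
    (Filter.Eventually.of_forall fun _ => norm_nonneg _)
    (by
      have : MemLp f 2 μ := (memLp_two_iff_integrable_sq_norm hf).2 hf2
      simpa using this.norm)
    (by
      have : MemLp g 2 μ := (memLp_two_iff_integrable_sq_norm hg).2 hg2
      simpa using this.norm)
  simpa [Real.sqrt_eq_rpow] using h

/-- Factor `x ^ 2 - y ^ 2 = (x - y) * (x + y)` and cancel `x + y ≥ y`; no constant is lost. -/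
lemma abs_sub_le_of_abs_sq_sub_sq_le {x y c : ℝ} (hx : 0 ≤ x) (hy : 0 ≤ y)
    (h : |x ^ 2 - y ^ 2| ≤ c * y ^ 2) : |x - y| ≤ c * y := by
  rcases hy.eq_or_lt with rfl | hy'
  · have h1 : x ^ 2 ≤ 0 := by simpa using h
    have h2 : x = 0 := by nlinarith
    simp [h2]
  · have hc : 0 ≤ c := by
      by_contra! hc
      nlinarith [abs_nonneg (x ^ 2 - y ^ 2), pow_pos hy' 2]
    have h1 : x ^ 2 - y ^ 2 = (x - y) * (x + y) := by ring
    rw [h1, abs_mul, abs_of_nonneg (add_nonneg hx hy)] at h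
    have h2 : c * y ^ 2 ≤ c * y * (x + y) := by nlinarith [mul_nonneg (mul_nonneg hc hy) hx]
    exact le_of_mul_le_mul_right (h.trans h2) (by linarith)

/-! ### Integral estimates for almost isometries -/

section AlmostIsometries

attribute [local instance] cnNormedAddCommGroup cnNormedSpaceReal cnNormedSpaceComplex
  cnDualNormedAddCommGroup cnBilinNormedAddCommGroup

variable {n a : ℕ} {Y : Type*} [TopologicalSpace Y] [ChartedSpace (Cn (n + 1)) Y]
  [IsManifold 𝓘(ℂ, Cn (n + 1)) ω Y] {π : Y → ℂ} {D : Fin a → Set Y} {γ : KahlerMetric (n + 1) Y}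
  {s : ℂ} {A : Set Y} {F : Y → Y} {δ : ℝ}

/-- The constant in the estimate of the ratio of the volume forms. -/
def ratioConst (n : ℕ) : ℝ := wedgeConst n * 2 ^ n / volConst n

lemma ratioConst_nonneg (n : ℕ) : 0 ≤ ratioConst n :=
  div_nonneg (mul_nonneg (wedgeConst_nonneg n) (by positivity)) (volConst_pos n).le

/-- The constant in the estimate of Dirichlet energies. -/
def energyConst (n : ℕ) : ℝ := 4 * frameCard n ^ 3 + ratioConst n

/-- Diffeomorphisms between open subsets of fibres which preserve the metric up to a small
error. -/
structure IsAlmostIsometry (π : Y → ℂ) (D : Fin a → Set Y) (γ : KahlerMetric (n + 1) Y) (s : ℂ)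
    (A : Set Y) (F : Y → Y) (δ : ℝ) : Prop where
  isOpen : IsFibreOpen π D 0 A
  diffeo : IsFibreDiffeo (n := n) π D s A F
  almostUnitary : ∀ z ∈ A, ∀ b, IsUnitary π γ z b →
    IsAlmostUnitary π γ (F z) δ fun p => mapDL F A z (realFrame b p)
  ratio : ratioConst n * δ ≤ 1 / 2

namespace IsAlmostIsometry

lemma isFibreMap (h : IsAlmostIsometry π D γ s A F δ) : IsFibreMap (n := n) π D s A F :=
  h.diffeo.isFibreMap h.isOpen

/-- The bound `ratioConst n * δ ≤ 1 / 2` makes the volume ratio positive, so the absolute value in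
the Jacobian can be dropped. -/
lemma exists_frames (hn : 1 ≤ n) (hπ : IsSemistableDegeneration (n := n) π D)
    (h : IsAlmostIsometry π D γ s A F δ) {z : Y} (hz : z ∈ A) :
    ∃ b b', IsUnitary π γ z b ∧ IsUnitary π γ (F z) b' ∧
      IsAlmostUnitary π γ (F z) δ (fun p => mapDL F A z (realFrame b p)) ∧
      fibreJac π γ F A z = volRatio γ (F z) (fun p => mapDL F A z (realFrame b p)) ∧
      |fibreJac π γ F A z - 1| ≤ ratioConst n * δ := by
  obtain ⟨b, hb⟩ := exists_isUnitary hπ γ (h.isOpen.subset hz)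
  obtain ⟨b', hb'⟩ := exists_isUnitary hπ γ (h.diffeo.1 hz)
  have hw := h.almostUnitary z hz b hb
  have h1 := hw.abs_volRatio_sub_le hn
  have h2 : fibreJac π γ F A z = volRatio γ (F z) (fun p => mapDL F A z (realFrame b p)) := by
    rw [hb.fibreJac_eq, abs_of_nonneg]
    have h3 := (abs_le.1 h1).1
    have h4 := h.ratio
    rw [ratioConst] at h4
    linarith
  exact ⟨b, b', hb, hb', hw, h2, h2 ▸ h1⟩

lemma abs_fibreJac_sub_one_le (hn : 1 ≤ n) (hπ : IsSemistableDegeneration (n := n) π D)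
    (h : IsAlmostIsometry π D γ s A F δ) {z : Y} (hz : z ∈ A) :
    |fibreJac π γ F A z - 1| ≤ ratioConst n * δ := by
  obtain ⟨_, _, -, -, -, -, h1⟩ := h.exists_frames hn hπ hz
  exact h1

lemma fibreDiffL_mapDL (hπ : IsSemistableDegeneration (n := n) π D)
    (h : IsAlmostIsometry π D γ s A F δ) {χ : Y → ℂ} (hχ : IsTestFunction (n := n) A χ) {z : Y}
    (hz : z ∈ A) {b : Fin n → Cn (n + 1)} (hb : IsUnitary π γ z b) (p : Fin n × Fin 2) :
    fibreDiffL π D s (pushFwd F A χ) (F z) (mapDL F A z (realFrame b p)) =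
      fibreDiffL π D 0 χ z (realFrame b p) :=
  h.diffeo.fibreDiffL_pushFwd hπ h.isOpen hχ.1 hz (hb.isFrame.mem p)

variable [T2Space Y]

lemma eventually_eq_zero {χ : Y → ℂ} {K : Set Y} (hK : IsCompact K) (hχ : ∀ y ∉ K, χ y = 0) {y : Y}
    (hy : y ∉ K) : ∀ᶠ y' in 𝓝 y, χ y' = 0 := by
  filter_upwards [hK.isClosed.isOpen_compl.mem_nhds hy] with y' hy'
  exact hχ y' hy'

lemma eventually_pushFwd_eq_zero (h : IsAlmostIsometry π D γ s A F δ) {χ : Y → ℂ} {K : Set Y}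
    (hK : IsCompact K) (hKA : K ⊆ A) (hχ : ∀ y ∉ K, χ y = 0) {y : Y} (hy : y ∉ F '' A) :
    ∀ᶠ y' in 𝓝 y, pushFwd F A χ y' = 0 :=
  eventually_eq_zero (hK.image_of_continuousOn (h.isFibreMap.smooth.continuousOn.mono hKA))
    (fun _ hy' => pushFwd_eq_zero h.isFibreMap.injOn hχ hy') fun hyK => hy (image_mono hKA hyK)

variable [SecondCountableTopology Y] [MeasurableSpace Y] [BorelSpace Y]

/-- The values of the functions are transported unchanged. The integrand is perturbed only by the
factor `fibreJac - 1`, and Cauchy–Schwarz finishes. -/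
theorem norm_fibreInner_sub_le (hn : 1 ≤ n) (hπ : IsSemistableDegeneration (n := n) π D)
    (h : IsAlmostIsometry π D γ s A F δ) (hδ : 0 ≤ δ) {χ χ' : Y → ℂ}
    (hχ : IsTestFunction (n := n) A χ) (hχ' : IsTestFunction (n := n) A χ') :
    ‖fibreInner π D γ s (pushFwd F A χ) (pushFwd F A χ') - fibreInner π D γ 0 χ χ'‖ ≤
      ratioConst n * δ * fibreL2 π D γ 0 χ * fibreL2 π D γ 0 χ' := by
  obtain ⟨hχs, K, hKA, hK, hK0⟩ := hχ
  obtain ⟨hχs', K', hKA', hK', hK0'⟩ := hχ'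
  have hF := h.isFibreMap
  have h1 := hF.norm_integral_sub_le hπ γ (C := ratioConst n * δ)
    (g := fun y => χ y * (starRingEnd ℂ) (χ' y))
    (g' := fun y => pushFwd F A χ y * (starRingEnd ℂ) (pushFwd F A χ' y))
    (h := fun y => ‖χ y‖ * ‖χ' y‖) hK hKA
    ((h.diffeo.contMDiffOn_pushFwd hχs).continuousOn.mul
      (Complex.continuous_conj.comp_continuousOn (h.diffeo.contMDiffOn_pushFwd hχs').continuousOn))
    (fun y _ hy => by
      rw [pushFwd_eq_zero hF.injOn hK0 fun hyK => hy (image_mono hKA hyK), zero_mul])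
    (hχs.continuousOn.mul (Complex.continuous_conj.comp_continuousOn hχs'.continuousOn))
    (fun y _ hy => by rw [hK0 y hy, zero_mul])
    (hχs.continuousOn.norm.mul hχs'.continuousOn.norm)
    (fun y _ hy => by rw [hK0 y hy, norm_zero, zero_mul])
    (fun z hz => by
      rw [pushFwd_apply hF.injOn hz, pushFwd_apply hF.injOn hz]
      have h2 : fibreJac π γ F A z • (χ z * (starRingEnd ℂ) (χ' z)) -
          χ z * (starRingEnd ℂ) (χ' z) =
          (fibreJac π γ F A z - 1) • (χ z * (starRingEnd ℂ) (χ' z)) := by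
        rw [sub_smul, one_smul]
      rw [h2, norm_smul, norm_mul, RCLike.norm_conj, Real.norm_eq_abs]
      exact mul_le_mul_of_nonneg_right (h.abs_fibreJac_sub_one_le hn hπ hz) (by positivity))
  refine h1.trans ?_
  rw [mul_assoc (ratioConst n * δ)]
  refine mul_le_mul_of_nonneg_left ?_ (mul_nonneg (ratioConst_nonneg n) hδ)
  have hAm := h.isOpen.measurableSet hπ
  rw [fibreL2, fibreL2,
    integral_fibreVolume_eq_setIntegral hπ γ (B := A) (g := fun y => ‖χ y‖ * ‖χ' y‖)
      fun y _ hy => by rw [hK0 y fun hyK => hy (hKA hyK), norm_zero, zero_mul],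
    integral_fibreVolume_eq_setIntegral hπ γ (B := A) (g := fun y => ‖χ y‖ ^ 2)
      fun y _ hy => by rw [hK0 y fun hyK => hy (hKA hyK), norm_zero, zero_pow two_ne_zero],
    integral_fibreVolume_eq_setIntegral hπ γ (B := A) (g := fun y => ‖χ' y‖ ^ 2)
      fun y _ hy => by rw [hK0' y fun hyK => hy (hKA' hyK), norm_zero, zero_pow two_ne_zero]]
  exact integral_norm_mul_norm_le (hχs.continuousOn.aestronglyMeasurable hAm)
    (hχs'.continuousOn.aestronglyMeasurable hAm)
    (h.isOpen.integrableOn hπ γ (hχs.continuousOn.norm.pow 2) hK hKA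
      fun y _ hy => by rw [hK0 y hy, norm_zero, zero_pow two_ne_zero])
    (h.isOpen.integrableOn hπ γ (hχs'.continuousOn.norm.pow 2) hK' hKA'
      fun y _ hy => by rw [hK0' y hy, norm_zero, zero_pow two_ne_zero])

lemma fibreDiffL2_sq (π : Y → ℂ) (D : Fin a → Set Y) (γ : KahlerMetric (n + 1) Y) (s : ℂ)
    (f : Y → ℂ) : fibreDiffL2 π D γ s f ^ 2 =
      ∫ y, fibreDiffNormSq π D γ s f y ∂fibreVolume π D γ s :=
  Real.sq_sqrt (integral_nonneg fun y => fibreDiffNormSq_nonneg γ f y)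

/-- The error splits as `J * (X - X') + (J - 1) * X'`: the first term comes from the Gram matrix,
the second from the Jacobian, with `J ≤ 2`. -/
theorem abs_fibreDiffL2_sq_sub_le (hn : 1 ≤ n) (hπ : IsSemistableDegeneration (n := n) π D)
    (h : IsAlmostIsometry π D γ s A F δ) {χ : Y → ℂ} (hχ : IsTestFunction (n := n) A χ) :
    |fibreDiffL2 π D γ s (pushFwd F A χ) ^ 2 - fibreDiffL2 π D γ 0 χ ^ 2| ≤
      energyConst n * δ * fibreDiffL2 π D γ 0 χ ^ 2 := by
  have hχ0 := hχ
  obtain ⟨hχs, K, hKA, hK, hK0⟩ := hχ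
  have hF := h.isFibreMap
  rw [fibreDiffL2_sq, fibreDiffL2_sq, ← Real.norm_eq_abs]
  refine hF.norm_integral_sub_le hπ γ hK hKA
    (h.diffeo.isFibreOpen_image.continuousOn_fibreDiffNormSq hπ (h.diffeo.contMDiffOn_pushFwd hχs))
    (fun y hy hyA => fibreDiffNormSq_eq_zero hπ hy (h.eventually_pushFwd_eq_zero hK hKA hK0 hyA))
    (h.isOpen.continuousOn_fibreDiffNormSq hπ hχs)
    (fun y hy hyK => fibreDiffNormSq_eq_zero hπ hy (eventually_eq_zero hK hK0 hyK))
    (h.isOpen.continuousOn_fibreDiffNormSq hπ hχs)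
    (fun y hy hyK => fibreDiffNormSq_eq_zero hπ hy (eventually_eq_zero hK hK0 hyK))
    (fun z hz => ?_)
  obtain ⟨b, b', hb, hb', hw, -, hJ⟩ := h.exists_frames hn hπ hz
  have h1 := hw.abs_fibreDiffNormSq_sub_le (D := D) (s := s) (s' := 0) hb' hb
    fun p => h.fibreDiffL_mapDL hπ hχ0 hz hb p
  set X := fibreDiffNormSq π D γ s (pushFwd F A χ) (F z)
  set X' := fibreDiffNormSq π D γ 0 χ z
  set J := fibreJac π γ F A z
  have hX' : 0 ≤ X' := fibreDiffNormSq_nonneg γ χ z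
  have hJ0 : 0 ≤ J := fibreJac_nonneg _ _ _ _ _
  have hJ2 : J ≤ 2 := by
    have h3 := (abs_le.1 hJ).2
    have h4 := h.ratio
    linarith
  have h2 : J • X - X' = J * (X - X') + (J - 1) * X' := by rw [smul_eq_mul]; ring
  rw [h2, Real.norm_eq_abs]
  calc _ ≤ |J * (X - X')| + |(J - 1) * X'| := abs_add_le _ _
    _ ≤ 2 * (2 * frameCard n ^ 3 * δ * X') + ratioConst n * δ * X' := by
        rw [abs_mul, abs_mul, abs_of_nonneg hJ0, abs_of_nonneg hX']
        gcongr
    _ = _ := by rw [energyConst]; ring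

variable {α : DForm (m := n + 1) Y 2} {M : ℝ}

theorem norm_integral_mulPow_sub_le (hn : 1 ≤ n) (hπ : IsSemistableDegeneration (n := n) π D)
    (h : IsAlmostIsometry π D γ s A F δ) (hα : α.IsSmooth)
    (hM : ∀ z ∈ A, ∀ b, IsUnitary π γ z b → ∀ p q,
      ‖α.bil z (realFrame b p) (realFrame b q)‖ ≤ M ∧
      ‖α.bil (F z) (mapDL F A z (realFrame b p)) (mapDL F A z (realFrame b q)) -
        α.bil z (realFrame b p) (realFrame b q)‖ ≤ δ * M)
    {χ : Y → ℂ} (hχ : IsTestFunction (n := n) A χ) :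
    ‖fibreIntegral π D γ s (mulPow (pushFwd F A χ) α) - fibreIntegral π D γ 0 (mulPow χ α)‖ ≤
      wedgeConst n * (2 * M) ^ n / volConst n * δ * fibreL1 π D γ 0 χ := by
  obtain ⟨hχs, K, hKA, hK, hK0⟩ := hχ
  have hF := h.isFibreMap
  refine hF.norm_integral_sub_le hπ γ hK hKA
    (h.diffeo.isFibreOpen_image.continuousOn_mulPow hπ (h.diffeo.contMDiffOn_pushFwd hχs) hα)
    (fun y hy hyA => topQuotient_mulPow_eq_zero hπ hy
      (pushFwd_eq_zero hF.injOn hK0 fun hyK => hyA (image_mono hKA hyK)) α)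
    (h.isOpen.continuousOn_mulPow hπ hχs hα)
    (fun y hy hyK => topQuotient_mulPow_eq_zero hπ hy (hK0 y hyK) α)
    hχs.continuousOn.norm (fun y _ hyK => by rw [hK0 y hyK, norm_zero]) (fun z hz => ?_)
  obtain ⟨b, b', hb, hb', hw, hJ, -⟩ := h.exists_frames hn hπ hz
  rw [Complex.real_smul, hJ]
  exact hw.norm_mulPow_sub_le hn h.ratio hb' hb (fun p q => (hM z hz b hb p q).1)
    (fun p q => (hM z hz b hb p q).2) (pushFwd_apply hF.injOn hz χ)

theorem norm_integral_dWedgeDcPow_sub_le (hn : 1 ≤ n) (hπ : IsSemistableDegeneration (n := n) π D)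
    (h : IsAlmostIsometry π D γ s A F δ) (hα : α.IsSmooth)
    (hM : ∀ z ∈ A, ∀ b, IsUnitary π γ z b → ∀ p q,
      ‖α.bil z (realFrame b p) (realFrame b q)‖ ≤ M ∧
      ‖α.bil (F z) (mapDL F A z (realFrame b p)) (mapDL F A z (realFrame b q)) -
        α.bil z (realFrame b p) (realFrame b q)‖ ≤ δ * M)
    {χ : Y → ℂ} (hχ : IsTestFunction (n := n) A χ) :
    ‖fibreIntegral π D γ s (dWedgeDcPow π D s (pushFwd F A χ) α) -
        fibreIntegral π D γ 0 (dWedgeDcPow π D 0 χ α)‖ ≤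
      wedgeConst n * (2 * dcConst n * (2 * M) ^ (n - 1)) / volConst n * δ *
        fibreDiffL2 π D γ 0 χ ^ 2 := by
  have hχ0 := hχ
  obtain ⟨hχs, K, hKA, hK, hK0⟩ := hχ
  have hF := h.isFibreMap
  rw [fibreDiffL2_sq]
  refine hF.norm_integral_sub_le hπ γ hK hKA
    (h.diffeo.isFibreOpen_image.continuousOn_dWedgeDcPow hπ
      (h.diffeo.contMDiffOn_pushFwd hχs) hα)
    (fun y hy hyA => topQuotient_dWedgeDcPow_eq_zero hn hπ hy
      (h.eventually_pushFwd_eq_zero hK hKA hK0 hyA) α)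
    (h.isOpen.continuousOn_dWedgeDcPow hπ hχs hα)
    (fun y hy hyK => topQuotient_dWedgeDcPow_eq_zero hn hπ hy (eventually_eq_zero hK hK0 hyK) α)
    (h.isOpen.continuousOn_fibreDiffNormSq hπ hχs)
    (fun y hy hyK => fibreDiffNormSq_eq_zero hπ hy (eventually_eq_zero hK hK0 hyK))
    (fun z hz => ?_)
  obtain ⟨b, b', hb, hb', hw, hJ, -⟩ := h.exists_frames hn hπ hz
  rw [Complex.real_smul, hJ]
  exact hw.norm_dWedgeDcPow_sub_le hn h.ratio hb' hb (fun p q => (hM z hz b hb p q).1)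
    (fun p q => (hM z hz b hb p q).2) fun p => h.fibreDiffL_mapDL hπ hχ0 hz hb p

end IsAlmostIsometry

end AlmostIsometries

/-! ### Uniform estimates for the flow on the domains `A_s` -/

section Retractions

attribute [local instance] cnNormedAddCommGroup cnNormedSpaceReal cnNormedSpaceComplex
  cnDualNormedAddCommGroup cnBilinNormedAddCommGroup

variable {n a : ℕ} {Y : Type*} [TopologicalSpace Y] [ChartedSpace (Cn (n + 1)) Y]
  [IsManifold 𝓘(ℂ, Cn (n + 1)) ω Y] {π : Y → ℂ} {D : Fin a → Set Y} {γ : KahlerMetric (n + 1) Y}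
  {ν : ℕ} {ρ K : ℝ} {e : OpenPartialHomeomorph Y (Cn (n + 1))} {U : Set Y}
  {Q : Set (Cn (n + 1))}

lemma FlowChart.exists_sup_bound (h : FlowChart π D γ ν ρ e U Q K) {k : ℕ}
    {β : DForm (m := n + 1) Y k} (hβ : β.IsSmooth) :
    ∃ K' : ℝ, ∀ s : ℂ, ‖s‖ < ρ → ∀ z ∈ retractDomain π D γ ν s, z ∈ U →
      ∀ v : Fin k → Cn (n + 1), ‖β z v‖ ≤ K' * ∏ i, γ.vnorm z (v i) := by
  obtain ⟨C, hC, hbd⟩ := exists_bound_lipschitz e.open_target (hβ e h.mem_atlas) h.isCompact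
    h.convex h.subset_target
  refine ⟨C * Real.sqrt K ^ k, fun s hs z hz hzU v => ?_⟩
  obtain ⟨-, hzQ, -, Φ, hΦ, -⟩ := h.flow s hs z hz hzU
  have h1 : β z v = β.inChart e (e z) (fun i => chartD e z (v i)) :=
    β.apply_eq_inChart h.mem_maximalAtlas hΦ.mem_source v
  rw [h1]
  refine (ContinuousAlternatingMap.le_opNorm _ _).trans ?_
  calc _ ≤ C * ∏ i, (Real.sqrt K * γ.vnorm z (v i)) := by
        refine mul_le_mul (hbd _ hzQ).1 (Finset.prod_le_prod (fun i _ => norm_nonneg _)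
          fun i _ => h.norm_chartD_le hΦ.mem_source hzQ (v i)) ?_ hC.le
        exact Finset.prod_nonneg fun i _ => norm_nonneg _
    _ = _ := by rw [Finset.prod_mul_distrib]; simp [mul_assoc]

/-- The principle that a property which depends monotonically on a constant holds uniformly on the
domains `A_s` as soon as it does in flow charts. -/
def UniformOnFlowCharts (π : Y → ℂ) (D : Fin a → Set Y) (γ : KahlerMetric (n + 1) Y) (ν : ℕ)
    (ρ : ℝ) : Prop :=
  ∀ P : ℝ → ℂ → Y → Prop, (∀ K K' s z, K ≤ K' → P K s z → P K' s z) →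
    (∀ e U Q K, FlowChart π D γ ν ρ e U Q K → ∃ K', ∀ s : ℂ, ‖s‖ < ρ →
      ∀ z ∈ retractDomain π D γ ν s, z ∈ U → P K' s z) →
    ∃ K' : ℝ, 0 ≤ K' ∧ ∀ s : ℂ, ‖s‖ < ρ → ∀ z ∈ retractDomain π D γ ν s, P K' s z

lemma UniformOnFlowCharts.mono (h : UniformOnFlowCharts π D γ ν ρ) {ρ' : ℝ} (hρ : ρ' ≤ ρ) :
    UniformOnFlowCharts π D γ ν ρ' := by
  intro P hP hc
  -- The smaller radius is built into the property itself.
  obtain ⟨K', hK', h1⟩ := h (fun K s z => ‖s‖ < ρ' → P K s z)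
    (fun _ _ _ _ hK hPK hs => hP _ _ _ _ hK (hPK hs)) (fun e U Q K hF => by
      obtain ⟨K', hK'⟩ := hc e U Q K (hF.mono hρ)
      exact ⟨K', fun s _ z hz hzU hs => hK' s hs z hz hzU⟩)
  exact ⟨K', hK', fun s hs z hz => h1 s (hs.trans_le hρ) z hz hs⟩

namespace UniformOnFlowCharts

/-- The principle is applied to a property that does not involve the constant. -/
lemma exists_localRep (h : UniformOnFlowCharts π D γ ν ρ) {s : ℂ} (hs : ‖s‖ < ρ) {z : Y}
    (hz : z ∈ retractDomain π D γ ν s) :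
    (∃ c : ℝ → Y, c 0 = z ∧ IsFlowCurve π D γ s c) ∧
      ∃ e ∈ IsManifold.maximalAtlas 𝓘(ℂ, Cn (n + 1)) ω Y, ∃ Φ,
        IsLocalRep π (retractDomain π D γ ν s) (flowMap π D γ s) s e z Φ := by
  obtain ⟨-, -, h1⟩ := h (fun _ s z => (∃ c : ℝ → Y, c 0 = z ∧ IsFlowCurve π D γ s c) ∧
      ∃ e ∈ IsManifold.maximalAtlas 𝓘(ℂ, Cn (n + 1)) ω Y, ∃ Φ,
        IsLocalRep π (retractDomain π D γ ν s) (flowMap π D γ s) s e z Φ)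
    (fun _ _ _ _ _ h => h) (fun e U Q K hF => ⟨0, fun s hs z hz hzU => by
      obtain ⟨hc, -, -, Φ, hΦ, -⟩ := hF.flow s hs z hz hzU
      exact ⟨hc, e, hF.mem_maximalAtlas, Φ, hΦ⟩⟩)
  exact h1 s hs z hz

lemma isFibreOpen (h : UniformOnFlowCharts π D γ ν ρ) {s : ℂ} (hs : ‖s‖ < ρ) :
    IsFibreOpen π D 0 (retractDomain π D γ ν s) := by
  refine ⟨retractDomain_subset π D γ ν s, fun z hz => ?_⟩
  obtain ⟨-, e, -, Φ, hΦ⟩ := h.exists_localRep hs hz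
  exact hΦ.eventually_mem

lemma isFibreDiffeo [T2Space Y] (hπ : IsSemistableDegeneration (n := n) π D)
    (h : UniformOnFlowCharts π D γ ν ρ) {s : ℂ} (hs : ‖s‖ < ρ) :
    IsFibreDiffeo (n := n) π D s (retractDomain π D γ ν s) (flowMap π D γ s) := by
  refine isFibreDiffeo_of_localRep (retractDomain_subset π D γ ν s) (fun z hz => ?_)
    (flowMap_injOn hπ fun z hz => (h.exists_localRep hs hz).1)
    (fun z hz => (h.exists_localRep hs hz).2)
  obtain ⟨⟨c, rfl, hc⟩, -⟩ := h.exists_localRep hs hz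
  rw [flowMap_eq hπ hc]
  exact hc.apply_one_mem

lemma exists_edist_le (h : UniformOnFlowCharts π D γ ν ρ) :
    ∃ K : ℝ, ∀ s : ℂ, ‖s‖ < ρ → ∀ z ∈ retractDomain π D γ ν s,
      γ.edist (flowMap π D γ s z) z ≤ ENNReal.ofReal (K * ‖s‖ ^ (3 / 4 : ℝ)) := by
  obtain ⟨K, -, hK⟩ := h (fun K s z => γ.edist (flowMap π D γ s z) z ≤
      ENNReal.ofReal (K * ‖s‖ ^ (3 / 4 : ℝ)))
    (fun _ _ _ _ hKK' h => h.trans (ENNReal.ofReal_le_ofReal (by gcongr)))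
    (fun _ _ _ K hF => ⟨K * K, fun s hs z hz hzU => hF.edist_flowMap_le hs hz hzU⟩)
  exact ⟨K, hK⟩

lemma prod_vnorm_nonneg {k : ℕ} (γ : KahlerMetric (n + 1) Y) (z : Y) (v : Fin k → Cn (n + 1)) :
    0 ≤ ∏ i, γ.vnorm z (v i) :=
  Finset.prod_nonneg fun _ _ => Real.sqrt_nonneg _

lemma exists_form_bound (hπ : IsSemistableDegeneration (n := n) π D) (hρ : ρ ≤ 1)
    (h : UniformOnFlowCharts π D γ ν ρ) {k : ℕ} {β : DForm (m := n + 1) Y k} (hβ : β.IsSmooth) :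
    ∃ K : ℝ, 0 ≤ K ∧ ∀ s : ℂ, ‖s‖ < ρ → ∀ z ∈ retractDomain π D γ ν s,
      ∀ v : Fin k → TangentSpace 𝓘(ℝ, Cn (n + 1)) z, (∀ i, hdiff π z (v i) = 0) →
      ‖β (flowMap π D γ s z)
          (fun i => mapDiff (flowMap π D γ s) (retractDomain π D γ ν s) z (v i)) - β z v‖ ≤
        K * ‖s‖ ^ (1 / 2 : ℝ) * ∏ i, γ.vnorm z (v i) := by
  refine h (fun K s z => ∀ v : Fin k → TangentSpace 𝓘(ℝ, Cn (n + 1)) z,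
      (∀ i, hdiff π z (v i) = 0) →
      ‖β (flowMap π D γ s z)
          (fun i => mapDiff (flowMap π D γ s) (retractDomain π D γ ν s) z (v i)) - β z v‖ ≤
        K * ‖s‖ ^ (1 / 2 : ℝ) * ∏ i, γ.vnorm z (v i))
    (fun _ _ _ z hKK' h v hv => (h v hv).trans ?_)
    (fun _ _ _ _ hF => hF.exists_form_bound hπ hρ hβ)
  exact mul_le_mul_of_nonneg_right (by gcongr) (prod_vnorm_nonneg γ z v)

lemma exists_sup_bound (h : UniformOnFlowCharts π D γ ν ρ) {k : ℕ} {β : DForm (m := n + 1) Y k}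
    (hβ : β.IsSmooth) :
    ∃ K : ℝ, 0 ≤ K ∧ ∀ s : ℂ, ‖s‖ < ρ → ∀ z ∈ retractDomain π D γ ν s,
      ∀ v : Fin k → Cn (n + 1), ‖β z v‖ ≤ K * ∏ i, γ.vnorm z (v i) :=
  h (fun K s z => ∀ v : Fin k → Cn (n + 1), ‖β z v‖ ≤ K * ∏ i, γ.vnorm z (v i))
    (fun _ _ _ z hKK' h v => (h v).trans
      (mul_le_mul_of_nonneg_right hKK' (prod_vnorm_nonneg γ z v)))
    (fun _ _ _ _ hF => hF.exists_sup_bound hβ)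

lemma exists_metric_bound (hπ : IsSemistableDegeneration (n := n) π D) (hρ : ρ ≤ 1)
    (h : UniformOnFlowCharts π D γ ν ρ) {c : ℂ} (hc : ‖c‖ ≤ 1) :
    ∃ K : ℝ, 0 ≤ K ∧ ∀ s : ℂ, ‖s‖ < ρ → ∀ z ∈ retractDomain π D γ ν s,
      ∀ u v : Cn (n + 1), hd (m := n + 1) π z u = 0 → hd (m := n + 1) π z v = 0 →
      |γ.gm (flowMap π D γ s z)
          (c • mapD (flowMap π D γ s) (retractDomain π D γ ν s) z u)
          (mapD (flowMap π D γ s) (retractDomain π D γ ν s) z v) -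
        γ.gm z (c • u) v| ≤
        K * ‖s‖ ^ (1 / 2 : ℝ) * (γ.vnorm z u * γ.vnorm z v) := by
  refine h (fun K s z => ∀ u v : Cn (n + 1),
      hd (m := n + 1) π z u = 0 → hd (m := n + 1) π z v = 0 →
      |γ.gm (flowMap π D γ s z)
          (c • mapD (flowMap π D γ s) (retractDomain π D γ ν s) z u)
          (mapD (flowMap π D γ s) (retractDomain π D γ ν s) z v) -
        γ.gm z (c • u) v| ≤ K * ‖s‖ ^ (1 / 2 : ℝ) * (γ.vnorm z u * γ.vnorm z v))
    (fun _ _ _ z hKK' h u v hu hv => (h u v hu hv).trans ?_)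
    (fun _ _ _ _ hF => hF.exists_metric_bound hπ hρ hc)
  exact mul_le_mul_of_nonneg_right (by gcongr)
    (mul_nonneg (Real.sqrt_nonneg _) (Real.sqrt_nonneg _))

/-- After shrinking the disc, the maps are almost isometries. -/
theorem exists_isAlmostIsometry [T2Space Y] (hπ : IsSemistableDegeneration (n := n) π D)
    (hρ₀ : 0 < ρ) (hρ : ρ ≤ 1) (h : UniformOnFlowCharts π D γ ν ρ) :
    ∃ ρ' : ℝ, 0 < ρ' ∧ ρ' ≤ ρ ∧ ∃ K : ℝ, 1 ≤ K ∧ ∀ s : ℂ, ‖s‖ < ρ' →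
      IsAlmostIsometry π D γ s (retractDomain π D γ ν s) (flowMap π D γ s)
        (K * ‖s‖ ^ (1 / 2 : ℝ)) := by
  obtain ⟨K₁, -, hK₁⟩ := h.exists_metric_bound hπ hρ (c := 1) (by simp)
  obtain ⟨K₂, -, hK₂⟩ := h.exists_metric_bound hπ hρ (c := Complex.I) (by simp)
  obtain ⟨K, hK1, hKK₁, hKK₂⟩ : ∃ K : ℝ, 1 ≤ K ∧ K₁ ≤ K ∧ K₂ ≤ K :=
    ⟨max 1 (max K₁ K₂), le_max_left _ _, (le_max_left _ _).trans (le_max_right _ _),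
      (le_max_right _ _).trans (le_max_right _ _)⟩
  have hf := frameCard_nonneg n
  have hr := ratioConst_nonneg n
  -- If `|s|^{1/2} ≤ d`, then `frameCard n * δ` and `ratioConst n * δ` are at most `1 / 2`, which
  -- makes the Gram matrix invertible and the Jacobian positive. The summand `1` keeps the
  -- denominator positive.
  set d : ℝ := 1 / (2 * (frameCard n + ratioConst n + 1) * K)
  have hd0 : 0 < d := by positivity
  refine ⟨min ρ (d ^ 2), by positivity, min_le_left _ _, K, hK1, fun s hs => ?_⟩
  have hsρ : ‖s‖ < ρ := hs.trans_le (min_le_left _ _)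
  have hsd : ‖s‖ ^ (1 / 2 : ℝ) ≤ d := by
    rw [← Real.sqrt_eq_rpow]
    exact Real.sqrt_le_iff.2 ⟨hd0.le, (hs.trans_le (min_le_right _ _)).le⟩
  have hs0 : 0 ≤ ‖s‖ ^ (1 / 2 : ℝ) := by positivity
  have hsmall : ∀ c : ℝ, 0 ≤ c → c ≤ frameCard n + ratioConst n + 1 →
      c * (K * ‖s‖ ^ (1 / 2 : ℝ)) ≤ 1 / 2 := by
    intro c hc hc'
    calc _ ≤ (frameCard n + ratioConst n + 1) * (K * d) := by gcongr
      _ = 1 / 2 := by simp only [d]; field_simp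
  refine ⟨h.isFibreOpen hsρ, h.isFibreDiffeo hπ hsρ, fun z hz b hb => ?_,
    hsmall _ hr (by linarith)⟩
  refine ⟨by positivity, hsmall _ hf (by linarith), fun p => ?_, fun p q => ?_, fun p q => ?_⟩
  · exact ((h.isFibreDiffeo hπ hsρ).isFibreMap (h.isFibreOpen hsρ)).hd_mapDL hπ hz
      (hb.isFrame.mem p)
  · have h1 := hK₁ s hsρ z hz _ _ (hb.isFrame.mem p) (hb.isFrame.mem q)
    rw [one_smul, one_smul, hb.vnorm_eq_one, hb.vnorm_eq_one, hb.gram, one_mul, mul_one] at h1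
    exact h1.trans (by gcongr)
  · have h1 := hK₂ s hsρ z hz _ _ (hb.isFrame.mem p) (hb.isFrame.mem q)
    rw [hb.vnorm_eq_one, hb.vnorm_eq_one, hb.sympl, one_mul, mul_one] at h1
    exact h1.trans (by gcongr)

/-- The bounds on a two-form which enter the comparison of integrals. -/
lemma exists_bil_bound [T2Space Y] (hπ : IsSemistableDegeneration (n := n) π D) (hρ : ρ ≤ 1)
    (h : UniformOnFlowCharts π D γ ν ρ) (hK : 1 ≤ K) {α : DForm (m := n + 1) Y 2}
    (hα : α.IsSmooth) :
    ∃ M : ℝ, ∀ s : ℂ, ‖s‖ < ρ → ∀ z ∈ retractDomain π D γ ν s, ∀ b, IsUnitary π γ z b →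
      ∀ p q, ‖α.bil z (realFrame b p) (realFrame b q)‖ ≤ M ∧
        ‖α.bil (flowMap π D γ s z)
            (mapDL (flowMap π D γ s) (retractDomain π D γ ν s) z (realFrame b p))
            (mapDL (flowMap π D γ s) (retractDomain π D γ ν s) z (realFrame b q)) -
          α.bil z (realFrame b p) (realFrame b q)‖ ≤ K * ‖s‖ ^ (1 / 2 : ℝ) * M := by
  obtain ⟨M₁, hM₁, h1⟩ := h.exists_sup_bound hα
  obtain ⟨M₂, hM₂, h2⟩ := h.exists_form_bound hπ hρ hα
  refine ⟨max M₁ M₂, fun s hs z hz b hb p q => ⟨?_, ?_⟩⟩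
  · have h3 := h1 s hs z hz ![realFrame b p, realFrame b q]
    rw [Fin.prod_univ_two] at h3
    simp only [Matrix.cons_val_zero, Matrix.cons_val_one, hb.vnorm_eq_one, mul_one] at h3
    exact h3.trans (le_max_left _ _)
  · let v : Fin 2 → Cn (n + 1) := ![realFrame b p, realFrame b q]
    have h3 := h2 s hs z hz v (fun i => by
      fin_cases i
      · exact hb.isFrame.mem p
      · exact hb.isFrame.mem q)
    have h4 : (fun i => (mapDiff (flowMap π D γ s) (retractDomain π D γ ν s) z (v i) :
        Cn (n + 1))) = ![mapDL (flowMap π D γ s) (retractDomain π D γ ν s) z (realFrame b p),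
          mapDL (flowMap π D γ s) (retractDomain π D γ ν s) z (realFrame b q)] := by
      funext i
      fin_cases i <;> rfl
    have h5 : ∏ i, γ.vnorm z (v i) = 1 := by
      rw [Fin.prod_univ_two]
      simp only [v, Matrix.cons_val_zero, Matrix.cons_val_one, hb.vnorm_eq_one, mul_one]
    rw [h5, mul_one] at h3
    have h6 : ‖α.bil (flowMap π D γ s z)
            (mapDL (flowMap π D γ s) (retractDomain π D γ ν s) z (realFrame b p))
            (mapDL (flowMap π D γ s) (retractDomain π D γ ν s) z (realFrame b q)) -
          α.bil z (realFrame b p) (realFrame b q)‖ ≤ M₂ * ‖s‖ ^ (1 / 2 : ℝ) := by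
      have h7 := congrArg (fun w : Fin 2 → Cn (n + 1) => ‖α (flowMap π D γ s z) w - α z v‖) h4
      exact h7.symm.trans_le h3
    refine h6.trans ?_
    have hs0 : 0 ≤ ‖s‖ ^ (1 / 2 : ℝ) := by positivity
    calc M₂ * ‖s‖ ^ (1 / 2 : ℝ) = 1 * ‖s‖ ^ (1 / 2 : ℝ) * M₂ := by ring
      _ ≤ _ := by gcongr; exact le_max_right _ _

end UniformOnFlowCharts

end Retractions

/-! ### Assembly of the theorem -/

theorem mainTheorem5 {n a : ℕ} (hn : 1 ≤ n) {Y : Type*} [TopologicalSpace Y] [T2Space Y]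
    [SecondCountableTopology Y] [MeasurableSpace Y] [BorelSpace Y]
    [ChartedSpace (Cn (n + 1)) Y] [IsManifold 𝓘(ℂ, Cn (n + 1)) ω Y]
    (π : Y → ℂ) (D : Fin a → Set Y) (hπ : IsSemistableDegeneration (n := n) π D)
    (γ : KahlerMetric (n + 1) Y) (ν : ℕ) (hν : n ≤ ν) :
    ∃ ρ : ℝ, 0 < ρ ∧ ρ ≤ 1 ∧ ∃ F : ℂ → Y → Y,
      -- the maps are diffeomorphisms onto their images
      (∀ s : ℂ, ‖s‖ < ρ → IsFibreDiffeo (n := n) π D s (retractDomain π D γ ν s) (F s)) ∧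
      -- they are given by the flow along the horizontal lift of the vector field `s` on the disc
      (∀ s : ℂ, ‖s‖ < ρ → ∀ z ∈ retractDomain π D γ ν s, ∃ c : ℝ → Y, c 0 = z ∧ c 1 = F s z ∧
        ∀ t ∈ Icc (0 : ℝ) 1, c t ∈ smoothFibre π D ((t : ℂ) * s) ∧
          ∃ w : TangentSpace 𝓘(ℝ, Cn (n + 1)) (c t), IsHorizontalLift π γ (c t) s w ∧
            HasMFDerivWithinAt 𝓘(ℝ, ℝ) 𝓘(ℝ, Cn (n + 1)) c (Icc 0 1) t
              ((1 : ℝ →L[ℝ] ℝ).smulRight w)) ∧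
      -- the map over the centre is the identity
      (∀ z ∈ smoothFibre π D 0, F 0 z = z) ∧
      -- displacement
      (∃ K₁ : ℝ, ∀ s : ℂ, ‖s‖ < ρ → ∀ z ∈ retractDomain π D γ ν s,
        γ.edist (F s z) z ≤ ENNReal.ofReal (K₁ * ‖s‖ ^ (3 / 4 : ℝ))) ∧
      -- pull-backs of smooth forms
      (∀ (k : ℕ) (β : DForm (m := n + 1) Y k), β.IsSmooth →
        ∃ K₂ : ℝ, ∀ s : ℂ, ‖s‖ < ρ → ∀ z ∈ retractDomain π D γ ν s,
          ∀ v : Fin k → TangentSpace 𝓘(ℝ, Cn (n + 1)) z, (∀ i, hdiff π z (v i) = 0) →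
            ‖β (F s z) (fun i => mapDiff (F s) (retractDomain π D γ ν s) z (v i)) - β z v‖ ≤
              K₂ * ‖s‖ ^ (1 / 2 : ℝ) * ∏ i, γ.vnorm z (v i)) ∧
      -- inner products and Dirichlet energies
      (∃ K₃ : ℝ, ∀ s : ℂ, ‖s‖ < ρ →
        (∀ χ χ' : Y → ℂ, IsTestFunction (n := n) (retractDomain π D γ ν s) χ →
          IsTestFunction (n := n) (retractDomain π D γ ν s) χ' →
          ‖fibreInner π D γ s (pushFwd (F s) (retractDomain π D γ ν s) χ)
              (pushFwd (F s) (retractDomain π D γ ν s) χ') - fibreInner π D γ 0 χ χ'‖ ≤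
            K₃ * ‖s‖ ^ (1 / 2 : ℝ) * fibreL2 π D γ 0 χ * fibreL2 π D γ 0 χ') ∧
        ∀ χ : Y → ℂ, IsTestFunction (n := n) (retractDomain π D γ ν s) χ →
          |fibreDiffL2 π D γ s (pushFwd (F s) (retractDomain π D γ ν s) χ) ^ 2 -
              fibreDiffL2 π D γ 0 χ ^ 2| ≤
            K₃ * ‖s‖ ^ (1 / 2 : ℝ) * fibreDiffL2 π D γ 0 χ ^ 2 ∧
          |fibreDiffL2 π D γ s (pushFwd (F s) (retractDomain π D γ ν s) χ) -
              fibreDiffL2 π D γ 0 χ| ≤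
            K₃ * ‖s‖ ^ (1 / 2 : ℝ) * fibreDiffL2 π D γ 0 χ) ∧
      -- integrals against powers of a (1,1)-form
      (∀ α : DForm (m := n + 1) Y 2, α.IsSmooth → α.IsOneOne →
        ∃ K₄ : ℝ, ∀ s : ℂ, ‖s‖ < ρ →
          ∀ χ : Y → ℂ, IsTestFunction (n := n) (retractDomain π D γ ν s) χ →
            ‖fibreIntegral π D γ s
                (mulPow (pushFwd (F s) (retractDomain π D γ ν s) χ) α) -
              fibreIntegral π D γ 0 (mulPow χ α)‖ ≤
              K₄ * ‖s‖ ^ (1 / 2 : ℝ) * fibreL1 π D γ 0 χ ∧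
            ‖fibreIntegral π D γ s
                (dWedgeDcPow π D s (pushFwd (F s) (retractDomain π D γ ν s) χ) α) -
              fibreIntegral π D γ 0 (dWedgeDcPow π D 0 χ α)‖ ≤
              K₄ * ‖s‖ ^ (1 / 2 : ℝ) * fibreDiffL2 π D γ 0 χ ^ 2) := by
  obtain ⟨ρ₀, hρ₀, hρ₀1, hU₀⟩ := exists_uniform_flow hn hπ γ hν
  have hU₀' : UniformOnFlowCharts π D γ ν ρ₀ := hU₀
  -- The disc is shrunk only here, by a condition on the metric alone, so `ρ` does not depend on the
  -- forms `β` and `α`.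
  obtain ⟨ρ, hρ, hρρ₀, K, hK, hiso⟩ := hU₀'.exists_isAlmostIsometry hπ hρ₀ hρ₀1
  have hU := hU₀'.mono hρρ₀
  have hρ1 := hρρ₀.trans hρ₀1
  have hδ : ∀ s : ℂ, 0 ≤ K * ‖s‖ ^ (1 / 2 : ℝ) := fun s =>
    mul_nonneg (zero_le_one.trans hK) (Real.rpow_nonneg (norm_nonneg _) _)
  refine ⟨ρ, hρ, hρ1, flowMap π D γ, fun s hs => hU.isFibreDiffeo hπ hs, fun s hs z hz => ?_,
    fun z hz => flowMap_zero hπ hz, hU.exists_edist_le, fun k β hβ => ?_, ?_, fun α hα _ => ?_⟩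
  · obtain ⟨⟨c, rfl, hc⟩, -⟩ := hU.exists_localRep hs hz
    exact ⟨c, rfl, (flowMap_eq hπ hc).symm, hc⟩
  · obtain ⟨K₂, -, h⟩ := hU.exists_form_bound hπ hρ1 hβ
    exact ⟨K₂, h⟩
  · refine ⟨max (ratioConst n * K) (energyConst n * K), fun s hs =>
      ⟨fun χ χ' hχ hχ' => ?_, fun χ hχ => ?_⟩⟩
    · refine ((hiso s hs).norm_fibreInner_sub_le hn hπ (hδ s) hχ hχ').trans ?_
      have h2 : 0 ≤ fibreL2 π D γ 0 χ := Real.sqrt_nonneg _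
      have h3 : 0 ≤ fibreL2 π D γ 0 χ' := Real.sqrt_nonneg _
      rw [← mul_assoc (ratioConst n)]
      gcongr
      exact le_max_left _ _
    · have h1 : |fibreDiffL2 π D γ s (pushFwd (flowMap π D γ s) (retractDomain π D γ ν s) χ) ^ 2 -
          fibreDiffL2 π D γ 0 χ ^ 2| ≤ max (ratioConst n * K) (energyConst n * K) *
            ‖s‖ ^ (1 / 2 : ℝ) * fibreDiffL2 π D γ 0 χ ^ 2 := by
        refine ((hiso s hs).abs_fibreDiffL2_sq_sub_le hn hπ hχ).trans ?_
        rw [← mul_assoc (energyConst n)]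
        gcongr
        exact le_max_right _ _
      -- The estimate for the norms follows from that for their squares with the same constant.
      exact ⟨h1, abs_sub_le_of_abs_sq_sub_sq_le (Real.sqrt_nonneg _) (Real.sqrt_nonneg _) h1⟩
  · obtain ⟨M, hM⟩ := hU.exists_bil_bound hπ hρ1 hK hα
    refine ⟨max (wedgeConst n * (2 * M) ^ n / volConst n * K)
      (wedgeConst n * (2 * dcConst n * (2 * M) ^ (n - 1)) / volConst n * K),
      fun s hs χ hχ => ⟨?_, ?_⟩⟩
    · refine ((hiso s hs).norm_integral_mulPow_sub_le hn hπ hα (hM s hs) hχ).trans ?_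
      have h2 : 0 ≤ fibreL1 π D γ 0 χ := integral_nonneg fun _ => norm_nonneg _
      rw [← mul_assoc (wedgeConst n * (2 * M) ^ n / volConst n)]
      gcongr
      exact le_max_left _ _
    · refine ((hiso s hs).norm_integral_dWedgeDcPow_sub_le hn hπ hα (hM s hs) hχ).trans ?_
      rw [← mul_assoc (wedgeConst n * (2 * dcConst n * (2 * M) ^ (n - 1)) / volConst n)]
      gcongr
      exact le_max_right _ _

end
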